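/- **Conventions.** For $N\ge 4$ let $W(\mathsf B_N)=\mathfrak S_N\ltimes\{\pm1\}^N$ be the automorphism group of the $N$ pairs of symbols $j^+,j^-$ ($1\le j\le N$): $\tau\in\mathfrak S_N$ sends $j^{\pm}$ to $\tau(j)^{\pm}$, and $c_j$ exchanges $j^+$ and $j^-$. Let $pr:W(\mathsf B_N)\to\mathfrak S_N$ be the projection, and let $W(\mathsf D_N)$ be the kernel of the character $c_{j_1}\cdots c_{j_t}\tau\mapsto(-1)^t$. The group $W(\mathsf D_N)$ acts on $\mathrm{Pic}=\bigoplus_{i=-1}^N\mathbb Z l_i$ as follows: $g=c_{j_1}\cdots c_{j_t}\tau$ ($t$ even, $j_1,\dots,j_t$ distinct) fixes $l_0$, sends $l_{-1}$ to $l_{-1}+\frac t2 l_0-\sum_{k=1}^t l_{j_k}$, and sends $l_j$ ($j\ge1$) to $l_0-l_{\tau(j)}$ if $\tau(j)\in\{j_1,\dots,j_t\}$ and to $l_{\tau(j)}$ otherwise. Put $K=-2(l_{-1}+l_0)+\sum_{i=1}^N l_i$. A subgroup $G\subseteq W(\mathsf D_N)$ satisfies **(H1)** if $\mathrm H^1(H,\mathrm{Pic})=0$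 for every subgroup $H\subseteq G$, and it is **relatively minimal** if $\mathrm{Pic}^G=\mathbb Z l_0\oplus\mathbb Z K$. The *orbits* of $G$ are those of $pr(G)$ on $\{1,\dots,N\}$. $\mathfrak C_m$ is the cyclic group of order $m$, $\mathfrak D_m$ the dihedral group of order $2m$, and $A:B$ (or $A\rtimes B$) denotes some semidirect product with normal subgroup $A$. All of $n,n_1,n_2,n_3,r$ are positive integers, $p$ is an odd prime and $q=p^r$. Let $\mathbb F_q=(\mathbb Z/p)[x]/(h)$ with $h$ any monic irreducible polynomial of degree $r$, let $\Gamma$ be any generator of $\mathbb F_q^*$, let $\mathrm{lab}(0)=q$ and $\mathrm{lab}(\sum_{i<r} a_ix^i)=\sum_{i<r} a_ip^i$ ($0\le a_i<p$, not all $a_i=0$), and $\mathfrak F_q=AGL(1,\mathbb F_q)\cong\mathbb F_q\rtimes\mathbb F_q^*$. For $a\ge0$ write - $\rho_{a,n}=(a+1,a+2,a+4,\dots,a+2n,a+2n+1,a+2n-1,\dots,a+3)$, a $(2n+1)$-cycle; - $\phi_{a,n}=(a+2,a+3)(a+4,a+5)\cdots(a+2n,a+2n+1)$; - $\mu_a=(a+1,a+\mathrm{lab}(\Gamma),\dots,a+\mathrm{lab}(\Gamma^{q-2}))$;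 - $\alpha_a$, the permutation $a+\mathrm{lab}(y)\mapsto a+\mathrm{lab}(y+1)$, $y\in\mathbb F_q$, that is (for $a=0$) $(q,1,\dots,p-1)(p,\dots,2p-1)\cdots(q-p,\dots,q-1)$; - $\omega_n=(1,2n+2)(2,3+2n)(3,4+2n)\cdots(2n+1,4n+2)$ and $\theta_n=\prod_{i=1}^{2n+1}(i,\,i+2n+1,\,i+4n+2)$; - $\psi_n=(1,2n+2)(2,2n+3,3,2n+4)\cdots(2n,4n+1,2n+1,4n+2)$; - $c_{[a,b]}=c_ac_{a+1}\cdots c_b$. **Theorem.** Each of the following groups $G$ is a subgroup of $W(\mathsf D_N)$ that satisfies (H1) and is relatively minimal. Moreover $G$ has the stated isomorphism type, orbit lengths and Sylow 2-subgroup ("Syl in $S$" means that $S\subseteq G$ contains a Sylow 2-subgroup of $G$; "Syl $=S$" that $S$ is one). 1. $N=2n+2$, $G=\langle g_1=c_{[1,2n+2]}\phi_{0,n},\ g_2=\rho_{0,n}\rangle\cong\mathfrak D_{2n+1}$; orbits $(2n+1)+1$; Syl in $\langle g_1\rangle$. 2. $N=q+1$, $G=\langle g_1=c_{[1,q+1]}\mu_0,\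 g_2=\alpha_0\rangle\cong\mathfrak F_q$; orbits $q+1$; Syl in $\langle g_1\rangle$. 3. $N=2n_1+2n_2+3$, $G=\langle c_{[1,2n_1+1]}c_N\phi_{0,n_1},\ \rho_{0,n_1},\ c_{[2n_1+2,N-1]}c_N\phi_{2n_1+1,n_2},\ \rho_{2n_1+1,n_2}\rangle\cong\mathfrak D_{2n_1+1}\times\mathfrak D_{2n_2+1}$ (two groups of class 1 with the orbits of length one identified); orbits $(2n_1+1)+(2n_2+1)+1$. 4. $N=2n+q+2$, $G=\langle c_{[1,2n+1]}c_N\phi_{0,n},\ \rho_{0,n},\ c_{[2n+2,N-1]}c_N\mu_{2n+1},\ \alpha_{2n+1}\rangle\cong\mathfrak D_{2n+1}\times\mathfrak F_q$; orbits $(2n+1)+q+1$. 5. $N=2n_1+2n_2+2$, $G=\langle c_{[1,N]}\phi_{0,n_1}\phi_{2n_1+1,n_2},\ \rho_{0,n_1},\ \rho_{2n_1+1,n_2}\rangle\cong\mathfrak C_{2n_1+1}\rtimes\mathfrak D_{2n_2+1}$; orbits $(2n_1+1)+(2n_2+1)$. 6. $N=2n+q+1$, $G=\langle c_{[1,N]}\phi_{0,n}\mu_{2n+1},\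 \rho_{0,n},\ \alpha_{2n+1}\rangle\cong\mathfrak C_{2n+1}:\mathfrak F_q$; orbits $(2n+1)+q$. 7. $N=2n_1+2n_2+2$, $G=\langle c_{[1,N]}\phi_{0,n_1}\phi_{2n_1+1,n_2},\ \rho_{0,n_1}\rho_{2n_1+1,n_2}\rangle\cong\mathfrak D_{\mathrm{lcm}(2n_1+1,2n_2+1)}$; if $2n_1+1$ and $2n_2+1$ are coprime it is equal to the group of class 5, and if $2n_2+1$ divides $2n_1+1$ it is isomorphic to $\mathfrak D_{2n_1+1}$; orbits $(2n_1+1)+(2n_2+1)$. 8. $N=2n+q+1$, $G=\langle c_{[1,N]}\phi_{0,n}\mu_{2n+1},\ \rho_{0,n}\alpha_{2n+1}\rangle$; if $2n+1$ and $p$ are coprime it is equal to the group of class 6; orbits $(2n+1)+q$. 9. $N=2n+3$, $G=\langle g_1=c_{[1,2n+2]}\phi_{0,n},\ g_2=\rho_{0,n},\ g_3=c_{2n+2}c_{2n+3}\rangle\cong\mathfrak D_{4n+2}$; orbits $(2n+1)+1+1$; Syl $=\langle g_1,g_3\rangle\cong\mathfrak C_2^2$. 10. $N=2n+3$, $G=\langle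 g_1=c_{[1,2n+2]}\phi_{0,n}(2n+2,2n+3),\ g_2=\rho_{0,n}\rangle\cong\mathfrak C_{2n+1}:\mathfrak C_4$; orbits $(2n+1)+2$; Syl $=\langle g_1\rangle\cong\mathfrak C_4$. 11. $N=2n+3$, $G=\langle g_1,g_2,g_3\rangle\cong\mathfrak C_{2n+1}:\mathfrak D_4$ with $g_1,g_2$ as in 10 and $g_3=(2n+2,2n+3)$; orbits $(2n+1)+2$; Syl $=S=\langle g_1,g_3\rangle\cong\mathfrak D_4$, and $\mathrm H^1(S,\mathrm{Pic})=0$. 12. $N=4n+2$, $G=\langle g_1=c_{[1,4n+2]}\phi_{0,n}\phi_{2n+1,n},\ g_2=\rho_{0,n}\rho_{2n+1,n},\ g_3=\omega_n\rangle\cong\mathfrak D_{4n+2}$; one orbit; Syl $=\langle g_1,g_3\rangle\cong\mathfrak C_2^2$. 13. $N=4n+2$, $G=\langle g_1=c_{[1,4n+2]}\phi_{0,n}\phi_{2n+1,n},\ g_2=\rho_{0,n},\ g_3=\rho_{2n+1,n},\ g_4=\omega_n\rangle\cong(\mathfrak D_{2n+1})^2$; one orbit; Syl $=\langle g_1,g_4\rangle\cong\mathfrak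 C_2^2$. 14. $N=q+2$, $G=\langle g_1=c_{[1,q+1]}\mu_0(q+1,q+2),\ g_2=\alpha_0\rangle$, isomorphic to $\mathfrak F_q$ if $4\mid q-1$ and to a semidirect product $\mathbb F_q\rtimes\mathfrak C_{2(q-1)}$ otherwise; orbits $q+2$; Syl in $\langle g_1\rangle$. 15. $N=4n+3$, $G=\langle g_1=c_{[1,2n+1]}c_{4n+3}\psi_n,\ g_2=\rho_{0,n},\ g_3=\rho_{2n+1,n}\rangle\cong\mathfrak C_{2n+1}^2\rtimes\mathfrak C_4$; orbits $(4n+2)+1$; Syl $=\langle g_1\rangle\cong\mathfrak C_4$. 16. $N=q+2$, $G=\langle g_1,g_2,g_3\rangle$ with $g_1,g_2$ as in 14 and $g_3=c_{q+1}c_{q+2}$, isomorphic to $\mathfrak C_2\times\mathfrak F_q$ if $4\mid q-1$ and to a semidirect product $\mathbb F_q\rtimes\mathfrak C_{2(q-1)}$ otherwise; orbits $q+2$; Syl in $\langle g_1,g_3\rangle$. 17. $N=q+2$, $G=\langle g_1=c_{[1,q+1]}\mu_0,\ g_2=\alpha_0,\ g_3=c_{q+1}c_{q+2}\rangle\cong\mathfrak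 C_2\times\mathfrak F_q$; orbits $q+1+1$; Syl in $\langle g_1,g_3\rangle$. 18. $N=4n+3$, $G=\langle g_1=c_{[1,2n+1]}c_N\phi_{0,n},\ g_2=c_{[2n+2,4n+2]}c_N\phi_{2n+1,n},\ g_3=\omega_n,\ g_4=\rho_{0,n},\ g_5=\rho_{2n+1,n}\rangle\cong\mathfrak D_{2n+1}\wr\mathfrak C_2$; orbits $(4n+2)+1$; Syl $=S=\langle g_1,g_2,g_3\rangle\cong\mathfrak D_4$, and $\mathrm H^1(S,\mathrm{Pic})=0$. 19. $N=q+2$, $G=\langle g_1=c_{[1,q+1]}\mu_0(q+1,q+2),\ g_2=\alpha_0,\ g_3=(q+1,q+2),\ g_4=c_{q+1}c_{q+2}\rangle\cong\mathfrak C_2^2:\mathfrak F_q$; orbits $q+2$; Syl in $S=\langle g_1,g_3,g_4\rangle\cong\mathfrak C_2^2:\mathfrak C_{q-1}$, and $S$ satisfies (H1). 20. $N=2n_1+2n_2+2n_3+3$, $G=\langle g_1=c_{[1,2n_1+2n_2+2]}\phi_{0,n_1}\phi_{2n_1+1,n_2},\ g_2=c_{[2n_1+2,N]}\phi_{2n_1+1,n_2}\phi_{2n_1+2n_2+2,n_3},\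 \rho_{0,n_1},\ \rho_{2n_1+1,n_2},\ \rho_{2n_1+2n_2+2,n_3}\rangle\cong(\mathfrak C_{2n_1+1}\times\mathfrak C_{2n_2+1}\times\mathfrak C_{2n_3+1}):\mathfrak C_2^2$; orbits $(2n_1+1)+(2n_2+1)+(2n_3+1)$; Syl $=\langle g_1,g_2\rangle\cong\mathfrak C_2^2$. 21. $N=4n_1+2n_2+3$, $G=\langle g_1=c_{[2n_1+2,N]}\psi_{n_1}\phi_{4n_1+2,n_2},\ \rho_{0,n_1},\ \rho_{2n_1+1,n_1},\ \rho_{4n_1+2,n_2}\rangle\cong\mathfrak C_{2n_1+1}^2:(\mathfrak C_{2n_2+1}:\mathfrak C_4)$; orbits $(4n_1+2)+(2n_2+1)$; Syl $=\langle g_1\rangle\cong\mathfrak C_4$. 22. $N=4n_1+2n_2+3$, $G=\langle g_1=c_{[1,4n_1+2]}\phi_{0,n_1}\phi_{2n_1+1,n_1},\ g_2=c_{[2n_1+2,N]}\phi_{2n_1+1,n_1}\phi_{4n_1+2,n_2},\ g_3=\omega_{n_1},\ \rho_{0,n_1},\ \rho_{2n_1+1,n_1},\ \rho_{4n_1+2,n_2}\rangle\cong(\mathfrak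 C_{2n_1+1}^2\times\mathfrak C_{2n_2+1}):\mathfrak D_4$; orbits $(4n_1+2)+(2n_2+1)$; Syl $=S=\langle g_1,g_2,g_3\rangle\cong\mathfrak D_4$, and $\mathrm H^1(S,\mathrm{Pic})=0$. 23. $N=6n+3$, $G=\langle g_1=c_{[1,4n+2]}\phi_{0,n}\phi_{2n+1,n},\ g_2=c_{[2n+2,6n+3]}\phi_{2n+1,n}\phi_{4n+2,n},\ \rho_{0,n},\ \rho_{2n+1,n},\ \rho_{4n+2,n},\ \theta_n\rangle\cong(\mathfrak C_{2n+1}^3:\mathfrak C_2^2):\mathfrak C_3$; one orbit; Syl $=\langle g_1,g_2\rangle\cong\mathfrak C_2^2$. 24. $N=6n+3$, $G$ generated by the group of class 23 and $g_3=\omega_n$, $G\cong\mathfrak C_{2n+1}^3:\mathfrak S_4$; one orbit; Syl $=S=\langle g_1,g_2,g_3\rangle\cong\mathfrak D_4$ with $g_1,g_2$ as in 23, and $\mathrm H^1(S,\mathrm{Pic})=0$. -/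

import Mathlib

open Finset

namespace ConicBundle

/-! ### The Weyl groups `W(B_n)` and `W(D_n)` -/

/-- `W(B_n) = 𝔖_n ⋉ {±1}ⁿ`, the automorphism group of the `n` pairs of symbols `j⁺, j⁻`.
The element with left component `ε` and right component `τ` is `c_{j₁} ⋯ c_{j_t} τ`, where
`j₁, …, j_t` are the positions of the signs `-1` in `ε`; it sends `j^±` to `τ(j)^{± ε (τ j)}`.
Products are composed from right to left, so that `τ c_j = c_{τ(j)} τ`. -/
abbrev WB (n : ℕ) : Type :=
  (Fin n → ℤˣ) ⋊[mulAutArrow] Equiv.Perm (Fin n)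

/-- The projection `pr : W(B_n) → 𝔖_n`. -/
def pr (n : ℕ) : WB n →* Equiv.Perm (Fin n) := SemidirectProduct.rightHom

/-- The character `σ(c_{j₁} ⋯ c_{j_t} τ) = (-1)^t`. -/
def sigma (n : ℕ) : WB n →* ℤˣ where
  toFun g := ∏ i, g.left i
  map_one' := by simp
  map_mul' g h := by
    have : ∏ i, (mulAutArrow g.right h.left) i = ∏ i, h.left i :=
      Equiv.prod_comp (g.right⁻¹ : Equiv.Perm (Fin n)) (fun i => h.left i)
    simp only [SemidirectProduct.mul_left, Pi.mul_apply, Finset.prod_mul_distrib, this]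

/-- `W(D_n)`, the kernel of `σ`: an even number of signs `-1`. -/
def WD (n : ℕ) : Subgroup (WB n) := (sigma n).ker

/-! ### The Picard lattice and the action of `W(D_n)` on it -/

/-- The lattice `Pic(X̄) = ℤ l₋₁ ⊕ ℤ l₀ ⊕ ℤ l₁ ⊕ ⋯ ⊕ ℤ l_n`, an element being its triple of
coordinates `(x₋₁, x₀, (x₁, …, x_n))`. -/
abbrev Pic (n : ℕ) : Type := ℤ × ℤ × (Fin n → ℤ)

/-- The class `l₀` of a fibre. -/
def fiberClass (n : ℕ) : Pic n := (0, 1, 0)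

/-- The canonical class `K = -2 (l₋₁ + l₀) + l₁ + ⋯ + l_n`. -/
def canonicalClass (n : ℕ) : Pic n := (-2, -2, fun _ => 1)

/-- The number `t` of minus signs of `c_{j₁} ⋯ c_{j_t} τ`. -/
def negCount {n : ℕ} (g : WB n) : ℕ := #{i | g.left i = -1}

/-- The action of `g = c_{j₁} ⋯ c_{j_t} τ` on the Picard lattice:
`l₋₁ ↦ l₋₁ + (t / 2) l₀ - (l_{j₁} + ⋯ + l_{j_t})`, `l₀ ↦ l₀`, and
`l_j ↦ l_{τ j}` or `l_j ↦ l₀ - l_{τ j}` according to the sign of `g` at `τ j`.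
It is used for `g` in `W(D_n)` only, where `t` is even. -/
def picAct {n : ℕ} (g : WB n) : Pic n →ₗ[ℤ] Pic n where
  toFun v :=
    (v.1,
     v.2.1 + ((negCount g / 2 : ℕ) : ℤ) * v.1
       + ∑ i, (if g.left i = -1 then v.2.2 (g.right⁻¹ i) else 0),
     fun i => if g.left i = -1 then - v.2.2 (g.right⁻¹ i) - v.1 else v.2.2 (g.right⁻¹ i))
  map_add' v w := by
    refine Prod.ext rfl (Prod.ext ?_ (funext fun i => ?_))
    · simp only [Prod.fst_add, Prod.snd_add, Pi.add_apply]
      have : ∀ i, (if g.left i = -1 then v.2.2 (g.right⁻¹ i) + w.2.2 (g.right⁻¹ i) else 0)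
          = (if g.left i = -1 then v.2.2 (g.right⁻¹ i) else 0)
            + (if g.left i = -1 then w.2.2 (g.right⁻¹ i) else 0) := by
        intro i; split_ifs <;> simp
      simp only [this, Finset.sum_add_distrib]
      ring
    · simp only [Prod.fst_add, Prod.snd_add, Pi.add_apply]
      split_ifs <;> ring
  map_smul' a v := by
    refine Prod.ext rfl (Prod.ext ?_ (funext fun i => ?_))
    · simp only [Prod.smul_fst, Prod.smul_snd, Pi.smul_apply, smul_eq_mul, RingHom.id_apply,
        mul_add, Finset.mul_sum, mul_ite, mul_zero]
      ring
    · simp only [Prod.smul_fst, Prod.smul_snd, Pi.smul_apply, smul_eq_mul, RingHom.id_apply]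
      split_ifs <;> ring

theorem two_mul_half_negCount {n : ℕ} (g : WB n) (hg : g ∈ WD n) :
    2 * ((negCount g / 2 : ℕ) : ℤ) = ∑ i, (if g.left i = -1 then 1 else 0) := by
  have h1 : ∏ i, g.left i = 1 := hg
  have h2 : ∏ i, g.left i = (-1) ^ negCount g := by
    have : ∀ i, g.left i = if g.left i = -1 then -1 else 1 := by
      intro i
      rcases Int.units_eq_one_or (g.left i) with h | h <;> simp [h]
    rw [Finset.prod_congr rfl (fun i _ => this i), Finset.prod_ite]
    simp [negCount]
  have h3 : Even (negCount g) := by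
    rcases Nat.even_or_odd (negCount g) with h | h
    · exact h
    · rw [h2, h.neg_one_pow] at h1
      exact absurd h1 (by decide)
  have h4 : 2 * (negCount g / 2) = negCount g := Nat.two_mul_div_two_of_even h3
  rw [Finset.sum_boole, ← Nat.cast_ofNat, ← Nat.cast_mul, h4]
  rfl

/-- The integral representation of `W(D_n)` on the Picard lattice. -/
def picRep (n : ℕ) : Representation ℤ (WD n) (Pic n) where
  toFun g := picAct (g : WB n)
  map_one' := by
    ext1 <;> ext <;> simp [picAct, negCount]
  map_mul' := by
    rintro ⟨g, hg⟩ ⟨h, hh⟩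
    have hgh := two_mul_half_negCount (g * h) ((WD n).mul_mem hg hh)
    have hg' := two_mul_half_negCount g hg
    have hh' := two_mul_half_negCount h hh
    have hl : ∀ i, (g * h).left i = g.left i * h.left (g.right⁻¹ i) := fun i => rfl
    have hr : ∀ i, (g * h).right⁻¹ i = h.right⁻¹ (g.right⁻¹ i) := fun i => by
      simp [SemidirectProduct.mul_right, mul_inv_rev]
    have re : ∀ f : Fin n → ℤ, ∑ i, f (g.right⁻¹ i) = ∑ i, f i := fun f =>
      Equiv.sum_comp (g.right⁻¹ : Equiv.Perm (Fin n)) f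
    refine LinearMap.ext fun v => Prod.ext rfl (Prod.ext ?_ (funext fun i => ?_))
    · change v.2.1 + ((negCount (g * h) / 2 : ℕ) : ℤ) * v.1
          + ∑ i, (if (g * h).left i = -1 then v.2.2 ((g * h).right⁻¹ i) else 0)
        = (v.2.1 + ((negCount h / 2 : ℕ) : ℤ) * v.1
            + ∑ i, (if h.left i = -1 then v.2.2 (h.right⁻¹ i) else 0))
          + ((negCount g / 2 : ℕ) : ℤ) * v.1
          + ∑ i, (if g.left i = -1 then
              (if h.left (g.right⁻¹ i) = -1 then - v.2.2 (h.right⁻¹ (g.right⁻¹ i)) - v.1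
                else v.2.2 (h.right⁻¹ (g.right⁻¹ i))) else 0)
      rw [← re (fun i => if h.left i = -1 then v.2.2 (h.right⁻¹ i) else 0)]
      rw [← re (fun i => if h.left i = -1 then 1 else 0)] at hh'
      refine mul_left_cancel₀ (two_ne_zero (α := ℤ)) ?_
      simp only [mul_add, ← mul_assoc, hgh, hg', hh', hl, hr, Finset.mul_sum, Finset.sum_mul]
      have : ∀ a b c d e f k : ℤ, b + c = d + e + f + k → 2 * a + b + c = 2 * a + d + e + f + k :=
        fun a b c d e f k hh => by linarith
      apply this
      simp only [← Finset.sum_add_distrib]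
      refine Finset.sum_congr rfl fun i _ => ?_
      rcases Int.units_eq_one_or (g.left i) with h1 | h1 <;>
      rcases Int.units_eq_one_or (h.left (g.right⁻¹ i)) with h2 | h2 <;>
      simp only [h1, h2, mul_one, one_mul, neg_mul, neg_neg, reduceIte,
        (by decide : ¬ ((1 : ℤˣ) = -1))] <;> ring
    · change (if (g * h).left i = -1 then - v.2.2 ((g * h).right⁻¹ i) - v.1
          else v.2.2 ((g * h).right⁻¹ i))
        = if g.left i = -1 then
            - (if h.left (g.right⁻¹ i) = -1 then - v.2.2 (h.right⁻¹ (g.right⁻¹ i)) - v.1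
                else v.2.2 (h.right⁻¹ (g.right⁻¹ i))) - v.1
          else (if h.left (g.right⁻¹ i) = -1 then - v.2.2 (h.right⁻¹ (g.right⁻¹ i)) - v.1
                else v.2.2 (h.right⁻¹ (g.right⁻¹ i)))
      rw [hl, hr]
      rcases Int.units_eq_one_or (g.left i) with h1 | h1 <;>
      rcases Int.units_eq_one_or (h.left (g.right⁻¹ i)) with h2 | h2 <;>
      simp only [h1, h2, mul_one, one_mul, neg_mul, neg_neg, reduceIte,
        (by decide : ¬ ((1 : ℤˣ) = -1))] <;> ring

/-! ### The conditions on a subgroup -/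

/-- `H¹(H, Pic(X̄)) = 0`, for a subgroup `H` of `W(D_n)`. -/
def H1Vanishes {n : ℕ} (H : Subgroup (WD n)) : Prop :=
  Subsingleton (groupCohomology.H1 (Rep.of ((picRep n).comp H.subtype)))

/-- Condition (H1): `H¹(H, Pic(X̄)) = 0` for every subgroup `H` of `G`. -/
def ConditionH1 {n : ℕ} (G : Subgroup (WD n)) : Prop :=
  ∀ H : Subgroup (WD n), H ≤ G → H1Vanishes H

/-- Relative minimality: `Pic(X̄)^G = ℤ l₀ ⊕ ℤ K`. -/
def RelativelyMinimal {n : ℕ} (G : Subgroup (WD n)) : Prop :=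
  Representation.invariants ((picRep n).comp G.subtype) =
    Submodule.span ℤ {fiberClass n, canonicalClass n}

/-- `G` is a subgroup of `W(D_n)` satisfying (H1) and relative minimality. -/
structure IsAdmissible {n : ℕ} (G : Subgroup (WB n)) : Prop where
  le_WD : G ≤ WD n
  conditionH1 : ConditionH1 (G.subgroupOf (WD n))
  relativelyMinimal : RelativelyMinimal (G.subgroupOf (WD n))

/-- The orbits of `pr(G)` on `{1, …, n}` have the lengths in the list `l`, with multiplicity. -/
def HasOrbitLengths {n : ℕ} (G : Subgroup (WB n)) (l : List ℕ) : Prop :=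
  ∃ e : MulAction.orbitRel.Quotient (G.map (pr n)) (Fin n) ≃ Fin l.length,
    ∀ o, o.orbit.ncard = l.get (e o)

/-- `S` is a Sylow 2-subgroup of `G`. -/
def IsSylowTwo {Γ : Type*} [Group Γ] (G S : Subgroup Γ) : Prop :=
  ∃ P : Sylow 2 G, (P : Subgroup G).map G.subtype = S

/-- `S` is a subgroup of `G` that contains a Sylow 2-subgroup of `G`. -/
def ContainsSylowTwo {Γ : Type*} [Group Γ] (G S : Subgroup Γ) : Prop :=
  S ≤ G ∧ ∃ P : Sylow 2 G, (P : Subgroup G).map G.subtype ≤ S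

/-- The cyclic group of order `m`. -/
abbrev Cyc (m : ℕ) : Type := Multiplicative (ZMod m)

/-- `G` is isomorphic to a semidirect product `N ⋊ K`. -/
def IsSemidirect (N K G : Type*) [Group N] [Group K] [Group G] : Prop :=
  ∃ φ : K →* MulAut N, Nonempty (G ≃* N ⋊[φ] K)

/-! ### Signed permutations written with the labels `1, …, N` -/

section words

variable {N : ℕ} [NeZero N]

/-- The point of `Fin N` with label `j`, for `1 ≤ j ≤ N`. -/
def pt (j : ℕ) : Fin N := Fin.ofNat N (j - 1)

/-- The product of the `c_j` with `j ∈ S`. -/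
def c (S : Finset ℕ) : WB N :=
  SemidirectProduct.inl fun i => if i.val + 1 ∈ S then -1 else 1

/-- A permutation as a signed permutation without signs. -/
def perm (τ : Equiv.Perm (Fin N)) : WB N := SemidirectProduct.inr τ

/-- The cycle `(j₁, j₂, …, j_k)`, sending `j₁` to `j₂` and so on. -/
def cyc (l : List ℕ) : Equiv.Perm (Fin N) := (l.map pt).formPerm

/-- `(a+2, a+3)(a+4, a+5) ⋯ (a+2n, a+2n+1)`. -/
def flips (a n : ℕ) : Equiv.Perm (Fin N) :=
  ((List.range n).map fun i => cyc [a + 2 * i + 2, a + 2 * i + 3]).prod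

/-- `(a+1, a+2, a+4, …, a+2n, a+2n+1, a+2n-1, …, a+3)`, a cycle of length `2n+1`. -/
def rot (a n : ℕ) : Equiv.Perm (Fin N) :=
  cyc ((a + 1) :: ((List.range n).map fun i => a + 2 * i + 2)
    ++ ((List.range n).reverse.map fun i => a + 2 * i + 3))

/-- `(1, m+1)(2, m+2) ⋯ (m, 2m)`. -/
def blockSwap (m : ℕ) : Equiv.Perm (Fin N) :=
  ((List.range m).map fun i => cyc [i + 1, m + i + 1]).prod

/-- `(1, m+1, 2m+1)(2, m+2, 2m+2) ⋯ (m, 2m, 3m)`. -/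
def blockCycle (m : ℕ) : Equiv.Perm (Fin N) :=
  ((List.range m).map fun i => cyc [i + 1, m + i + 1, 2 * m + i + 1]).prod

/-- `(1, 2n+2)(2, 2n+3, 3, 2n+4) ⋯ (2n, 4n+1, 2n+1, 4n+2)`. -/
def fourCycles (n : ℕ) : Equiv.Perm (Fin N) :=
  cyc [1, 2 * n + 2] * ((List.range n).map fun i =>
    cyc [2 * i + 2, 2 * n + 2 * i + 3, 2 * i + 3, 2 * n + 2 * i + 4]).prod

end words

/-! ### Labels for the elements of a finite field -/

/-- A presentation `𝔽 = (ℤ/p)[x]/(h)` of the field with `p ^ r` elements, `h` monic irreducible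
of degree `r`, together with a generator `Γ` of its multiplicative group. -/
structure FieldData (p r : ℕ) where
  h : Polynomial (ZMod p)
  monic : h.Monic
  irreducible : Irreducible h
  natDegree_eq : h.natDegree = r
  Γ : (AdjoinRoot h)ˣ
  generates : ∀ u : (AdjoinRoot h)ˣ, u ∈ Subgroup.zpowers Γ

namespace FieldData

variable {p r : ℕ} (D : FieldData p r)

/-- The field `(ℤ/p)[x]/(h)`. -/
abbrev field : Type := AdjoinRoot D.h

open Classical in
/-- `a₀ + a₁ x + ⋯ + a_{r-1} x^{r-1}`, `0 ≤ a_i < p`, has the label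
`a₀ + a₁ p + ⋯ + a_{r-1} p^{r-1}`, except that `0` has the label `p ^ r`. -/
noncomputable def lab (a : D.field) : ℕ :=
  if a = 0 then p ^ r
  else ∑ i ∈ range r, ((AdjoinRoot.modByMonicHom D.monic a).coeff i).val * p ^ i

variable {N : ℕ} [NeZero N]

/-- `(a + 1, a + lab Γ, …, a + lab Γ^(p^r-2))`: multiplication by `Γ`, labels shifted by `a`. -/
noncomputable def mulCycle (a : ℕ) : Equiv.Perm (Fin N) :=
  cyc ((List.range (p ^ r - 1)).map fun k => a + D.lab ((D.Γ ^ k : D.fieldˣ) : D.field))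

end FieldData

/-- `(p^r, 1, …, p-1)(p, p+1, …, 2p-1) ⋯ (p^r-p, …, p^r-1)`: addition of `1` in the field with
`p ^ r` elements, all labels shifted by `a`. -/
def addCycles {N : ℕ} [NeZero N] (p r a : ℕ) : Equiv.Perm (Fin N) :=
  ((List.range (p ^ (r - 1))).map fun k =>
    cyc ((List.range p).map fun i => a + if k = 0 ∧ i = 0 then p ^ r else k * p + i)).prod

/-! ### The generators of the 24 classes -/

namespace Class1

variable (n : ℕ)

def g₁ : WB (2 * n + 2) := c (Icc 1 (2 * n + 2)) * perm (flips 0 n)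
def g₂ : WB (2 * n + 2) := perm (rot 0 n)
def G : Subgroup (WB (2 * n + 2)) := Subgroup.closure {g₁ n, g₂ n}

end Class1

namespace Class2

variable {p r : ℕ} (D : FieldData p r)

noncomputable def g₁ : WB (p ^ r + 1) := c (Icc 1 (p ^ r + 1)) * perm (D.mulCycle 0)
def g₂ (_ : FieldData p r) : WB (p ^ r + 1) := perm (addCycles p r 0)
noncomputable def G : Subgroup (WB (p ^ r + 1)) := Subgroup.closure {g₁ D, g₂ D}

end Class2

/-! Two dihedral groups, on the labels `1, …, 2n₁+1` and `2n₁+2, …, 2n₁+2n₂+2`, with the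
orbits of length one of both identified with the last label. -/

namespace Class3

variable (n₁ n₂ : ℕ)

def g₁ : WB (2 * n₁ + 2 * n₂ + 3) :=
  c (Icc 1 (2 * n₁ + 1) ∪ {2 * n₁ + 2 * n₂ + 3}) * perm (flips 0 n₁)
def g₂ : WB (2 * n₁ + 2 * n₂ + 3) := perm (rot 0 n₁)
def g₁' : WB (2 * n₁ + 2 * n₂ + 3) :=
  c (Icc (2 * n₁ + 2) (2 * n₁ + 2 * n₂ + 2) ∪ {2 * n₁ + 2 * n₂ + 3}) *
    perm (flips (2 * n₁ + 1) n₂)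
def g₂' : WB (2 * n₁ + 2 * n₂ + 3) := perm (rot (2 * n₁ + 1) n₂)
def G : Subgroup (WB (2 * n₁ + 2 * n₂ + 3)) :=
  Subgroup.closure {g₁ n₁ n₂, g₂ n₁ n₂, g₁' n₁ n₂, g₂' n₁ n₂}

end Class3

/-! A dihedral group on the labels `1, …, 2n+1` and a Frobenius group on the labels
`2n+2, …, 2n+1+p^r`, with the orbits of length one of both identified with the last label. -/

namespace Class4

variable (n : ℕ) {p r : ℕ} (D : FieldData p r)

def g₁ (_ : FieldData p r) : WB (2 * n + p ^ r + 2) :=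
  c (Icc 1 (2 * n + 1) ∪ {2 * n + p ^ r + 2}) * perm (flips 0 n)
def g₂ (_ : FieldData p r) : WB (2 * n + p ^ r + 2) := perm (rot 0 n)
noncomputable def g₁' : WB (2 * n + p ^ r + 2) :=
  c (Icc (2 * n + 2) (2 * n + p ^ r + 1) ∪ {2 * n + p ^ r + 2}) *
    perm (D.mulCycle (2 * n + 1))
def g₂' (_ : FieldData p r) : WB (2 * n + p ^ r + 2) := perm (addCycles p r (2 * n + 1))
noncomputable def G : Subgroup (WB (2 * n + p ^ r + 2)) :=
  Subgroup.closure {g₁ n D, g₂ n D, g₁' n D, g₂' n D}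

end Class4

/-! Classes 5 and 7: the elements `g₁g₁'`, `g₂`, `g₂'` of class 3 fix the last pair of symbols,
which is removed. -/

namespace Class5

variable (n₁ n₂ : ℕ)

/-- `g₁g₁'` -/
def s : WB (2 * n₁ + 2 * n₂ + 2) :=
  c (Icc 1 (2 * n₁ + 2 * n₂ + 2)) * perm (flips 0 n₁ * flips (2 * n₁ + 1) n₂)
def g₂ : WB (2 * n₁ + 2 * n₂ + 2) := perm (rot 0 n₁)
def g₂' : WB (2 * n₁ + 2 * n₂ + 2) := perm (rot (2 * n₁ + 1) n₂)
def G : Subgroup (WB (2 * n₁ + 2 * n₂ + 2)) :=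
  Subgroup.closure {s n₁ n₂, g₂ n₁ n₂, g₂' n₁ n₂}

end Class5

namespace Class7

def G (n₁ n₂ : ℕ) : Subgroup (WB (2 * n₁ + 2 * n₂ + 2)) :=
  Subgroup.closure {Class5.s n₁ n₂, Class5.g₂ n₁ n₂ * Class5.g₂' n₁ n₂}

end Class7

/-! Classes 6 and 8: the elements `g₁g₁'`, `g₂`, `g₂'` of class 4 fix the last pair of symbols,
which is removed. -/

namespace Class6

variable (n : ℕ) {p r : ℕ} (D : FieldData p r)

/-- `g₁g₁'` -/
noncomputable def s : WB (2 * n + p ^ r + 1) :=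
  c (Icc 1 (2 * n + p ^ r + 1)) * perm (flips 0 n * D.mulCycle (2 * n + 1))
def g₂ (_ : FieldData p r) : WB (2 * n + p ^ r + 1) := perm (rot 0 n)
def g₂' (_ : FieldData p r) : WB (2 * n + p ^ r + 1) := perm (addCycles p r (2 * n + 1))
noncomputable def G : Subgroup (WB (2 * n + p ^ r + 1)) :=
  Subgroup.closure {s n D, g₂ n D, g₂' n D}

end Class6

namespace Class8

noncomputable def G (n : ℕ) {p r : ℕ} (D : FieldData p r) : Subgroup (WB (2 * n + p ^ r + 1)) :=
  Subgroup.closure {Class6.s n D, Class6.g₂ n D * Class6.g₂' n D}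

end Class8

namespace Class9

variable (n : ℕ)

def g₁ : WB (2 * n + 3) := c (Icc 1 (2 * n + 2)) * perm (flips 0 n)
def g₂ : WB (2 * n + 3) := perm (rot 0 n)
def g₃ : WB (2 * n + 3) := c {2 * n + 2, 2 * n + 3}
def G : Subgroup (WB (2 * n + 3)) := Subgroup.closure {g₁ n, g₂ n, g₃ n}

end Class9

namespace Class10

variable (n : ℕ)

def g₁ : WB (2 * n + 3) :=
  c (Icc 1 (2 * n + 2)) * perm (flips 0 n * cyc [2 * n + 2, 2 * n + 3])
def g₂ : WB (2 * n + 3) := perm (rot 0 n)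
def G : Subgroup (WB (2 * n + 3)) := Subgroup.closure {g₁ n, g₂ n}

end Class10

namespace Class11

variable (n : ℕ)

def g₁ : WB (2 * n + 3) :=
  c (Icc 1 (2 * n + 2)) * perm (flips 0 n * cyc [2 * n + 2, 2 * n + 3])
def g₂ : WB (2 * n + 3) := perm (rot 0 n)
def g₃ : WB (2 * n + 3) := perm (cyc [2 * n + 2, 2 * n + 3])
def G : Subgroup (WB (2 * n + 3)) := Subgroup.closure {g₁ n, g₂ n, g₃ n}

end Class11

namespace Class12

variable (n : ℕ)

def g₁ : WB (4 * n + 2) := c (Icc 1 (4 * n + 2)) * perm (flips 0 n * flips (2 * n + 1) n)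
def g₂ : WB (4 * n + 2) := perm (rot 0 n * rot (2 * n + 1) n)
def g₃ : WB (4 * n + 2) := perm (blockSwap (2 * n + 1))
def G : Subgroup (WB (4 * n + 2)) := Subgroup.closure {g₁ n, g₂ n, g₃ n}

end Class12

namespace Class13

variable (n : ℕ)

def g₁ : WB (4 * n + 2) := c (Icc 1 (4 * n + 2)) * perm (flips 0 n * flips (2 * n + 1) n)
def g₂ : WB (4 * n + 2) := perm (rot 0 n)
def g₃ : WB (4 * n + 2) := perm (rot (2 * n + 1) n)
def g₄ : WB (4 * n + 2) := perm (blockSwap (2 * n + 1))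
def G : Subgroup (WB (4 * n + 2)) := Subgroup.closure {g₁ n, g₂ n, g₃ n, g₄ n}

end Class13

namespace Class14

variable {p r : ℕ} (D : FieldData p r)

noncomputable def g₁ : WB (p ^ r + 2) :=
  c (Icc 1 (p ^ r + 1)) * perm (D.mulCycle 0 * cyc [p ^ r + 1, p ^ r + 2])
def g₂ (_ : FieldData p r) : WB (p ^ r + 2) := perm (addCycles p r 0)
noncomputable def G : Subgroup (WB (p ^ r + 2)) := Subgroup.closure {g₁ D, g₂ D}

end Class14

namespace Class15

variable (n : ℕ)

def g₁ : WB (4 * n + 3) := c (Icc 1 (2 * n + 1) ∪ {4 * n + 3}) * perm (fourCycles n)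
def g₂ : WB (4 * n + 3) := perm (rot 0 n)
def g₃ : WB (4 * n + 3) := perm (rot (2 * n + 1) n)
def G : Subgroup (WB (4 * n + 3)) := Subgroup.closure {g₁ n, g₂ n, g₃ n}

end Class15

namespace Class16

variable {p r : ℕ} (D : FieldData p r)

noncomputable def g₁ : WB (p ^ r + 2) :=
  c (Icc 1 (p ^ r + 1)) * perm (D.mulCycle 0 * cyc [p ^ r + 1, p ^ r + 2])
def g₂ (_ : FieldData p r) : WB (p ^ r + 2) := perm (addCycles p r 0)
def g₃ (_ : FieldData p r) : WB (p ^ r + 2) := c {p ^ r + 1, p ^ r + 2}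
noncomputable def G : Subgroup (WB (p ^ r + 2)) := Subgroup.closure {g₁ D, g₂ D, g₃ D}

end Class16

namespace Class17

variable {p r : ℕ} (D : FieldData p r)

noncomputable def g₁ : WB (p ^ r + 2) := c (Icc 1 (p ^ r + 1)) * perm (D.mulCycle 0)
def g₂ (_ : FieldData p r) : WB (p ^ r + 2) := perm (addCycles p r 0)
def g₃ (_ : FieldData p r) : WB (p ^ r + 2) := c {p ^ r + 1, p ^ r + 2}
noncomputable def G : Subgroup (WB (p ^ r + 2)) := Subgroup.closure {g₁ D, g₂ D, g₃ D}

end Class17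

namespace Class18

variable (n : ℕ)

def g₁ : WB (4 * n + 3) := c (Icc 1 (2 * n + 1) ∪ {4 * n + 3}) * perm (flips 0 n)
def g₂ : WB (4 * n + 3) :=
  c (Icc (2 * n + 2) (4 * n + 2) ∪ {4 * n + 3}) * perm (flips (2 * n + 1) n)
def g₃ : WB (4 * n + 3) := perm (blockSwap (2 * n + 1))
def g₄ : WB (4 * n + 3) := perm (rot 0 n)
def g₅ : WB (4 * n + 3) := perm (rot (2 * n + 1) n)
def G : Subgroup (WB (4 * n + 3)) := Subgroup.closure {g₁ n, g₂ n, g₃ n, g₄ n, g₅ n}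

end Class18

namespace Class19

variable {p r : ℕ} (D : FieldData p r)

noncomputable def g₁ : WB (p ^ r + 2) :=
  c (Icc 1 (p ^ r + 1)) * perm (D.mulCycle 0 * cyc [p ^ r + 1, p ^ r + 2])
def g₂ (_ : FieldData p r) : WB (p ^ r + 2) := perm (addCycles p r 0)
def g₃ (_ : FieldData p r) : WB (p ^ r + 2) := perm (cyc [p ^ r + 1, p ^ r + 2])
def g₄ (_ : FieldData p r) : WB (p ^ r + 2) := c {p ^ r + 1, p ^ r + 2}
noncomputable def G : Subgroup (WB (p ^ r + 2)) :=
  Subgroup.closure {g₁ D, g₂ D, g₃ D, g₄ D}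

end Class19

namespace Class20

variable (n₁ n₂ n₃ : ℕ)

def g₁ : WB (2 * n₁ + 2 * n₂ + 2 * n₃ + 3) :=
  c (Icc 1 (2 * n₁ + 2 * n₂ + 2)) * perm (flips 0 n₁ * flips (2 * n₁ + 1) n₂)
def g₂ : WB (2 * n₁ + 2 * n₂ + 2 * n₃ + 3) :=
  c (Icc (2 * n₁ + 2) (2 * n₁ + 2 * n₂ + 2 * n₃ + 3)) *
    perm (flips (2 * n₁ + 1) n₂ * flips (2 * n₁ + 2 * n₂ + 2) n₃)
def g₃ : WB (2 * n₁ + 2 * n₂ + 2 * n₃ + 3) := perm (rot 0 n₁)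
def g₄ : WB (2 * n₁ + 2 * n₂ + 2 * n₃ + 3) := perm (rot (2 * n₁ + 1) n₂)
def g₅ : WB (2 * n₁ + 2 * n₂ + 2 * n₃ + 3) := perm (rot (2 * n₁ + 2 * n₂ + 2) n₃)
def G : Subgroup (WB (2 * n₁ + 2 * n₂ + 2 * n₃ + 3)) :=
  Subgroup.closure {g₁ n₁ n₂ n₃, g₂ n₁ n₂ n₃, g₃ n₁ n₂ n₃, g₄ n₁ n₂ n₃, g₅ n₁ n₂ n₃}

end Class20

namespace Class21

variable (n₁ n₂ : ℕ)

def g₁ : WB (4 * n₁ + 2 * n₂ + 3) :=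
  c (Icc (2 * n₁ + 2) (4 * n₁ + 2 * n₂ + 3)) * perm (fourCycles n₁ * flips (4 * n₁ + 2) n₂)
def g₂ : WB (4 * n₁ + 2 * n₂ + 3) := perm (rot 0 n₁)
def g₃ : WB (4 * n₁ + 2 * n₂ + 3) := perm (rot (2 * n₁ + 1) n₁)
def g₄ : WB (4 * n₁ + 2 * n₂ + 3) := perm (rot (4 * n₁ + 2) n₂)
def G : Subgroup (WB (4 * n₁ + 2 * n₂ + 3)) :=
  Subgroup.closure {g₁ n₁ n₂, g₂ n₁ n₂, g₃ n₁ n₂, g₄ n₁ n₂}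

end Class21

namespace Class22

variable (n₁ n₂ : ℕ)

def g₁ : WB (4 * n₁ + 2 * n₂ + 3) :=
  c (Icc 1 (4 * n₁ + 2)) * perm (flips 0 n₁ * flips (2 * n₁ + 1) n₁)
def g₂ : WB (4 * n₁ + 2 * n₂ + 3) :=
  c (Icc (2 * n₁ + 2) (4 * n₁ + 2 * n₂ + 3)) *
    perm (flips (2 * n₁ + 1) n₁ * flips (4 * n₁ + 2) n₂)
def g₃ : WB (4 * n₁ + 2 * n₂ + 3) := perm (blockSwap (2 * n₁ + 1))
def g₄ : WB (4 * n₁ + 2 * n₂ + 3) := perm (rot 0 n₁)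
def g₅ : WB (4 * n₁ + 2 * n₂ + 3) := perm (rot (2 * n₁ + 1) n₁)
def g₆ : WB (4 * n₁ + 2 * n₂ + 3) := perm (rot (4 * n₁ + 2) n₂)
def G : Subgroup (WB (4 * n₁ + 2 * n₂ + 3)) :=
  Subgroup.closure {g₁ n₁ n₂, g₂ n₁ n₂, g₃ n₁ n₂, g₄ n₁ n₂, g₅ n₁ n₂, g₆ n₁ n₂}

end Class22

namespace Class23

variable (n : ℕ)

def g₁ : WB (6 * n + 3) := c (Icc 1 (4 * n + 2)) * perm (flips 0 n * flips (2 * n + 1) n)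
def g₂ : WB (6 * n + 3) :=
  c (Icc (2 * n + 2) (6 * n + 3)) * perm (flips (2 * n + 1) n * flips (4 * n + 2) n)
def g₃ : WB (6 * n + 3) := perm (rot 0 n)
def g₄ : WB (6 * n + 3) := perm (rot (2 * n + 1) n)
def g₅ : WB (6 * n + 3) := perm (rot (4 * n + 2) n)
def g₆ : WB (6 * n + 3) := perm (blockCycle (2 * n + 1))
def G : Subgroup (WB (6 * n + 3)) :=
  Subgroup.closure {g₁ n, g₂ n, g₃ n, g₄ n, g₅ n, g₆ n}

end Class23

namespace Class24

variable (n : ℕ)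

def g₁ : WB (6 * n + 3) := c (Icc 1 (4 * n + 2)) * perm (flips 0 n * flips (2 * n + 1) n)
def g₂ : WB (6 * n + 3) :=
  c (Icc (2 * n + 2) (6 * n + 3)) * perm (flips (2 * n + 1) n * flips (4 * n + 2) n)
def g₃ : WB (6 * n + 3) := perm (blockSwap (2 * n + 1))
def g₄ : WB (6 * n + 3) := perm (rot 0 n)
def g₅ : WB (6 * n + 3) := perm (rot (2 * n + 1) n)
def g₆ : WB (6 * n + 3) := perm (rot (4 * n + 2) n)
def g₇ : WB (6 * n + 3) := perm (blockCycle (2 * n + 1))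
def G : Subgroup (WB (6 * n + 3)) :=
  Subgroup.closure {g₁ n, g₂ n, g₃ n, g₄ n, g₅ n, g₆ n, g₇ n}

end Class24

end ConicBundle

open ConicBundle

/-! Say that g flips the point i if it fixes the pair i and exchanges i⁺ and i⁻. Everything about H¹
is controlled by the flips. Write a one-cocycle f of a finite group H of order n in the coordinates
along l₋₁, l₀ and the l_i. The coordinate along l₋₁ is a homomorphism to ℤ, hence zero. If Y_i is
the sum of the i-th coordinates of all values of f, summing the cocycle relation gives n f(g) = Y -
gY along the l_i, so only integrality is at stake. At points which nobody flips, the signs come from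
a choice of signs of the points; the lattice is a permutation lattice there, and a coboundary
removes these coordinates. At a point i flipped by g one has 2Y_i = n f(g)_i, so only the parity of
f(g)_i matters. The points of odd parity form an invariant set A, and the relation along l₀ forces
the product of the signs over A to be 1 for every element of H. If all flipped points are odd, the
coboundary of l₋₁ makes them all even. Hence H¹ vanishes unless some invariant set with trivial
product of signs separates two flipped points (`h1Vanishes_of_criterion`).

One structure, `IsFrame`, verifies this for all subgroups of G at once: G is a semidirect product of
a normal subgroup V of odd order and a subgroup S which preserves a set B of at most three points
containing every point that S flips. Suppose that A separates two flipped points for a subgroup H.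
By Sylow's theorem, odd powers and conjugations, which do not destroy flips, move the two flipping
elements into one conjugate of S, with B replaced by its translate B'. Outside B' these elements and
their powers flip nothing, so their signs over any invariant set multiply to 1 there. Since B' has
at most three points, A or its complement meets B' in one point only, and that point is flipped: the
product of the signs is -1, a contradiction (`IsFrame.criterion`). Relative minimality holds because
every point is moved into B, so that every point is flipped by a conjugate of an element of S.
Oddness of V gives the statements on Sylow subgroups.

It remains to find frames. A set of 2n+1 labels gets a coordinate in ℤ/(2n+1) for which ρ is the
translation by 1 and φ is negation. The generators become translations and signed permutations of at
most three such blocks, where the sign attached to a block is also the factor multiplying the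
coordinate (`lin`). A flipped point then satisfies 2k = 0, so it is the base point k = 0 of its
block (`flips_lin`). For the Frobenius groups a block is 𝔽_q, on which α adds 1 and μ multiplies by
Γ with the sign of the quadratic character; a unit other than 1 fixes only 0, so again only 0 can be
flipped.

The isomorphism types follow from splitting off translations. The remaining groups lie in the signed
permutations of two or three blocks, where identities are decided by computation, or are affine
groups of 𝔽_q with a prescribed action on the other blocks. -/

namespace ConicBundle

/-! ### Signed permutations of a set -/

/-- The signed permutations of `ι`. -/
abbrev WX (ι : Type*) : Type _ := (ι → ℤˣ) ⋊[mulAutArrow] Equiv.Perm ι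

namespace WX

variable {ι : Type*}

theorem mul_left_apply (g h : WX ι) (i : ι) :
    (g * h).left i = g.left i * h.left (g.right⁻¹ i) := rfl

theorem mul_right_apply (g h : WX ι) (i : ι) : (g * h).right i = g.right (h.right i) := rfl

theorem one_right_apply (i : ι) : (1 : WX ι).right i = i := rfl

/-- The sign with which `g` maps `i` to `g i`. -/
def sgn (g : WX ι) (i : ι) : ℤˣ := g.left (g.right i)

theorem left_eq_sgn (g : WX ι) (i : ι) : g.left i = sgn g (g.right⁻¹ i) := by
  simp [sgn]

theorem sgn_mul (g h : WX ι) (i : ι) : sgn (g * h) i = sgn g (h.right i) * sgn h i := by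
  simp [sgn, mul_left_apply]

theorem sgn_one (i : ι) : sgn (1 : WX ι) i = 1 := rfl

theorem right_inv_apply (g : WX ι) (i : ι) : (g⁻¹).right (g.right i) = i := by
  simp

theorem sgn_inv (g : WX ι) (i : ι) : sgn g⁻¹ (g.right i) = sgn g i := by
  have h := sgn_mul g⁻¹ g i
  rw [inv_mul_cancel, sgn_one] at h
  have := Int.units_mul_self (sgn g i)
  calc sgn g⁻¹ (g.right i) = sgn g⁻¹ (g.right i) * (sgn g i * sgn g i) := by rw [this, mul_one]
    _ = sgn g i := by rw [← mul_assoc, ← h, one_mul]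

theorem ext' {g h : WX ι} (h1 : ∀ i, g.right i = h.right i) (h2 : ∀ i, sgn g i = sgn h i) :
    g = h := by
  have hr : g.right = h.right := Equiv.ext h1
  refine SemidirectProduct.ext (funext fun i => ?_) hr
  rw [left_eq_sgn, left_eq_sgn, hr, h2]

/-- `g` exchanges the two symbols of the pair `i`. -/
def Flips (g : WX ι) (i : ι) : Prop := g.right i = i ∧ g.left i = -1

theorem flips_iff {g : WX ι} {i : ι} : Flips g i ↔ g.right i = i ∧ sgn g i = -1 := by
  unfold Flips sgn
  constructor <;> rintro ⟨h, h'⟩ <;> simp_all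

/-- The sign of t at i occurs twice and cancels. -/
theorem Flips.conj {g : WX ι} {i : ι} (h : Flips g i) (t : WX ι) :
    Flips (t * g * t⁻¹) (t.right i) := by
  rw [flips_iff] at h ⊢
  refine ⟨?_, ?_⟩
  · simp only [mul_right_apply, right_inv_apply, h.1]
  · simp only [sgn_mul, right_inv_apply, h.1, sgn_inv, h.2]
    rcases Int.units_eq_one_or (sgn t i) with h | h <;> simp [h]

/-- This allows an element that flips a point to be replaced by one of 2-power order with the same
flip. -/
theorem Flips.pow {g : WX ι} {i : ι} (h : Flips g i) {m : ℕ} (hm : Odd m) :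
    Flips (g ^ m) i := by
  rw [flips_iff] at h ⊢
  have key : ∀ k : ℕ, (g ^ k).right i = i ∧ sgn (g ^ k) i = (-1) ^ k := by
    intro k
    induction k with
    | zero => exact ⟨rfl, rfl⟩
    | succ k ih =>
      rw [_root_.pow_succ, mul_right_apply, sgn_mul, h.1, h.2, ih.1, ih.2, _root_.pow_succ]
      exact ⟨rfl, rfl⟩
  exact ⟨(key m).1, by rw [(key m).2, hm.neg_one_pow]⟩

/-- On the points flipped by no element of `K`, the signs of the elements of `K` come from a
choice of signs of the points. -/
theorem exists_sign (K : Subgroup (WX ι)) :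
    ∃ ε : ι → ℤˣ, ∀ i, (∀ g ∈ K, ¬ Flips g i) → ∀ g ∈ K, ε (g.right i) = sgn g i * ε i := by
  classical
  let s : Setoid ι :=
    { r := fun i j => ∃ g ∈ K, g.right i = j
      iseqv := ⟨fun i => ⟨1, K.one_mem, rfl⟩,
        fun {i j} ⟨g, hg, h⟩ => ⟨g⁻¹, K.inv_mem hg, by rw [← h, right_inv_apply]⟩,
        fun {i j k} ⟨g, hg, h⟩ ⟨g', hg', h'⟩ => ⟨g' * g, K.mul_mem hg' hg, by
          rw [mul_right_apply, h, h']⟩⟩ }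
  -- The sign of i will be the sign with which a chosen element of K carries the representative of
  -- the orbit to i.
  have hrep : ∀ i, ∃ g ∈ K, g.right (Quotient.mk s i).out = i := fun i => Quotient.mk_out (s := s) i
  choose k hk hki using hrep
  refine ⟨fun i => sgn (k i) (Quotient.mk s i).out, fun i hi g hg => ?_⟩
  have hq : Quotient.mk s (g.right i) = Quotient.mk s i := (Quotient.sound ⟨g, hg, rfl⟩ :
    Quotient.mk s i = Quotient.mk s (g.right i)).symm
  have h1 := hki (g.right i)
  have h2 := hki i
  rw [hq] at h1
  simp only [hq]
  set r := (Quotient.mk s i).out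
  set a := k (g.right i)
  set b := k i
  have ha : a ∈ K := hk _
  have hb : b ∈ K := hk _
  -- The two ways from the representative to the image of i, by a and by b followed by g, differ by
  -- an element fixing i. It does not flip i, so its sign there is 1, which is the asserted
  -- relation.
  have hf := hi (g⁻¹ * a * b⁻¹) (K.mul_mem (K.mul_mem (K.inv_mem hg) ha) (K.inv_mem hb))
  rw [flips_iff, not_and] at hf
  have hbi : (b⁻¹).right i = r := by rw [← h2, right_inv_apply]
  have e1 : (g⁻¹ * a * b⁻¹).right i = i := by
    simp only [mul_right_apply, hbi, h1, right_inv_apply]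
  have e2 := hf e1
  have e3 : sgn b⁻¹ i = sgn b r := by rw [← h2, sgn_inv]
  simp only [sgn_mul, hbi, h1, sgn_inv, e3] at e2
  rcases Int.units_eq_one_or (sgn a r) with h | h <;>
  rcases Int.units_eq_one_or (sgn b r) with h' | h' <;>
  rcases Int.units_eq_one_or (sgn g i) with h'' | h'' <;> simp_all

/-- Without flips on C, the signs of s are quotients ε(s i)/ε(i), and their product over the
invariant set C telescopes. -/
theorem prod_left_eq_one {s : WX ι} {C : Finset ι} (hC : ∀ i, s.right i ∈ C ↔ i ∈ C)
    (hf : ∀ i ∈ C, ∀ g ∈ Subgroup.zpowers s, ¬ Flips g i) : ∏ i ∈ C, s.left i = 1 := by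
  obtain ⟨ε, hε⟩ := exists_sign (Subgroup.zpowers s)
  have h1 : ∏ i ∈ C, s.left i = ∏ i ∈ C, sgn s i := by
    refine (Finset.prod_equiv s.right (fun i => (hC i).symm) fun i _ => rfl).symm
  have h2 : ∏ i ∈ C, ε (s.right i) = ∏ i ∈ C, ε i :=
    Finset.prod_equiv s.right (fun i => (hC i).symm) fun i _ => rfl
  have h3 : ∏ i ∈ C, ε (s.right i) = (∏ i ∈ C, sgn s i) * ∏ i ∈ C, ε i := by
    rw [← Finset.prod_mul_distrib]
    exact Finset.prod_congr rfl fun i hi => hε i (hf i hi) s (Subgroup.mem_zpowers s)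
  rw [h1]
  rw [h2] at h3
  exact mul_eq_right.mp h3.symm

instance [Finite ι] : Finite (WX ι) :=
  Finite.of_equiv _ (SemidirectProduct.equivProd (φ := (mulAutArrow :
    Equiv.Perm ι →* MulAut (ι → ℤˣ)))).symm

end WX

/-! ### One-cocycles with values in the Picard lattice -/

section cocycles

variable {N : ℕ}

theorem picAct_snd_snd (g : WB N) (v : Pic N) (i : Fin N) :
    (picAct g v).2.2 i = (g.left i : ℤ) * v.2.2 (g.right⁻¹ i) -
      (if g.left i = -1 then v.1 else 0) := by
  change (if g.left i = -1 then - v.2.2 (g.right⁻¹ i) - v.1 else v.2.2 (g.right⁻¹ i)) = _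
  rcases Int.units_eq_one_or (g.left i) with h | h <;> simp [h]

theorem picAct_snd_fst (g : WB N) (v : Pic N) :
    (picAct g v).2.1 = v.2.1 + ((negCount g / 2 : ℕ) : ℤ) * v.1
       + ∑ i, (if g.left i = -1 then v.2.2 (g.right⁻¹ i) else 0) := rfl

theorem picAct_mul {g h : WB N} (hg : g ∈ WD N) (hh : h ∈ WD N) (v : Pic N) :
    picAct (g * h) v = picAct g (picAct h v) :=
  LinearMap.congr_fun ((picRep N).map_mul ⟨g, hg⟩ ⟨h, hh⟩) v

/-- A finite group has no non-zero homomorphism to ℤ. It applies to the coordinate of a cocycle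
along l₋₁ and, once the coordinates along the l_i vanish, to the one along l₀. -/
theorem eq_zero_of_additive {Γ : Type*} [Group Γ] [Finite Γ] (f : Γ → ℤ)
    (hf : ∀ g h, f (g * h) = f h + f g) (g : Γ) : f g = 0 := by
  have h1 : f 1 = 0 := by
    have := hf 1 1
    rw [mul_one] at this
    omega
  have hp : ∀ k : ℕ, f (g ^ k) = k * f g := by
    intro k
    induction k with
    | zero => simp [h1]
    | succ k ih => rw [_root_.pow_succ, hf, ih]; push_cast; ring
  have h2 := hp (Nat.card Γ)
  rw [pow_card_eq_one', h1] at h2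
  rcases mul_eq_zero.mp h2.symm with h | h
  · exact absurd (Nat.cast_eq_zero.mp h) Nat.card_pos.ne'
  · exact h

variable {Γ : Type*} [Group Γ] (ρ : Γ →* WB N)

/-- A one-cocycle of `Γ` in the Picard lattice. -/
def IsPicCocycle (f : Γ → Pic N) : Prop := ∀ g h, f (g * h) = picAct (ρ g) (f h) + f g

variable {ρ} {f : Γ → Pic N}

theorem IsPicCocycle.fst_eq_zero [Finite Γ] (hf : IsPicCocycle ρ f) (g : Γ) : (f g).1 = 0 :=
  eq_zero_of_additive (fun g => (f g).1) (fun g h => by rw [hf g h]; rfl) g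

theorem IsPicCocycle.sub (hρ : ∀ g, ρ g ∈ WD N) (hf : IsPicCocycle ρ f) (v : Pic N) :
    IsPicCocycle ρ fun g => f g - (picAct (ρ g) v - v) := by
  intro g h
  simp only [hf g h, map_mul, picAct_mul (hρ g) (hρ h), map_sub]
  abel

variable [Fintype Γ]

theorem IsPicCocycle.coord (hf : IsPicCocycle ρ f) (g h : Γ) (i : Fin N) :
    (f (g * h)).2.2 i =
      ((ρ g).left i : ℤ) * (f h).2.2 ((ρ g).right⁻¹ i) + (f g).2.2 i := by
  rw [hf g h, Prod.snd_add, Prod.snd_add, Pi.add_apply, picAct_snd_snd, hf.fst_eq_zero]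
  simp

/-- Averaging: the cocycle relation is summed over h, and translation by g permutes the summands on
the left. Thus the order of the group times f is the coboundary of the negative of this sum, along
the l_i. -/
theorem IsPicCocycle.sum_coord (hf : IsPicCocycle ρ f) (g : Γ) (i : Fin N) :
    ∑ h, (f h).2.2 i = ((ρ g).left i : ℤ) * ∑ h, (f h).2.2 ((ρ g).right⁻¹ i)
      + Fintype.card Γ * (f g).2.2 i := by
  rw [← Equiv.sum_comp (Equiv.mulLeft g)]
  simp only [Equiv.coe_mulLeft, hf.coord g, Finset.sum_add_distrib, Finset.mul_sum]
  simp [Finset.card_univ]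

/-- At a flip the averaged relation compares the sum with its own negative. In particular the
coordinate of f at i is the same for all g that flip i. -/
theorem IsPicCocycle.two_mul_sum (hf : IsPicCocycle ρ f) {g : Γ} {i : Fin N}
    (h : WX.Flips (ρ g) i) :
    2 * ∑ h, (f h).2.2 i = Fintype.card Γ * (f g).2.2 i := by
  have h1 := hf.sum_coord g i
  have h2 : (ρ g).right⁻¹ i = i := by
    rw [Equiv.Perm.inv_eq_iff_eq]
    exact h.1.symm
  rw [h2, h.2] at h1
  push_cast at h1
  linarith

/-- The averaged relation along l₀. The group acts trivially on l₀, so the sum of the l₀-coordinates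
cancels and a relation among the other coordinates remains. -/
theorem IsPicCocycle.sum_fibre (hf : IsPicCocycle ρ f) (g : Γ) :
    ∑ i, (if (ρ g).left i = -1 then ∑ h, (f h).2.2 ((ρ g).right⁻¹ i) else 0)
      + Fintype.card Γ * (f g).2.1 = 0 := by
  have h1 : ∀ h, (f (g * h)).2.1 = (f h).2.1
      + ∑ i, (if (ρ g).left i = -1 then (f h).2.2 ((ρ g).right⁻¹ i) else 0) + (f g).2.1 := by
    intro h
    rw [hf g h, Prod.snd_add, Prod.fst_add, picAct_snd_fst, hf.fst_eq_zero]
    simp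
  have h2 : ∑ h, (f (g * h)).2.1 = ∑ h, (f h).2.1 := Equiv.sum_comp (Equiv.mulLeft g) fun h => (f h).2.1
  simp only [h1, Finset.sum_add_distrib] at h2
  rw [Finset.sum_comm] at h2
  have h3 : ∀ i, ∑ h, (if (ρ g).left i = -1 then (f h).2.2 ((ρ g).right⁻¹ i) else 0)
      = if (ρ g).left i = -1 then ∑ h, (f h).2.2 ((ρ g).right⁻¹ i) else 0 := by
    intro i
    split_ifs <;> simp
  simp only [h3, Finset.sum_const, Finset.card_univ, nsmul_eq_mul] at h2
  linarith

/-- A cocycle with vanishing coordinates along `l_i`, `i ≥ 1`, vanishes. -/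
theorem IsPicCocycle.eq_zero (hf : IsPicCocycle ρ f) (h0 : ∀ g i, (f g).2.2 i = 0) (g : Γ) :
    f g = 0 := by
  have h1 : (f g).2.1 = 0 := by
    refine eq_zero_of_additive (fun g => (f g).2.1) (fun g h => ?_) g
    rw [hf g h, Prod.snd_add, Prod.fst_add, picAct_snd_fst, hf.fst_eq_zero]
    simp [h0]
  exact Prod.ext (hf.fst_eq_zero g) (Prod.ext h1 (funext fun i => h0 g i))

/-- Up to a coboundary, the coordinates at the points that are not flipped vanish. -/
theorem IsPicCocycle.exists_sub_unflipped (hf : IsPicCocycle ρ f) :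
    ∃ v : Pic N, v.1 = 0 ∧ ∀ i, (∀ g, ¬ WX.Flips (ρ g) i) → ∀ g,
      (f g - (picAct (ρ g) v - v)).2.2 i = 0 := by
  classical
  obtain ⟨ε, hε⟩ := WX.exists_sign ρ.range
  set n : ℤ := (Fintype.card Γ : ℤ) with hn
  have hn0 : n ≠ 0 := by rw [hn]; exact_mod_cast Fintype.card_ne_zero
  let Y : Fin N → ℤ := fun i => ∑ h, (f h).2.2 i
  -- R is an equivariant lift of Y modulo n: after the signs ε are removed, the residues are
  -- constant on orbits, so taking remainders commutes with the action. The cochain used is (R -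
  -- Y)/n.
  let R : Fin N → ℤ := fun i => (ε i : ℤ) * (((ε i : ℤ) * Y i) % n)
  have hεε : ∀ i, (ε i : ℤ) * (ε i : ℤ) = 1 := fun i => by
    rw [← Units.val_mul, Int.units_mul_self, Units.val_one]
  have hdvd : ∀ i, n ∣ R i - Y i := by
    intro i
    have h1 : n ∣ ((ε i : ℤ) * Y i) - ((ε i : ℤ) * Y i) % n := Int.dvd_self_sub_emod
    have h2 : R i - Y i = -(ε i : ℤ) * (((ε i : ℤ) * Y i) - ((ε i : ℤ) * Y i) % n) := by
      have : Y i = (ε i : ℤ) * (ε i : ℤ) * Y i := by rw [hεε, one_mul]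
      simp only [R]
      linear_combination -this
    rw [h2]
    exact Dvd.dvd.mul_left h1 _
  choose y hy using hdvd
  refine ⟨(0, 0, y), rfl, fun i hi g => ?_⟩
  set j := (ρ g).right⁻¹ i with hj
  have hij : (ρ g).right j = i := by simp [hj]
  -- A flip of j would be conjugated by g into a flip of i.
  have hjf : ∀ k ∈ ρ.range, ¬ WX.Flips k j := by
    rintro _ ⟨k, rfl⟩ hk
    have := hk.conj (ρ g)
    rw [hij, ← map_inv, ← map_mul, ← map_mul] at this
    exact hi _ this
  have h1 := hε j hjf (ρ g) ⟨g, rfl⟩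
  rw [hij] at h1
  have hl : (ρ g).left i = WX.sgn (ρ g) j := by rw [WX.left_eq_sgn]
  have h2 := hf.sum_coord g i
  have hR : R i = ((ρ g).left i : ℤ) * R j := by
    have e : ((ε i : ℤ) * Y i) % n = ((ε j : ℤ) * Y j) % n := by
      apply Int.ModEq.symm
      apply (Int.modEq_iff_dvd).mpr
      refine ⟨(ε i : ℤ) * (f g).2.2 i, ?_⟩
      simp only [Y, h2]
      rw [h1, hl]
      rcases Int.units_eq_one_or (WX.sgn (ρ g) j) with h | h <;> rw [h] <;> push_cast <;> ring
    simp only [R, e]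
    rw [h1, hl]
    push_cast
    ring
  simp only [Prod.snd_sub, Pi.sub_apply, picAct_snd_snd]
  refine mul_left_cancel₀ hn0 ?_
  have e1 := hy i
  have e2 := hy j
  simp only [ite_self, ← hj]
  simp only [Y] at e1 e2
  rw [h2] at e1
  linear_combination -e1 + ((ρ g).left i : ℤ) * e2 + hR

theorem flips_inv_apply {g : WB N} {i : Fin N} (h : WX.Flips g i) : g.right⁻¹ i = i := by
  rw [Equiv.Perm.inv_eq_iff_eq]
  exact h.1.symm

/-- A cocycle which is even at the flips is a coboundary. -/
theorem IsPicCocycle.exists_of_even (hρ : ∀ g, ρ g ∈ WD N) (hf : IsPicCocycle ρ f)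
    (he : ∀ g i, WX.Flips (ρ g) i → Even ((f g).2.2 i)) :
    ∃ v, ∀ g, f g = picAct (ρ g) v - v := by
  obtain ⟨v₀, hv₀, h0⟩ := hf.exists_sub_unflipped
  have hf' := hf.sub hρ v₀
  obtain ⟨f', hf'def⟩ : ∃ f' : Γ → Pic N, f' = fun g => f g - (picAct (ρ g) v₀ - v₀) := ⟨_, rfl⟩
  have hff : ∀ g, f' g = f g - (picAct (ρ g) v₀ - v₀) := fun g => by rw [hf'def]
  rw [← hf'def] at hf'
  simp only [← hff] at h0
  set n : ℤ := (Fintype.card Γ : ℤ) with hn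
  have hn0 : n ≠ 0 := by rw [hn]; exact_mod_cast Fintype.card_ne_zero
  have hdvd : ∀ i, n ∣ - ∑ h, (f' h).2.2 i := by
    intro i
    by_cases hi : ∀ g, ¬ WX.Flips (ρ g) i
    · simp [h0 i hi]
    · push Not at hi
      obtain ⟨g, hg⟩ := hi
      obtain ⟨k, hk⟩ := he g i hg
      have := hf'.two_mul_sum hg
      -- The coboundary already subtracted changes the coordinate at a flip by the even number 2
      -- v₀ᵢ, so the coordinate stays even and can be halved in `two_mul_sum`.
      refine ⟨-(k + v₀.2.2 i), ?_⟩
      have h1 : (f' g).2.2 i = 2 * (k + v₀.2.2 i) := by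
        rw [hff, Prod.snd_sub, Prod.snd_sub, Pi.sub_apply, Prod.snd_sub, Prod.snd_sub,
          Pi.sub_apply, picAct_snd_snd, hv₀, flips_inv_apply hg, hg.2, hk]
        simp
        ring
      rw [h1] at this
      linarith
  choose y hy using hdvd
  -- With Y divisible by n, the cochain -Y/n is integral. Subtracting its coboundary kills all
  -- coordinates along the l_i, and `IsPicCocycle.eq_zero` disposes of the fibre coordinate.
  refine ⟨(0, 0, y) + v₀, fun g => ?_⟩
  have := (hf'.sub hρ (0, 0, y)).eq_zero (fun g i => ?_) g
  · rw [hff] at this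
    rw [map_add]
    linear_combination (exp := 1) this
  have e1 := hy i
  have e2 := hy ((ρ g).right⁻¹ i)
  have h2 := hf'.sum_coord g i
  rw [Prod.snd_sub, Prod.snd_sub, Pi.sub_apply, Prod.snd_sub, Prod.snd_sub, Pi.sub_apply,
    picAct_snd_snd]
  refine mul_left_cancel₀ hn0 ?_
  simp only [ite_self]
  linear_combination -e1 + ((ρ g).left i : ℤ) * e2 - h2

theorem even_sum_iff {ι : Type*} (s : Finset ι) (w : ι → ℤ) :
    Even (∑ i ∈ s, w i) ↔ Even #{i ∈ s | Odd (w i)} := by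
  classical
  induction s using Finset.induction_on with
  | empty => simp
  | insert a s ha ih =>
    rw [Finset.sum_insert ha, Finset.filter_insert, Int.even_add, ih]
    split_ifs with h
    · rw [Finset.card_insert_of_notMem (by simp [ha]), Nat.even_add_one]
      simp [Int.not_even_iff_odd.mpr h]
    · simp [Int.not_odd_iff_even.mp h]

theorem prod_units_eq_neg_one_pow {ι : Type*} (A : Finset ι) (u : ι → ℤˣ) :
    ∏ i ∈ A, u i = (-1) ^ #{i ∈ A | u i = -1} := by
  have : ∀ i ∈ A, u i = if u i = -1 then -1 else 1 := by
    intro i _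
    rcases Int.units_eq_one_or (u i) with h | h <;> simp [h]
  rw [Finset.prod_congr rfl this, Finset.prod_ite]
  simp

/-- The vanishing criterion for one-cocycles: there is no invariant set `A` with trivial character
which separates the flipped points. -/
theorem IsPicCocycle.exists_of_criterion (hρ : ∀ g, ρ g ∈ WD N) (hf : IsPicCocycle ρ f)
    (crit : ∀ A : Finset (Fin N), (∀ g i, (ρ g).right i ∈ A ↔ i ∈ A) →
      (∀ g, ∏ i ∈ A, (ρ g).left i = 1) → (∃ g, ∃ j ∈ A, WX.Flips (ρ g) j) →
      ∀ g k, WX.Flips (ρ g) k → k ∈ A) :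
    ∃ v, ∀ g, f g = picAct (ρ g) v - v := by
  classical
  obtain ⟨v₀, hv₀, h0⟩ := hf.exists_sub_unflipped
  have hf' := hf.sub hρ v₀
  obtain ⟨f', hf'def⟩ : ∃ f' : Γ → Pic N, f' = fun g => f g - (picAct (ρ g) v₀ - v₀) := ⟨_, rfl⟩
  have hff : ∀ g, f' g = f g - (picAct (ρ g) v₀ - v₀) := fun g => by rw [hf'def]
  rw [← hf'def] at hf'
  simp only [← hff] at h0
  suffices h : ∃ v, ∀ g, f' g = picAct (ρ g) v - v by
    obtain ⟨v, hv⟩ := h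
    refine ⟨v + v₀, fun g => ?_⟩
    have := hv g
    rw [hff] at this
    rw [map_add]
    linear_combination (exp := 1) this
  set n : ℤ := (Fintype.card Γ : ℤ) with hn
  have hn0 : n ≠ 0 := by rw [hn]; exact_mod_cast Fintype.card_ne_zero
  let Y : Fin N → ℤ := fun i => ∑ h, (f' h).2.2 i
  -- w i is the common value at all flips of i, and 0 if nobody flips i; in both cases it is 2Y i /
  -- n.
  have hw : ∀ i, ∃ w : ℤ, 2 * Y i = n * w ∧ ∀ g, WX.Flips (ρ g) i → (f' g).2.2 i = w := by
    intro i
    by_cases hi : ∀ g, ¬ WX.Flips (ρ g) i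
    · exact ⟨0, by simp [Y, h0 i hi], fun g hg => absurd hg (hi g)⟩
    · push Not at hi
      obtain ⟨g, hg⟩ := hi
      refine ⟨(f' g).2.2 i, hf'.two_mul_sum hg, fun g' hg' => ?_⟩
      have := (hf'.two_mul_sum hg').symm.trans (hf'.two_mul_sum hg)
      exact mul_left_cancel₀ hn0 this
  choose w hw hwf using hw
  have hY : ∀ g i, Y i = ((ρ g).left i : ℤ) * Y ((ρ g).right⁻¹ i) + n * (f' g).2.2 i :=
    fun g i => hf'.sum_coord g i
  -- By the averaged relation w is equivariant up to signs and even numbers, so its parity is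
  -- constant on orbits.
  have hwodd : ∀ g i, Odd (w i) ↔ Odd (w ((ρ g).right⁻¹ i)) := by
    intro g i
    have h1 : w i = ((ρ g).left i : ℤ) * w ((ρ g).right⁻¹ i) + 2 * (f' g).2.2 i := by
      refine mul_left_cancel₀ hn0 ?_
      rw [← hw, hY g i, mul_add, mul_add, mul_left_comm, hw]
      ring
    rw [h1]
    rcases Int.units_eq_one_or ((ρ g).left i) with h | h <;> rw [h] <;> push_cast <;> grind
  let A : Finset (Fin N) := {i | Odd (w i)}
  have hA : ∀ g i, (ρ g).right i ∈ A ↔ i ∈ A := by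
    intro g i
    simp only [A, Finset.mem_filter, Finset.mem_univ, true_and]
    rw [hwodd g]
    simp
  have hprod : ∀ g, ∏ i ∈ A, (ρ g).left i = 1 := by
    intro g
    -- The relation along l₀, doubled and divided by n. Modulo 2 it says that g has an even number
    -- of signs -1 on the set A of odd points.
    have h1 : ∑ i, (if (ρ g).left i = -1 then w ((ρ g).right⁻¹ i) else 0)
        + 2 * (f' g).2.1 = 0 := by
      refine mul_left_cancel₀ hn0 ?_
      have := hf'.sum_fibre g
      rw [mul_add, Finset.mul_sum, mul_zero]
      simp only [mul_ite, mul_zero, ← hw]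
      have h2 : ∀ i, (if (ρ g).left i = -1 then 2 * Y ((ρ g).right⁻¹ i) else 0)
          = 2 * (if (ρ g).left i = -1 then Y ((ρ g).right⁻¹ i) else 0) := by
        intro i; split_ifs <;> simp
      simp only [h2, ← Finset.mul_sum]
      linear_combination 2 * this
    have h2 : Even (∑ i, (if (ρ g).left i = -1 then w ((ρ g).right⁻¹ i) else 0)) :=
      ⟨-(f' g).2.1, by linarith⟩
    rw [← Finset.sum_filter, even_sum_iff] at h2
    rw [prod_units_eq_neg_one_pow]
    apply Even.neg_one_pow
    convert h2 using 2
    ext i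
    simp only [A, Finset.mem_filter, Finset.mem_univ, true_and, ← hwodd g i]
    exact and_comm
  by_cases hne : ∃ g, ∃ j ∈ A, WX.Flips (ρ g) j
  · have hall := crit A hA hprod hne
    -- The coboundary of l₋₁ has the coordinate -1 at every flip. Subtracting it turns the values at
    -- the flipped points, all odd here, into even ones.
    obtain ⟨v, hv⟩ := (hf'.sub hρ (1, 0, 0)).exists_of_even hρ (fun g i hg => by
      have h1 := hall g i hg
      simp only [A, Finset.mem_filter, Finset.mem_univ, true_and] at h1
      simp only [Prod.snd_sub, Pi.sub_apply, picAct_snd_snd, hwf i g hg, hg.2]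
      simp
      grind)
    refine ⟨v + (1, 0, 0), fun g => ?_⟩
    have := hv g
    rw [map_add]
    linear_combination (exp := 1) this
  · push Not at hne
    refine hf'.exists_of_even hρ fun g i hg => ?_
    have h1 : i ∉ A := fun h => hne g i h hg
    simpa [A, hwf i g hg] using h1

end cocycles

/-! ### The vanishing criterion and relative minimality -/

theorem h1Vanishes_of_criterion {N : ℕ} (H : Subgroup (WD N))
    (crit : ∀ A : Finset (Fin N), (∀ g ∈ H, ∀ i, (g : WB N).right i ∈ A ↔ i ∈ A) →
      (∀ g ∈ H, ∏ i ∈ A, (g : WB N).left i = 1) →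
      (∃ g ∈ H, ∃ j ∈ A, WX.Flips (g : WB N) j) →
      ∀ g ∈ H, ∀ k, WX.Flips (g : WB N) k → k ∈ A) : H1Vanishes H := by
  have : Finite (WB N) := inferInstanceAs (Finite (WX (Fin N)))
  have := Fintype.ofFinite H
  refine ⟨fun a b => ?_⟩
  have key : ∀ a : groupCohomology.H1 (Rep.of ((picRep N).comp H.subtype)), a = 0 := by
    intro a
    induction a using groupCohomology.H1_induction_on with
    | h x =>
      rw [groupCohomology.H1π_eq_zero_iff]
      have hx := (groupCohomology.mem_cocycles₁_iff _).mp x.2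
      obtain ⟨v, hv⟩ := IsPicCocycle.exists_of_criterion (ρ := (WD N).subtype.comp H.subtype)
        (f := x.1) (fun g => g.1.2) hx (fun A h1 h2 h3 g k => crit A (fun g hg => h1 ⟨g, hg⟩)
          (fun g hg => h2 ⟨g, hg⟩)
          (by obtain ⟨g, j, hj, h⟩ := h3; exact ⟨g.1, g.2, j, hj, h⟩) g.1 g.2 k)
      exact ⟨v, (funext fun g => (hv g).symm)⟩
  rw [key a, key b]

/-- A vector x fixed by a flip of i satisfies 2xᵢ = -x₋₁. If every point is flipped, all xᵢ have one
value c, x₋₁ = -2c, and x = (x₀ + 2c) l₀ + c K. -/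
theorem relativelyMinimal_of_flips {N : ℕ} [NeZero N] (G : Subgroup (WD N))
    (hG : ∀ i, ∃ g ∈ G, WX.Flips (g : WB N) i) : RelativelyMinimal G := by
  have hK : ∀ g ∈ WD N, picAct g (canonicalClass N) = canonicalClass N := by
    intro g hg
    have h1 := two_mul_half_negCount g hg
    refine Prod.ext rfl (Prod.ext ?_ (funext fun i => ?_))
    · rw [picAct_snd_fst]
      simp only [canonicalClass]
      linarith
    · rw [picAct_snd_snd]
      simp only [canonicalClass]
      rcases Int.units_eq_one_or (g.left i) with h | h <;> simp [h]
  have hl : ∀ g, picAct g (fiberClass N) = fiberClass N := by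
    intro g
    refine Prod.ext rfl (Prod.ext ?_ (funext fun i => ?_))
    · rw [picAct_snd_fst]
      simp [fiberClass]
    · rw [picAct_snd_snd]
      simp [fiberClass]
  ext v
  rw [Representation.mem_invariants, Submodule.mem_span_pair]
  constructor
  · intro hv
    have h1 : ∀ i, 2 * v.2.2 i = - v.1 := by
      intro i
      obtain ⟨g, hg, hf⟩ := hG i
      have h2 := congrArg (fun w : Pic N => w.2.2 i) (hv ⟨g, hg⟩)
      change (picAct (g : WB N) v).2.2 i = v.2.2 i at h2
      rw [picAct_snd_snd, flips_inv_apply hf, hf.2] at h2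
      simp at h2
      linarith
    have h3 : ∀ i, v.2.2 i = v.2.2 0 := fun i => by linarith [h1 i, h1 0]
    refine ⟨v.2.1 + 2 * v.2.2 0, v.2.2 0, Prod.ext ?_ (Prod.ext ?_ (funext fun i => ?_))⟩
    · simp [fiberClass, canonicalClass]
      linarith [h1 0]
    · simp [fiberClass, canonicalClass]
      ring
    · simp [fiberClass, canonicalClass, h3 i]
  · rintro ⟨a, b, rfl⟩ g
    change picAct (g : WB N) _ = _
    rw [map_add, map_smul, map_smul, hl, hK _ g.1.2]

/-! ### Sylow subgroups -/

section groups

variable {Γ : Type*} [Group Γ]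

/-- Sylow's theorem is applied twice. The odd part of the order of h is removed by a power, the
result is conjugated within H into a fixed Sylow 2-subgroup of H, and that subgroup is conjugated
within G into S. The last conjugation is by one g for all h, so several elements of H can be treated
in the same conjugate of S. -/
theorem ContainsSylowTwo.exists_odd_conj [Finite Γ] {G S H : Subgroup Γ}
    (hS : ContainsSylowTwo G S) (hH : H ≤ G) :
    ∃ g ∈ G, ∀ h ∈ H, ∃ t ∈ H, ∃ m : ℕ, Odd m ∧ g * (t * h ^ m * t⁻¹) * g⁻¹ ∈ S := by
  obtain ⟨-, P, hP⟩ := hS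
  let Q : Sylow 2 H := default
  obtain ⟨R, hR⟩ := (Q.2.map (Subgroup.inclusion hH)).exists_le_sylow
  obtain ⟨g, hg⟩ := MulAction.exists_smul_eq G R P
  refine ⟨g, g.2, fun h hh => ?_⟩
  obtain ⟨k, m, hm, hkm⟩ := Nat.exists_eq_two_pow_mul_odd (n := orderOf (⟨h, hh⟩ : H))
    (orderOf_pos _).ne'
  have h2 : IsPGroup 2 (Subgroup.zpowers ((⟨h, hh⟩ : H) ^ m)) := by
    apply IsPGroup.of_card (n := k)
    rw [Nat.card_zpowers, orderOf_pow_of_dvd hm.pos.ne' ⟨_, hkm.trans (mul_comm _ _)⟩, hkm,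
      Nat.mul_div_cancel _ hm.pos]
  obtain ⟨Q', hQ'⟩ := h2.exists_le_sylow
  obtain ⟨t, ht⟩ := MulAction.exists_smul_eq H Q' Q
  refine ⟨t, t.2, m, hm, ?_⟩
  have e1 : t * (⟨h, hh⟩ : H) ^ m * t⁻¹ ∈ Q := by
    rw [← ht]
    exact Subgroup.smul_mem_pointwise_smul _ (MulAut.conj t) _ (hQ' (Subgroup.mem_zpowers _))
  have e2 : g * (Subgroup.inclusion hH (t * (⟨h, hh⟩ : H) ^ m * t⁻¹)) * g⁻¹ ∈ P := by
    rw [← hg]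
    exact Subgroup.smul_mem_pointwise_smul _ (MulAut.conj g) _
      (hR (Subgroup.mem_map_of_mem _ e1))
  exact hP ⟨_, e2, rfl⟩

/-- A Sylow 2-subgroup of S has odd index in S, hence in G. -/
theorem containsSylowTwo_of_odd [Finite Γ] {G S : Subgroup Γ} (hS : S ≤ G)
    (hodd : Odd (S.relIndex G)) : ContainsSylowTwo G S := by
  let P : Sylow 2 (S.subgroupOf G) := default
  have hP : ¬ 2 ∣ ((P : Subgroup (S.subgroupOf G)).map (S.subgroupOf G).subtype).index := by
    rw [Subgroup.index_map_subtype, Nat.prime_two.dvd_mul, not_or]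
    exact ⟨P.not_dvd_index, hodd.not_two_dvd_nat⟩
  refine ⟨hS, (P.2.map (S.subgroupOf G).subtype).toSylow hP, ?_⟩
  rintro _ ⟨_, ⟨x, hx, rfl⟩, rfl⟩
  exact x.2

theorem isSylowTwo_of_odd [Finite Γ] {G S : Subgroup Γ} (hS : S ≤ G)
    (hodd : Odd (S.relIndex G)) (h2 : IsPGroup 2 S) : IsSylowTwo G S := by
  have h3 : IsPGroup 2 (S.subgroupOf G) :=
    h2.of_injective (Subgroup.subgroupOfEquivOfLe hS).toMonoidHom
      (Subgroup.subgroupOfEquivOfLe hS).injective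
  have h4 : ¬ 2 ∣ (S.subgroupOf G).index := hodd.not_two_dvd_nat
  exact ⟨h3.toSylow h4, Subgroup.map_subgroupOf_eq_of_le hS⟩

/-! ### Internal semidirect products and recognition of groups -/

/-- `G` is the internal semidirect product of its normal subgroup `V` and its subgroup `S`. -/
structure IsInternalSemidirect (V S G : Subgroup Γ) : Prop where
  left_le : V ≤ G
  right_le : S ≤ G
  normal : ∀ g ∈ G, ∀ v ∈ V, g * v * g⁻¹ ∈ V
  disjoint : ∀ v ∈ V, v ∈ S → v = 1
  le_sup : G ≤ V ⊔ S

namespace IsInternalSemidirect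

variable {V S G : Subgroup Γ}

/-- If `S` normalizes `V`, it suffices to check generators. -/
theorem of_closure {X : Set Γ} (hV : V ≤ Subgroup.closure X) (hS : S ≤ Subgroup.closure X)
    (hn : ∀ s ∈ S, ∀ v ∈ V, s * v * s⁻¹ ∈ V) (hd : ∀ v ∈ V, v ∈ S → v = 1)
    (hX : ∀ x ∈ X, x ∈ V ⊔ S) : IsInternalSemidirect V S (Subgroup.closure X) := by
  have hle : Subgroup.closure X ≤ V ⊔ S := (Subgroup.closure_le _).mpr hX
  refine ⟨hV, hS, ?_, hd, hle⟩
  have h1 : V ⊔ S ≤ Subgroup.normalizer V := by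
    refine sup_le Subgroup.le_normalizer fun s hs => ?_
    rw [Subgroup.mem_normalizer_iff]
    intro v
    refine ⟨hn s hs v, fun h => ?_⟩
    have := hn s⁻¹ (S.inv_mem hs) _ h
    simpa [mul_assoc] using this
  intro g hg v hv
  exact (Subgroup.mem_normalizer_iff.mp (h1 (hle hg)) v).mp hv

variable (h : IsInternalSemidirect V S G)
include h

theorem normal_subgroupOf : (V.subgroupOf G).Normal :=
  ⟨fun v hv g => h.normal g g.2 v hv⟩

theorem isComplement' : (V.subgroupOf G).IsComplement' (S.subgroupOf G) := by
  have := h.normal_subgroupOf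
  refine Subgroup.isComplement'_of_disjoint_and_mul_eq_univ ?_ ?_
  · rw [Subgroup.disjoint_def]
    intro x hx hx'
    exact Subtype.ext (h.disjoint x hx hx')
  · rw [← Subgroup.normal_mul, ← Subgroup.subgroupOf_sup h.left_le h.right_le,
      Subgroup.subgroupOf_eq_top.mpr h.le_sup]
    rfl

theorem relIndex_eq : S.relIndex G = Nat.card V := by
  rw [Subgroup.relIndex, h.isComplement'.index_eq_card]
  exact Nat.card_congr (Subgroup.subgroupOfEquivOfLe h.left_le).toEquiv

theorem isSemidirect {N K : Type*} [Group N] [Group K] (eN : V ≃* N) (eK : S ≃* K) :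
    IsSemidirect N K G := by
  have := h.normal_subgroupOf
  let e₁ : V.subgroupOf G ≃* N := (Subgroup.subgroupOfEquivOfLe h.left_le).trans eN
  let e₂ : S.subgroupOf G ≃* K := (Subgroup.subgroupOfEquivOfLe h.right_le).trans eK
  exact ⟨_, ⟨(SemidirectProduct.mulEquivSubgroup h.isComplement').symm.trans
    (SemidirectProduct.congr' e₁ e₂)⟩⟩

theorem nonempty_mulEquiv_prod (hc : ∀ v ∈ V, ∀ s ∈ S, v * s = s * v) :
    Nonempty (V × S ≃* G) := by
  have hcomm : ∀ (m : V) (n : S), Commute (Subgroup.inclusion h.left_le m)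
      (Subgroup.inclusion h.right_le n) := fun m n => Subtype.ext (hc m m.2 n n.2)
  refine ⟨MulEquiv.ofBijective (MonoidHom.noncommCoprod _ _ hcomm) ⟨?_, ?_⟩⟩
  · rw [injective_iff_map_eq_one]
    rintro ⟨v, s⟩ hvs
    have h1 : (v : Γ) * s = 1 := congrArg Subtype.val hvs
    have h2 : (v : Γ) = (s : Γ)⁻¹ := eq_inv_of_mul_eq_one_left h1
    have h3 : (v : Γ) = 1 := h.disjoint v v.2 (h2 ▸ S.inv_mem s.2)
    rw [h3, one_mul] at h1
    exact Prod.ext (Subtype.ext h3) (Subtype.ext h1)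
  · intro g
    have := h.normal_subgroupOf
    have hg : g ∈ V.subgroupOf G ⊔ S.subgroupOf G := by
      rw [← Subgroup.subgroupOf_sup h.left_le h.right_le, Subgroup.subgroupOf_eq_top.mpr h.le_sup]
      trivial
    rw [← SetLike.mem_coe, Subgroup.normal_mul] at hg
    obtain ⟨v, hv, s, hs, rfl⟩ := hg
    exact ⟨(⟨v, hv⟩, ⟨s, hs⟩), Subtype.ext rfl⟩

end IsInternalSemidirect

/-- The powers of an element whose exponents are residues modulo its order. -/
noncomputable def zmodPow {m : ℕ} (a : Γ) (ha : a ^ m = 1) : Multiplicative (ZMod m) →* Γ :=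
  AddMonoidHom.toMultiplicativeLeft
    (ZMod.lift m ⟨(zmultiplesHom (Additive Γ)) (Additive.ofMul a), by
      simp [← ofMul_pow, ha]⟩)

theorem zmodPow_intCast {m : ℕ} (a : Γ) (ha : a ^ m = 1) (k : ℤ) :
    zmodPow a ha (Multiplicative.ofAdd (k : ZMod m)) = a ^ k := by
  simp [zmodPow, ← ofMul_zpow]

theorem zmodPow_injective {a : Γ} : Function.Injective (zmodPow a (pow_orderOf_eq_one a)) := by
  rw [injective_iff_map_eq_one]
  intro x hx
  obtain ⟨k, hk⟩ := ZMod.intCast_surjective x.toAdd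
  have hk' : x = Multiplicative.ofAdd (k : ZMod (orderOf a)) := by rw [hk]; rfl
  rw [hk', zmodPow_intCast] at hx
  rw [hk', (ZMod.intCast_zmod_eq_zero_iff_dvd _ _).mpr (orderOf_dvd_iff_zpow_eq_one.mpr hx)]
  rfl

theorem nonempty_mulEquiv_cyc {a : Γ} {m : ℕ} (ha : orderOf a = m) :
    Nonempty (Subgroup.closure {a} ≃* Cyc m) := by
  subst ha
  rw [← Subgroup.zpowers_eq_closure]
  have hr : (zmodPow a (pow_orderOf_eq_one a)).range = Subgroup.zpowers a := by
    ext x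
    constructor
    · rintro ⟨y, rfl⟩
      obtain ⟨k, hk⟩ := ZMod.intCast_surjective y.toAdd
      have hk' : y = Multiplicative.ofAdd (k : ZMod (orderOf a)) := by rw [hk]; rfl
      rw [hk', zmodPow_intCast]
      exact ⟨k, rfl⟩
    · rintro ⟨k, rfl⟩
      exact ⟨_, zmodPow_intCast a _ k⟩
  rw [← hr]
  exact ⟨(MonoidHom.ofInjective zmodPow_injective).symm⟩

theorem nonempty_mulEquiv_cyc_prod {a b : Γ} {m n : ℕ} (ha : orderOf a = m) (hb : orderOf b = n)
    (hab : a * b = b * a) (hd : ∀ x ∈ Subgroup.closure {a}, x ∈ Subgroup.closure {b} → x = 1) :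
    Nonempty (Subgroup.closure {a, b} ≃* Cyc m × Cyc n) := by
  have hc : ∀ v ∈ Subgroup.closure {a}, ∀ s ∈ Subgroup.closure {b}, v * s = s * v := by
    simp only [← Subgroup.zpowers_eq_closure]
    rintro _ ⟨k, rfl⟩ _ ⟨l, rfl⟩
    exact (Commute.zpow_zpow (show Commute a b from hab) k l)
  have h : IsInternalSemidirect (Subgroup.closure {a}) (Subgroup.closure {b})
      (Subgroup.closure {a, b}) := by
    refine IsInternalSemidirect.of_closure (Subgroup.closure_mono (by simp))
      (Subgroup.closure_mono (by simp)) (fun s hs v hv => ?_) hd ?_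
    · rw [← hc v hv s hs]
      simpa using hv
    · rintro x (rfl | rfl)
      · exact Subgroup.mem_sup_left (Subgroup.subset_closure rfl)
      · exact Subgroup.mem_sup_right (Subgroup.subset_closure rfl)
  obtain ⟨e⟩ := h.nonempty_mulEquiv_prod hc
  obtain ⟨ea⟩ := nonempty_mulEquiv_cyc ha
  obtain ⟨eb⟩ := nonempty_mulEquiv_cyc hb
  exact ⟨e.symm.trans (ea.prodCongr eb)⟩

theorem nonempty_mulEquiv_klein {a b : Γ} (ha : a * a = 1) (hb : b * b = 1) (hab : a * b = b * a)
    (ha1 : a ≠ 1) (hb1 : b ≠ 1) (hne : a ≠ b) :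
    Nonempty (Subgroup.closure {a, b} ≃* Cyc 2 × Cyc 2) := by
  have ho : ∀ x : Γ, x * x = 1 → x ≠ 1 → orderOf x = 2 := fun x h h1 =>
    orderOf_eq_prime (by rw [pow_two, h]) h1
  have hz : ∀ x : Γ, x * x = 1 → ∀ y ∈ Subgroup.closure {x}, y = 1 ∨ y = x := by
    intro x hx y hy
    rw [← Subgroup.zpowers_eq_closure] at hy
    obtain ⟨k, rfl⟩ := hy
    have h2 : x ^ (2 : ℤ) = 1 := by rw [zpow_two, hx]
    rcases Int.even_or_odd' k with ⟨l, rfl | rfl⟩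
    · left; simp [zpow_mul, h2]
    · right; simp [zpow_add, zpow_mul, h2]
  refine nonempty_mulEquiv_cyc_prod (ho a ha ha1) (ho b hb hb1) hab fun x hx hx' => ?_
  rcases hz a ha x hx with h | h
  · exact h
  · rcases hz b hb x hx' with h' | h'
    · exact h'
    · exact absurd (h.symm.trans h') hne

section dihedral

variable {a b : Γ} {m : ℕ} (ha : a ^ m = 1) (hb : b * b = 1) (hab : b * a * b = a⁻¹)
include hb hab

theorem zmodPow_mul_of_inverts (x : Multiplicative (ZMod m)) :
    zmodPow a ha x * b = b * zmodPow a ha x⁻¹ := by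
  obtain ⟨k, hk⟩ := ZMod.intCast_surjective x.toAdd
  have hk' : x = Multiplicative.ofAdd (k : ZMod m) := by rw [hk]; rfl
  have hbi : b⁻¹ = b := inv_eq_of_mul_eq_one_left hb
  have h1 : b * a * b⁻¹ = a⁻¹ := by rw [hbi, hab]
  have h2 : b * a ^ k * b⁻¹ = (a ^ k)⁻¹ := by rw [← conj_zpow, h1, inv_zpow]
  rw [map_inv, hk', zmodPow_intCast, ← h2, hbi, ← mul_assoc, ← mul_assoc, hb, one_mul]

/-- The homomorphism from a dihedral group given by a rotation `a` and a reflection `b`. -/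
noncomputable def dihedralLift : DihedralGroup m →* Γ where
  toFun
    | .r i => zmodPow a ha (Multiplicative.ofAdd i)
    | .sr i => b * zmodPow a ha (Multiplicative.ofAdd i)
  map_one' := map_one (zmodPow a ha)
  map_mul' x y := by
    have key := zmodPow_mul_of_inverts ha hb hab
    rcases x with i | i <;> rcases y with j | j
    · exact map_mul (zmodPow a ha) (Multiplicative.ofAdd i) (Multiplicative.ofAdd j)
    · change b * zmodPow a ha (Multiplicative.ofAdd (j - i)) = _ * (b * _)
      rw [← mul_assoc, key, mul_assoc, ← map_mul, ← ofAdd_neg, ← ofAdd_add, neg_add_eq_sub]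
    · change b * zmodPow a ha (Multiplicative.ofAdd (i + j)) = b * _ * _
      rw [mul_assoc, ← map_mul, ← ofAdd_add]
    · change zmodPow a ha (Multiplicative.ofAdd (j - i)) = b * _ * (b * _)
      rw [mul_assoc, ← mul_assoc _ b, key, mul_assoc, ← mul_assoc b b, hb, one_mul, ← map_mul,
        ← ofAdd_neg, ← ofAdd_add, neg_add_eq_sub]

end dihedral

/-- The lift from the abstract dihedral group is injective on rotations because m is the exact order
of a; a reflection in the kernel would make b a power of a. -/
theorem nonempty_mulEquiv_dihedral {a b : Γ} {m : ℕ} (ha : orderOf a = m) (hb : b * b = 1)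
    (hab : b * a * b = a⁻¹) (hba : b ∉ Subgroup.zpowers a) :
    Nonempty (Subgroup.closure {a, b} ≃* DihedralGroup m) := by
  subst ha
  have hmem : ∀ x, zmodPow a (pow_orderOf_eq_one a) x ∈ Subgroup.zpowers a := by
    intro x
    obtain ⟨k, hk⟩ := ZMod.intCast_surjective x.toAdd
    have hk' : x = Multiplicative.ofAdd (k : ZMod (orderOf a)) := by rw [hk]; rfl
    rw [hk', zmodPow_intCast]
    exact ⟨k, rfl⟩
  let f := dihedralLift (pow_orderOf_eq_one a) hb hab
  have hfr : ∀ i, f (.r i) = zmodPow a (pow_orderOf_eq_one a) (Multiplicative.ofAdd i) :=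
    fun _ => rfl
  have hfs : ∀ i, f (.sr i) = b * zmodPow a (pow_orderOf_eq_one a) (Multiplicative.ofAdd i) :=
    fun _ => rfl
  have hf : Function.Injective f := by
    rw [injective_iff_map_eq_one]
    rintro (i | i) hi
    · rw [hfr, map_eq_one_iff _ zmodPow_injective] at hi
      exact congrArg DihedralGroup.r (ofAdd_eq_one.mp hi)
    · rw [hfs] at hi
      refine absurd ?_ hba
      rw [eq_inv_of_mul_eq_one_left hi]
      exact (Subgroup.zpowers a).inv_mem (hmem _)
  have hr : f.range = Subgroup.closure {a, b} := by
    have hab' : a ∈ Subgroup.closure {a, b} := Subgroup.subset_closure (by simp)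
    have hbb' : b ∈ Subgroup.closure {a, b} := Subgroup.subset_closure (by simp)
    have hz : Subgroup.zpowers a ≤ Subgroup.closure {a, b} := by
      rw [Subgroup.zpowers_le]; exact hab'
    apply le_antisymm
    · rintro _ ⟨i | i, rfl⟩
      · exact hz (hmem _)
      · exact Subgroup.mul_mem _ hbb' (hz (hmem _))
    · rw [Subgroup.closure_le]
      rintro x (rfl | rfl)
      · refine ⟨.r 1, ?_⟩
        rw [hfr]
        simpa using zmodPow_intCast x (pow_orderOf_eq_one x) 1
      · refine ⟨.sr 0, ?_⟩
        rw [hfs]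
        simp
  rw [← hr]
  exact ⟨(MonoidHom.ofInjective hf).symm⟩

end groups

/-! ### Frames -/

namespace WX

variable {ι κ : Type*}

/-- Signed permutations of `ι` as signed permutations of `κ`. -/
def relabel (e : ι ≃ κ) : WX ι →* WX κ where
  toFun g := ⟨fun i => g.left (e.symm i), e.permCongr g.right⟩
  map_one' := ext' (fun i => by simp [Equiv.permCongr_apply]) fun i => rfl
  map_mul' g h := by
    refine SemidirectProduct.ext (funext fun i => ?_) (Equiv.ext fun i => ?_)
    · change g.left (e.symm i) * h.left (g.right⁻¹ (e.symm i)) =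
        g.left (e.symm i) * h.left (e.symm (e (g.right⁻¹ (e.symm i))))
      rw [e.symm_apply_apply]
    · simp [Equiv.permCongr_apply]

theorem relabel_right_apply (e : ι ≃ κ) (g : WX ι) (i : ι) :
    (relabel e g).right (e i) = e (g.right i) := by
  simp [relabel, Equiv.permCongr_apply]

theorem relabel_left_apply (e : ι ≃ κ) (g : WX ι) (i : ι) :
    (relabel e g).left (e i) = g.left i := by
  simp [relabel]

theorem relabel_injective (e : ι ≃ κ) : Function.Injective (relabel e) := by
  intro g h hgh
  refine SemidirectProduct.ext (funext fun i => ?_) (Equiv.ext fun i => e.injective ?_)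
  · rw [← relabel_left_apply e g, hgh, relabel_left_apply]
  · rw [← relabel_right_apply, hgh, relabel_right_apply]

theorem flips_relabel {e : ι ≃ κ} {g : WX ι} {i : ι} :
    Flips (relabel e g) (e i) ↔ Flips g i := by
  simp [Flips, relabel_right_apply, relabel_left_apply]

end WX

/-- `G` is the semidirect product of a normal subgroup `V` of odd order and a subgroup `S` which
respects a set `B` of at most three points containing all the points that it flips. -/
structure IsFrame {ι : Type*} [Fintype ι] (V S G : Subgroup (WX ι)) (B : Finset ι) : Prop extends
    IsInternalSemidirect V S G where
  odd : Odd (Nat.card V)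
  card_le : #B ≤ 3
  maps : ∀ s ∈ S, ∀ b ∈ B, s.right b ∈ B
  flips_mem : ∀ s ∈ S, ∀ i, WX.Flips s i → i ∈ B
  flipped : ∀ b ∈ B, ∃ s ∈ S, WX.Flips s b
  move : ∀ i, ∃ g ∈ G, g.right i ∈ B
  even : ∀ g ∈ G, ∏ i, g.left i = 1

theorem IsInternalSemidirect.map {Γ Δ : Type*} [Group Γ] [Group Δ] {V S G : Subgroup Γ}
    (h : IsInternalSemidirect V S G) {f : Γ →* Δ} (hf : Function.Injective f) :
    IsInternalSemidirect (V.map f) (S.map f) (G.map f) where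
  left_le := Subgroup.map_mono h.left_le
  right_le := Subgroup.map_mono h.right_le
  normal := by
    rintro _ ⟨g, hg, rfl⟩ _ ⟨v, hv, rfl⟩
    exact ⟨_, h.normal g hg v hv, by simp⟩
  disjoint := by
    rintro _ ⟨v, hv, rfl⟩ ⟨s, hs, hsv⟩
    rw [h.disjoint v hv (hf hsv ▸ hs), map_one]
  le_sup := by
    rw [← Subgroup.map_sup]
    exact Subgroup.map_mono h.le_sup

namespace IsFrame

variable {ι κ : Type*} [Fintype ι] [Fintype κ] {V S G : Subgroup (WX ι)} {B : Finset ι}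

theorem map (h : IsFrame V S G B) (e : ι ≃ κ) :
    IsFrame (V.map (WX.relabel e)) (S.map (WX.relabel e)) (G.map (WX.relabel e))
      (B.map e.toEmbedding) where
  toIsInternalSemidirect := h.toIsInternalSemidirect.map (WX.relabel_injective e)
  odd := by rw [Subgroup.card_map_of_injective (WX.relabel_injective e)]; exact h.odd
  card_le := by rw [Finset.card_map]; exact h.card_le
  maps := by
    rintro _ ⟨s, hs, rfl⟩ b hb
    obtain ⟨b, hb', rfl⟩ := Finset.mem_map.mp hb
    refine Finset.mem_map.mpr ⟨_, h.maps s hs b hb', (WX.relabel_right_apply e s b).symm⟩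
  flips_mem := by
    rintro _ ⟨s, hs, rfl⟩ i hi
    obtain ⟨i, rfl⟩ := e.surjective i
    exact Finset.mem_map.mpr ⟨_, h.flips_mem s hs i (WX.flips_relabel.mp hi), rfl⟩
  flipped := by
    intro b hb
    obtain ⟨b, hb', rfl⟩ := Finset.mem_map.mp hb
    obtain ⟨s, hs, hf⟩ := h.flipped b hb'
    exact ⟨_, ⟨s, hs, rfl⟩, WX.flips_relabel.mpr hf⟩
  move := by
    intro i
    obtain ⟨i, rfl⟩ := e.surjective i
    obtain ⟨g, hg, hb⟩ := h.move i
    exact ⟨_, ⟨g, hg, rfl⟩, Finset.mem_map.mpr ⟨_, hb, (WX.relabel_right_apply e g i).symm⟩⟩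
  even := by
    rintro _ ⟨g, hg, rfl⟩
    rw [← Equiv.prod_comp e]
    simp only [WX.relabel_left_apply]
    exact h.even g hg

theorem odd_relIndex (h : IsFrame V S G B) : Odd (S.relIndex G) := by
  rw [h.relIndex_eq]
  exact h.odd

theorem containsSylowTwo (h : IsFrame V S G B) : ContainsSylowTwo G S :=
  containsSylowTwo_of_odd h.right_le h.odd_relIndex

theorem isSylowTwo (h : IsFrame V S G B) (h2 : IsPGroup 2 S) : IsSylowTwo G S :=
  isSylowTwo_of_odd h.right_le h.odd_relIndex h2

/-- An invariant set A with trivial product of signs cannot separate two flipped points. The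
flipping elements are brought into one conjugate of S; then all signs outside a set B' of at most
three points multiply to 1, and A or its complement has a single point in B'. -/
theorem criterion (h : IsFrame V S G B) {H : Subgroup (WX ι)} (hH : H ≤ G) {A : Finset ι}
    (hA : ∀ g ∈ H, ∀ i, g.right i ∈ A ↔ i ∈ A) (hp : ∀ g ∈ H, ∏ i ∈ A, g.left i = 1)
    {a b : WX ι} (ha : a ∈ H) (hb : b ∈ H) {j k : ι} (hj : j ∈ A) (hk : k ∉ A)
    (haj : WX.Flips a j) (hbk : WX.Flips b k) : False := by
  classical
  obtain ⟨g, hg, hgH⟩ := h.containsSylowTwo.exists_odd_conj hH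
  -- An odd power keeps the flip, and conjugation by t in H moves the flipped point within its side
  -- of the invariant set A.
  have main : ∀ x ∈ H, ∀ i, WX.Flips x i → ∃ y ∈ H, g * y * g⁻¹ ∈ S ∧ ∃ i', WX.Flips y i' ∧
      (i' ∈ A ↔ i ∈ A) := by
    intro x hx i hxi
    obtain ⟨t, ht, m, hm, hS⟩ := hgH x hx
    exact ⟨_, H.mul_mem (H.mul_mem ht (H.pow_mem hx m)) (H.inv_mem ht), hS, t.right i,
      (hxi.pow hm).conj t, hA t ht i⟩
  obtain ⟨a', ha', haS, j', haj', hj'⟩ := main a ha j haj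
  obtain ⟨b', hb', hbS, k', hbk', hk'⟩ := main b hb k hbk
  rw [iff_true_right hj] at hj'
  rw [iff_false_right hk] at hk'
  -- B' plays for the conjugate of S by g⁻¹ the role that B plays for S.
  let B' : Finset ι := B.map g.right.symm.toEmbedding
  have hmem : ∀ i, i ∈ B' ↔ g.right i ∈ B := by
    intro i
    simp only [B', Finset.mem_map_equiv, Equiv.symm_symm]
  have hginv : ∀ x : WX ι, x = g⁻¹ * (g * x * g⁻¹) * g⁻¹⁻¹ := fun x => by group
  have hB'c : #B' ≤ 3 := by rw [Finset.card_map]; exact h.card_le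
  have hflip : ∀ x, g * x * g⁻¹ ∈ S → ∀ i, WX.Flips x i → i ∈ B' := by
    intro x hx i hi
    exact (hmem i).mpr (h.flips_mem _ hx _ (hi.conj g))
  have hmaps : ∀ x, g * x * g⁻¹ ∈ S → ∀ i, x.right i ∈ B' ↔ i ∈ B' := by
    have h1 : ∀ x, g * x * g⁻¹ ∈ S → ∀ i, i ∈ B' → x.right i ∈ B' := by
      intro x hx i hi
      have := h.maps _ hx _ ((hmem i).mp hi)
      rw [hmem]
      simpa only [WX.mul_right_apply, WX.right_inv_apply] using this
    refine fun x hx i => ⟨fun hi => ?_, h1 x hx i⟩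
    have := h1 x⁻¹ (by simpa [mul_assoc] using S.inv_mem hx) _ hi
    rwa [WX.right_inv_apply] at this
  -- All powers of x lie in the same conjugate of S, so none of them flips a point outside B'; hence
  -- `prod_left_eq_one` applies to C without B'.
  have hprod : ∀ x ∈ H, g * x * g⁻¹ ∈ S → ∀ C : Finset ι, (∀ i, x.right i ∈ C ↔ i ∈ C) →
      ∏ i ∈ C \ B', x.left i = 1 := by
    intro x _ hx C hC
    refine WX.prod_left_eq_one (fun i => ?_) fun i hi y hy hf => ?_
    · rw [Finset.mem_sdiff, Finset.mem_sdiff, hC, hmaps x hx]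
    · refine (Finset.mem_sdiff.mp hi).2 (hflip y ?_ i hf)
      obtain ⟨n, rfl⟩ := hy
      simp only [← conj_zpow]
      exact S.zpow_mem hx n
  have hsingle : ∀ x ∈ H, g * x * g⁻¹ ∈ S → ∀ i, WX.Flips x i → ∀ C : Finset ι,
      (∀ i, x.right i ∈ C ↔ i ∈ C) → C ∩ B' = {i} → ∏ i ∈ C, x.left i = 1 → False := by
    intro x hx hxS i hi C hC hCB hCp
    rw [← Finset.prod_inter_mul_prod_sdiff C B', hCB, hprod x hx hxS C hC, mul_one,
      Finset.prod_singleton, hi.2] at hCp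
    exact absurd hCp (by decide)
  have hjB := hflip a' haS j' haj'
  have hkB := hflip b' hbS k' hbk'
  -- Of at most three points, either A or its complement contains at most one. It contains the
  -- flipped point j' or k', so exactly that one.
  by_cases h1 : #(A ∩ B') ≤ 1
  · refine hsingle a' ha' haS j' haj' A (hA a' ha') ?_ (hp a' ha')
    have hj2 : j' ∈ A ∩ B' := Finset.mem_inter.mpr ⟨hj', hjB⟩
    exact Finset.eq_singleton_iff_unique_mem.mpr
      ⟨hj2, fun x hx => Finset.card_le_one.mp h1 x hx j' hj2⟩
  · have h2 : #(Aᶜ ∩ B') ≤ 1 := by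
      have := Finset.card_inter_add_card_sdiff B' A
      rw [Finset.inter_comm] at this
      have e : B' \ A = Aᶜ ∩ B' := by ext; simp [and_comm]
      rw [e] at this
      omega
    have hk2 : k' ∈ Aᶜ ∩ B' := Finset.mem_inter.mpr ⟨Finset.mem_compl.mpr hk', hkB⟩
    refine hsingle b' hb' hbS k' hbk' Aᶜ (fun i => ?_) ?_ ?_
    · rw [Finset.mem_compl, Finset.mem_compl, hA b' hb']
    · exact Finset.eq_singleton_iff_unique_mem.mpr
        ⟨hk2, fun x hx => Finset.card_le_one.mp h2 x hx k' hk2⟩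
    -- The product of all signs is 1, so the product over the complement of A is 1 as well.
    · have e1 := h.even b' (hH hb')
      rw [← Finset.prod_mul_prod_compl A, hp b' hb', one_mul] at e1
      exact e1

/-- The frame criterion holds for every subgroup, which is (H1). For relative minimality, an element
moving i into B conjugates a flip of its image back to a flip of i. -/
theorem isAdmissible {N : ℕ} [NeZero N] {V S G : Subgroup (WB N)} {B : Finset (Fin N)}
    (h : IsFrame V S G B) : IsAdmissible G where
  le_WD g hg := h.even g hg
  conditionH1 H hH := by
    refine h1Vanishes_of_criterion H fun A hA hp ⟨a, ha, j, hj, haj⟩ b hb k hbk => ?_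
    by_contra hk
    refine h.criterion (H := H.map (WD N).subtype) ?_ (A := A) ?_ ?_ ⟨a, ha, rfl⟩ ⟨b, hb, rfl⟩
      hj hk haj hbk
    · rintro _ ⟨x, hx, rfl⟩
      exact hH hx
    · rintro _ ⟨x, hx, rfl⟩
      exact hA x hx
    · rintro _ ⟨x, hx, rfl⟩
      exact hp x hx
  relativelyMinimal := by
    refine relativelyMinimal_of_flips _ fun i => ?_
    obtain ⟨g, hg, hb⟩ := h.move i
    obtain ⟨s, hs, hf⟩ := h.flipped _ hb
    have h1 : g⁻¹ * s * g⁻¹⁻¹ ∈ G :=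
      G.mul_mem (G.mul_mem (G.inv_mem hg) (h.right_le hs)) (G.inv_mem (G.inv_mem hg))
    have h2 := hf.conj g⁻¹
    rw [WX.right_inv_apply] at h2
    exact ⟨⟨_, h.even _ h1⟩, h1, h2⟩

end IsFrame

theorem IsAdmissible.h1Vanishes {N : ℕ} {G S : Subgroup (WB N)} (h : IsAdmissible G)
    (hS : S ≤ G) : H1Vanishes (S.subgroupOf (WD N)) :=
  h.conditionH1 _ (Subgroup.comap_mono hS)

theorem IsAdmissible.conditionH1_of_le {N : ℕ} {G S : Subgroup (WB N)} (h : IsAdmissible G)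
    (hS : S ≤ G) : ConditionH1 (S.subgroupOf (WD N)) :=
  fun H hH => h.conditionH1 H (hH.trans (Subgroup.comap_mono hS))

/-! ### Orbit lengths -/

/-- The function β is invariant, and every point can be moved to the representative of its value, so
the fibres of β are exactly the orbits. -/
theorem hasOrbitLengths_map {ι : Type*} [Fintype ι] {N : ℕ} {G : Subgroup (WX ι)} (e : ι ≃ Fin N)
    {l : List ℕ} (β : ι → Fin l.length) (rep : Fin l.length → ι) (hrep : ∀ o, β (rep o) = o)
    (hG : ∀ g ∈ G, ∀ i, β (g.right i) = β i)
    (hm : ∀ i, ∃ g ∈ G, g.right i = rep (β i))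
    (hcard : ∀ o, Nat.card {i // β i = o} = l.get o) :
    HasOrbitLengths (G.map (WX.relabel e)) l := by
  let P := (G.map (WX.relabel e)).map (pr N)
  have hP : ∀ q : P, ∀ i, β (e.symm (q • i)) = β (e.symm i) := by
    rintro ⟨_, _, ⟨g, hg, rfl⟩, rfl⟩ i
    change β (e.symm ((WX.relabel e g).right i)) = _
    obtain ⟨i, rfl⟩ := e.surjective i
    rw [WX.relabel_right_apply, e.symm_apply_apply, e.symm_apply_apply, hG g hg]
  have hQ : ∀ i j : Fin N, β (e.symm i) = β (e.symm j) → i ∈ MulAction.orbit P j := by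
    intro i j hij
    obtain ⟨g, hg, hgi⟩ := hm (e.symm i)
    obtain ⟨g', hg', hgj⟩ := hm (e.symm j)
    rw [hij, ← hgj] at hgi
    refine ⟨⟨_, ⟨_, ⟨g⁻¹ * g', Subgroup.mul_mem _ (Subgroup.inv_mem _ hg) hg', rfl⟩, rfl⟩⟩, ?_⟩
    change (WX.relabel e (g⁻¹ * g')).right j = i
    obtain ⟨j, rfl⟩ := e.surjective j
    rw [WX.relabel_right_apply, WX.mul_right_apply]
    rw [e.symm_apply_apply] at hgi
    rw [← hgi, WX.right_inv_apply, e.apply_symm_apply]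
  refine ⟨Equiv.ofBijective (Quotient.lift (fun i => β (e.symm i)) ?_) ⟨?_, ?_⟩, ?_⟩
  · rintro i j ⟨q, rfl⟩
    exact hP q j
  · intro x y
    induction x using Quotient.inductionOn with | h i =>
    induction y using Quotient.inductionOn with | h j =>
    intro hij
    exact Quotient.sound (hQ i j hij)
  · intro o
    exact ⟨Quotient.mk _ (e (rep o)), by simp [hrep]⟩
  · intro o
    induction o using Quotient.inductionOn with | h i =>
    have h1 : MulAction.orbitRel.Quotient.orbit (Quotient.mk (MulAction.orbitRel P (Fin N)) i)
        = e '' {j | β j = β (e.symm i)} := by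
      ext j
      rw [MulAction.orbitRel.Quotient.mem_orbit]
      constructor
      · intro h
        obtain ⟨q, rfl⟩ := Quotient.exact h
        exact ⟨e.symm (q • i), hP q i, e.apply_symm_apply _⟩
      · rintro ⟨j, hj, rfl⟩
        refine Quotient.sound (hQ _ _ ?_)
        rw [e.symm_apply_apply]
        exact hj
    rw [h1, Set.ncard_image_of_injective _ e.injective]
    exact hcard (β (e.symm i))

/-! ### Permutations written with labels -/

section labels

variable {N : ℕ} [NeZero N]

theorem pt_val_add_one {j : ℕ} (h1 : 1 ≤ j) (h2 : j ≤ N) : (pt j : Fin N).val + 1 = j := by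
  simp only [pt, Fin.val_ofNat]
  rw [Nat.mod_eq_of_lt (by omega)]
  omega

theorem pt_inj {i j : ℕ} (hi : 1 ≤ i) (hi' : i ≤ N) (hj : 1 ≤ j) (hj' : j ≤ N) :
    (pt i : Fin N) = pt j ↔ i = j := by
  refine ⟨fun h => ?_, fun h => h ▸ rfl⟩
  rw [← pt_val_add_one hi hi', ← pt_val_add_one hj hj', h]

theorem nodup_map_pt {l : List ℕ} (hl : l.Nodup) (hN : ∀ j ∈ l, 1 ≤ j ∧ j ≤ N) :
    (l.map (pt : ℕ → Fin N)).Nodup := by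
  refine hl.map_on fun i hi j hj h => ?_
  exact (pt_inj (hN i hi).1 (hN i hi).2 (hN j hj).1 (hN j hj).2).mp h

theorem cyc_apply_getElem {l : List ℕ} (hl : l.Nodup) (hN : ∀ j ∈ l, 1 ≤ j ∧ j ≤ N) (i : ℕ)
    (hi : i < l.length) :
    (cyc l : Equiv.Perm (Fin N)) (pt l[i]) =
      pt (l[(i + 1) % l.length]'(Nat.mod_lt _ (by omega))) := by
  have := List.formPerm_apply_getElem _ (nodup_map_pt hl hN) i (by simpa using hi)
  simpa [cyc] using this

theorem cyc_apply_of_notMem {l : List ℕ} (hN : ∀ j ∈ l, 1 ≤ j ∧ j ≤ N) {j : ℕ} (h1 : 1 ≤ j)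
    (h2 : j ≤ N) (hj : j ∉ l) : (cyc l : Equiv.Perm (Fin N)) (pt j) = pt j := by
  refine List.formPerm_apply_of_notMem fun h => hj ?_
  obtain ⟨i, hi, hij⟩ := List.mem_map.mp h
  rwa [← (pt_inj (hN i hi).1 (hN i hi).2 h1 h2).mp hij]

theorem cyc_pair (i j : ℕ) :
    (cyc [i, j] : Equiv.Perm (Fin N)) = Equiv.swap (pt i) (pt j) := by
  simp [cyc]

theorem cyc_pair_of_ne {i j k : ℕ} (hi : 1 ≤ i ∧ i ≤ N) (hj : 1 ≤ j ∧ j ≤ N) (hk : 1 ≤ k ∧ k ≤ N)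
    (hki : k ≠ i) (hkj : k ≠ j) : (cyc [i, j] : Equiv.Perm (Fin N)) (pt k) = pt k := by
  rw [cyc_pair, Equiv.swap_apply_of_ne_of_ne]
  · rwa [Ne, pt_inj hk.1 hk.2 hi.1 hi.2]
  · rwa [Ne, pt_inj hk.1 hk.2 hj.1 hj.2]

/-- With the next lemma, this evaluates a product of disjoint cycles point by point: all factors but
one fix both the point and its image. -/
theorem prod_apply_of_fixed {α : Type*} {f : ℕ → Equiv.Perm α} {n : ℕ} {x : α}
    (h : ∀ j < n, f j x = x) : ((List.range n).map f).prod x = x := by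
  induction n with
  | zero => rfl
  | succ n ih =>
    rw [List.range_succ, List.map_append, List.prod_append, Equiv.Perm.mul_apply]
    simp only [List.map_cons, List.map_nil, List.prod_cons, List.prod_nil, mul_one]
    rw [h n (by omega), ih fun j hj => h j (by omega)]

theorem prod_apply_of_unique {α : Type*} {f : ℕ → Equiv.Perm α} {n i : ℕ} {x y : α} (hi : i < n)
    (h : f i x = y) (hx : ∀ j < n, j ≠ i → f j x = x) (hy : ∀ j < n, j ≠ i → f j y = y) :
    ((List.range n).map f).prod x = y := by
  induction n with
  | zero => omega
  | succ n ih =>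
    rw [List.range_succ, List.map_append, List.prod_append, Equiv.Perm.mul_apply]
    simp only [List.map_cons, List.map_nil, List.prod_cons, List.prod_nil, mul_one]
    by_cases hn : i = n
    · subst hn
      rw [h, prod_apply_of_fixed fun j hj => hy j (by omega) (by omega)]
    · rw [hx n (by omega) (by omega)]
      exact ih (by omega) (fun j hj => hx j (by omega)) fun j hj => hy j (by omega)

/-! ### The coordinate on a block of `2n+1` labels -/

/-- The label in `1, …, 2n+1` of the residue of `v` modulo `2n+1`, for `v ≤ 2n`: the residues
`0, k, -k`, for `1 ≤ k ≤ n`, have the labels `1, 2k, 2k+1`. -/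
def natLabel (n v : ℕ) : ℕ := if v = 0 then 1 else if v ≤ n then 2 * v else 2 * (2 * n + 1 - v) + 1

/-- The label of a residue modulo `2n+1`. -/
def label (n : ℕ) (x : ZMod (2 * n + 1)) : ℕ := natLabel n x.val

theorem label_pos (n : ℕ) (x : ZMod (2 * n + 1)) : 1 ≤ label n x := by
  unfold label natLabel; split_ifs <;> omega

theorem label_le (n : ℕ) (x : ZMod (2 * n + 1)) : label n x ≤ 2 * n + 1 := by
  have := ZMod.val_lt x
  unfold label natLabel; split_ifs <;> omega

theorem label_injective (n : ℕ) : Function.Injective (label n) := by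
  intro x y h
  have hx := ZMod.val_lt x
  have hy := ZMod.val_lt y
  refine ZMod.val_injective _ ?_
  unfold label natLabel at h
  split_ifs at h <;> omega

/-- The labels 1, 2, 4, …, 2n, 2n+1, …, 5, 3 are those of the residues 0, 1, …, 2n in this order, so
the rotation adds 1 to the residue. -/
theorem rot_eq_cyc (a n : ℕ) : (rot a n : Equiv.Perm (Fin N)) =
    cyc ((List.range (2 * n + 1)).map fun v => a + natLabel n v) := by
  unfold rot
  congr 1
  refine List.ext_getElem (by simp; omega) fun i h1 h2 => ?_
  simp only [List.length_map, List.length_range] at h2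
  simp only [List.getElem_append, List.getElem_cons, List.getElem_map, List.getElem_range,
    List.getElem_reverse, List.length_cons, List.length_map, List.length_range, natLabel]
  split_ifs <;> omega

omit [NeZero N] in
theorem natLabel_list_mem {a n : ℕ} (ha : a + 2 * n + 1 ≤ N) :
    ∀ j ∈ (List.range (2 * n + 1)).map fun v => a + natLabel n v, 1 ≤ j ∧ j ≤ N := by
  intro j hj
  simp only [List.mem_map, List.mem_range] at hj
  obtain ⟨v, hv, rfl⟩ := hj
  unfold natLabel
  split_ifs <;> omega

theorem rot_apply {a n : ℕ} (ha : a + 2 * n + 1 ≤ N) (x : ZMod (2 * n + 1)) :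
    (rot a n : Equiv.Perm (Fin N)) (pt (a + label n x)) = pt (a + label n (x + 1)) := by
  have hx := ZMod.val_lt x
  have hnd : ((List.range (2 * n + 1)).map fun v => a + natLabel n v).Nodup := by
    refine List.nodup_range.map_on fun i hi j hj h => ?_
    simp only [List.mem_range] at hi hj
    unfold natLabel at h
    split_ifs at h <;> omega
  have h1 := cyc_apply_getElem (N := N) hnd (natLabel_list_mem ha) x.val (by simpa using hx)
  have h2 : (x + 1).val = (x.val + 1) % (2 * n + 1) := by
    conv_lhs => rw [← ZMod.natCast_zmod_val x]
    rw [← Nat.cast_succ, ZMod.val_natCast]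
  rw [rot_eq_cyc, label, label, h2]
  simpa using h1

theorem rot_apply_of_notMem {a n j : ℕ} (ha : a + 2 * n + 1 ≤ N) (h1 : 1 ≤ j) (h2 : j ≤ N)
    (hj : j ≤ a ∨ a + 2 * n + 1 < j) : (rot a n : Equiv.Perm (Fin N)) (pt j) = pt j := by
  rw [rot_eq_cyc]
  refine cyc_apply_of_notMem (natLabel_list_mem ha) h1 h2 ?_
  simp only [List.mem_map, List.mem_range, not_exists, not_and]
  intro v hv
  unfold natLabel
  split_ifs <;> omega

theorem flips_apply_of_notMem {a n j : ℕ} (ha : a + 2 * n + 1 ≤ N) (h1 : 1 ≤ j) (h2 : j ≤ N)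
    (hj : j ≤ a + 1 ∨ a + 2 * n + 1 < j) : (flips a n : Equiv.Perm (Fin N)) (pt j) = pt j :=
  prod_apply_of_fixed fun i hi =>
    cyc_pair_of_ne ⟨by omega, by omega⟩ ⟨by omega, by omega⟩ ⟨h1, h2⟩ (by omega) (by omega)

theorem flips_apply_pair {a n i : ℕ} (ha : a + 2 * n + 1 ≤ N) (hi : i < n) :
    (flips a n : Equiv.Perm (Fin N)) (pt (a + 2 * i + 2)) = pt (a + 2 * i + 3) ∧
    (flips a n : Equiv.Perm (Fin N)) (pt (a + 2 * i + 3)) = pt (a + 2 * i + 2) := by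
  constructor <;>
  refine prod_apply_of_unique hi (by rw [cyc_pair]; simp) (fun j hj hji => ?_)
    (fun j hj hji => ?_) <;>
  exact cyc_pair_of_ne ⟨by omega, by omega⟩ ⟨by omega, by omega⟩ ⟨by omega, by omega⟩ (by omega)
    (by omega)

/-- The residues ±(i+1) have the labels 2i+2 and 2i+3. Thus negation of residues is the product of
the transpositions in `flips` and, for two blocks, is visible in the four-cycles. -/
theorem natLabel_neg_cases {n : ℕ} (x : ZMod (2 * n + 1)) :
    (label n x = 1 ∧ label n (-x) = 1) ∨
    ∃ i < n, (label n x = 2 * i + 2 ∧ label n (-x) = 2 * i + 3) ∨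
      (label n x = 2 * i + 3 ∧ label n (-x) = 2 * i + 2) := by
  have hx := ZMod.val_lt x
  have hn : (-x).val = if x = 0 then 0 else 2 * n + 1 - x.val := ZMod.neg_val x
  have h0 : x = 0 ↔ x.val = 0 := (ZMod.val_eq_zero x).symm
  simp only [h0] at hn
  unfold label natLabel
  by_cases h : x.val = 0
  · left; simp [h] at hn ⊢; simp [hn]
  · right
    rw [if_neg h] at hn
    by_cases h' : x.val ≤ n
    · refine ⟨x.val - 1, by omega, Or.inl ?_⟩
      rw [if_neg h, if_pos h', if_neg (by omega), if_neg (by omega)]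
      omega
    · refine ⟨2 * n + 1 - x.val - 1, by omega, Or.inr ?_⟩
      rw [if_neg h, if_neg h', if_neg (by omega), if_pos (by omega)]
      omega

theorem flips_apply {a n : ℕ} (ha : a + 2 * n + 1 ≤ N) (x : ZMod (2 * n + 1)) :
    (flips a n : Equiv.Perm (Fin N)) (pt (a + label n x)) = pt (a + label n (-x)) := by
  rcases natLabel_neg_cases x with ⟨h1, h2⟩ | ⟨i, hi, ⟨h1, h2⟩ | ⟨h1, h2⟩⟩
  · rw [h1, h2]
    exact flips_apply_of_notMem ha (by omega) (by omega) (by omega)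
  · rw [h1, h2]
    exact (flips_apply_pair ha hi).1
  · rw [h1, h2]
    exact (flips_apply_pair ha hi).2

theorem blockSwap_apply {m i : ℕ} (hN : 2 * m ≤ N) (h1 : 1 ≤ i) (h2 : i ≤ m) :
    (blockSwap m : Equiv.Perm (Fin N)) (pt i) = pt (m + i) ∧
    (blockSwap m : Equiv.Perm (Fin N)) (pt (m + i)) = pt i := by
  obtain ⟨k, rfl⟩ : ∃ k, i = k + 1 := ⟨i - 1, by omega⟩
  constructor <;>
  refine prod_apply_of_unique (i := k) (by omega)
    (by rw [cyc_pair]; simp [← add_assoc])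
    (fun j hj hji => ?_) (fun j hj hji => ?_) <;>
  exact cyc_pair_of_ne ⟨by omega, by omega⟩ ⟨by omega, by omega⟩ ⟨by omega, by omega⟩ (by omega)
    (by omega)

theorem blockSwap_apply_of_lt {m j : ℕ} (h1 : 2 * m < j) (h2 : j ≤ N) :
    (blockSwap m : Equiv.Perm (Fin N)) (pt j) = pt j :=
  prod_apply_of_fixed fun i hi =>
    cyc_pair_of_ne ⟨by omega, by omega⟩ ⟨by omega, by omega⟩ ⟨by omega, h2⟩ (by omega) (by omega)

theorem blockCycle_apply {m i : ℕ} (hN : 3 * m ≤ N) (h1 : 1 ≤ i) (h2 : i ≤ m) :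
    (blockCycle m : Equiv.Perm (Fin N)) (pt i) = pt (m + i) ∧
    (blockCycle m : Equiv.Perm (Fin N)) (pt (m + i)) = pt (2 * m + i) ∧
    (blockCycle m : Equiv.Perm (Fin N)) (pt (2 * m + i)) = pt i := by
  obtain ⟨k, rfl⟩ : ∃ k, i = k + 1 := ⟨i - 1, by omega⟩
  have hnd : ∀ j < m, [j + 1, m + j + 1, 2 * m + j + 1].Nodup := by
    intro j hj; simp; omega
  have hmem : ∀ j < m, ∀ x ∈ [j + 1, m + j + 1, 2 * m + j + 1], 1 ≤ x ∧ x ≤ N := by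
    intro j hj; simp; omega
  have key : ∀ x y, 1 ≤ x → x ≤ N → 1 ≤ y → y ≤ N →
      (∀ j < m, j ≠ k → x ∉ [j + 1, m + j + 1, 2 * m + j + 1]) →
      (∀ j < m, j ≠ k → y ∉ [j + 1, m + j + 1, 2 * m + j + 1]) →
      (cyc [k + 1, m + k + 1, 2 * m + k + 1] : Equiv.Perm (Fin N)) (pt x) = pt y →
      (blockCycle m : Equiv.Perm (Fin N)) (pt x) = pt y := by
    intro x y hx hx' hy hy' hxl hyl h
    exact prod_apply_of_unique (i := k) (by omega) h
      (fun j hj hji => cyc_apply_of_notMem (hmem j hj) hx hx' (hxl j hj hji))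
      (fun j hj hji => cyc_apply_of_notMem (hmem j hj) hy hy' (hyl j hj hji))
  have h := cyc_apply_getElem (N := N) (hnd k (by omega)) (hmem k (by omega))
  refine ⟨key _ _ ?_ ?_ ?_ ?_ ?_ ?_ (by simpa [← add_assoc] using h 0 (by simp)),
    key _ _ ?_ ?_ ?_ ?_ ?_ ?_ (by simpa [← add_assoc] using h 1 (by simp)),
    key _ _ ?_ ?_ ?_ ?_ ?_ ?_ (by simpa [← add_assoc] using h 2 (by simp))⟩ <;>
  first | omega | (intro j hj hji; simp only [List.mem_cons, List.not_mem_nil, or_false]; omega)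

theorem fourCycles_apply_of_lt {n j : ℕ} (h1 : 4 * n + 2 < j) (h2 : j ≤ N) :
    (fourCycles n : Equiv.Perm (Fin N)) (pt j) = pt j := by
  rw [fourCycles, Equiv.Perm.mul_apply, prod_apply_of_fixed fun i hi =>
    cyc_apply_of_notMem (by simp; omega) (by omega) (by omega) (by simp; omega)]
  exact cyc_pair_of_ne ⟨by omega, by omega⟩ ⟨by omega, by omega⟩ ⟨by omega, h2⟩ (by omega)
    (by omega)

theorem fourCycles_apply_one {n : ℕ} (hN : 4 * n + 2 ≤ N) :
    (fourCycles n : Equiv.Perm (Fin N)) (pt 1) = pt (2 * n + 2) ∧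
    (fourCycles n : Equiv.Perm (Fin N)) (pt (2 * n + 2)) = pt 1 := by
  constructor <;>
  · rw [fourCycles, Equiv.Perm.mul_apply, prod_apply_of_fixed fun i hi =>
      cyc_apply_of_notMem (by simp; omega) (by omega) (by omega) (by simp <;> omega)]
    rw [cyc_pair]
    simp

theorem fourCycles_apply_four {n i : ℕ} (hN : 4 * n + 2 ≤ N) (hi : i < n) :
    (fourCycles n : Equiv.Perm (Fin N)) (pt (2 * i + 2)) = pt (2 * n + 2 * i + 3) ∧
    (fourCycles n : Equiv.Perm (Fin N)) (pt (2 * n + 2 * i + 3)) = pt (2 * i + 3) ∧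
    (fourCycles n : Equiv.Perm (Fin N)) (pt (2 * i + 3)) = pt (2 * n + 2 * i + 4) ∧
    (fourCycles n : Equiv.Perm (Fin N)) (pt (2 * n + 2 * i + 4)) = pt (2 * i + 2) := by
  have hnd : ∀ j < n, [2 * j + 2, 2 * n + 2 * j + 3, 2 * j + 3, 2 * n + 2 * j + 4].Nodup := by
    intro j hj; simp; omega
  have hmem : ∀ j < n, ∀ x ∈ [2 * j + 2, 2 * n + 2 * j + 3, 2 * j + 3, 2 * n + 2 * j + 4],
      1 ≤ x ∧ x ≤ N := by
    intro j hj; simp; omega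
  have key : ∀ x y, 1 < x → x ≤ N → 1 < y → y ≤ N → x ≠ 2 * n + 2 → y ≠ 2 * n + 2 →
      (∀ j < n, j ≠ i → x ∉ [2 * j + 2, 2 * n + 2 * j + 3, 2 * j + 3, 2 * n + 2 * j + 4]) →
      (∀ j < n, j ≠ i → y ∉ [2 * j + 2, 2 * n + 2 * j + 3, 2 * j + 3, 2 * n + 2 * j + 4]) →
      (cyc [2 * i + 2, 2 * n + 2 * i + 3, 2 * i + 3, 2 * n + 2 * i + 4] : Equiv.Perm (Fin N))
        (pt x) = pt y → (fourCycles n : Equiv.Perm (Fin N)) (pt x) = pt y := by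
    intro x y hx hx' hy hy' hxn hyn hxl hyl h
    rw [fourCycles, Equiv.Perm.mul_apply, prod_apply_of_unique hi h
      (fun j hj hji => cyc_apply_of_notMem (hmem j hj) (by omega) hx' (hxl j hj hji))
      (fun j hj hji => cyc_apply_of_notMem (hmem j hj) (by omega) hy' (hyl j hj hji))]
    exact cyc_pair_of_ne ⟨by omega, by omega⟩ ⟨by omega, by omega⟩ ⟨by omega, by omega⟩
      (by omega) (by omega)
  have h := cyc_apply_getElem (N := N) (hnd i hi) (hmem i hi)
  refine ⟨key _ _ ?_ ?_ ?_ ?_ ?_ ?_ ?_ ?_ (h 0 (by simp)),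
    key _ _ ?_ ?_ ?_ ?_ ?_ ?_ ?_ ?_ (h 1 (by simp)), key _ _ ?_ ?_ ?_ ?_ ?_ ?_ ?_ ?_ (h 2 (by simp)),
    key _ _ ?_ ?_ ?_ ?_ ?_ ?_ ?_ ?_ (by simpa using h 3 (by simp))⟩ <;>
  first | omega | (intro j hj hji; simp only [List.mem_cons, List.not_mem_nil, or_false]; omega)

/-- The permutation ψ is a square root of negation on two blocks: passing to the second block keeps
the coordinate, and coming back changes its sign. -/
theorem fourCycles_apply {n : ℕ} (hN : 4 * n + 2 ≤ N) (x : ZMod (2 * n + 1)) :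
    (fourCycles n : Equiv.Perm (Fin N)) (pt (label n x)) = pt (2 * n + 1 + label n x) ∧
    (fourCycles n : Equiv.Perm (Fin N)) (pt (2 * n + 1 + label n x)) = pt (label n (-x)) := by
  rcases natLabel_neg_cases x with ⟨h1, h2⟩ | ⟨i, hi, ⟨h1, h2⟩ | ⟨h1, h2⟩⟩
  · rw [h1, h2]
    exact fourCycles_apply_one hN
  · rw [h1, h2]
    obtain ⟨e1, e2, -, -⟩ := fourCycles_apply_four hN hi
    rw [show 2 * n + 1 + (2 * i + 2) = 2 * n + 2 * i + 3 by ring]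
    exact ⟨e1, e2⟩
  · rw [h1, h2]
    obtain ⟨-, -, e3, e4⟩ := fourCycles_apply_four hN hi
    rw [show 2 * n + 1 + (2 * i + 3) = 2 * n + 2 * i + 4 by ring]
    exact ⟨e3, e4⟩

end labels

/-! ### Blocks of odd length -/

theorem WX.prod_left_mul {ι : Type*} [Fintype ι] (g h : WX ι) :
    ∏ i, (g * h).left i = (∏ i, g.left i) * ∏ i, h.left i := by
  simp only [WX.mul_left_apply, Finset.prod_mul_distrib]
  congr 1
  exact Equiv.prod_comp (g.right⁻¹ : Equiv.Perm ι) _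

/-- The product of the signs. -/
def WX.sign {ι : Type*} [Fintype ι] : WX ι →* ℤˣ where
  toFun g := ∏ i, g.left i
  map_one' := by simp
  map_mul' := WX.prod_left_mul

section blocks

variable {m : ℕ}

/-- `m` blocks, of lengths `2 ν b + 1`. -/
abbrev Blocks (ν : Fin m → ℕ) : Type := Σ b : Fin m, ZMod (2 * ν b + 1)

variable {ν : Fin m → ℕ}

/-- The point with coordinate `k` of the block `b`. -/
def bp (b : Fin m) (k : ℤ) : Blocks ν := ⟨b, (k : ZMod (2 * ν b + 1))⟩

theorem exists_bp (p : Blocks ν) : ∃ k : ℤ, p = bp p.1 k := by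
  obtain ⟨b, x⟩ := p
  obtain ⟨k, rfl⟩ := ZMod.intCast_surjective x
  exact ⟨k, rfl⟩

theorem bp_eq_iff {b : Fin m} {k l : ℤ} :
    (bp b k : Blocks ν) = bp b l ↔ ((2 * ν b + 1 : ℕ) : ℤ) ∣ l - k := by
  simp only [bp, Sigma.mk.injEq, heq_eq_eq, true_and]
  exact ZMod.intCast_eq_intCast_iff_dvd_sub _ _ _

theorem WX.ext_bp {g h : WX (Blocks ν)} (h1 : ∀ b k, g.right (bp b k) = h.right (bp b k))
    (h2 : ∀ b k, WX.sgn g (bp b k) = WX.sgn h (bp b k)) : g = h := by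
  refine WX.ext' (fun p => ?_) fun p => ?_
  · obtain ⟨k, hk⟩ := exists_bp p
    rw [hk, h1]
  · obtain ⟨k, hk⟩ := exists_bp p
    rw [hk, h2]

/-- The translation by `w b` on every block `b`. -/
def tr (w : Fin m → ℤ) : WX (Blocks ν) :=
  SemidirectProduct.inr (Equiv.sigmaCongrRight fun b => Equiv.addRight (w b : ZMod (2 * ν b + 1)))

theorem tr_right (w : Fin m → ℤ) (b : Fin m) (k : ℤ) :
    (tr w : WX (Blocks ν)).right (bp b k) = bp b (k + w b) := by
  simp [tr, bp]

theorem tr_sgn (w : Fin m → ℤ) (p : Blocks ν) : WX.sgn (tr w : WX (Blocks ν)) p = 1 := rfl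

theorem tr_add (v w : Fin m → ℤ) : (tr (v + w) : WX (Blocks ν)) = tr v * tr w := by
  refine WX.ext_bp (fun b k => ?_) fun b k => ?_
  · simp only [WX.mul_right_apply, tr_right, Pi.add_apply]
    congr 1
    ring
  · simp only [WX.sgn_mul, tr_sgn, mul_one]

theorem tr_zero : (tr 0 : WX (Blocks ν)) = 1 := by
  refine WX.ext_bp (fun b k => ?_) fun b k => rfl
  simp [tr_right]

theorem tr_neg (v : Fin m → ℤ) : (tr (-v) : WX (Blocks ν)) = (tr v)⁻¹ := by
  rw [eq_inv_iff_mul_eq_one, ← tr_add, neg_add_cancel, tr_zero]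

theorem tr_zsmul (k : ℤ) (v : Fin m → ℤ) : (tr (k • v) : WX (Blocks ν)) = tr v ^ k := by
  let f : Multiplicative (Fin m → ℤ) →* WX (Blocks ν) :=
    { toFun := fun v => tr v.toAdd, map_one' := tr_zero, map_mul' := fun v w => tr_add _ _ }
  exact map_zpow f (Multiplicative.ofAdd v) k

theorem tr_eq_one_iff {w : Fin m → ℤ} :
    (tr w : WX (Blocks ν)) = 1 ↔ ∀ b, ((2 * ν b + 1 : ℕ) : ℤ) ∣ w b := by
  constructor
  · intro h b
    have h1 := tr_right (ν := ν) w b 0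
    rw [h, WX.one_right_apply, bp_eq_iff] at h1
    simpa using h1
  · intro h
    refine WX.ext_bp (fun b k => ?_) fun b k => rfl
    rw [tr_right, WX.one_right_apply, bp_eq_iff]
    simpa using h b

variable (ν)

/-- The translations which are trivial outside the blocks in `J`. -/
def translations (J : Set (Fin m)) : Subgroup (WX (Blocks ν)) where
  carrier := {g | ∃ w : Fin m → ℤ, (∀ b, b ∉ J → w b = 0) ∧ tr w = g}
  one_mem' := ⟨0, fun _ _ => rfl, tr_zero⟩
  mul_mem' := by
    rintro _ _ ⟨v, hv, rfl⟩ ⟨w, hw, rfl⟩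
    exact ⟨v + w, fun b hb => by simp [hv b hb, hw b hb], tr_add _ _⟩
  inv_mem' := by
    rintro _ ⟨v, hv, rfl⟩
    exact ⟨-v, fun b hb => by simp [hv b hb], tr_neg _⟩

/-- The translation by `1` on the block `b`. -/
def tb (b : Fin m) : WX (Blocks ν) := tr (Pi.single b 1)

variable {ν}

theorem tr_mem_translations {J : Set (Fin m)} {w : Fin m → ℤ} (h : ∀ b, b ∉ J → w b = 0) :
    tr w ∈ translations ν J := ⟨w, h, rfl⟩

theorem tr_mem_univ (w : Fin m → ℤ) : tr w ∈ translations ν Set.univ :=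
  tr_mem_translations fun _ hb => absurd trivial hb

theorem translations_mono {J K : Set (Fin m)} (h : J ⊆ K) :
    translations ν J ≤ translations ν K := by
  rintro _ ⟨w, hw, rfl⟩
  exact tr_mem_translations fun b hb => hw b fun h' => hb (h h')

theorem tb_mem {J : Set (Fin m)} {b : Fin m} (hb : b ∈ J) : tb ν b ∈ translations ν J :=
  tr_mem_translations fun b' hb' => Pi.single_eq_of_ne (fun h => hb' (by rw [h]; exact hb)) _

theorem translations_le_of_tb {J : Set (Fin m)} {G : Subgroup (WX (Blocks ν))}
    (h : ∀ b ∈ J, tb ν b ∈ G) : translations ν J ≤ G := by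
  rintro _ ⟨w, hw, rfl⟩
  have h1 : ∀ s : Finset (Fin m), tr (∑ b ∈ s, Pi.single b (w b)) ∈ G := by
    intro s
    induction s using Finset.induction_on with
    | empty => rw [Finset.sum_empty, tr_zero]; exact G.one_mem
    | insert b s hb ih =>
      rw [Finset.sum_insert hb, tr_add]
      refine G.mul_mem ?_ ih
      have e : (Pi.single b (w b) : Fin m → ℤ) = w b • Pi.single b 1 := by
        rw [← Pi.single_smul]; simp
      rw [e, tr_zsmul]
      by_cases hbJ : b ∈ J
      · exact G.zpow_mem (h b hbJ) _
      · rw [hw b hbJ, zpow_zero]; exact G.one_mem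
  have h2 := h1 Finset.univ
  rwa [Finset.univ_sum_single] at h2

theorem translations_eq_closure (J : Set (Fin m)) :
    translations ν J = Subgroup.closure (tb ν '' J) := by
  refine le_antisymm (translations_le_of_tb fun b hb => Subgroup.subset_closure ⟨b, hb, rfl⟩) ?_
  rw [Subgroup.closure_le]
  rintro _ ⟨b, hb, rfl⟩
  exact tb_mem hb

/-- A single label is a block of length one. This is why conditions on translations and on
coordinates are waived when ν b = 0. -/
theorem tb_eq_one {b : Fin m} (hb : ν b = 0) : tb ν b = 1 := by
  rw [tb, tr_eq_one_iff]
  intro b'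
  by_cases h : b' = b
  · subst h; simp [hb]
  · simp [Pi.single_eq_of_ne h]

theorem translations_disjoint {J K : Set (Fin m)} (h : ∀ b ∈ J, b ∉ K) {x : WX (Blocks ν)}
    (hJ : x ∈ translations ν J) (hK : x ∈ translations ν K) : x = 1 := by
  obtain ⟨v, hv, rfl⟩ := hJ
  obtain ⟨w, hw, hvw⟩ := hK
  have h1 : (tr (v - w) : WX (Blocks ν)) = 1 := by
    rw [sub_eq_add_neg, tr_add, tr_neg, hvw, mul_inv_cancel]
  rw [tr_eq_one_iff] at h1 ⊢
  intro b
  by_cases hb : b ∈ J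
  · simpa [hw b (h b hb)] using h1 b
  · simp [hv b hb]

theorem tr_comm (v w : Fin m → ℤ) : (tr v * tr w : WX (Blocks ν)) = tr w * tr v := by
  rw [← tr_add, add_comm, tr_add]

theorem translations_comm {J K : Set (Fin m)} {x y : WX (Blocks ν)}
    (hJ : x ∈ translations ν J) (hK : y ∈ translations ν K) : x * y = y * x := by
  obtain ⟨v, hv, rfl⟩ := hJ
  obtain ⟨w, hw, rfl⟩ := hK
  exact tr_comm v w

theorem translations_sup (J K : Set (Fin m)) :
    translations ν J ⊔ translations ν K = translations ν (J ∪ K) := by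
  rw [translations_eq_closure, translations_eq_closure, translations_eq_closure,
    ← Subgroup.closure_union, Set.image_union]

theorem orderOf_tb (b : Fin m) : orderOf (tb ν b) = 2 * ν b + 1 := by
  refine Nat.dvd_antisymm ?_ ?_
  · rw [orderOf_dvd_iff_pow_eq_one, ← zpow_natCast, tb, ← tr_zsmul, tr_eq_one_iff]
    intro b'
    by_cases h : b' = b
    · subst h; simp
    · simp [Pi.single_eq_of_ne h]
  · have h := pow_orderOf_eq_one (tb ν b)
    rw [← zpow_natCast, tb, ← tr_zsmul, tr_eq_one_iff] at h
    have h1 := h b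
    simp only [Pi.smul_apply, Pi.single_eq_same, smul_eq_mul, mul_one] at h1
    exact Int.natCast_dvd_natCast.mp h1

theorem translations_prod {J K : Set (Fin m)} (h : ∀ b ∈ J, b ∉ K) {A B : Type*} [Group A]
    [Group B] (hA : Nonempty (translations ν J ≃* A)) (hB : Nonempty (translations ν K ≃* B)) :
    Nonempty (translations ν (J ∪ K) ≃* A × B) := by
  have hs : IsInternalSemidirect (translations ν J) (translations ν K)
      (translations ν (J ∪ K)) := by
    refine ⟨translations_mono Set.subset_union_left, translations_mono Set.subset_union_right,
      fun g hg v hv => ?_, fun v hv hv' => translations_disjoint h hv hv', ?_⟩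
    · rw [translations_comm hg hv, mul_inv_cancel_right]; exact hv
    · rw [translations_sup]
  obtain ⟨e⟩ := hs.nonempty_mulEquiv_prod fun v hv s hs => translations_comm hv hs
  obtain ⟨eA⟩ := hA
  obtain ⟨eB⟩ := hB
  exact ⟨e.symm.trans (eA.prodCongr eB)⟩

theorem translations_singleton (b : Fin m) {n : ℕ} (hn : 2 * ν b + 1 = n) :
    Nonempty (translations ν {b} ≃* Cyc n) := by
  rw [translations_eq_closure, Set.image_singleton]
  exact nonempty_mulEquiv_cyc ((orderOf_tb b).trans hn)

theorem translations_odd (J : Set (Fin m)) : Odd (Nat.card (translations ν J)) := by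
  have h1 : ∀ s : Finset (Fin m), Odd (Nat.card (translations ν (s : Set (Fin m)))) := by
    intro s
    induction s using Finset.induction_on with
    | empty =>
      rw [translations_eq_closure]
      simp
    | insert b s hb ih =>
      obtain ⟨e⟩ := translations_prod (ν := ν) (J := {b}) (K := s) (by simpa using hb)
        (translations_singleton b rfl) ⟨MulEquiv.refl _⟩
      rw [Finset.coe_insert, ← Set.singleton_union, Nat.card_congr e.toEquiv, Nat.card_prod]
      refine Odd.mul ?_ ih
      change Odd (Nat.card (ZMod (2 * ν b + 1)))
      rw [Nat.card_zmod]
      exact odd_two_mul_add_one _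
  classical
  simpa using h1 J.toFinset

/-! ### Signed permutations of the blocks -/

variable (ν) in
/-- The signed permutations of the blocks which respect the lengths. -/
def lengthStab : Subgroup (WX (Fin m)) where
  carrier := {q | ∀ b, ν (q.right b) = ν b}
  one_mem' _ := rfl
  mul_mem' {q q'} hq hq' b := by rw [WX.mul_right_apply, hq, hq']
  inv_mem' {q} hq b := by
    rw [← hq, ← WX.mul_right_apply, mul_inv_cancel, WX.one_right_apply]

/-- The action of a signed permutation of the blocks on the points. -/
def linFun (q : WX (Fin m)) (p : Blocks ν) : Blocks ν :=
  -- The cast is used only for q in `lengthStab`, where both blocks have the same length and it is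
  -- the identity on residues.
  ⟨q.right p.1, ((WX.sgn q p.1 : ℤ) : ZMod _) * (ZMod.cast p.2 : ZMod (2 * ν (q.right p.1) + 1))⟩

theorem linFun_bp {q : WX (Fin m)} (hq : q ∈ lengthStab ν) (b : Fin m) (k : ℤ) :
    linFun q (bp b k : Blocks ν) = bp (q.right b) (WX.sgn q b * k) := by
  have h : (2 * ν (q.right b) + 1) ∣ 2 * ν b + 1 := by rw [hq b]
  have h1 : ((k : ZMod (2 * ν b + 1)).cast : ZMod (2 * ν (q.right b) + 1)) = k :=
    ZMod.cast_intCast h k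
  change (⟨q.right b, ((WX.sgn q b : ℤ) : ZMod (2 * ν (q.right b) + 1)) *
    ((k : ZMod (2 * ν b + 1)).cast : ZMod (2 * ν (q.right b) + 1))⟩ : Blocks ν) = _
  rw [h1, ← Int.cast_mul]
  rfl

/-- A signed permutation of the blocks, which respects the lengths, as a signed permutation of
the points. It multiplies the coordinates by the signs. -/
def lin : lengthStab ν →* WX (Blocks ν) where
  toFun q := ⟨fun p => q.1.left p.1,
    { toFun := linFun q.1
      invFun := linFun (q.1⁻¹)
      left_inv := by
        intro p
        obtain ⟨k, hk⟩ := exists_bp p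
        rw [hk, linFun_bp q.2, linFun_bp ((lengthStab ν).inv_mem q.2), WX.right_inv_apply,
          WX.sgn_inv, ← mul_assoc, ← Units.val_mul, Int.units_mul_self, Units.val_one, one_mul]
      right_inv := by
        intro p
        obtain ⟨k, hk⟩ := exists_bp p
        obtain ⟨b, hb⟩ := q.1.right.surjective p.1
        rw [hk, ← hb, linFun_bp ((lengthStab ν).inv_mem q.2), linFun_bp q.2, WX.right_inv_apply,
          WX.sgn_inv, ← mul_assoc, ← Units.val_mul, Int.units_mul_self, Units.val_one, one_mul] }⟩
  map_one' := by
    refine WX.ext_bp (fun b k => ?_) fun b k => rfl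
    change linFun (1 : WX (Fin m)) _ = _
    rw [linFun_bp (lengthStab ν).one_mem]
    simp [WX.sgn_one]
  map_mul' q q' := by
    refine WX.ext_bp (fun b k => ?_) fun b k => ?_
    · change linFun (q.1 * q'.1) _ = linFun q.1 (linFun q'.1 _)
      rw [linFun_bp ((lengthStab ν).mul_mem q.2 q'.2), linFun_bp q'.2, linFun_bp q.2,
        WX.sgn_mul, WX.mul_right_apply]
      push_cast
      rw [mul_assoc]
    · rw [WX.sgn_mul]
      exact WX.sgn_mul q.1 q'.1 b

theorem lin_right (q : lengthStab ν) (b : Fin m) (k : ℤ) :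
    (lin q).right (bp b k) = bp (q.1.right b) (WX.sgn q.1 b * k) := linFun_bp q.2 b k

theorem lin_left (q : lengthStab ν) (p : Blocks ν) : (lin q).left p = q.1.left p.1 := rfl

theorem lin_sgn (q : lengthStab ν) (p : Blocks ν) : WX.sgn (lin q) p = WX.sgn q.1 p.1 := rfl

theorem lin_injective : Function.Injective (lin : lengthStab ν →* WX (Blocks ν)) := by
  intro q q' h
  refine Subtype.ext (WX.ext' (fun b => ?_) fun b => ?_)
  · have h1 := lin_right q b 0
    rw [h, lin_right q' b 0] at h1
    exact (congrArg Sigma.fst h1).symm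
  · have h1 := lin_sgn q (bp b 0)
    rw [h, lin_sgn] at h1
    exact h1.symm

theorem lin_mul_tr (q : lengthStab ν) (w : Fin m → ℤ) :
    lin q * tr w = tr (fun b => q.1.left b * w (q.1.right⁻¹ b)) * lin q := by
  refine WX.ext_bp (fun b k => ?_) fun b k => ?_
  · simp only [WX.mul_right_apply, tr_right, lin_right, Equiv.Perm.coe_inv, Equiv.symm_apply_apply]
    congr 1
    rw [WX.sgn]
    ring
  · simp only [WX.sgn_mul, tr_sgn, tr_right, lin_sgn, mul_one, one_mul]
    rfl

theorem lin_conj_tr (q : lengthStab ν) (w : Fin m → ℤ) :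
    lin q * tr w * (lin q)⁻¹ = tr (fun b => q.1.left b * w (q.1.right⁻¹ b)) := by
  rw [lin_mul_tr, mul_inv_cancel_right]

theorem lin_conj_mem {J : Set (Fin m)} {q : lengthStab ν} (hJ : ∀ b ∈ J, q.1.right b ∈ J)
    {v : WX (Blocks ν)} (hv : v ∈ translations ν J) :
    lin q * v * (lin q)⁻¹ ∈ translations ν J := by
  obtain ⟨w, hw, rfl⟩ := hv
  rw [lin_conj_tr]
  refine tr_mem_translations fun b hb => ?_
  rw [hw, mul_zero]
  intro h
  apply hb
  simpa using hJ _ h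

/-- Linear elements permute the base points of the blocks, whereas a translation sends base points
to base points only if it is trivial. -/
theorem translations_inter_lin {v : WX (Blocks ν)} (hv : v ∈ translations ν Set.univ)
    {q : lengthStab ν} (h : lin q = v) : v = 1 := by
  obtain ⟨w, -, rfl⟩ := hv
  rw [tr_eq_one_iff]
  intro b
  have h1 := lin_right q b 0
  rw [h, tr_right, mul_zero, zero_add] at h1
  have h2 : b = q.1.right b := congrArg Sigma.fst h1
  rw [← h2, eq_comm, bp_eq_iff, sub_zero] at h1
  exact h1

/-- This is why the sign also acts on the coordinate: a flipped point satisfies k = -k, and the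
length of the block is odd, so k = 0. -/
theorem flips_lin {q : lengthStab ν} {b : Fin m} {k : ℤ} (h : WX.Flips (lin q) (bp b k)) :
    (bp b k : Blocks ν) = bp b 0 := by
  have h1 := h.1
  have h2 := (WX.flips_iff.mp h).2
  rw [lin_sgn] at h2
  change WX.sgn q.1 b = -1 at h2
  rw [lin_right, h2] at h1
  have h3 : q.1.right b = b := congrArg Sigma.fst h1
  rw [h3, bp_eq_iff] at h1
  rw [bp_eq_iff, zero_sub, dvd_neg]
  have h4 : ((2 * ν b + 1 : ℕ) : ℤ) ∣ 2 * k := by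
    convert h1 using 1
    push_cast
    ring
  refine IsCoprime.dvd_of_dvd_mul_left ?_ h4
  -- Bézout: 1·(2ν+1) - ν·2 = 1.
  exact ⟨1, -(ν b : ℤ), by push_cast; ring⟩

/-- The sign is constant on a block, and the number of points of the block is odd. -/
theorem lin_prod_left (q : lengthStab ν) : ∏ p, (lin q).left p = ∏ b, q.1.left b := by
  rw [Fintype.prod_sigma]
  refine Finset.prod_congr rfl fun b _ => ?_
  simp only [lin_left, Finset.prod_const, Finset.card_univ, ZMod.card]
  rw [_root_.pow_succ, pow_mul, Int.units_sq, one_pow, one_mul]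

/-- The base points of the blocks. -/
def basePoints (ν : Fin m → ℕ) : Finset (Blocks ν) := Finset.univ.image fun b => bp b 0

theorem bp_zero_mem (b : Fin m) : bp b 0 ∈ basePoints ν :=
  Finset.mem_image_of_mem _ (Finset.mem_univ b)

/-- The base points serve as the set B: linear elements preserve them and flip no other points by
`flips_lin`, and the translations in V, of odd order, move every point to the base point of its
block. The subgroup V need not contain all translations, which is used for diagonal translations. -/
theorem isFrame_of_blocks (hm : m ≤ 3) {V : Subgroup (WX (Blocks ν))}
    {Q : Subgroup (lengthStab ν)} (hV : V ≤ translations ν Set.univ)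
    (hn : ∀ q ∈ Q, ∀ v ∈ V, lin q * v * (lin q)⁻¹ ∈ V)
    (hmove : ∀ b k, ∃ v ∈ V, v.right (bp b k) = bp b 0)
    (hQ : ∀ q ∈ Q, ∏ b, (q : WX (Fin m)).left b = 1)
    (hf : ∀ b, ∃ q ∈ Q, WX.Flips (q : WX (Fin m)) b) :
    IsFrame V (Q.map lin) (V ⊔ Q.map lin) (basePoints ν) where
  left_le := le_sup_left
  right_le := le_sup_right
  normal := by
    have h1 : V ⊔ Q.map lin ≤ Subgroup.normalizer V := by
      refine sup_le Subgroup.le_normalizer ?_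
      rintro _ ⟨q, hq, rfl⟩
      rw [Subgroup.mem_normalizer_iff]
      intro v
      refine ⟨hn q hq v, fun h => ?_⟩
      have := hn q⁻¹ (Q.inv_mem hq) _ h
      simpa [mul_assoc] using this
    intro g hg v hv
    exact (Subgroup.mem_normalizer_iff.mp (h1 hg) v).mp hv
  disjoint := by
    rintro v hv ⟨q, hq, rfl⟩
    exact translations_inter_lin (hV hv) rfl
  le_sup := le_rfl
  odd := (translations_odd Set.univ).of_dvd_nat (Subgroup.card_dvd_of_le hV)
  card_le := (Finset.card_image_le.trans (by simp)).trans hm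
  maps := by
    rintro _ ⟨q, hq, rfl⟩ p hp
    obtain ⟨b, -, rfl⟩ := Finset.mem_image.mp hp
    rw [lin_right, mul_zero]
    exact bp_zero_mem _
  flips_mem := by
    rintro _ ⟨q, hq, rfl⟩ p hp
    obtain ⟨k, hk⟩ := exists_bp p
    rw [hk] at hp ⊢
    rw [flips_lin hp]
    exact bp_zero_mem _
  flipped := by
    intro p hp
    obtain ⟨b, -, rfl⟩ := Finset.mem_image.mp hp
    obtain ⟨q, hq, h⟩ := hf b
    refine ⟨_, ⟨q, hq, rfl⟩, ?_, h.2⟩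
    rw [lin_right, h.1, mul_zero]
  move := by
    intro p
    obtain ⟨k, hk⟩ := exists_bp p
    obtain ⟨v, hv, h⟩ := hmove p.1 k
    rw [hk]
    exact ⟨v, Subgroup.mem_sup_left hv, h ▸ bp_zero_mem _⟩
  even := by
    have h1 : V ⊔ Q.map lin ≤ (WX.sign : WX (Blocks ν) →* ℤˣ).ker := by
      refine sup_le (fun v hv => ?_) ?_
      · obtain ⟨w, -, rfl⟩ := hV hv
        exact Finset.prod_eq_one fun _ _ => rfl
      · rintro _ ⟨q, hq, rfl⟩
        exact (lin_prod_left q).trans (hQ q hq)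
    exact fun g hg => h1 hg

theorem isFrame_translations (hm : m ≤ 3) {Q : Subgroup (lengthStab ν)}
    (hQ : ∀ q ∈ Q, ∏ b, (q : WX (Fin m)).left b = 1)
    (hf : ∀ b, ∃ q ∈ Q, WX.Flips (q : WX (Fin m)) b) :
    IsFrame (translations ν Set.univ) (Q.map lin) (translations ν Set.univ ⊔ Q.map lin)
      (basePoints ν) := by
  refine isFrame_of_blocks hm le_rfl
    (fun q hq v hv => lin_conj_mem (J := Set.univ) (fun _ _ => trivial) hv) (fun b k => ?_) hQ hf
  refine ⟨tr (Pi.single b (-k)), tr_mem_univ _, ?_⟩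
  rw [tr_right]
  simp

end blocks

/-! ### Labels of the points of the blocks -/

/-- The bijection given by labels from `1` to `N`. -/
noncomputable def labelEquiv {ι : Type*} [Fintype ι] {N : ℕ} [NeZero N] (ℓ : ι → ℕ)
    (h : ∀ p, 1 ≤ ℓ p ∧ ℓ p ≤ N) (hinj : Function.Injective ℓ) (hcard : Fintype.card ι = N) :
    ι ≃ Fin N :=
  Equiv.ofBijective (fun p => pt (ℓ p)) ((Fintype.bijective_iff_injective_and_card _).mpr
    ⟨fun p q hpq => hinj ((pt_inj (h p).1 (h p).2 (h q).1 (h q).2).mp hpq), by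
      rw [hcard, Fintype.card_fin]⟩)

/-- A signed permutation written with labels. -/
theorem c_mul_perm_eq_relabel {ι : Type*} {N : ℕ} [NeZero N] {e : ι ≃ Fin N} {g : WX ι}
    {S : Finset ℕ} {τ : Equiv.Perm (Fin N)} (hτ : ∀ p, τ (e p) = e (g.right p))
    (hS : ∀ p, (e p).val + 1 ∈ S ↔ g.left p = -1) : c S * perm τ = WX.relabel e g := by
  refine SemidirectProduct.ext (funext fun i => ?_) (Equiv.ext fun i => ?_)
  · obtain ⟨p, rfl⟩ := e.surjective i
    rw [WX.relabel_left_apply]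
    change (if (e p).val + 1 ∈ S then -1 else 1) * 1 = g.left p
    rw [mul_one]
    split_ifs with h
    · exact ((hS p).mp h).symm
    · rcases Int.units_eq_one_or (g.left p) with h' | h'
      · exact h'.symm
      · exact absurd ((hS p).mpr h') h
  · obtain ⟨p, rfl⟩ := e.surjective i
    rw [WX.relabel_right_apply, ← hτ]
    rfl

theorem c_empty {N : ℕ} : (c ∅ : WB N) = 1 := by
  simp only [c, Finset.notMem_empty, if_false]
  exact map_one (SemidirectProduct.inl : _ →* WB N)

theorem perm_eq_relabel {ι : Type*} {N : ℕ} [NeZero N] {e : ι ≃ Fin N} {g : WX ι}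
    {τ : Equiv.Perm (Fin N)} (hτ : ∀ p, τ (e p) = e (g.right p))
    (hS : ∀ p, g.left p = 1) : perm τ = WX.relabel e g := by
  rw [← c_mul_perm_eq_relabel (S := ∅) hτ fun p => by simp [hS p], c_empty, one_mul]

section blockLabels

variable {m : ℕ} {ν : Fin m → ℕ}

/-- The number of labels before those of the block `b`. -/
def offset (ν : Fin m → ℕ) (b : Fin m) : ℕ := ∑ j, if j < b then 2 * ν j + 1 else 0

theorem offset_add_le {b b' : Fin m} (h : b < b') :
    offset ν b + (2 * ν b + 1) ≤ offset ν b' := by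
  unfold offset
  rw [← Finset.sum_filter, ← Finset.sum_filter, add_comm,
    ← Finset.sum_insert (f := fun j => 2 * ν j + 1) (by simp)]
  refine Finset.sum_le_sum_of_subset fun j hj => ?_
  simp only [Finset.mem_insert, Finset.mem_filter, Finset.mem_univ, true_and] at hj ⊢
  rcases hj with rfl | hj
  · exact h
  · exact hj.trans h

theorem offset_add_le_sum (b : Fin m) : offset ν b + (2 * ν b + 1) ≤ ∑ j, (2 * ν j + 1) := by
  unfold offset
  rw [← Finset.sum_filter, add_comm, ← Finset.sum_insert (f := fun j => 2 * ν j + 1) (by simp)]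
  exact Finset.sum_le_sum_of_subset (Finset.subset_univ _)

/-- The label of the residue of an integer modulo `2n+1`. -/
def intLabel (n : ℕ) (k : ℤ) : ℕ := label n k

theorem intLabel_pos (n : ℕ) (k : ℤ) : 1 ≤ intLabel n k := label_pos _ _

theorem intLabel_le (n : ℕ) (k : ℤ) : intLabel n k ≤ 2 * n + 1 := label_le _ _

/-- The label of a point. -/
def pointLabel (p : Blocks ν) : ℕ := offset ν p.1 + label (ν p.1) p.2

theorem pointLabel_injective : Function.Injective (pointLabel : Blocks ν → ℕ) := by
  rintro ⟨b, x⟩ ⟨b', x'⟩ h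
  simp only [pointLabel] at h
  have h1 := label_pos _ x
  have h2 := label_le _ x
  have h3 := label_pos _ x'
  have h4 := label_le _ x'
  rcases lt_trichotomy b b' with hb | rfl | hb
  · have := offset_add_le (ν := ν) hb
    omega
  · rw [label_injective _ (Nat.add_left_cancel h)]
  · have := offset_add_le (ν := ν) hb
    omega

variable {N : ℕ} [NeZero N]

/-- The points of the blocks labelled by `1, …, N`, one block after the other. -/
noncomputable def blockEquiv (hN : ∑ b, (2 * ν b + 1) = N) : Blocks ν ≃ Fin N :=
  labelEquiv pointLabel
    (fun p => by
      have h1 := label_pos _ p.2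
      have h2 := label_le _ p.2
      have h3 := offset_add_le_sum (ν := ν) p.1
      unfold pointLabel
      omega) pointLabel_injective (by simp [Fintype.card_sigma, ZMod.card, hN])

variable (hN : ∑ b, (2 * ν b + 1) = N)

theorem blockEquiv_bp (b : Fin m) (k : ℤ) :
    blockEquiv hN (bp b k) = pt (offset ν b + intLabel (ν b) k) := rfl

omit [NeZero N] in
include hN in
theorem bp_label_le (b : Fin m) (k : ℤ) : offset ν b + intLabel (ν b) k ≤ N := by
  have h2 := intLabel_le (ν b) k
  have h3 := offset_add_le_sum (ν := ν) b
  omega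

theorem blockEquiv_val (b : Fin m) (k : ℤ) :
    (blockEquiv hN (bp b k)).val + 1 = offset ν b + intLabel (ν b) k := by
  rw [blockEquiv_bp, pt_val_add_one]
  · have := intLabel_pos (ν b) k
    omega
  · exact bp_label_le hN b k

theorem bp_label_of_ne {b b' : Fin m} (h : b' ≠ b) (k : ℤ) :
    offset ν b' + intLabel (ν b') k ≤ offset ν b ∨
      offset ν b + 2 * ν b + 1 < offset ν b' + intLabel (ν b') k := by
  have h1 := intLabel_pos (ν b') k
  have h2 := intLabel_le (ν b') k
  rcases lt_or_gt_of_ne h with h | h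
  · have := offset_add_le (ν := ν) h
    omega
  · have := offset_add_le (ν := ν) h
    omega

theorem perm_rot (b : Fin m) {a n : ℕ} (ha : offset ν b = a) (hn : ν b = n) :
    perm (rot a n) = WX.relabel (blockEquiv hN) (tb ν b) := by
  subst ha hn
  have hle := offset_add_le_sum (ν := ν) b
  refine perm_eq_relabel (fun p => ?_) fun p => rfl
  obtain ⟨k, hk⟩ := exists_bp p
  rw [hk, tb, tr_right, blockEquiv_bp, blockEquiv_bp]
  by_cases h : p.1 = b
  · rw [h, Pi.single_eq_same, intLabel, rot_apply (by omega), intLabel]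
    push_cast
    rfl
  · rw [Pi.single_eq_of_ne h, add_zero]
    refine rot_apply_of_notMem (by omega) ?_ (bp_label_le hN _ _) (bp_label_of_ne h k)
    have := intLabel_pos (ν p.1) k
    omega

theorem flips_bp (b : Fin m) {a n : ℕ} (ha : offset ν b = a) (hn : ν b = n) (b' : Fin m)
    (k : ℤ) : flips a n (blockEquiv hN (bp b' k)) =
      blockEquiv hN (bp b' (if b' = b then -k else k)) := by
  subst ha hn
  have hle := offset_add_le_sum (ν := ν) b
  rw [blockEquiv_bp, blockEquiv_bp]
  split_ifs with h
  · rw [h, intLabel, flips_apply (by omega), intLabel]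
    push_cast
    rfl
  · have := intLabel_pos (ν b') k
    have := bp_label_of_ne (ν := ν) h k
    exact flips_apply_of_notMem (by omega) (by omega) (bp_label_le hN _ _) (by omega)

-- Since V is transitive on each block, the orbits are unions of blocks, determined by the action of
-- Y on the set of blocks.
omit [NeZero N] in
theorem hasOrbitLengths_blocks {V : Subgroup (WX (Blocks ν))} {Y : Set (lengthStab ν)}
    (hV : V ≤ translations ν Set.univ) (hmove : ∀ b k, ∃ v ∈ V, v.right (bp b k) = bp b 0)
    (e : Blocks ν ≃ Fin N) {l : List ℕ} (β : Fin m → Fin l.length) (rep : Fin l.length → Fin m)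
    (hrep : ∀ o, β (rep o) = o)
    (hY : ∀ q ∈ Y, ∀ b, β (q.1.right b) = β b)
    (hr : ∀ b, ∃ q ∈ Subgroup.closure Y, q.1.right b = rep (β b))
    (hcard : ∀ o, ∑ b, (if β b = o then 2 * ν b + 1 else 0) = l.get o) :
    HasOrbitLengths ((V ⊔ (Subgroup.closure Y).map lin).map (WX.relabel e)) l := by
  have hY' : ∀ q ∈ Subgroup.closure Y, ∀ b, β (q.1.right b) = β b := by
    intro q hq
    induction hq using Subgroup.closure_induction with
    | mem x hx => exact hY x hx
    | one => exact fun i => rfl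
    | mul x y _ _ hx hy =>
      intro b
      change β (x.1.right (y.1.right b)) = β b
      rw [hx, hy]
    | inv x _ hx =>
      intro b
      rw [← hx, ← WX.mul_right_apply, ← Subgroup.coe_mul, mul_inv_cancel]
      rfl
  have key : ∀ g ∈ V ⊔ (Subgroup.closure Y).map lin, ∀ p, β (g.right p).1 = β p.1 := by
    intro g hg
    rw [Subgroup.sup_eq_closure] at hg
    induction hg using Subgroup.closure_induction with
    | mem x hx =>
      rcases hx with hv | ⟨q, hq, rfl⟩
      · obtain ⟨w, -, rfl⟩ := hV hv
        exact fun p => rfl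
      · intro p
        obtain ⟨k, hk⟩ := exists_bp p
        rw [hk, lin_right]
        exact hY' q hq _
    | one => exact fun p => rfl
    | mul x y _ _ hx hy => intro p; rw [WX.mul_right_apply, hx, hy]
    | inv x _ hx =>
      intro p
      rw [← hx, ← WX.mul_right_apply, mul_inv_cancel]
      rfl
  refine hasOrbitLengths_map e (fun p => β p.1) (fun o => bp (rep o) 0) hrep key (fun p => ?_)
    fun o => ?_
  · obtain ⟨k, hk⟩ := exists_bp p
    obtain ⟨v, hv, h1⟩ := hmove p.1 k
    obtain ⟨q, hq, h2⟩ := hr p.1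
    refine ⟨lin q * v, Subgroup.mul_mem _ (Subgroup.mem_sup_right ⟨q, hq, rfl⟩)
      (Subgroup.mem_sup_left hv), ?_⟩
    rw [WX.mul_right_apply, hk, h1, lin_right, mul_zero, h2]
    rfl
  · rw [← hcard o, Nat.card_eq_fintype_card, Fintype.card_subtype, Finset.card_filter,
      Fintype.sum_sigma]
    refine Finset.sum_congr rfl fun b _ => ?_
    split_ifs with h
    · simp [ZMod.card]
    · simp

theorem exists_translation (b : Fin m) (k : ℤ) :
    ∃ v ∈ translations ν Set.univ, v.right (bp b k) = bp b 0 := by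
  refine ⟨tr (Pi.single b (-k)), tr_mem_univ _, ?_⟩
  rw [tr_right]
  simp

theorem nonempty_map_mulEquiv {Γ Δ A : Type*} [Group Γ] [Group Δ] [Group A] {f : Γ →* Δ}
    (hf : Function.Injective f) {G : Subgroup Γ} (h : Nonempty (G ≃* A)) :
    Nonempty (G.map f ≃* A) := by
  obtain ⟨e⟩ := h
  exact ⟨(G.equivMapOfInjective f hf).symm.trans e⟩

end blockLabels

/-! ### Recognition of the generators -/

section signedPermutations

variable {m : ℕ}

instance WX.instDecidableEq : DecidableEq (WX (Fin m)) := fun _ _ =>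
  decidable_of_iff _ SemidirectProduct.ext_iff.symm

instance WX.instDecidableFlips (g : WX (Fin m)) (b : Fin m) : Decidable (WX.Flips g b) :=
  inferInstanceAs (Decidable (_ ∧ _))

/-- The signed permutation of the blocks with signs `ε` and permutation `π`. -/
def sp (ε : Fin m → ℤˣ) (π : Equiv.Perm (Fin m)) : WX (Fin m) := ⟨ε, π⟩

end signedPermutations

/-! ### Generators written with labels as signed permutations of the blocks. -/

section generators

variable {m N : ℕ} [NeZero N] {ν : Fin m → ℕ}

/-- Signed permutations of the blocks, acting on labelled points. -/
def blockHom (e : Blocks ν ≃ Fin N) : lengthStab ν →* WB N := (WX.relabel e).comp lin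

omit [NeZero N] in
theorem blockHom_injective (e : Blocks ν ≃ Fin N) : Function.Injective (blockHom e) :=
  (WX.relabel_injective e).comp lin_injective

/-- The permutation `τ` of the labels permutes the blocks according to `π` and multiplies the
coordinates by `μ`. -/
def ActsBy (e : Blocks ν ≃ Fin N) (τ : Equiv.Perm (Fin N)) (π : Equiv.Perm (Fin m))
    (μ : Fin m → ℤˣ) : Prop :=
  ∀ b k, τ (e (bp b k)) = e (bp (π b) (μ b * k))

omit [NeZero N] in
theorem ActsBy.mul {e : Blocks ν ≃ Fin N} {τ τ' : Equiv.Perm (Fin N)} {π π' : Equiv.Perm (Fin m)}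
    {μ μ' : Fin m → ℤˣ} (h : ActsBy e τ π μ) (h' : ActsBy e τ' π' μ') :
    ActsBy e (τ * τ') (π * π') (fun b => μ (π' b) * μ' b) := by
  intro b k
  rw [Equiv.Perm.mul_apply, h', h, Units.val_mul, mul_assoc]
  rfl

omit [NeZero N] in
theorem ActsBy.one {e : Blocks ν ≃ Fin N} : ActsBy e 1 1 1 := by
  intro b k
  simp

/-- The signed permutation `g` of the labels is given by the signed permutation `q` of the
blocks. -/
def IsInducedBy (e : Blocks ν ≃ Fin N) (g : WB N) (q : WX (Fin m)) : Prop :=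
  ∃ h : q ∈ lengthStab ν, g = blockHom e ⟨q, h⟩

/-- The essential condition is that the factor μ on the coordinate agrees with the sign attached by
S to the image block. On a block with one point the factor is irrelevant and the sign is free. -/
theorem c_mul_perm_isInducedBy {e : Blocks ν ≃ Fin N} {S : Finset ℕ} {τ : Equiv.Perm (Fin N)}
    {π : Equiv.Perm (Fin m)} {μ : Fin m → ℤˣ} (hτ : ActsBy e τ π μ) {q : WX (Fin m)}
    (hq : ∀ b, ν (q.right b) = ν b) (hπ : ∀ b, π b = q.right b)
    (hμ : ∀ b, ν b = 0 ∨ μ b = q.left (q.right b))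
    (hS : ∀ b k, (e (bp b k)).val + 1 ∈ S ↔ q.left b = -1) :
    IsInducedBy e (c S * perm τ) q := by
  refine ⟨hq, c_mul_perm_eq_relabel (fun p => ?_) fun p => ?_⟩
  · obtain ⟨k, hk⟩ := exists_bp p
    rw [hk, hτ, lin_right, hπ _]
    congr 1
    rcases hμ p.1 with h | h
    · rw [bp_eq_iff, hq, h]
      simp
    · rw [h]
      rfl
  · obtain ⟨k, hk⟩ := exists_bp p
    rw [hk, lin_left]
    exact hS _ _

theorem c_isInducedBy {e : Blocks ν ≃ Fin N} {S : Finset ℕ} {q : WX (Fin m)}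
    (hq : ∀ b, q.right b = b) (hε : ∀ b, ν b = 0 ∨ 1 = q.left (q.right b))
    (hS : ∀ b k, (e (bp b k)).val + 1 ∈ S ↔ q.left b = -1) :
    IsInducedBy e (c S) q := by
  rw [← mul_one (c S), ← map_one (SemidirectProduct.inr : _ →* WB N)]
  exact c_mul_perm_isInducedBy .one (fun b => by rw [hq]) (fun b => (hq b).symm) hε hS

theorem perm_isInducedBy {e : Blocks ν ≃ Fin N} {τ : Equiv.Perm (Fin N)}
    {π : Equiv.Perm (Fin m)} (hτ : ActsBy e τ π 1) (hπ : ∀ b, ν (π b) = ν b) :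
    IsInducedBy e (perm τ) (sp 1 π) := by
  rw [← one_mul (perm τ), ← c_empty]
  exact c_mul_perm_isInducedBy hτ hπ (fun _ => rfl) (fun _ => .inr rfl) fun b k => by simp [sp]

variable (hN : ∑ b, (2 * ν b + 1) = N)

theorem blockEquiv_mem_iff {S : Finset ℕ} {ε : Fin m → ℤˣ}
    (hS : ∀ b, ∀ j, 1 ≤ j → j ≤ 2 * ν b + 1 → (offset ν b + j ∈ S ↔ ε b = -1)) (b : Fin m)
    (k : ℤ) : (blockEquiv hN (bp b k)).val + 1 ∈ S ↔ ε b = -1 := by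
  rw [blockEquiv_val]
  exact hS _ _ (intLabel_pos _ _) (intLabel_le _ _)

theorem flips_actsBy (b : Fin m) {a n : ℕ} (ha : offset ν b = a) (hn : ν b = n) :
    ActsBy (blockEquiv hN) (flips a n) 1 (Function.update 1 b (-1)) := by
  intro b' k
  rw [flips_bp hN b ha hn]
  by_cases h : b' = b
  · subst h
    simp
  · simp [h]

/-- Both blocks have one point, so a transposition of labels is a transposition of blocks and
coordinates play no role. -/
theorem swap_actsBy {b b' : Fin m} (hne : b ≠ b') {i j : ℕ} (hb : ν b = 0) (hb' : ν b' = 0)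
    (hi : offset ν b + 1 = i) (hj : offset ν b' + 1 = j) :
    ActsBy (blockEquiv hN) (cyc [i, j]) (Equiv.swap b b') 1 := by
  have key : ∀ b₁ k, ν b₁ = 0 → (bp b₁ k : Blocks ν) = bp b₁ 0 := by
    intro b₁ k h
    rw [bp_eq_iff, h]
    simp
  have h1 : ∀ b₁, ν b₁ = 0 → blockEquiv hN (bp b₁ 0) = pt (offset ν b₁ + 1) := by
    intro b₁ h
    rw [blockEquiv_bp]
    congr 2
  intro b₁ k
  rw [cyc_pair, ← hi, ← hj, ← h1 b hb, ← h1 b' hb', Equiv.swap_apply_def, Equiv.swap_apply_def]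
  simp only [Equiv.apply_eq_iff_eq, Pi.one_apply, Units.val_one, one_mul]
  by_cases e1 : b₁ = b
  · subst e1
    rw [if_pos (key _ _ hb), if_pos rfl, key _ k hb']
  · rw [if_neg fun h => e1 (congrArg Sigma.fst h), if_neg e1]
    by_cases e2 : b₁ = b'
    · subst e2
      rw [if_pos (key _ _ hb'), if_pos rfl, key _ k hb]
    · rw [if_neg fun h => e2 (congrArg Sigma.fst h), if_neg e2]

theorem blockSwap_actsBy {b b' : Fin m} {n : ℕ} (ho : offset ν b = 0)
    (ho' : offset ν b' = 2 * n + 1) (hb : ν b = n) (hb' : ν b' = n) :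
    ActsBy (blockEquiv hN) (blockSwap (2 * n + 1)) (Equiv.swap b b') 1 := by
  have hne : b' ≠ b := by rintro rfl; omega
  have hle := offset_add_le_sum (ν := ν) b'
  intro b₁ k
  simp only [Pi.one_apply, Units.val_one, one_mul, blockEquiv_bp]
  have h1 := intLabel_pos (ν b₁) k
  have h2 := intLabel_le (ν b₁) k
  by_cases e1 : b₁ = b
  · subst e1
    rw [Equiv.swap_apply_left, ho, ho', zero_add, hb, hb', (blockSwap_apply (by omega)
      (intLabel_pos _ _) (intLabel_le _ _)).1]
  · by_cases e2 : b₁ = b'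
    · subst e2
      rw [Equiv.swap_apply_right, ho, ho', zero_add, hb', hb, (blockSwap_apply (by omega)
        (intLabel_pos _ _) (intLabel_le _ _)).2]
    · have h3 := bp_label_of_ne (ν := ν) e1 k
      have h4 := bp_label_of_ne (ν := ν) e2 k
      have h5 := bp_label_le hN b₁ k
      rw [Equiv.swap_apply_of_ne_of_ne e1 e2, blockSwap_apply_of_lt (by omega) h5]

theorem fourCycles_actsBy {b b' : Fin m} {n : ℕ} (ho : offset ν b = 0)
    (ho' : offset ν b' = 2 * n + 1) (hb : ν b = n) (hb' : ν b' = n) :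
    ActsBy (blockEquiv hN) (fourCycles n) (Equiv.swap b b') (Function.update 1 b' (-1)) := by
  have hne : b' ≠ b := by rintro rfl; omega
  have hle := offset_add_le_sum (ν := ν) b'
  intro b₁ k
  simp only [blockEquiv_bp]
  have h1 := intLabel_pos (ν b₁) k
  have h2 := intLabel_le (ν b₁) k
  by_cases e1 : b₁ = b
  · subst e1
    rw [Equiv.swap_apply_left, Function.update_of_ne hne.symm, ho, ho', zero_add, hb, hb',
      intLabel, (fourCycles_apply (by omega) _).1]
    simp [intLabel]
  · by_cases e2 : b₁ = b'
    · subst e2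
      rw [Equiv.swap_apply_right, Function.update_self, ho, ho', zero_add, hb', hb,
        intLabel, (fourCycles_apply (by omega) _).2]
      simp [intLabel]
    · have h3 := bp_label_of_ne (ν := ν) e1 k
      have h4 := bp_label_of_ne (ν := ν) e2 k
      have h5 := bp_label_le hN b₁ k
      rw [Equiv.swap_apply_of_ne_of_ne e1 e2, Function.update_of_ne e2,
        fourCycles_apply_of_lt (by omega) h5]
      simp

end generators

theorem offset_two_one (a b : ℕ) : offset ![a, b] 1 = 2 * a + 1 := by
  simp [offset]

theorem offset_three_one (a b c : ℕ) : offset ![a, b, c] 1 = 2 * a + 1 := by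
  simp [offset]

theorem offset_three_two (a b c : ℕ) : offset ![a, b, c] 2 = 2 * a + 2 * b + 2 := by
  simp [offset, Fin.sum_univ_three]
  omega

theorem offset_zero {m : ℕ} (ν : Fin (m + 1) → ℕ) : offset ν 0 = 0 := by
  simp [offset]

theorem sum_two {a b N : ℕ} (h : 2 * a + 2 * b + 2 = N) : ∑ i, (2 * ![a, b] i + 1) = N := by
  simp
  omega

theorem sum_three {a b c N : ℕ} (h : 2 * a + 2 * b + 2 * c + 3 = N) :
    ∑ i, (2 * ![a, b, c] i + 1) = N := by
  simp [Fin.sum_univ_three]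
  omega

theorem blockCycle_actsBy {n N : ℕ} [NeZero N] (hN : ∑ i, (2 * ![n, n, n] i + 1) = N) :
    ActsBy (blockEquiv hN) (blockCycle (2 * n + 1)) (finRotate 3) 1 := by
  have hle : 3 * (2 * n + 1) ≤ N := by
    rw [← hN]
    simp [Fin.sum_univ_three]
    omega
  have h1 := offset_three_one n n n
  have h2 := offset_three_two n n n
  intro b k
  simp only [Pi.one_apply, Units.val_one, one_mul, blockEquiv_bp]
  have key := blockCycle_apply hle (intLabel_pos n k) (intLabel_le n k)
  fin_cases b
  · change blockCycle (2 * n + 1) (pt (offset ![n, n, n] 0 + intLabel n k)) =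
      pt (offset ![n, n, n] 1 + intLabel n k)
    rw [offset_zero, zero_add, h1, key.1]
  · change blockCycle (2 * n + 1) (pt (offset ![n, n, n] 1 + intLabel n k)) =
      pt (offset ![n, n, n] 2 + intLabel n k)
    rw [h1, key.2.1, h2]
    congr 1
    ring
  · change blockCycle (2 * n + 1) (pt (offset ![n, n, n] 2 + intLabel n k)) =
      pt (offset ![n, n, n] 0 + intLabel n k)
    rw [h2, offset_zero, zero_add, ← key.2.2]
    congr 2
    ring

/-! ### Groups containing all translations -/

section blockGroups

variable {m N : ℕ} {ν : Fin m → ℕ} {e : Blocks ν ≃ Fin N}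

/-- The signed permutations of the blocks are handled in the whole group, where identities are
decidable, but `lin` is defined on `lengthStab` only. This passes between the two generated groups.
-/
theorem closure_preimage_map {Γ : Type*} [Group Γ] {H : Subgroup Γ} {Y : Set Γ} (hY : Y ⊆ H) :
    (Subgroup.closure (((↑) : H → Γ) ⁻¹' Y)).map H.subtype = Subgroup.closure Y := by
  rw [MonoidHom.map_closure]
  congr 1
  exact Subtype.image_preimage_val _ _ |>.trans (Set.inter_eq_right.mpr hY)

theorem closure_preimage_mulEquiv {Γ : Type*} [Group Γ] {H : Subgroup Γ} {Y : Set Γ} (hY : Y ⊆ H) :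
    Nonempty (Subgroup.closure (((↑) : H → Γ) ⁻¹' Y) ≃* Subgroup.closure Y) := by
  rw [← closure_preimage_map hY]
  exact ⟨Subgroup.equivMapOfInjective _ _ H.subtype_injective⟩

/-- The elements of `X` are those given by the elements of `Y`. -/
structure IsInducedSet (e : Blocks ν ≃ Fin N) (X : Set (WB N)) (Y : Set (WX (Fin m))) : Prop where
  left : ∀ x ∈ X, ∃ y ∈ Y, IsInducedBy e x y
  right : ∀ y ∈ Y, ∃ x ∈ X, IsInducedBy e x y

namespace IsInducedSet

theorem singleton {x : WB N} {y : WX (Fin m)} (h : IsInducedBy e x y) :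
    IsInducedSet e {x} {y} :=
  ⟨by rintro _ rfl; exact ⟨_, rfl, h⟩, by rintro _ rfl; exact ⟨_, rfl, h⟩⟩

theorem insert {x : WB N} {y : WX (Fin m)} {X : Set (WB N)} {Y : Set (WX (Fin m))}
    (h : IsInducedBy e x y) (h' : IsInducedSet e X Y) :
    IsInducedSet e (insert x X) (insert y Y) := by
  constructor
  · rintro _ (rfl | hx)
    · exact ⟨_, .inl rfl, h⟩
    · obtain ⟨y, hy, hxy⟩ := h'.left _ hx
      exact ⟨y, .inr hy, hxy⟩
  · rintro _ (rfl | hy)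
    · exact ⟨_, .inl rfl, h⟩
    · obtain ⟨x, hx, hxy⟩ := h'.right _ hy
      exact ⟨x, .inr hx, hxy⟩

variable {X : Set (WB N)} {Y : Set (WX (Fin m))}

theorem subset (h : IsInducedSet e X Y) : Y ⊆ lengthStab ν := by
  intro y hy
  obtain ⟨x, hx, hq, -⟩ := h.right y hy
  exact hq

theorem image_eq (h : IsInducedSet e X Y) :
    X = blockHom e '' (((↑) : lengthStab ν → WX (Fin m)) ⁻¹' Y) := by
  ext x
  constructor
  · intro hx
    obtain ⟨y, hy, hq, rfl⟩ := h.left x hx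
    exact ⟨⟨y, hq⟩, hy, rfl⟩
  · rintro ⟨y, hy, rfl⟩
    obtain ⟨x, hx, hq, rfl⟩ := h.right _ hy
    exact hx

theorem closure_eq (h : IsInducedSet e X Y) : Subgroup.closure X =
    (Subgroup.closure (((↑) : lengthStab ν → WX (Fin m)) ⁻¹' Y)).map (blockHom e) := by
  rw [h.image_eq, MonoidHom.map_closure]

theorem nonempty_mulEquiv (h : IsInducedSet e X Y) {A : Type*} [Group A]
    (hA : Nonempty (Subgroup.closure Y ≃* A)) : Nonempty (Subgroup.closure X ≃* A) := by
  rw [h.closure_eq]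
  obtain ⟨f⟩ := hA
  obtain ⟨f'⟩ := closure_preimage_mulEquiv h.subset
  exact nonempty_map_mulEquiv (blockHom_injective e) ⟨f'.trans f⟩

end IsInducedSet

/-- Signed permutations without fixed signs: the products of the signs are `1`, and each point
is flipped by a product. -/
structure IsFlipping (Y : Set (WX (Fin m))) : Prop where
  prod_eq : ∀ y ∈ Y, ∏ b, y.left b = 1
  flips : ∀ b, ∃ q ∈ Subgroup.closure Y, WX.Flips q b

theorem IsFlipping.mono {Y Z : Set (WX (Fin m))} (h : IsFlipping Y)
    (hZ : ∀ z ∈ Z, ∏ b, z.left b = 1) (hYZ : Y ⊆ Subgroup.closure Z) : IsFlipping Z := by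
  refine ⟨hZ, fun b => ?_⟩
  obtain ⟨q, hq, h1⟩ := h.flips b
  exact ⟨q, (Subgroup.closure_le _).mpr hYZ hq, h1⟩

/-- `X` generates the group generated by the signed permutations in `Z` and all translations of
blocks. -/
structure IsBlockGenerating (e : Blocks ν ≃ Fin N) (X Z : Set (WB N)) : Prop where
  tb_mem_closure : ∀ b, ν b = 0 ∨ WX.relabel e (tb ν b) ∈ Subgroup.closure X
  subset : Z ⊆ X
  mem_cases : ∀ x ∈ X, x ∈ Z ∨ ∃ b, x = WX.relabel e (tb ν b) ∨ x = (WX.relabel e (tb ν b))⁻¹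

namespace IsBlockGenerating

variable {X Z : Set (WB N)} {Y : Set (WX (Fin m))}

/-- The translations by 1 of the separate blocks generate all translations, and those of blocks with
one point are trivial. -/
theorem closure_eq_sup (h : IsBlockGenerating e X Z) : Subgroup.closure X =
    (translations ν Set.univ).map (WX.relabel e) ⊔ Subgroup.closure Z := by
  apply le_antisymm
  · rw [Subgroup.closure_le]
    intro x hx
    rcases h.mem_cases x hx with hz | ⟨b, rfl | rfl⟩
    · exact Subgroup.mem_sup_right (Subgroup.subset_closure hz)
    · exact Subgroup.mem_sup_left ⟨_, tb_mem trivial, rfl⟩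
    · exact Subgroup.mem_sup_left (inv_mem ⟨_, tb_mem trivial, rfl⟩)
  · refine sup_le ?_ (Subgroup.closure_mono h.subset)
    rw [Subgroup.map_le_iff_le_comap]
    refine translations_le_of_tb fun b _ => ?_
    rcases h.tb_mem_closure b with hb | hb
    · rw [tb_eq_one hb]
      exact one_mem _
    · exact hb

variable (h : IsBlockGenerating e X Z) (hZ : IsInducedSet e Z Y)
include h hZ

theorem closure_eq : Subgroup.closure X = (translations ν Set.univ ⊔
    (Subgroup.closure (((↑) : lengthStab ν → WX (Fin m)) ⁻¹' Y)).map lin).map (WX.relabel e) := by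
  rw [h.closure_eq_sup, hZ.closure_eq, Subgroup.map_sup, Subgroup.map_map]
  rfl

theorem isFrame (hY : IsFlipping Y) (hm : m ≤ 3) :
    IsFrame ((translations ν Set.univ).map (WX.relabel e))
      (Subgroup.closure Z) (Subgroup.closure X) ((basePoints ν).map e.toEmbedding) := by
  have h0 := closure_preimage_map hZ.subset
  have h1 : Subgroup.closure (((↑) : lengthStab ν → WX (Fin m)) ⁻¹' Y) ≤
      (WX.sign.comp (lengthStab ν).subtype).ker := by
    rw [Subgroup.closure_le]
    exact fun y hy => hY.prod_eq _ hy
  have h2 := (isFrame_translations hm (fun q hq => h1 hq) fun b => by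
    obtain ⟨q, hq, hb⟩ := hY.flips b
    rw [← h0] at hq
    obtain ⟨q, hq, rfl⟩ := hq
    exact ⟨q, hq, hb⟩).map e
  rw [← h.closure_eq hZ, Subgroup.map_map] at h2
  rw [hZ.closure_eq]
  exact h2

theorem hasOrbitLengths {l : List ℕ} (β : Fin m → Fin l.length)
    (rep : Fin l.length → Fin m) (hrep : ∀ o, β (rep o) = o)
    (hY : ∀ q ∈ Y, ∀ b, β (q.right b) = β b)
    (hr : ∀ b, ∃ q ∈ Subgroup.closure Y, q.right b = rep (β b))
    (hcard : ∀ o, ∑ b, (if β b = o then 2 * ν b + 1 else 0) = l.get o) :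
    HasOrbitLengths (Subgroup.closure X) l := by
  rw [h.closure_eq hZ]
  have h0 := closure_preimage_map hZ.subset
  refine hasOrbitLengths_blocks le_rfl exists_translation e β rep hrep (fun q hq => hY _ hq)
    (fun b => ?_) hcard
  obtain ⟨q, hq, hb⟩ := hr b
  rw [← h0] at hq
  obtain ⟨q, hq, rfl⟩ := hq
  exact ⟨q, hq, hb⟩

/-- The case where every block is an orbit. -/
theorem hasOrbitLengths_of_right_eq {l : List ℕ} (hl : l.length = m)
    (hY : ∀ q ∈ Y, ∀ b, q.right b = b)
    (hcard : ∀ b : Fin m, 2 * ν b + 1 = l.get (b.cast hl.symm)) :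
    HasOrbitLengths (Subgroup.closure X) l := by
  refine h.hasOrbitLengths hZ (Fin.cast hl.symm) (Fin.cast hl) (fun o => rfl)
    (fun q hq b => by rw [hY q hq]) (fun b => ⟨1, one_mem _, rfl⟩) fun o => ?_
  obtain ⟨b, rfl⟩ : ∃ b : Fin m, o = b.cast hl.symm := ⟨o.cast hl, rfl⟩
  rw [← hcard b]
  simp

theorem isInternalSemidirect : IsInternalSemidirect
    ((translations ν Set.univ).map (WX.relabel e)) (Subgroup.closure Z)
    (Subgroup.closure X) := by
  refine .of_closure ?_ (Subgroup.closure_mono h.subset) ?_ ?_ fun x hx => ?_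
  · rw [h.closure_eq_sup]
    exact le_sup_left
  · rw [hZ.closure_eq]
    rintro _ ⟨s, -, rfl⟩ _ ⟨v, hv, rfl⟩
    exact ⟨_, lin_conj_mem (J := Set.univ) (q := s) (fun _ _ => trivial) hv, by simp [blockHom]⟩
  · rw [hZ.closure_eq]
    rintro _ ⟨v, hv, rfl⟩ ⟨s, -, hs⟩
    rw [translations_inter_lin hv (WX.relabel_injective e hs), map_one]
  · rw [← h.closure_eq_sup]
    exact Subgroup.subset_closure hx

theorem isSemidirect {A B : Type*} [Group A] [Group B]
    (hA : Nonempty (translations ν Set.univ ≃* A)) (hB : Nonempty (Subgroup.closure Y ≃* B)) :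
    IsSemidirect A B (Subgroup.closure X) := by
  obtain ⟨eA⟩ := nonempty_map_mulEquiv (WX.relabel_injective e) hA
  obtain ⟨eB⟩ := hZ.nonempty_mulEquiv hB
  exact (h.isInternalSemidirect hZ).isSemidirect eA eB

end IsBlockGenerating

theorem isPGroup_of_mulEquiv {Γ A : Type*} [Group Γ] [Group A] {S : Subgroup Γ}
    (h : Nonempty (S ≃* A)) (k : ℕ) (hA : Nat.card A = 2 ^ k) : IsPGroup 2 S := by
  obtain ⟨e⟩ := h
  exact IsPGroup.of_card (n := k) (by rw [Nat.card_congr e.toEquiv, hA])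

theorem translations_univ_eq (J : Set (Fin m)) (h : ∀ b, b ∉ J → ν b = 0) :
    translations ν Set.univ = translations ν J := by
  refine le_antisymm (translations_le_of_tb fun b _ => ?_) (translations_mono (Set.subset_univ _))
  by_cases hb : b ∈ J
  · exact tb_mem hb
  · rw [tb_eq_one (h b hb)]
    exact one_mem _

end blockGroups

theorem card_cyc (m : ℕ) : Nat.card (Cyc m) = m := Nat.card_zmod m

theorem card_klein : Nat.card (Cyc 2 × Cyc 2) = 2 ^ 2 := by
  rw [Nat.card_prod, card_cyc]; rfl

theorem card_dihedral_four : Nat.card (DihedralGroup 4) = 2 ^ 3 := DihedralGroup.nat_card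

theorem translations_single_block {m : ℕ} {ν : Fin m → ℕ} (b : Fin m)
    (h : ∀ b', b' ≠ b → ν b' = 0) : Nonempty (translations ν Set.univ ≃* Cyc (2 * ν b + 1)) := by
  rw [translations_univ_eq {b} h]
  exact translations_singleton b rfl

theorem translations_two_blocks {m : ℕ} {ν : Fin m → ℕ} {b b' : Fin m} (hne : b ≠ b')
    (h : ∀ d, d ≠ b → d ≠ b' → ν d = 0) :
    Nonempty (translations ν Set.univ ≃* Cyc (2 * ν b + 1) × Cyc (2 * ν b' + 1)) := by
  rw [translations_univ_eq ({b} ∪ {b'}) fun d hd => ?_]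
  · exact translations_prod (by simpa using hne) (translations_singleton b rfl)
      (translations_singleton b' rfl)
  · simp only [Set.mem_union, Set.mem_singleton_iff, not_or] at hd
    exact h d hd.1 hd.2

theorem translations_three_blocks (ν : Fin 3 → ℕ) :
    Nonempty (translations ν Set.univ ≃*
      Cyc (2 * ν 0 + 1) × Cyc (2 * ν 1 + 1) × Cyc (2 * ν 2 + 1)) := by
  have h : (Set.univ : Set (Fin 3)) = {0} ∪ ({1} ∪ {2}) := by
    ext b
    fin_cases b <;> simp
  rw [h]
  exact translations_prod (by simp) (translations_singleton 0 rfl)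
    (translations_prod (by simp) (translations_singleton 1 rfl) (translations_singleton 2 rfl))

/-! ### Groups of signed permutations of two or three blocks -/

/-- The sign `-1` on both blocks. -/
def flipBoth : WX (Fin 2) := sp ![-1, -1] 1

/-- The transposition of two blocks. -/
def swapBoth : WX (Fin 2) := sp 1 (Equiv.swap 0 1)

/-- The sign `-1` on the blocks `0` and `1`. -/
def flip01 : WX (Fin 3) := sp ![-1, -1, 1] 1

/-- The sign `-1` on the blocks `0` and `2`. -/
def flip02 : WX (Fin 3) := sp ![-1, 1, -1] 1

/-- The sign `-1` on the blocks `1` and `2`. -/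
def flip12 : WX (Fin 3) := sp ![1, -1, -1] 1

/-- The transposition of the blocks `0` and `1`. -/
def swap01 : WX (Fin 3) := sp 1 (Equiv.swap 0 1)

/-- The transposition of the blocks `1` and `2`. -/
def swap12 : WX (Fin 3) := sp 1 (Equiv.swap 1 2)

/-- The cyclic permutation of the blocks. -/
def cycle012 : WX (Fin 3) := sp 1 (finRotate 3)

/-! ### Recognition of dihedral groups and direct products. -/

section groups

variable {Γ : Type*} [Group Γ]

theorem mem_closure_left (a b : Γ) : a ∈ Subgroup.closure {a, b} :=
  Subgroup.subset_closure (.inl rfl)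

theorem mem_closure_right (a b : Γ) : b ∈ Subgroup.closure {a, b} :=
  Subgroup.subset_closure (.inr rfl)

theorem closure_eq_closure {X Y : Set Γ} (h : X ⊆ Subgroup.closure Y)
    (h' : Y ⊆ Subgroup.closure X) : Subgroup.closure X = Subgroup.closure Y :=
  le_antisymm ((Subgroup.closure_le _).mpr h) ((Subgroup.closure_le _).mpr h')

theorem orderOf_eq_four {a b : Γ} (h : a * a = b) (hb : b ≠ 1)
    (hb' : b * b = 1) : orderOf a = 4 := by
  refine orderOf_eq_prime_pow (p := 2) (n := 1) ?_ ?_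
  · rwa [pow_one, pow_two, h]
  · rw [show 2 ^ (1 + 1) = 2 * 2 from rfl, pow_mul, pow_two a, h, pow_two, hb']

/-- The reflection is not a rotation if the rotations have an order larger than two. -/
theorem nonempty_mulEquiv_dihedral_of_two_lt {a b : Γ} {m : ℕ} (ha : orderOf a = m) (hm : 2 < m)
    (hb : b * b = 1) (hab : b * a * b = a⁻¹) :
    Nonempty (Subgroup.closure {a, b} ≃* DihedralGroup m) := by
  refine nonempty_mulEquiv_dihedral ha hb hab ?_
  rintro ⟨k, rfl⟩
  have h1 : a ^ k * a * a ^ k = a := by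
    rw [← zpow_add_one, add_comm, zpow_one_add, mul_assoc, hb, mul_one]
  rw [h1] at hab
  have h2 : a ^ 2 = 1 := by
    rw [pow_two]
    exact mul_eq_one_iff_eq_inv.mpr hab
  have h3 := Nat.le_of_dvd two_pos (orderOf_dvd_of_pow_eq_one h2)
  omega

/-- Conjugation by x maps the group generated by Y into itself; by finiteness it maps onto it, so x
normalizes it. Hence generators suffice, with no condition on inverses of elements of X. -/
theorem conj_mem_closure [Finite Γ] {X Y : Set Γ}
    (h : ∀ x ∈ X, ∀ y ∈ Y, x * y * x⁻¹ ∈ Subgroup.closure Y) :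
    ∀ x ∈ Subgroup.closure X, ∀ y ∈ Subgroup.closure Y, x * y * x⁻¹ ∈ Subgroup.closure Y := by
  have h1 : Subgroup.closure X ≤ Subgroup.normalizer (Subgroup.closure Y) := by
    rw [Subgroup.closure_le]
    intro x hx
    have h2 : (Subgroup.closure Y).map (MulAut.conj x).toMonoidHom ≤ Subgroup.closure Y := by
      rw [MonoidHom.map_closure, Subgroup.closure_le]
      rintro _ ⟨y, hy, rfl⟩
      exact h x hx y hy
    have h3 : (Subgroup.closure Y).map (MulAut.conj x).toMonoidHom = Subgroup.closure Y := by
      refine Subgroup.eq_of_le_of_card_ge h2 ?_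
      rw [Subgroup.card_map_of_injective (MulAut.conj x).injective]
    rw [SetLike.mem_coe, Subgroup.mem_normalizer_iff]
    intro y
    refine ⟨fun hy => h2 ⟨y, hy, rfl⟩, fun hy => ?_⟩
    rw [← h3] at hy
    obtain ⟨z, hz, h4⟩ := hy
    have h5 : z = y := (MulAut.conj x).injective h4
    exact h5 ▸ hz
  intro x hx y hy
  exact (Subgroup.mem_normalizer_iff.mp (h1 hx) y).mp hy

/-- The dihedral group of order `4(2n+1)`, generated by a rotation `a` of order `2n+1`, a central
involution `z` and a reflection `b`. -/
theorem nonempty_mulEquiv_dihedral_two_mul {a b z : Γ} {n : ℕ} (hn : 1 ≤ n)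
    (ha : orderOf a = 2 * n + 1) (hb : b * b = 1) (hz : z * z = 1) (hz1 : z ≠ 1)
    (hab : b * a * b = a⁻¹) (hbz : b * z = z * b) (haz : Commute a z) :
    Nonempty (Subgroup.closure {b, a, z} ≃* DihedralGroup (4 * n + 2)) := by
  have oz : orderOf z = 2 := orderOf_eq_prime (by rw [pow_two, hz]) hz1
  have oaz : orderOf (a * z) = 4 * n + 2 := by
    rw [haz.orderOf_mul_eq_mul_orderOf_of_coprime, ha, oz]
    · ring
    · rw [ha, oz]
      exact (odd_two_mul_add_one n).coprime_two_right
  have zi : z⁻¹ = z := inv_eq_of_mul_eq_one_left hz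
  have hz' : z ∈ Subgroup.closure {a * z, b} := by
    -- The power kills a and leaves z, because 2n+1 is odd. So the element az of order 2(2n+1)
    -- recovers both z and a, and it is inverted by b.
    have h1 : (a * z) ^ (2 * n + 1) = z := by
      rw [haz.mul_pow, ← ha, pow_orderOf_eq_one, one_mul, ha, pow_succ, pow_mul, pow_two, hz,
        one_pow, one_mul]
    have h2 := pow_mem (mem_closure_left (a * z) b) (2 * n + 1)
    rwa [h1] at h2
  have h : Subgroup.closure {b, a, z} = Subgroup.closure {a * z, b} := by
    refine closure_eq_closure ?_ ?_
    · rintro x (rfl | rfl | rfl)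
      · exact mem_closure_right _ _
      · have h2 := mul_mem (mem_closure_left (x * z) b) hz'
        rwa [mul_assoc, hz, mul_one] at h2
      · exact hz'
    · rintro x (rfl | rfl)
      · exact mul_mem (Subgroup.subset_closure (by simp)) (Subgroup.subset_closure (by simp))
      · exact Subgroup.subset_closure (by simp)
  rw [h]
  refine nonempty_mulEquiv_dihedral_of_two_lt oaz (by omega) hb ?_
  rw [haz.eq, mul_inv_rev, zi, ← mul_assoc, hbz, mul_assoc, mul_assoc, ← mul_assoc b, hab,
    (haz.inv_left).eq]

/-- A group with trivial centre. -/
def IsCenterless (A : Type*) [Group A] : Prop := ∀ z : A, (∀ y, z * y = y * z) → z = 1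

theorem IsCenterless.of_mulEquiv {A B : Type*} [Group A] [Group B] (h : IsCenterless B)
    (e : A ≃* B) : IsCenterless A := by
  intro z hz
  refine e.injective ?_
  rw [map_one]
  refine h _ fun y => ?_
  rw [← e.apply_symm_apply y, ← map_mul, hz, map_mul]

theorem isCenterless_dihedral (n : ℕ) (hn : 1 ≤ n) :
    IsCenterless (DihedralGroup (2 * n + 1)) := by
  intro z hz
  have h := DihedralGroup.center_eq_bot_of_odd_ne_one (odd_two_mul_add_one n) (by omega)
  rw [← Subgroup.mem_bot, ← h, Subgroup.mem_center_iff]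
  exact fun y => (hz y).symm

/-- An element common to the commuting subgroups A and B commutes with all of A, so it is central in
A and therefore trivial. -/
theorem nonempty_mulEquiv_prod_of_isCenterless {A B : Subgroup Γ} {X : Set Γ}
    (hc : ∀ a ∈ A, ∀ b ∈ B, a * b = b * a) (hA : IsCenterless A)
    (hA' : A ≤ Subgroup.closure X) (hB' : B ≤ Subgroup.closure X) (hX : ∀ x ∈ X, x ∈ A ⊔ B) :
    Nonempty (A × B ≃* Subgroup.closure X) := by
  refine IsInternalSemidirect.nonempty_mulEquiv_prod (.of_closure hA' hB' ?_ ?_ hX) hc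
  · intro s hs v hv
    rw [← hc v hv s hs, mul_inv_cancel_right]
    exact hv
  · intro v hv hv'
    exact congrArg Subtype.val (hA ⟨v, hv⟩ fun y => Subtype.ext (hc y y.2 v hv').symm)

theorem commute_closure {X Y : Set Γ} (h : ∀ x ∈ X, ∀ y ∈ Y, x * y = y * x) :
    ∀ a ∈ Subgroup.closure X, ∀ b ∈ Subgroup.closure Y, a * b = b * a := by
  have h1 : Subgroup.closure X ≤ Subgroup.centralizer (Subgroup.closure Y : Set Γ) := by
    rw [Subgroup.closure_le, Subgroup.centralizer_closure]
    intro x hx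
    exact Subgroup.mem_centralizer_iff.mpr fun y hy => (h x hx y hy).symm
  intro a ha b hb
  exact (Subgroup.mem_centralizer_iff.mp (h1 ha) b hb).symm

theorem nonempty_mulEquiv_prod_of_closure {X Y Z : Set Γ} {A B : Type*} [Group A] [Group B]
    (hA : IsCenterless A) (eA : Nonempty (Subgroup.closure Y ≃* A))
    (eB : Nonempty (Subgroup.closure Z ≃* B)) (hc : ∀ y ∈ Y, ∀ z ∈ Z, y * z = z * y)
    (hY : Y ⊆ Subgroup.closure X) (hZ : Z ⊆ Subgroup.closure X)
    (hX : ∀ x ∈ X, x ∈ Subgroup.closure Y ⊔ Subgroup.closure Z) :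
    Nonempty (Subgroup.closure X ≃* A × B) := by
  obtain ⟨eA⟩ := eA
  obtain ⟨eB⟩ := eB
  obtain ⟨f⟩ := nonempty_mulEquiv_prod_of_isCenterless (commute_closure hc) (hA.of_mulEquiv eA)
    ((Subgroup.closure_le _).mpr hY) ((Subgroup.closure_le _).mpr hZ) hX
  exact ⟨f.symm.trans (eA.prodCongr eB)⟩

end groups

/-! ### The signed permutations of blocks occurring in the classes: flips and group structure. -/

theorem isFlipping_flipBoth : IsFlipping {flipBoth} :=
  ⟨by simp only [Set.mem_singleton_iff, forall_eq]; decide,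
    fun b => ⟨_, Subgroup.subset_closure rfl, by revert b; decide⟩⟩

theorem isFlipping_flipBoth_swapBoth : IsFlipping {flipBoth, swapBoth} :=
  isFlipping_flipBoth.mono
    (by simp only [Set.mem_singleton_iff, Set.mem_insert_iff, forall_eq_or_imp, forall_eq]; decide)
    (Set.singleton_subset_iff.mpr (mem_closure_left _ _))

theorem isFlipping_of_mem {Y : Set (WX (Fin 3))} (hY : ∀ y ∈ Y, ∏ b, y.left b = 1)
    (h1 : ∃ q ∈ Subgroup.closure Y, WX.Flips q 0)
    (h2 : ∃ q ∈ Subgroup.closure Y, WX.Flips q 1)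
    (h3 : ∃ q ∈ Subgroup.closure Y, WX.Flips q 2) : IsFlipping Y :=
  ⟨hY, Fin.forall_fin_succ.mpr ⟨h1, Fin.forall_fin_two.mpr ⟨h2, h3⟩⟩⟩

/-- The generator flips the block which it fixes, and its square flips the two blocks which it
exchanges. The same holds for the other two products below. -/
theorem isFlipping_flip01_swap12 : IsFlipping {flip01 * swap12} := by
  have h : flip01 * swap12 ∈ Subgroup.closure {flip01 * swap12} := Subgroup.subset_closure rfl
  exact isFlipping_of_mem (by simp only [Set.mem_singleton_iff, forall_eq]; decide)
    ⟨_, h, by decide⟩ ⟨_, mul_mem h h, by decide⟩ ⟨_, mul_mem h h, by decide⟩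

theorem isFlipping_flip02_swap01 : IsFlipping {flip02 * swap01} := by
  have h : flip02 * swap01 ∈ Subgroup.closure {flip02 * swap01} := Subgroup.subset_closure rfl
  exact isFlipping_of_mem (by simp only [Set.mem_singleton_iff, forall_eq]; decide)
    ⟨_, mul_mem h h, by decide⟩ ⟨_, mul_mem h h, by decide⟩ ⟨_, h, by decide⟩

theorem isFlipping_flip12_swap01 : IsFlipping {flip12 * swap01} := by
  have h : flip12 * swap01 ∈ Subgroup.closure {flip12 * swap01} := Subgroup.subset_closure rfl
  exact isFlipping_of_mem (by simp only [Set.mem_singleton_iff, forall_eq]; decide)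
    ⟨_, mul_mem h h, by decide⟩ ⟨_, mul_mem h h, by decide⟩ ⟨_, h, by decide⟩

theorem isFlipping_flip01_swap12_swap12 : IsFlipping {flip01 * swap12, swap12} :=
  isFlipping_flip01_swap12.mono
    (by simp only [Set.mem_singleton_iff, Set.mem_insert_iff, forall_eq_or_imp, forall_eq]; decide)
    (Set.singleton_subset_iff.mpr (mem_closure_left _ _))

theorem isFlipping_flip01_flip12 : IsFlipping {flip01, flip12} :=
  isFlipping_of_mem
    (by simp only [Set.mem_singleton_iff, Set.mem_insert_iff, forall_eq_or_imp, forall_eq]; decide)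
    ⟨_, mem_closure_left _ _, by decide⟩ ⟨_, mem_closure_left _ _, by decide⟩
    ⟨_, mem_closure_right _ _, by decide⟩

theorem isFlipping_flip02_flip12 : IsFlipping {flip02, flip12} :=
  isFlipping_of_mem
    (by simp only [Set.mem_singleton_iff, Set.mem_insert_iff, forall_eq_or_imp, forall_eq]; decide)
    ⟨_, mem_closure_left _ _, by decide⟩ ⟨_, mem_closure_right _ _, by decide⟩
    ⟨_, mem_closure_left _ _, by decide⟩

theorem isFlipping_flip02_flip12_swap01 : IsFlipping {flip02, flip12, swap01} :=
  isFlipping_flip02_flip12.mono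
    (by simp only [Set.mem_singleton_iff, Set.mem_insert_iff, forall_eq_or_imp, forall_eq]; decide)
    ((Set.insert_subset_insert (by simp)).trans Subgroup.subset_closure)

theorem isFlipping_flip01_flip12_swap01 : IsFlipping {flip01, flip12, swap01} :=
  isFlipping_flip01_flip12.mono
    (by simp only [Set.mem_singleton_iff, Set.mem_insert_iff, forall_eq_or_imp, forall_eq]; decide)
    ((Set.insert_subset_insert (by simp)).trans Subgroup.subset_closure)

theorem isFlipping_flip01_flip12_cycle012 : IsFlipping {flip01, flip12, cycle012} :=
  isFlipping_flip01_flip12.mono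
    (by simp only [Set.mem_singleton_iff, Set.mem_insert_iff, forall_eq_or_imp, forall_eq]; decide)
    ((Set.insert_subset_insert (by simp)).trans Subgroup.subset_closure)

theorem isFlipping_flip01_flip12_swap01_cycle012 :
    IsFlipping {flip01, flip12, swap01, cycle012} :=
  isFlipping_flip01_flip12.mono
    (by simp only [Set.mem_singleton_iff, Set.mem_insert_iff, forall_eq_or_imp, forall_eq]; decide)
    ((Set.insert_subset_insert (by simp)).trans Subgroup.subset_closure)

theorem flip01_swap12_cyc : Nonempty (Subgroup.closure {flip01 * swap12} ≃* Cyc 4) :=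
  nonempty_mulEquiv_cyc (orderOf_eq_four (b := flip12) (by decide) (by decide) (by decide))

theorem flip02_swap01_cyc : Nonempty (Subgroup.closure {flip02 * swap01} ≃* Cyc 4) :=
  nonempty_mulEquiv_cyc (orderOf_eq_four (b := flip01) (by decide) (by decide) (by decide))

theorem flip12_swap01_cyc : Nonempty (Subgroup.closure {flip12 * swap01} ≃* Cyc 4) :=
  nonempty_mulEquiv_cyc (orderOf_eq_four (b := flip01) (by decide) (by decide) (by decide))

theorem flip01_flip12_klein : Nonempty (Subgroup.closure {flip01, flip12} ≃* Cyc 2 × Cyc 2) :=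
  nonempty_mulEquiv_klein (by decide) (by decide) (by decide) (by decide) (by decide) (by decide)

theorem flipBoth_swapBoth_klein :
    Nonempty (Subgroup.closure {flipBoth, swapBoth} ≃* Cyc 2 × Cyc 2) :=
  nonempty_mulEquiv_klein (by decide) (by decide) (by decide) (by decide) (by decide) (by decide)

theorem flip01_swap12_dihedral :
    Nonempty (Subgroup.closure {flip01 * swap12, swap12} ≃* DihedralGroup 4) :=
  nonempty_mulEquiv_dihedral_of_two_lt
    (orderOf_eq_four (b := flip12) (by decide) (by decide) (by decide)) (by decide) (by decide)
    (by decide)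

/-- The product of a sign change with the transposition has order 4, its square being the sign
change on the two exchanged blocks. It is the rotation of the dihedral group, the transposition is a
reflection, and the given generators are products of the two. -/
theorem flip02_flip12_swap01_dihedral :
    Nonempty (Subgroup.closure {flip02, flip12, swap01} ≃* DihedralGroup 4) := by
  have h : Subgroup.closure {flip02, flip12, swap01} =
      Subgroup.closure {flip02 * swap01, swap01} := by
    have h1 := mem_closure_left (flip02 * swap01) swap01
    have h2 := mem_closure_right (flip02 * swap01) swap01
    refine closure_eq_closure ?_ ?_
    · rintro x (rfl | rfl | rfl)
      · have h3 := mul_mem h1 h2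
        rwa [(by decide : flip02 * swap01 * swap01 = flip02)] at h3
      · exact (by decide : flip12 = swap01 * (flip02 * swap01)) ▸ mul_mem h2 h1
      · exact h2
    · rintro x (rfl | rfl)
      · exact mul_mem (Subgroup.subset_closure (by simp)) (Subgroup.subset_closure (by simp))
      · exact Subgroup.subset_closure (by simp)
  rw [h]
  exact nonempty_mulEquiv_dihedral_of_two_lt
    (orderOf_eq_four (b := flip01) (by decide) (by decide) (by decide)) (by decide) (by decide)
    (by decide)

theorem flip01_flip12_swap01_dihedral :
    Nonempty (Subgroup.closure {flip01, flip12, swap01} ≃* DihedralGroup 4) := by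
  have h : Subgroup.closure {flip01, flip12, swap01} =
      Subgroup.closure {flip12 * swap01, swap01} := by
    have h1 := mem_closure_left (flip12 * swap01) swap01
    have h2 := mem_closure_right (flip12 * swap01) swap01
    refine closure_eq_closure ?_ ?_
    · rintro x (rfl | rfl | rfl)
      · exact (by decide : flip01 = flip12 * swap01 * (flip12 * swap01)) ▸ mul_mem h1 h1
      · have h3 := mul_mem h1 h2
        rwa [(by decide : flip12 * swap01 * swap01 = flip12)] at h3
      · exact h2
    · rintro x (rfl | rfl)
      · exact mul_mem (Subgroup.subset_closure (by simp)) (Subgroup.subset_closure (by simp))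
      · exact Subgroup.subset_closure (by simp)
  rw [h]
  exact nonempty_mulEquiv_dihedral_of_two_lt
    (orderOf_eq_four (b := flip01) (by decide) (by decide) (by decide)) (by decide) (by decide)
    (by decide)

/-! ### Splitting off the translations of some of the blocks. -/

theorem translations_eq_one_of_fixed {m : ℕ} {ν : Fin m → ℕ} {J : Set (Fin m)} {v : WX (Blocks ν)}
    (hv : v ∈ translations ν J) (h : ∀ b ∈ J, ∃ b', v.right (bp b 0) = bp b' 0) : v = 1 := by
  obtain ⟨w, hw, rfl⟩ := hv
  rw [tr_eq_one_iff]
  intro b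
  by_cases hb : b ∈ J
  · obtain ⟨b', h1⟩ := h b hb
    rw [tr_right] at h1
    have h2 : b = b' := congrArg Sigma.fst h1
    rw [← h2, eq_comm, bp_eq_iff] at h1
    simpa using h1
  · rw [hw b hb]
    exact dvd_zero _

/-- Signed permutations and translations of other blocks respect the base points of the blocks
in `J`. -/
theorem closure_maps_base {m N : ℕ} {ν : Fin m → ℕ} {e : Blocks ν ≃ Fin N} {J : Set (Fin m)}
    {X : Set (WB N)} (hX : ∀ x ∈ X, (∃ q, IsInducedBy e x q ∧ ∀ b ∈ J, q.right b ∈ J) ∨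
      ∃ b, b ∉ J ∧ x = WX.relabel e (tb ν b)) :
    ∀ x ∈ Subgroup.closure X, ∀ b ∈ J, ∃ b' ∈ J, x.right (e (bp b 0)) = e (bp b' 0) := by
  intro x hx
  -- The group is finite, so the generated subgroup is the generated submonoid and inverses need no
  -- separate case.
  rw [← Subgroup.mem_toSubmonoid, Subgroup.closure_toSubmonoid_of_finite] at hx
  induction hx using Submonoid.closure_induction with
  | one => exact fun b hb => ⟨b, hb, rfl⟩
  | mul x y _ _ ihx ihy =>
    intro b hb
    obtain ⟨b', hb', h⟩ := ihy b hb
    rw [WX.mul_right_apply, h]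
    exact ihx b' hb'
  | mem x hx =>
    intro b hb
    rcases hX x hx with ⟨q, ⟨hq, rfl⟩, h1⟩ | ⟨d, hd, rfl⟩
    · refine ⟨q.right b, h1 b hb, ?_⟩
      change (WX.relabel e (lin _)).right (e _) = _
      rw [WX.relabel_right_apply, lin_right, mul_zero]
    · refine ⟨b, hb, ?_⟩
      rw [WX.relabel_right_apply, tb, tr_right, Pi.single_eq_of_ne fun (h : b = d) => hd (h ▸ hb),
        add_zero]

/-- A group generated by signed permutations respecting the blocks in `J` and by all
translations: the translations of the blocks in `J` split off. -/
theorem isInternalSemidirect_of_blocks {m N : ℕ} {ν : Fin m → ℕ} {e : Blocks ν ≃ Fin N}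
    {J : Set (Fin m)} {X Z : Set (WB N)}
    (hZ : ∀ x ∈ Z, (∃ q, IsInducedBy e x q ∧ ∀ b, b ∈ J → q.right b ∈ J) ∨
      ∃ b, b ∉ J ∧ x = WX.relabel e (tb ν b))
    (hJ : ∀ b ∈ J, WX.relabel e (tb ν b) ∈ Subgroup.closure X) (hZX : Z ⊆ X)
    (hX : ∀ x ∈ X, x ∈ Z ∨ ∃ b ∈ J, x = WX.relabel e (tb ν b) ∨ x = (WX.relabel e (tb ν b))⁻¹) :
    IsInternalSemidirect ((translations ν J).map (WX.relabel e)) (Subgroup.closure Z)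
      (Subgroup.closure X) := by
  have hT : (translations ν J).map (WX.relabel e) =
      Subgroup.closure (WX.relabel e '' (tb ν '' J)) := by
    rw [translations_eq_closure, MonoidHom.map_closure]
  refine .of_closure ?_ (Subgroup.closure_mono hZX) ?_ ?_ fun x hx => ?_
  · rw [hT, Subgroup.closure_le]
    rintro _ ⟨_, ⟨b, hb, rfl⟩, rfl⟩
    exact hJ b hb
  · rw [hT]
    refine conj_mem_closure fun x hx y hy => ?_
    rw [← hT]
    obtain ⟨_, ⟨b, hb, rfl⟩, rfl⟩ := hy
    rcases hZ x hx with ⟨q, ⟨hq, rfl⟩, h1⟩ | ⟨d, hd, rfl⟩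
    · exact ⟨_, lin_conj_mem (q := ⟨q, hq⟩) h1 (tb_mem hb), by simp [blockHom]⟩
    · refine ⟨tb ν b, tb_mem hb, ?_⟩
      rw [← map_inv, ← map_mul, ← map_mul, tb, tb, tr_comm, mul_inv_cancel_right]
  · rintro _ ⟨v, hv, rfl⟩ hv'
    -- The complement preserves the set of base points of the blocks in J, and a translation of
    -- these blocks which does so is trivial.
    rw [translations_eq_one_of_fixed hv fun b hb => ?_, map_one]
    obtain ⟨b', -, h⟩ := closure_maps_base hZ _ hv' b hb
    rw [WX.relabel_right_apply] at h
    exact ⟨b', e.injective h⟩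
  · rcases hX x hx with hz | ⟨b, hb, rfl | rfl⟩
    · exact Subgroup.mem_sup_right (Subgroup.subset_closure hz)
    · exact Subgroup.mem_sup_left ⟨_, tb_mem hb, rfl⟩
    · exact Subgroup.mem_sup_left (inv_mem ⟨_, tb_mem hb, rfl⟩)

/-! ### Calculations with signed permutations of blocks and translations -/

section induced

variable {m N : ℕ} {ν : Fin m → ℕ} {e : Blocks ν ≃ Fin N}

/-- The translations of the labels. -/
def labTr (e : Blocks ν ≃ Fin N) (w : Fin m → ℤ) : WB N := WX.relabel e (tr w)

theorem labTr_add (v w : Fin m → ℤ) : labTr e (v + w) = labTr e v * labTr e w := by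
  rw [labTr, tr_add, map_mul, labTr, labTr]

theorem labTr_neg (v : Fin m → ℤ) : labTr e (-v) = (labTr e v)⁻¹ := by
  rw [labTr, tr_neg, map_inv, labTr]

theorem labTr_zsmul (k : ℤ) (v : Fin m → ℤ) : labTr e (k • v) = labTr e v ^ k := by
  rw [labTr, tr_zsmul, map_zpow, labTr]

theorem labTr_comm (v w : Fin m → ℤ) : labTr e v * labTr e w = labTr e w * labTr e v := by
  rw [← labTr_add, add_comm, labTr_add]

theorem labTr_eq_one_iff {w : Fin m → ℤ} :
    labTr e w = 1 ↔ ∀ b, ((2 * ν b + 1 : ℕ) : ℤ) ∣ w b := by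
  rw [labTr, map_eq_one_iff _ (WX.relabel_injective e), tr_eq_one_iff]

theorem labTr_eq_iff {v w : Fin m → ℤ} :
    labTr e v = labTr e w ↔ ∀ b, ((2 * ν b + 1 : ℕ) : ℤ) ∣ v b - w b := by
  rw [← mul_inv_eq_one, ← labTr_neg, ← labTr_add, labTr_eq_one_iff]
  simp [sub_eq_add_neg]

theorem orderOf_labTr {w : Fin m → ℤ} {n : ℕ}
    (h : ∀ k : ℤ, (∀ b, ((2 * ν b + 1 : ℕ) : ℤ) ∣ k * w b) ↔ (n : ℤ) ∣ k) :
    orderOf (labTr e w) = n := by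
  have key : ∀ k : ℤ, labTr e w ^ k = 1 ↔ (n : ℤ) ∣ k := by
    intro k
    rw [← labTr_zsmul, labTr_eq_one_iff, ← h]
    simp
  have h1 := pow_orderOf_eq_one (labTr e w)
  rw [← zpow_natCast, key, Int.natCast_dvd_natCast] at h1
  refine Nat.dvd_antisymm (orderOf_dvd_of_pow_eq_one ?_) h1
  rw [← zpow_natCast, key]

theorem orderOf_labTr_single (b : Fin m) {n : ℕ} (hn : ν b = n) :
    orderOf (labTr e (Pi.single b 1)) = 2 * n + 1 := by
  rw [labTr, orderOf_injective _ (WX.relabel_injective e), ← hn]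
  exact orderOf_tb b

theorem IsInducedBy.one : IsInducedBy e 1 1 := ⟨one_mem _, (map_one (blockHom e)).symm⟩

theorem IsInducedBy.mul {g h : WB N} {q r : WX (Fin m)} (hg : IsInducedBy e g q)
    (hh : IsInducedBy e h r) : IsInducedBy e (g * h) (q * r) := by
  obtain ⟨hq, rfl⟩ := hg
  obtain ⟨hr, rfl⟩ := hh
  exact ⟨mul_mem hq hr, (map_mul (blockHom e) ⟨q, hq⟩ ⟨r, hr⟩).symm⟩

theorem IsInducedBy.eq {g h : WB N} {q : WX (Fin m)} (hg : IsInducedBy e g q)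
    (hh : IsInducedBy e h q) : g = h := by
  obtain ⟨hq, rfl⟩ := hg
  obtain ⟨hr, rfl⟩ := hh
  rfl

theorem IsInducedBy.mul_eq_one {g h : WB N} {q r : WX (Fin m)} (hg : IsInducedBy e g q)
    (hh : IsInducedBy e h r) (hqr : q * r = 1) : g * h = 1 :=
  (hqr ▸ hg.mul hh).eq .one

theorem IsInducedBy.ne_one {g : WB N} {q : WX (Fin m)} (hg : IsInducedBy e g q) (hq : q ≠ 1) :
    g ≠ 1 := by
  obtain ⟨h, rfl⟩ := hg
  rw [Ne, map_eq_one_iff _ (blockHom_injective e)]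
  exact fun h1 => hq (congrArg Subtype.val h1)

theorem IsInducedBy.conj_labTr {g : WB N} {q : WX (Fin m)} (hg : IsInducedBy e g q)
    (w : Fin m → ℤ) :
    g * labTr e w * g⁻¹ = labTr e fun b => q.left b * w (q.right⁻¹ b) := by
  obtain ⟨hq, rfl⟩ := hg
  have := congrArg (WX.relabel e) (lin_conj_tr ⟨q, hq⟩ w)
  rw [map_mul, map_mul, map_inv] at this
  exact this

/-- A translation inverted by a signed permutation of order two. -/
theorem IsInducedBy.inverts {g : WB N} {q : WX (Fin m)} (hg : IsInducedBy e g q)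
    (hq : q * q = 1) {w : Fin m → ℤ} (hw : ∀ b, (q.left b : ℤ) * w (q.right⁻¹ b) = - w b) :
    g * labTr e w * g = (labTr e w)⁻¹ := by
  have h := hg.conj_labTr w
  rw [inv_eq_of_mul_eq_one_left (hg.mul_eq_one hg hq)] at h
  rw [h, ← labTr_neg]
  congr 1
  exact funext hw

theorem IsInducedBy.dihedral {g : WB N} {q : WX (Fin m)} (hg : IsInducedBy e g q)
    (hq : q * q = 1) {w : Fin m → ℤ} (hw : ∀ b, (q.left b : ℤ) * w (q.right⁻¹ b) = - w b) {n : ℕ}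
    (hn : orderOf (labTr e w) = n) (h2 : 2 < n) :
    Nonempty (Subgroup.closure {labTr e w, g} ≃* DihedralGroup n) :=
  nonempty_mulEquiv_dihedral_of_two_lt hn h2 (hg.mul_eq_one hg hq) (hg.inverts hq hw)

/-- A translation fixed by a signed permutation. -/
theorem IsInducedBy.comm_labTr {g : WB N} {q : WX (Fin m)} (hg : IsInducedBy e g q)
    {w : Fin m → ℤ} (hw : ∀ b, (q.left b : ℤ) * w (q.right⁻¹ b) = w b) :
    g * labTr e w = labTr e w * g := by
  rw [← mul_inv_eq_iff_eq_mul, hg.conj_labTr w]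
  congr 1
  exact funext hw

theorem IsInducedBy.comm {g h : WB N} {q r : WX (Fin m)} (hg : IsInducedBy e g q)
    (hh : IsInducedBy e h r) (hqr : q * r = r * q) : g * h = h * g :=
  (hg.mul hh).eq (hqr ▸ hh.mul hg)

end induced

/-! ### Classes 9, 10 and 11 -/

section classes9to11

variable (n : ℕ)

/-- The labels of classes 9, 10 and 11. -/
noncomputable def labels9 : Blocks ![n, 0, 0] ≃ Fin (2 * n + 3) := blockEquiv (sum_three (by ring))

/-- The model for recognising generators: the product of transpositions negates the coordinate of
the first block, and the set of signs is a union of blocks, which is checked on intervals of labels.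
The blocks 1 and 2 have one point each, so their coordinates impose no condition. -/
theorem flip01_class9 : IsInducedBy (labels9 n) (Class9.g₁ n) flip01 := by
  refine c_mul_perm_isInducedBy (flips_actsBy _ 0 (offset_zero _) rfl)
    (by intro b; fin_cases b <;> rfl) (by decide)
    (Fin.forall_fin_succ.mpr ⟨.inr (by decide), Fin.forall_fin_two.mpr ⟨.inl rfl, .inl rfl⟩⟩)
    (blockEquiv_mem_iff _ fun b j h1 h2 => ?_)
  rw [show flip01.left = ![-1, -1, 1] by decide]
  fin_cases b <;> simp [offset, Fin.sum_univ_three] at h2 ⊢ <;> omega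

theorem flip12_class9 : IsInducedBy (labels9 n) (Class9.g₃ n) flip12 := by
  refine c_isInducedBy (by decide)
    (Fin.forall_fin_succ.mpr ⟨.inr (by decide), Fin.forall_fin_two.mpr ⟨.inl rfl, .inl rfl⟩⟩)
    (blockEquiv_mem_iff _ fun b j h1 h2 => ?_)
  rw [show flip12.left = ![1, -1, -1] by decide]
  fin_cases b <;> simp [offset, Fin.sum_univ_three] at h2 ⊢ <;> omega

theorem swap12_acts (n : ℕ) :
    ActsBy (labels9 n) (cyc [2 * n + 2, 2 * n + 3]) (Equiv.swap 1 2) 1 :=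
  swap_actsBy _ (by decide) rfl rfl (by rw [offset_three_one])
    (by rw [offset_three_two])

theorem flip01_swap12_class10 : IsInducedBy (labels9 n) (Class10.g₁ n) (flip01 * swap12) := by
  refine c_mul_perm_isInducedBy ((flips_actsBy _ 0 (offset_zero _) rfl).mul (swap12_acts n))
    (by intro b; fin_cases b <;> rfl) (by decide)
    (Fin.forall_fin_succ.mpr ⟨.inr (by decide), Fin.forall_fin_two.mpr ⟨.inl rfl, .inl rfl⟩⟩)
    (blockEquiv_mem_iff _ fun b j h1 h2 => ?_)
  rw [show (flip01 * swap12).left = ![-1, -1, 1] by decide]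
  fin_cases b <;> simp [offset, Fin.sum_univ_three] at h2 ⊢ <;> omega

theorem swap12_class11 : IsInducedBy (labels9 n) (Class11.g₃ n) swap12 :=
  perm_isInducedBy (swap12_acts n) (by intro b; fin_cases b <;> rfl)

theorem rot_class9 : perm (rot 0 n) = labTr (labels9 n) (Pi.single 0 1) :=
  perm_rot _ 0 (offset_zero _) rfl

theorem class9_generating : IsBlockGenerating (labels9 n)
    {Class9.g₁ n, Class9.g₂ n, Class9.g₃ n} {Class9.g₁ n, Class9.g₃ n} where
  tb_mem_closure := Fin.forall_fin_succ.mpr ⟨.inr (Subgroup.subset_closure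
    (.inr (.inl (rot_class9 n).symm))), by simp [Fin.forall_fin_two]⟩
  subset := by rintro x (rfl | rfl) <;> simp
  mem_cases := by
    rintro x (rfl | rfl | rfl)
    · exact .inl (.inl rfl)
    · exact .inr ⟨0, .inl (rot_class9 n)⟩
    · exact .inl (.inr rfl)

theorem class10_generating : IsBlockGenerating (labels9 n)
    {Class10.g₁ n, Class10.g₂ n} {Class10.g₁ n} where
  tb_mem_closure := Fin.forall_fin_succ.mpr ⟨.inr (Subgroup.subset_closure
    (.inr (rot_class9 n).symm)), by simp [Fin.forall_fin_two]⟩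
  subset := by rintro x rfl; simp
  mem_cases := by
    rintro x (rfl | rfl)
    · exact .inl rfl
    · exact .inr ⟨0, .inl (rot_class9 n)⟩

theorem class11_generating : IsBlockGenerating (labels9 n)
    {Class11.g₁ n, Class11.g₂ n, Class11.g₃ n} {Class11.g₁ n, Class11.g₃ n} where
  tb_mem_closure := Fin.forall_fin_succ.mpr ⟨.inr (Subgroup.subset_closure
    (.inr (.inl (rot_class9 n).symm))), by simp [Fin.forall_fin_two]⟩
  subset := by rintro x (rfl | rfl) <;> simp
  mem_cases := by
    rintro x (rfl | rfl | rfl)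
    · exact .inl (.inl rfl)
    · exact .inr ⟨0, .inl (rot_class9 n)⟩
    · exact .inl (.inr rfl)

theorem translations_labels9 :
    Nonempty (translations ![n, 0, 0] Set.univ ≃* Cyc (2 * n + 1)) :=
  translations_single_block 0 (by simp [Fin.forall_fin_succ])

/-- The sign change g₃ on the two single points is a central involution, and g₁ inverts the rotation
g₂. -/
theorem class9_dihedral (hn : 1 ≤ n) :
    Nonempty (Class9.G n ≃* DihedralGroup (4 * n + 2)) := by
  have h1 := flip01_class9 n
  have h3 := flip12_class9 n
  have e1 : Class9.g₁ n * Class9.g₁ n = 1 := h1.mul_eq_one h1 (by decide)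
  have e3 : Class9.g₃ n * Class9.g₃ n = 1 := h3.mul_eq_one h3 (by decide)
  have e13 : Class9.g₁ n * Class9.g₃ n = Class9.g₃ n * Class9.g₁ n := h1.comm h3 (by decide)
  have h2 : Class9.g₂ n = labTr (labels9 n) (Pi.single 0 1) := rot_class9 n
  have e23 : Commute (Class9.g₂ n) (Class9.g₃ n) := h2 ▸ (h3.comm_labTr (by decide)).symm
  exact nonempty_mulEquiv_dihedral_two_mul hn (h2 ▸ orderOf_labTr_single 0 rfl) e1 e3
    (h3.ne_one (by decide)) (h2 ▸ h1.inverts (by decide) (by decide)) e13 e23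

theorem class9_main (hn : 1 ≤ n) : IsAdmissible (Class9.G n) ∧
    Nonempty (Class9.G n ≃* DihedralGroup (4 * n + 2)) ∧
    HasOrbitLengths (Class9.G n) [2 * n + 1, 1, 1] ∧
    IsSylowTwo (Class9.G n) (Subgroup.closure {Class9.g₁ n, Class9.g₃ n}) ∧
    Nonempty (Subgroup.closure {Class9.g₁ n, Class9.g₃ n} ≃* Cyc 2 × Cyc 2) := by
  have h := class9_generating n
  have hi := IsInducedSet.insert (flip01_class9 n) (.singleton (flip12_class9 n))
  have hf := h.isFrame hi isFlipping_flip01_flip12 le_rfl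
  have hk := hi.nonempty_mulEquiv flip01_flip12_klein
  refine ⟨hf.isAdmissible, class9_dihedral n hn, ?_,
    hf.isSylowTwo (isPGroup_of_mulEquiv hk 2 card_klein), hk⟩
  refine h.hasOrbitLengths_of_right_eq hi rfl ?_ fun b => by fin_cases b <;> rfl
  rintro q (rfl | rfl) <;> exact fun b => rfl

theorem class10_main : IsAdmissible (Class10.G n) ∧
    IsSemidirect (Cyc (2 * n + 1)) (Cyc 4) (Class10.G n) ∧
    HasOrbitLengths (Class10.G n) [2 * n + 1, 2] ∧
    IsSylowTwo (Class10.G n) (Subgroup.closure {Class10.g₁ n}) ∧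
    Nonempty (Subgroup.closure {Class10.g₁ n} ≃* Cyc 4) := by
  have h := class10_generating n
  have hi := IsInducedSet.singleton (flip01_swap12_class10 n)
  have hf := h.isFrame hi isFlipping_flip01_swap12 le_rfl
  have hk := hi.nonempty_mulEquiv flip01_swap12_cyc
  refine ⟨hf.isAdmissible, h.isSemidirect hi (translations_labels9 n) flip01_swap12_cyc, ?_,
    hf.isSylowTwo (isPGroup_of_mulEquiv hk 2 (card_cyc 4)), hk⟩
  refine h.hasOrbitLengths hi ![0, 1, 1] ![0, 1] (by simp [Fin.forall_fin_two]) ?_ ?_ ?_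
  · rintro q rfl
    exact fun b => by fin_cases b <;> rfl
  · exact Fin.forall_fin_succ.mpr ⟨⟨1, one_mem _, rfl⟩, Fin.forall_fin_two.mpr
      ⟨⟨1, one_mem _, rfl⟩, ⟨_, Subgroup.subset_closure rfl, rfl⟩⟩⟩
  · intro o
    fin_cases o <;> simp [Fin.sum_univ_three]

theorem class11_main : IsAdmissible (Class11.G n) ∧
    IsSemidirect (Cyc (2 * n + 1)) (DihedralGroup 4) (Class11.G n) ∧
    HasOrbitLengths (Class11.G n) [2 * n + 1, 2] ∧
    IsSylowTwo (Class11.G n) (Subgroup.closure {Class11.g₁ n, Class11.g₃ n}) ∧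
    Nonempty (Subgroup.closure {Class11.g₁ n, Class11.g₃ n} ≃* DihedralGroup 4) ∧
    H1Vanishes ((Subgroup.closure {Class11.g₁ n, Class11.g₃ n}).subgroupOf (WD _)) := by
  have h := class11_generating n
  have hi := IsInducedSet.insert (flip01_swap12_class10 n) (.singleton (swap12_class11 n))
  have hf := h.isFrame hi isFlipping_flip01_swap12_swap12 le_rfl
  have hk := hi.nonempty_mulEquiv flip01_swap12_dihedral
  refine ⟨hf.isAdmissible, h.isSemidirect hi (translations_labels9 n) flip01_swap12_dihedral, ?_,
    hf.isSylowTwo (isPGroup_of_mulEquiv hk 3 card_dihedral_four), hk,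
    hf.isAdmissible.h1Vanishes hf.right_le⟩
  refine h.hasOrbitLengths hi ![0, 1, 1] ![0, 1] (by simp [Fin.forall_fin_two]) ?_ ?_ ?_
  · rintro q (rfl | rfl)
    · exact fun b => by fin_cases b <;> rfl
    · exact fun b => by fin_cases b <;> rfl
  · exact Fin.forall_fin_succ.mpr ⟨⟨1, one_mem _, rfl⟩, Fin.forall_fin_two.mpr
      ⟨⟨1, one_mem _, rfl⟩, ⟨_, mem_closure_right _ _, rfl⟩⟩⟩
  · intro o
    fin_cases o <;> simp [Fin.sum_univ_three]

end classes9to11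

/-! ### Classes 1 and 3 -/

section class1

variable (n : ℕ)

/-- The labels of class 1. -/
noncomputable def labels1 : Blocks ![n, 0] ≃ Fin (2 * n + 2) := blockEquiv (sum_two (by ring))

theorem flipBoth_class1 : IsInducedBy (labels1 n) (Class1.g₁ n) flipBoth := by
  refine c_mul_perm_isInducedBy (flips_actsBy _ 0 (offset_zero _) rfl)
    (by intro b; fin_cases b <;> rfl) (by decide)
    (Fin.forall_fin_two.mpr ⟨.inr (by decide), .inl rfl⟩)
    (blockEquiv_mem_iff _ fun b j h1 h2 => ?_)
  rw [show flipBoth.left = ![-1, -1] by decide]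
  fin_cases b <;> simp [offset] at h2 ⊢ <;> omega

theorem rot_class1 : Class1.g₂ n = labTr (labels1 n) (Pi.single 0 1) :=
  perm_rot _ 0 (offset_zero _) rfl

theorem class1_generating : IsBlockGenerating (labels1 n)
    {Class1.g₁ n, Class1.g₂ n} {Class1.g₁ n} where
  tb_mem_closure := Fin.forall_fin_two.mpr ⟨.inr (Subgroup.subset_closure
    (.inr (rot_class1 n).symm)), .inl rfl⟩
  subset := by rintro x rfl; simp
  mem_cases := by
    rintro x (rfl | rfl)
    · exact .inl rfl
    · exact .inr ⟨0, .inl (rot_class1 n)⟩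

theorem class1_main (hn : 1 ≤ n) : IsAdmissible (Class1.G n) ∧
    Nonempty (Class1.G n ≃* DihedralGroup (2 * n + 1)) ∧
    HasOrbitLengths (Class1.G n) [2 * n + 1, 1] ∧
    ContainsSylowTwo (Class1.G n) (Subgroup.closure {Class1.g₁ n}) := by
  have h := class1_generating n
  have hi := IsInducedSet.singleton (flipBoth_class1 n)
  have hf := h.isFrame hi isFlipping_flipBoth (by decide)
  refine ⟨hf.isAdmissible, ?_, ?_, hf.containsSylowTwo⟩
  · rw [Class1.G, Set.pair_comm, rot_class1]
    exact (flipBoth_class1 n).dihedral (by decide) (by decide) (orderOf_labTr_single 0 rfl)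
      (by omega)
  · refine h.hasOrbitLengths_of_right_eq hi rfl ?_ fun b => by fin_cases b <;> rfl
    rintro q rfl
    exact fun b => rfl

end class1

section class3

variable (n₁ n₂ : ℕ)

/-- The labels of class 3. -/
noncomputable def labels3 : Blocks ![n₁, n₂, 0] ≃ Fin (2 * n₁ + 2 * n₂ + 3) :=
  blockEquiv (sum_three (by ring))

theorem flip02_class3 : IsInducedBy (labels3 n₁ n₂) (Class3.g₁ n₁ n₂) flip02 := by
  refine c_mul_perm_isInducedBy (flips_actsBy _ 0 (offset_zero _) rfl)
    (by intro b; fin_cases b <;> rfl) (by decide)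
    (Fin.forall_fin_succ.mpr ⟨.inr (by decide), Fin.forall_fin_two.mpr
      ⟨.inr (by decide), .inl rfl⟩⟩) (blockEquiv_mem_iff _ fun b j h1 h2 => ?_)
  rw [show flip02.left = ![-1, 1, -1] by decide]
  fin_cases b <;> simp [offset, Fin.sum_univ_three] at h2 ⊢ <;> omega

theorem flip12_class3 : IsInducedBy (labels3 n₁ n₂) (Class3.g₁' n₁ n₂) flip12 := by
  refine c_mul_perm_isInducedBy (flips_actsBy _ 1 (offset_three_one _ _ _) rfl)
    (by intro b; fin_cases b <;> rfl) (by decide)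
    (Fin.forall_fin_succ.mpr ⟨.inr (by decide), Fin.forall_fin_two.mpr
      ⟨.inr (by decide), .inl rfl⟩⟩) (blockEquiv_mem_iff _ fun b j h1 h2 => ?_)
  rw [show flip12.left = ![1, -1, -1] by decide]
  fin_cases b <;> simp [offset, Fin.sum_univ_three] at h2 ⊢ <;> omega

theorem rot_class3 : Class3.g₂ n₁ n₂ = labTr (labels3 n₁ n₂) (Pi.single 0 1) :=
  perm_rot _ 0 (offset_zero _) rfl

theorem rot'_class3 : Class3.g₂' n₁ n₂ = labTr (labels3 n₁ n₂) (Pi.single 1 1) :=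
  perm_rot _ 1 (offset_three_one _ _ _) rfl

theorem class3_generating : IsBlockGenerating (labels3 n₁ n₂)
    {Class3.g₁ n₁ n₂, Class3.g₂ n₁ n₂, Class3.g₁' n₁ n₂, Class3.g₂' n₁ n₂}
    {Class3.g₁ n₁ n₂, Class3.g₁' n₁ n₂} where
  tb_mem_closure := Fin.forall_fin_succ.mpr
    ⟨.inr (Subgroup.subset_closure (.inr (.inl (rot_class3 n₁ n₂).symm))), Fin.forall_fin_two.mpr
      ⟨.inr (Subgroup.subset_closure (.inr (.inr (.inr (rot'_class3 n₁ n₂).symm)))), .inl rfl⟩⟩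
  subset := by rintro x (rfl | rfl) <;> simp
  mem_cases := by
    rintro x (rfl | rfl | rfl | rfl)
    · exact .inl (.inl rfl)
    · exact .inr ⟨0, .inl (rot_class3 n₁ n₂)⟩
    · exact .inl (.inr rfl)
    · exact .inr ⟨1, .inl (rot'_class3 n₁ n₂)⟩

theorem class3_main (h₁ : 1 ≤ n₁) (h₂ : 1 ≤ n₂) : IsAdmissible (Class3.G n₁ n₂) ∧
    Nonempty (Class3.G n₁ n₂ ≃* DihedralGroup (2 * n₁ + 1) × DihedralGroup (2 * n₂ + 1)) ∧
    HasOrbitLengths (Class3.G n₁ n₂) [2 * n₁ + 1, 2 * n₂ + 1, 1] := by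
  have h := class3_generating n₁ n₂
  have i1 := flip02_class3 n₁ n₂
  have i2 := flip12_class3 n₁ n₂
  have hi := IsInducedSet.insert i1 (.singleton i2)
  have hf := h.isFrame hi isFlipping_flip02_flip12 le_rfl
  refine ⟨hf.isAdmissible, ?_, ?_⟩
  -- Each dihedral group is generated by a translation of one block and a sign change that is
  -- trivial on the other long block; the two meet only in signs at the last point, which commute.
  · refine nonempty_mulEquiv_prod_of_closure (isCenterless_dihedral n₁ h₁)
      (i1.dihedral (w := Pi.single 0 1) (by decide) (by decide)
        (orderOf_labTr_single 0 rfl) (by simp; omega))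
      (i2.dihedral (w := Pi.single 1 1) (by decide) (by decide)
        (orderOf_labTr_single 1 rfl) (by simp; omega)) ?_ ?_ ?_ ?_
    · rintro _ (rfl | rfl) _ (rfl | rfl)
      · exact labTr_comm _ _
      · exact (i2.comm_labTr (by decide)).symm
      · exact i1.comm_labTr (by decide)
      · exact i1.comm i2 (by decide)
    · rintro _ (rfl | rfl)
      · exact Subgroup.subset_closure (.inr (.inl (rot_class3 n₁ n₂).symm))
      · exact Subgroup.subset_closure (.inl rfl)
    · rintro _ (rfl | rfl)
      · exact Subgroup.subset_closure (.inr (.inr (.inr (rot'_class3 n₁ n₂).symm)))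
      · exact Subgroup.subset_closure (.inr (.inr (.inl rfl)))
    · rintro _ (rfl | rfl | rfl | rfl)
      · exact Subgroup.mem_sup_left (mem_closure_right _ _)
      · exact rot_class3 n₁ n₂ ▸ Subgroup.mem_sup_left (mem_closure_left _ _)
      · exact Subgroup.mem_sup_right (mem_closure_right _ _)
      · exact rot'_class3 n₁ n₂ ▸ Subgroup.mem_sup_right (mem_closure_left _ _)
  · refine h.hasOrbitLengths_of_right_eq hi rfl ?_ fun b => by fin_cases b <;> rfl
    rintro q (rfl | rfl) <;> exact fun b => rfl

end class3

/-! ### Class 5 -/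

section class5

variable (n₁ n₂ : ℕ)

/-- The labels of classes 5 and 7. -/
noncomputable def labels5 : Blocks ![n₁, n₂] ≃ Fin (2 * n₁ + 2 * n₂ + 2) :=
  blockEquiv (sum_two rfl)

theorem flipBoth_class5 : IsInducedBy (labels5 n₁ n₂) (Class5.s n₁ n₂) flipBoth := by
  refine c_mul_perm_isInducedBy ((flips_actsBy _ 0 (offset_zero _) rfl).mul
    (flips_actsBy _ 1 (offset_two_one _ _) rfl)) (by intro b; fin_cases b <;> rfl) (by decide)
    (fun b => .inr (by revert b; decide)) (blockEquiv_mem_iff _ fun b j h1 h2 => ?_)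
  rw [show flipBoth.left = ![-1, -1] by decide]
  fin_cases b <;> simp [offset] at h2 ⊢ <;> omega

theorem rot_class5 : Class5.g₂ n₁ n₂ = labTr (labels5 n₁ n₂) (Pi.single 0 1) :=
  perm_rot _ 0 (offset_zero _) rfl

theorem rot'_class5 : Class5.g₂' n₁ n₂ = labTr (labels5 n₁ n₂) (Pi.single 1 1) :=
  perm_rot _ 1 (offset_two_one _ _) rfl

theorem class5_generating : IsBlockGenerating (labels5 n₁ n₂)
    {Class5.s n₁ n₂, Class5.g₂ n₁ n₂, Class5.g₂' n₁ n₂} {Class5.s n₁ n₂} where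
  tb_mem_closure := Fin.forall_fin_two.mpr
    ⟨.inr (Subgroup.subset_closure (.inr (.inl (rot_class5 n₁ n₂).symm))),
      .inr (Subgroup.subset_closure (.inr (.inr (rot'_class5 n₁ n₂).symm)))⟩
  subset := by rintro x rfl; simp
  mem_cases := by
    rintro x (rfl | rfl | rfl)
    · exact .inl rfl
    · exact .inr ⟨0, .inl (rot_class5 n₁ n₂)⟩
    · exact .inr ⟨1, .inl (rot'_class5 n₁ n₂)⟩

/-- The translations of the first block are normal. The reflection and the translations of the
second block generate a dihedral complement, because they fix the base point of the first block. -/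
theorem class5_semidirect (h₂ : 1 ≤ n₂) : IsSemidirect (Cyc (2 * n₁ + 1))
    (DihedralGroup (2 * n₂ + 1)) (Class5.G n₁ n₂) := by
  have i1 := flipBoth_class5 n₁ n₂
  have h : IsInternalSemidirect ((translations ![n₁, n₂] {0}).map (WX.relabel (labels5 n₁ n₂)))
      (Subgroup.closure {Class5.g₂' n₁ n₂, Class5.s n₁ n₂}) (Class5.G n₁ n₂) := by
    refine isInternalSemidirect_of_blocks ?_ ?_ ?_ ?_
    · rintro x (rfl | rfl)
      · exact .inr ⟨1, by simp, rot'_class5 n₁ n₂⟩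
      · exact .inl ⟨_, i1, fun b h => h⟩
    · rintro b rfl
      exact Subgroup.subset_closure (.inr (.inl (rot_class5 n₁ n₂).symm))
    · rintro x (rfl | rfl) <;> simp
    · rintro x (rfl | rfl | rfl)
      · exact .inl (.inr rfl)
      · exact .inr ⟨0, rfl, .inl (rot_class5 n₁ n₂)⟩
      · exact .inl (.inl rfl)
  obtain ⟨eN⟩ := nonempty_map_mulEquiv (WX.relabel_injective (labels5 n₁ n₂))
    (translations_singleton (ν := ![n₁, n₂]) 0 rfl)
  obtain ⟨eK⟩ := i1.dihedral (w := Pi.single 1 1) (by decide) (by decide)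
    (orderOf_labTr_single 1 rfl) (by simp; omega)
  rw [← rot'_class5] at eK
  exact h.isSemidirect eN eK

theorem class5_main (h₂ : 1 ≤ n₂) : IsAdmissible (Class5.G n₁ n₂) ∧
    IsSemidirect (Cyc (2 * n₁ + 1)) (DihedralGroup (2 * n₂ + 1)) (Class5.G n₁ n₂) ∧
    HasOrbitLengths (Class5.G n₁ n₂) [2 * n₁ + 1, 2 * n₂ + 1] := by
  have h := class5_generating n₁ n₂
  have hi := IsInducedSet.singleton (flipBoth_class5 n₁ n₂)
  have hf := h.isFrame hi isFlipping_flipBoth (by decide)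
  refine ⟨hf.isAdmissible, class5_semidirect n₁ n₂ h₂, ?_⟩
  refine h.hasOrbitLengths_of_right_eq hi rfl ?_ fun b => by fin_cases b <;> rfl
  rintro q rfl
  exact fun b => rfl

end class5

/-! ### Groups with equal translations on all blocks -/

section diagonal

variable {m N : ℕ} {ν : Fin m → ℕ} {e : Blocks ν ≃ Fin N} {X Z : Set (WB N)}
  {Y : Set (WX (Fin m))}

theorem closure_labTr_sup (hZ : IsInducedSet e Z Y)
    (hX : Subgroup.closure X = Subgroup.closure {labTr e 1} ⊔ Subgroup.closure Z) :
    Subgroup.closure X = (Subgroup.closure {tr 1} ⊔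
      (Subgroup.closure (((↑) : lengthStab ν → WX (Fin m)) ⁻¹' Y)).map lin).map
        (WX.relabel e) := by
  rw [hX, hZ.closure_eq, Subgroup.map_sup, Subgroup.map_map, MonoidHom.map_closure _ {tr 1},
    Set.image_singleton]
  rfl

theorem tr_one_mem : (tr 1 : WX (Blocks ν)) ∈ Subgroup.closure {tr 1} :=
  Subgroup.subset_closure (Set.mem_singleton _)

theorem exists_diagonal_translation (b : Fin m) (k : ℤ) :
    ∃ v ∈ Subgroup.closure {tr 1}, (v : WX (Blocks ν)).right (bp b k) = bp b 0 := by
  refine ⟨tr 1 ^ (-k), zpow_mem tr_one_mem _, ?_⟩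
  rw [← tr_zsmul, tr_right]
  simp

theorem closure_tr_one_le :
    Subgroup.closure {(tr 1 : WX (Blocks ν))} ≤ translations ν Set.univ := by
  rw [Subgroup.closure_le, Set.singleton_subset_iff]
  exact tr_mem_univ _

/-- The diagonal translation alone is transitive on each block. It generates a normal subgroup
because every element of Y has one sign ε on all blocks and so conjugates this translation to its
power with exponent ε. -/
theorem isFrame_diagonal (hm : m ≤ 3) (hZ : IsInducedSet e Z Y) (hY : IsFlipping Y)
    (hq : ∀ q ∈ Y, ∃ ε : ℤˣ, ∀ b, q.left b = ε)
    (hX : Subgroup.closure X = Subgroup.closure {labTr e 1} ⊔ Subgroup.closure Z) :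
    IsFrame ((Subgroup.closure {tr 1}).map (WX.relabel e)) (Subgroup.closure Z)
      (Subgroup.closure X) ((basePoints ν).map e.toEmbedding) := by
  have h0 := closure_preimage_map hZ.subset
  have h1 : Subgroup.closure (((↑) : lengthStab ν → WX (Fin m)) ⁻¹' Y) ≤
      (WX.sign.comp (lengthStab ν).subtype).ker := by
    rw [Subgroup.closure_le]
    exact fun y hy => hY.prod_eq _ hy
  have h2 := (isFrame_of_blocks hm closure_tr_one_le
    (Q := Subgroup.closure (((↑) : lengthStab ν → WX (Fin m)) ⁻¹' Y)) (fun q hq' => ?_)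
    exists_diagonal_translation (fun q hq => h1 hq) fun b => by
      obtain ⟨q, hq, hb⟩ := hY.flips b
      rw [← h0] at hq
      obtain ⟨q, hq, rfl⟩ := hq
      exact ⟨q, hq, hb⟩).map e
  · rw [← closure_labTr_sup hZ hX, Subgroup.map_map] at h2
    rw [hZ.closure_eq]
    exact h2
  · have h3 : lin q ∈ Subgroup.closure (lin '' (((↑) : lengthStab ν → WX (Fin m)) ⁻¹' Y)) := by
      rw [← MonoidHom.map_closure]
      exact ⟨q, hq', rfl⟩
    refine conj_mem_closure ?_ _ h3
    rintro _ ⟨y, hy, rfl⟩ x hx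
    rw [Set.mem_singleton_iff] at hx
    subst hx
    obtain ⟨ε, hε⟩ := hq _ hy
    rw [lin_conj_tr]
    have h4 : (fun b => (y.1.left b : ℤ) * (1 : Fin m → ℤ) (y.1.right⁻¹ b)) = (ε : ℤ) • 1 := by
      funext b
      simp [hε b]
    rw [h4, tr_zsmul]
    exact zpow_mem tr_one_mem _

theorem hasOrbitLengths_diagonal (hZ : IsInducedSet e Z Y)
    (hX : Subgroup.closure X = Subgroup.closure {labTr e 1} ⊔ Subgroup.closure Z) {l : List ℕ}
    (β : Fin m → Fin l.length)
    (rep : Fin l.length → Fin m) (hrep : ∀ o, β (rep o) = o)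
    (hY : ∀ q ∈ Y, ∀ b, β (q.right b) = β b)
    (hr : ∀ b, ∃ q ∈ Subgroup.closure Y, q.right b = rep (β b))
    (hcard : ∀ o, ∑ b, (if β b = o then 2 * ν b + 1 else 0) = l.get o) :
    HasOrbitLengths (Subgroup.closure X) l := by
  rw [closure_labTr_sup hZ hX]
  have h0 := closure_preimage_map hZ.subset
  refine hasOrbitLengths_blocks closure_tr_one_le exists_diagonal_translation e β rep hrep
    (fun q hq => hY _ hq) (fun b => ?_) hcard
  obtain ⟨q, hq, hb⟩ := hr b
  rw [← h0] at hq
  obtain ⟨q, hq, rfl⟩ := hq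
  exact ⟨q, hq, hb⟩

end diagonal

theorem orderOf_labTr_one {a b N : ℕ} {e : Blocks ![a, b] ≃ Fin N} :
    orderOf (labTr e 1) = Nat.lcm (2 * a + 1) (2 * b + 1) := by
  refine orderOf_labTr fun k => ?_
  rw [Fin.forall_fin_two, Int.natCast_dvd, Int.natCast_dvd, Int.natCast_dvd, Nat.lcm_dvd_iff]
  simp

/-! ### Class 7 -/

section class7

variable (n₁ n₂ : ℕ)

theorem rot_class7 : Class5.g₂ n₁ n₂ * Class5.g₂' n₁ n₂ = labTr (labels5 n₁ n₂) 1 := by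
  rw [rot_class5, rot'_class5, ← labTr_add]
  congr 1
  decide

theorem class7_eq_class5 (h : (2 * n₁ + 1).Coprime (2 * n₂ + 1)) :
    Class7.G n₁ n₂ = Class5.G n₁ n₂ := by
  have h1 : labTr (labels5 n₁ n₂) 1 ∈ Class7.G n₁ n₂ :=
    Subgroup.subset_closure (.inr (rot_class7 n₁ n₂).symm)
  -- Chinese remainders: v(2n₂+1) is 1 modulo 2n₁+1 and 0 modulo 2n₂+1, and u(2n₁+1) conversely.
  -- These exponents extract the two separate translations from the diagonal one.
  obtain ⟨u, v, huv⟩ := Nat.isCoprime_iff_coprime.mpr h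
  refine closure_eq_closure ?_ ?_
  · rintro x (rfl | rfl)
    · exact Subgroup.subset_closure (.inl rfl)
    · exact mul_mem (Subgroup.subset_closure (by simp)) (Subgroup.subset_closure (by simp))
  · rintro x (rfl | rfl | rfl)
    · exact Subgroup.subset_closure (.inl rfl)
    · have h2 : Class5.g₂ n₁ n₂ = labTr (labels5 n₁ n₂) 1 ^ (v * (2 * n₂ + 1 : ℕ)) := by
        rw [rot_class5, ← labTr_zsmul, labTr_eq_iff, Fin.forall_fin_two]
        constructor
        · exact ⟨u, by simp; push_cast at huv; linarith⟩
        · exact ⟨-v, by simp; ring⟩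
      exact Set.mem_of_eq_of_mem h2 (zpow_mem h1 _)
    · have h2 : Class5.g₂' n₁ n₂ = labTr (labels5 n₁ n₂) 1 ^ (u * (2 * n₁ + 1 : ℕ)) := by
        rw [rot'_class5, ← labTr_zsmul, labTr_eq_iff, Fin.forall_fin_two]
        constructor
        · exact ⟨-u, by simp; ring⟩
        · exact ⟨v, by simp; push_cast at huv; linarith⟩
      exact Set.mem_of_eq_of_mem h2 (zpow_mem h1 _)

theorem class7_main (h₁ : 1 ≤ n₁) : IsAdmissible (Class7.G n₁ n₂) ∧
    Nonempty (Class7.G n₁ n₂ ≃* DihedralGroup (Nat.lcm (2 * n₁ + 1) (2 * n₂ + 1))) ∧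
    ((2 * n₁ + 1).Coprime (2 * n₂ + 1) → Class7.G n₁ n₂ = Class5.G n₁ n₂) ∧
    (2 * n₂ + 1 ∣ 2 * n₁ + 1 → Nonempty (Class7.G n₁ n₂ ≃* DihedralGroup (2 * n₁ + 1))) ∧
    HasOrbitLengths (Class7.G n₁ n₂) [2 * n₁ + 1, 2 * n₂ + 1] := by
  have i := flipBoth_class5 n₁ n₂
  have hi := IsInducedSet.singleton i
  have hX : Class7.G n₁ n₂ = Subgroup.closure {labTr (labels5 n₁ n₂) 1} ⊔
      Subgroup.closure {Class5.s n₁ n₂} := by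
    rw [← Subgroup.closure_union, Class7.G, rot_class7, Set.pair_comm]
    rfl
  have hf := isFrame_diagonal (by decide) hi isFlipping_flipBoth
    (by rintro q rfl; exact ⟨-1, by decide⟩) hX
  have hd : Nonempty (Class7.G n₁ n₂ ≃* DihedralGroup (Nat.lcm (2 * n₁ + 1) (2 * n₂ + 1))) := by
    rw [Class7.G, Set.pair_comm, rot_class7]
    refine i.dihedral (by decide) (by decide) orderOf_labTr_one ?_
    have := Nat.le_of_dvd (Nat.lcm_pos (by omega) (by omega))
      (Nat.dvd_lcm_left (2 * n₁ + 1) (2 * n₂ + 1))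
    omega
  refine ⟨hf.isAdmissible, hd, class7_eq_class5 n₁ n₂, fun h => ?_, ?_⟩
  · rwa [Nat.lcm_eq_left h] at hd
  · refine hasOrbitLengths_diagonal hi hX ![0, 1] ![0, 1] (by simp [Fin.forall_fin_two]) ?_ ?_ ?_
    · rintro q rfl
      exact fun b => rfl
    · intro b
      exact ⟨1, one_mem _, by fin_cases b <;> rfl⟩
    · intro o
      fin_cases o <;> simp

end class7

/-! ### Classes 12 and 13 -/

section class13

variable (n : ℕ)

/-- The labels of classes 12 and 13. -/
noncomputable def labels13 : Blocks ![n, n] ≃ Fin (4 * n + 2) := blockEquiv (sum_two (by ring))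

theorem flipBoth_class13 : IsInducedBy (labels13 n) (Class13.g₁ n) flipBoth := by
  refine c_mul_perm_isInducedBy ((flips_actsBy _ 0 (offset_zero _) rfl).mul
    (flips_actsBy _ 1 (offset_two_one _ _) rfl)) (by intro b; fin_cases b <;> rfl) (by decide)
    (fun b => .inr (by revert b; decide)) (blockEquiv_mem_iff _ fun b j h1 h2 => ?_)
  rw [show flipBoth.left = ![-1, -1] by decide]
  fin_cases b <;> simp [offset] at h2 ⊢ <;> omega

theorem swapBoth_class13 : IsInducedBy (labels13 n) (Class13.g₄ n) swapBoth :=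
  perm_isInducedBy (blockSwap_actsBy _ (b := 0) (b' := 1) (offset_zero _) (offset_two_one _ _)
    rfl rfl) (by intro b; fin_cases b <;> rfl)

theorem rot_class13 : Class13.g₂ n = labTr (labels13 n) (Pi.single 0 1) :=
  perm_rot _ 0 (offset_zero _) rfl

theorem rot'_class13 : Class13.g₃ n = labTr (labels13 n) (Pi.single 1 1) :=
  perm_rot _ 1 (offset_two_one _ _) rfl

theorem rot_class12 : Class12.g₂ n = labTr (labels13 n) 1 := by
  have h : Class12.g₂ n = Class13.g₂ n * Class13.g₃ n :=
    map_mul (SemidirectProduct.inr : _ →* WB (4 * n + 2)) _ _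
  rw [h, rot_class13, rot'_class13, ← labTr_add]
  congr 1
  decide

theorem inducedSet_class13 : IsInducedSet (labels13 n) {Class13.g₁ n, Class13.g₄ n}
    {flipBoth, swapBoth} :=
  .insert (flipBoth_class13 n) (.singleton (swapBoth_class13 n))

/-- The transposition g₃ of the blocks commutes with the diagonal translation and with g₁, so it is
the central involution of a dihedral group. -/
theorem class12_main (hn : 1 ≤ n) : IsAdmissible (Class12.G n) ∧
    Nonempty (Class12.G n ≃* DihedralGroup (4 * n + 2)) ∧
    HasOrbitLengths (Class12.G n) [4 * n + 2] ∧
    IsSylowTwo (Class12.G n) (Subgroup.closure {Class12.g₁ n, Class12.g₃ n}) ∧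
    Nonempty (Subgroup.closure {Class12.g₁ n, Class12.g₃ n} ≃* Cyc 2 × Cyc 2) := by
  have i1 : IsInducedBy _ (Class12.g₁ n) _ := flipBoth_class13 n
  have i3 : IsInducedBy _ (Class12.g₃ n) _ := swapBoth_class13 n
  have hi := IsInducedSet.insert i1 (.singleton i3)
  have hX : Class12.G n = Subgroup.closure {labTr (labels13 n) 1} ⊔
      Subgroup.closure {Class12.g₁ n, Class12.g₃ n} := by
    rw [← Subgroup.closure_union, Class12.G, rot_class12, Set.insert_comm]
    rfl
  have hf := isFrame_diagonal (by decide) hi isFlipping_flipBoth_swapBoth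
    (by rintro q (rfl | rfl); exacts [⟨-1, by decide⟩, ⟨1, by decide⟩]) hX
  have hk := hi.nonempty_mulEquiv flipBoth_swapBoth_klein
  have h2 := rot_class12 n
  refine ⟨hf.isAdmissible, ?_, ?_, hf.isSylowTwo (isPGroup_of_mulEquiv hk 2 card_klein), hk⟩
  · refine nonempty_mulEquiv_dihedral_two_mul hn ?_ (i1.mul_eq_one i1 (by decide))
      (i3.mul_eq_one i3 (by decide)) (i3.ne_one (by decide)) ?_ (i1.comm i3 (by decide)) ?_
    · rw [h2, orderOf_labTr_one, Nat.lcm_self]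
    · rw [h2]
      exact i1.inverts (by decide) (by decide)
    · rw [h2]
      exact (i3.comm_labTr (by decide)).symm
  · refine hasOrbitLengths_diagonal hi hX ![0, 0] ![0] (by simp) ?_ ?_ ?_
    · rintro q (rfl | rfl) <;> exact fun b => by fin_cases b <;> rfl
    · exact Fin.forall_fin_two.mpr ⟨⟨1, one_mem _, rfl⟩, ⟨_, mem_closure_right _ _, rfl⟩⟩
    · intro o
      fin_cases o
      simp
      ring

theorem class13_generating : IsBlockGenerating (labels13 n)
    {Class13.g₁ n, Class13.g₂ n, Class13.g₃ n, Class13.g₄ n} {Class13.g₁ n, Class13.g₄ n} where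
  tb_mem_closure := Fin.forall_fin_two.mpr
    ⟨.inr (Subgroup.subset_closure (.inr (.inl (rot_class13 n).symm))),
      .inr (Subgroup.subset_closure (.inr (.inr (.inl (rot'_class13 n).symm))))⟩
  subset := by rintro x (rfl | rfl) <;> simp
  mem_cases := by
    rintro x (rfl | rfl | rfl | rfl)
    · exact .inl (.inl rfl)
    · exact .inr ⟨0, .inl (rot_class13 n)⟩
    · exact .inr ⟨1, .inl (rot'_class13 n)⟩
    · exact .inl (.inr rfl)

/-- The plane of translations is decomposed into diagonal and antidiagonal. The swap g₄ fixes (1,1)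
and inverts (1,-1), and g₁g₄ does the opposite, so the two dihedral groups generated by ((1,1),
g₁g₄) and ((1,-1), g₄) commute. -/
theorem class13_dihedral (hn : 1 ≤ n) : Nonempty (Class13.G n ≃*
    DihedralGroup (2 * n + 1) × DihedralGroup (2 * n + 1)) := by
  have i1 := flipBoth_class13 n
  have i4 := swapBoth_class13 n
  have ho : orderOf (labTr (labels13 n) ![1, -1]) = 2 * n + 1 := by
    refine orderOf_labTr fun k => ?_
    rw [Fin.forall_fin_two]
    simp
  have m1 := mem_closure_left (labTr (labels13 n) 1) (Class13.g₁ n * Class13.g₄ n)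
  have m2 := mem_closure_left (labTr (labels13 n) ![1, -1]) (Class13.g₄ n)
  refine nonempty_mulEquiv_prod_of_closure (isCenterless_dihedral n hn)
    ((i1.mul i4).dihedral (w := 1) (by decide) (by decide)
      (by rw [orderOf_labTr_one, Nat.lcm_self]) (by omega))
    (i4.dihedral (w := ![1, -1]) (by decide) (by decide) ho (by omega)) ?_ ?_ ?_ ?_
  · rintro _ (rfl | rfl) _ (rfl | rfl)
    · exact labTr_comm _ _
    · exact (i4.comm_labTr (by decide)).symm
    · exact (i1.mul i4).comm_labTr (by decide)
    · exact (i1.mul i4).comm i4 (by decide)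
  · rintro _ (rfl | rfl)
    · rw [show (1 : Fin 2 → ℤ) = Pi.single 0 1 + Pi.single 1 1 by decide, labTr_add,
        ← rot_class13, ← rot'_class13]
      exact mul_mem (Subgroup.subset_closure (by simp)) (Subgroup.subset_closure (by simp))
    · exact mul_mem (Subgroup.subset_closure (by simp)) (Subgroup.subset_closure (by simp))
  · rintro _ (rfl | rfl)
    · rw [show (![1, -1] : Fin 2 → ℤ) = Pi.single 0 1 + -Pi.single 1 1 by decide, labTr_add,
        labTr_neg, ← rot_class13, ← rot'_class13]
      exact mul_mem (Subgroup.subset_closure (by simp))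
        (inv_mem (Subgroup.subset_closure (by simp)))
    · exact Subgroup.subset_closure (by simp)
  · rintro _ (rfl | rfl | rfl | rfl)
    · have h := mul_mem (Subgroup.mem_sup_left (mem_closure_right (labTr (labels13 n) 1)
        (Class13.g₁ n * Class13.g₄ n))) (Subgroup.mem_sup_right
          (mem_closure_right (labTr (labels13 n) ![1, -1]) (Class13.g₄ n)))
      rwa [mul_assoc, i4.mul_eq_one i4 (by decide), mul_one] at h
    -- The exponent n+1 is the inverse of 2 modulo 2n+1, so it halves (1,1) + (1,-1) = (2,0).
    · have h : Class13.g₂ n =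
          (labTr (labels13 n) 1 * labTr (labels13 n) ![1, -1]) ^ (n + 1 : ℤ) := by
        rw [rot_class13, ← labTr_add, show (1 + ![1, -1] : Fin 2 → ℤ) = ![2, 0] by decide,
          ← labTr_zsmul, labTr_eq_iff, Fin.forall_fin_two]
        exact ⟨⟨-1, by simp; ring⟩, ⟨0, by simp⟩⟩
      rw [h]
      exact zpow_mem (mul_mem (Subgroup.mem_sup_left m1) (Subgroup.mem_sup_right m2)) _
    · have h : Class13.g₃ n =
          (labTr (labels13 n) 1 * (labTr (labels13 n) ![1, -1])⁻¹) ^ (n + 1 : ℤ) := by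
        rw [rot'_class13, ← labTr_neg, ← labTr_add,
          show (1 + -![1, -1] : Fin 2 → ℤ) = ![0, 2] by decide,
          ← labTr_zsmul, labTr_eq_iff, Fin.forall_fin_two]
        exact ⟨⟨0, by simp⟩, ⟨-1, by simp; ring⟩⟩
      rw [h]
      exact zpow_mem (mul_mem (Subgroup.mem_sup_left m1)
        (inv_mem (Subgroup.mem_sup_right m2))) _
    · exact Subgroup.mem_sup_right (mem_closure_right _ _)

theorem class13_main (hn : 1 ≤ n) : IsAdmissible (Class13.G n) ∧
    Nonempty (Class13.G n ≃* DihedralGroup (2 * n + 1) × DihedralGroup (2 * n + 1)) ∧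
    HasOrbitLengths (Class13.G n) [4 * n + 2] ∧
    IsSylowTwo (Class13.G n) (Subgroup.closure {Class13.g₁ n, Class13.g₄ n}) ∧
    Nonempty (Subgroup.closure {Class13.g₁ n, Class13.g₄ n} ≃* Cyc 2 × Cyc 2) := by
  have h := class13_generating n
  have hi := inducedSet_class13 n
  have hf := h.isFrame hi isFlipping_flipBoth_swapBoth (by decide)
  have hk := hi.nonempty_mulEquiv flipBoth_swapBoth_klein
  refine ⟨hf.isAdmissible, class13_dihedral n hn, ?_,
    hf.isSylowTwo (isPGroup_of_mulEquiv hk 2 card_klein), hk⟩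
  refine h.hasOrbitLengths hi ![0, 0] ![0] (by simp) ?_ ?_ ?_
  · rintro q (rfl | rfl) <;> exact fun b => by fin_cases b <;> rfl
  · exact Fin.forall_fin_two.mpr ⟨⟨1, one_mem _, rfl⟩, ⟨_, mem_closure_right _ _, rfl⟩⟩
  · intro o
    fin_cases o
    simp
    ring

end class13

/-! ### Wreath products -/

section wreath

variable {Γ D : Type*} [Group Γ] [Group D] {t : Γ} (ht : t * t = 1) {f : D →* Γ}
  (hc : ∀ x y, f x * (t * f y * t) = t * f y * t * f x)
include ht hc

/-- The homomorphism from the wreath product with a group of order two, given by an involution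
`t` and a homomorphism whose image commutes with its conjugate by `t`. -/
noncomputable def wreathLift : RegularWreathProduct D (Cyc 2) →* Γ where
  toFun w := f (w.left 1) * (t * f (w.left (.ofAdd 1)) * t) *
    zmodPow t (by rw [pow_two, ht]) w.right
  map_one' := by simp [ht]
  map_mul' := by
    have key : ∀ q : Cyc 2, q = 1 ∨ q = .ofAdd 1 := by decide
    have hτ : zmodPow t (by rw [pow_two, ht]) (.ofAdd 1 : Cyc 2) = t := by
      simpa using zmodPow_intCast (m := 2) t (by rw [pow_two, ht]) 1
    have hm : ∀ x y, t * f (x * y) * t = t * f x * t * (t * f y * t) := by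
      intro x y
      simp only [map_mul, mul_assoc]
      rw [← mul_assoc t t, ht, one_mul]
    rintro ⟨a, q⟩ ⟨b, r⟩
    simp only [RegularWreathProduct.mul_left, RegularWreathProduct.mul_right, Pi.mul_apply,
      map_mul (zmodPow t _)]
    rcases key q with rfl | rfl
    · simp only [inv_one, one_mul, map_one, mul_one]
      rw [map_mul, hm, mul_assoc (f (a 1)) (f (b 1)), ← mul_assoc (f (b 1)), hc]
      simp only [mul_assoc]
    · rw [show (Multiplicative.ofAdd 1 : Cyc 2)⁻¹ * 1 = .ofAdd 1 by decide,
        show (Multiplicative.ofAdd 1 : Cyc 2)⁻¹ * .ofAdd 1 = 1 by decide, hτ, map_mul, hm]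
      have h1 : t * (f (b 1) * (t * f (b (.ofAdd 1)) * t)) =
          t * f (b 1) * t * f (b (.ofAdd 1)) * t := by
        simp only [mul_assoc]
      -- Moving t to the right exchanges the two factors of b; the commutation of the image of f
      -- with its conjugate restores the order.
      have h2 := hc (b (.ofAdd 1)) (a (.ofAdd 1) * b 1)
      rw [hm] at h2
      calc _ = f (a 1) * (f (b (.ofAdd 1)) * (t * f (a (.ofAdd 1)) * t * (t * f (b 1) * t))) *
            (t * zmodPow t (by rw [pow_two, ht]) r) := by simp only [mul_assoc]
        _ = f (a 1) * (t * f (a (.ofAdd 1)) * t) *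
            (t * f (b 1) * t * f (b (.ofAdd 1)) * t) * zmodPow t (by rw [pow_two, ht]) r := by
          rw [h2]; simp only [mul_assoc]
        _ = _ := by rw [← h1]; simp only [mul_assoc]

/-- The image of f meets its conjugate by t trivially, since a common element commutes with the
whole image and D has trivial centre. This settles the elements without t. -/
theorem wreathLift_injective (hf : Function.Injective f) (hD : IsCenterless D) [Nontrivial D] :
    Function.Injective (wreathLift ht hc) := by
  have hτ : zmodPow t (by rw [pow_two, ht]) (.ofAdd 1 : Cyc 2) = t := by
    simpa using zmodPow_intCast (m := 2) t (by rw [pow_two, ht]) 1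
  have key : ∀ q : Cyc 2, q = 1 ∨ q = .ofAdd 1 := by decide
  have hz : ∀ x y, f x = t * f y * t → x = 1 := by
    intro x y h
    refine hD x fun z => hf ?_
    rw [map_mul, map_mul, h, hc]
  rw [injective_iff_map_eq_one]
  rintro ⟨a, q⟩ h
  change f (a 1) * (t * f (a (.ofAdd 1)) * t) * zmodPow t _ q = 1 at h
  have hti : t⁻¹ = t := inv_eq_of_mul_eq_one_left ht
  rcases key q with rfl | rfl
  · rw [map_one (zmodPow t _), mul_one] at h
    have h1 : a 1 = 1 := by
      refine hz _ (a (.ofAdd 1))⁻¹ ?_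
      rw [eq_inv_of_mul_eq_one_left h]
      simp [mul_assoc, hti]
    rw [h1, map_one, one_mul] at h
    have h2 : a (.ofAdd 1) = 1 := by
      apply hf
      rw [map_one f, ← conj_eq_one_iff (a := t), hti, h]
    have h3 : a = 1 := by
      funext x
      rcases key x with rfl | rfl
      · exact h1
      · exact h2
    rw [h3]
    rfl
  -- Here t itself would be a product of an element of the image of f and one of the conjugate.
  -- Conjugation by t would then agree on the image with conjugation by f (a 1), so a conjugate of
  -- any x ≠ 1 would lie in the trivial intersection.
  · exfalso
    rw [hτ] at h
    obtain ⟨x, hx⟩ := exists_ne (1 : D)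
    have h1 : t = f (a 1) * (t * f (a (.ofAdd 1)) * t) := by
      rw [eq_inv_of_mul_eq_one_left h, hti]
    have h2 : a 1 * x * (a 1)⁻¹ = 1 := by
      refine hz _ x ?_
      have h3 : t * f x * t⁻¹ = f (a 1) * f x * (f (a 1))⁻¹ := by
        calc t * f x * t⁻¹ = f (a 1) * (t * f (a (.ofAdd 1)) * t) * f x *
              (f (a 1) * (t * f (a (.ofAdd 1)) * t))⁻¹ := by rw [← h1]
          _ = f (a 1) * (t * f (a (.ofAdd 1)) * t * f x) *
              ((t * f (a (.ofAdd 1)) * t)⁻¹ * (f (a 1))⁻¹) := by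
            rw [mul_inv_rev]; simp only [mul_assoc]
          _ = _ := by rw [← hc]; group
      rw [hti] at h3
      rw [h3]
      simp
    exact hx (conj_eq_one_iff.mp h2)

end wreath

theorem nonempty_mulEquiv_wreath {Γ D : Type*} [Group Γ] [Group D] {t : Γ} {X Y : Set Γ}
    [Nontrivial D] (hD : IsCenterless D) (eD : Nonempty (Subgroup.closure Y ≃* D))
    (ht : t * t = 1) (hc : ∀ x ∈ Y, ∀ y ∈ Y, x * (t * y * t) = t * y * t * x)
    (hY : Y ⊆ Subgroup.closure X) (htX : t ∈ Subgroup.closure X)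
    (hX : ∀ x ∈ X, x ∈ Y ∨ x = t ∨ ∃ y ∈ Y, x = t * y * t) :
    Nonempty (Subgroup.closure X ≃* RegularWreathProduct D (Cyc 2)) := by
  obtain ⟨eD⟩ := eD
  have hti : t⁻¹ = t := inv_eq_of_mul_eq_one_left ht
  let f : D →* Γ := (Subgroup.closure Y).subtype.comp eD.symm.toMonoidHom
  have hf : Function.Injective f := (Subgroup.subtype_injective _).comp eD.symm.injective
  have hfY : ∀ x, f x ∈ Subgroup.closure Y := fun x => (eD.symm x).2
  have hYf : ∀ y ∈ Subgroup.closure Y, ∃ x, f x = y := fun y hy =>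
    ⟨eD ⟨y, hy⟩, congrArg Subtype.val (eD.symm_apply_apply _)⟩
  have hc' : ∀ x y, f x * (t * f y * t) = t * f y * t * f x := by
    intro x y
    refine commute_closure (X := Y) (Y := (fun y => t * y * t) '' Y) ?_ _ (hfY x) _ ?_
    · rintro x hx _ ⟨y, hy, rfl⟩
      exact hc x hx y hy
    · have h1 : (fun y => t * y * t) '' Y = (MulAut.conj t).toMonoidHom '' Y := by
        exact Set.image_congr fun y _ => by simp [hti]
      rw [h1, ← MonoidHom.map_closure]
      exact ⟨_, hfY y, by simp [hti]⟩
  have hτ : zmodPow t (by rw [pow_two, ht]) (.ofAdd 1 : Cyc 2) = t := by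
    simpa using zmodPow_intCast (m := 2) t (by rw [pow_two, ht]) 1
  have key : ∀ q : Cyc 2, q = 1 ∨ q = .ofAdd 1 := by decide
  have hr : (wreathLift ht hc').range = Subgroup.closure X := by
    have hYX : Subgroup.closure Y ≤ Subgroup.closure X := (Subgroup.closure_le _).mpr hY
    apply le_antisymm
    · rintro _ ⟨w, rfl⟩
      refine mul_mem (mul_mem (hYX (hfY _)) (mul_mem (mul_mem htX (hYX (hfY _))) htX)) ?_
      rcases key w.right with h | h <;> rw [h]
      · rw [map_one]
        exact one_mem _
      · rw [hτ]
        exact htX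
    · rw [Subgroup.closure_le]
      intro x hx
      rcases hX x hx with hx | rfl | ⟨y, hy, rfl⟩
      · obtain ⟨d, rfl⟩ := hYf x (Subgroup.subset_closure hx)
        refine ⟨⟨Pi.mulSingle 1 d, 1⟩, ?_⟩
        change f _ * (t * f _ * t) * zmodPow t _ 1 = _
        dsimp only
        rw [Pi.mulSingle_eq_same, Pi.mulSingle_eq_of_ne (by decide), map_one, map_one, mul_one,
          mul_one, ht, mul_one]
      · refine ⟨⟨1, .ofAdd 1⟩, ?_⟩
        change f 1 * (x * f 1 * x) * zmodPow x _ (.ofAdd 1) = _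
        rw [hτ, map_one, mul_one, ht, one_mul, one_mul]
      · obtain ⟨d, rfl⟩ := hYf y (Subgroup.subset_closure hy)
        refine ⟨⟨Pi.mulSingle (.ofAdd 1) d, 1⟩, ?_⟩
        change f _ * (t * f _ * t) * zmodPow t _ 1 = _
        dsimp only
        rw [Pi.mulSingle_eq_same, Pi.mulSingle_eq_of_ne (by decide), map_one, map_one, mul_one,
          one_mul]
  rw [← hr]
  exact ⟨(MonoidHom.ofInjective (wreathLift_injective ht hc' hf hD)).symm⟩

/-! ### The symmetric group on four letters -/

/-- Signed permutations act on vectors of signs. -/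
def signAction : WX (Fin 3) →* Equiv.Perm (Fin 3 → ℤˣ) where
  toFun q := (mulAutArrow q.right).toEquiv.trans (Equiv.mulLeft q.left)
  map_one' := by
    ext v
    simp
  map_mul' q r := by
    refine Equiv.ext fun v => ?_
    change (q * r).left * mulAutArrow (q * r).right v =
      q.left * mulAutArrow q.right (r.left * mulAutArrow r.right v)
    rw [SemidirectProduct.mul_left, SemidirectProduct.mul_right, map_mul, map_mul, mul_assoc]
    rfl

theorem signAction_apply (q : WX (Fin 3)) (v : Fin 3 → ℤˣ) (i : Fin 3) :
    signAction q v i = q.left i * v (q.right⁻¹ i) := rfl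

theorem prod_signAction (q : WX (Fin 3)) (v : Fin 3 → ℤˣ) :
    ∏ i, signAction q v i = (∏ i, q.left i) * ∏ i, v i := by
  simp only [signAction_apply, Finset.prod_mul_distrib]
  rw [Equiv.prod_comp (q.right⁻¹ : Equiv.Perm (Fin 3)) v]

/-- The vectors of three signs with product `1`. -/
abbrev EvenSigns : Type := {v : Fin 3 → ℤˣ // ∏ i, v i = 1}

/-- Even signed permutations act on the four even vectors of signs. -/
def evenAction : (WX.sign : WX (Fin 3) →* ℤˣ).ker →* Equiv.Perm EvenSigns where
  toFun q := (signAction q.1).subtypePerm fun v => by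
    have h : ∏ i, q.1.left i = 1 := q.2
    rw [prod_signAction, h, one_mul]
  map_one' := by
    ext v
    simp
  map_mul' q r := by
    exact Equiv.ext fun v => Subtype.ext
      (congrArg (fun f : Equiv.Perm _ => f v.1) (map_mul signAction q.1 r.1))

theorem evenAction_injective : Function.Injective evenAction := by
  rw [injective_iff_map_eq_one]
  rintro ⟨q, hq⟩ h
  have h1 : ∀ v : EvenSigns, ∀ i, q.left i * v.1 (q.right⁻¹ i) = v.1 i := fun v i =>
    congrFun (congrArg Subtype.val (Equiv.congr_fun h v)) i
  have h2 : q.left = 1 := funext fun i => by simpa using h1 ⟨1, by simp⟩ i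
  have h3 : ∀ π : Equiv.Perm (Fin 3), (∀ v : EvenSigns, ∀ i, v.1 (π⁻¹ i) = v.1 i) → π = 1 := by
    decide
  refine Subtype.ext (SemidirectProduct.ext h2 (h3 _ fun v i => ?_))
  have := h1 v i
  rwa [h2, Pi.one_apply, one_mul] at this

/-- The action on the four even sign vectors embeds the group into 𝔖₄, so its order divides 24. It
contains a dihedral group of order 8 and an element of order 3, so the embedding is onto. -/
theorem card_closure_signed :
    Nat.card (Subgroup.closure {flip01, flip12, swap01, cycle012}) = 24 ∧
    Nonempty (Subgroup.closure {flip01, flip12, swap01, cycle012} ≃* Equiv.Perm (Fin 4)) := by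
  let H := Subgroup.closure {flip01, flip12, swap01, cycle012}
  have hH : H ≤ (WX.sign : WX (Fin 3) →* ℤˣ).ker := by
    rw [Subgroup.closure_le]
    exact isFlipping_flip01_flip12_swap01_cycle012.prod_eq
  let f : H →* Equiv.Perm EvenSigns := evenAction.comp (Subgroup.inclusion hH)
  have hf : Function.Injective f := evenAction_injective.comp (Subgroup.inclusion_injective hH)
  have hV : Fintype.card EvenSigns = 4 := by decide
  have hP : Nat.card (Equiv.Perm EvenSigns) = 24 := by
    rw [Nat.card_perm, Nat.card_eq_fintype_card, hV]
    rfl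
  have h1 : Nat.card H ∣ 24 := hP ▸ Subgroup.card_dvd_of_injective f hf
  have h2 : 8 ∣ Nat.card H := by
    obtain ⟨e⟩ := flip01_flip12_swap01_dihedral
    have h : Nat.card (Subgroup.closure {flip01, flip12, swap01}) = 8 := by
      rw [Nat.card_congr e.toEquiv, card_dihedral_four]
      rfl
    rw [← h]
    refine Subgroup.card_dvd_of_le (Subgroup.closure_mono ?_)
    rintro x (rfl | rfl | rfl) <;> simp
  have h3 : 3 ∣ Nat.card H := by
    have h : orderOf cycle012 = 3 := orderOf_eq_prime (by decide) (by decide)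
    have h' := orderOf_dvd_natCard (⟨cycle012, Subgroup.subset_closure (by simp)⟩ : H)
    rwa [Subgroup.orderOf_mk, h] at h'
  have h4 : Nat.card H = 24 := Nat.dvd_antisymm h1
    (Nat.Coprime.mul_dvd_of_dvd_of_dvd (by norm_num) h2 h3)
  refine ⟨h4, ?_⟩
  have h5 : Function.Bijective f := by
    rw [Nat.bijective_iff_injective_and_card]
    exact ⟨hf, h4.trans hP.symm⟩
  exact ⟨(MulEquiv.ofBijective f h5).trans
    (Fintype.equivFinOfCardEq hV).permCongrHom⟩

/-! ### Classes 15 and 18 -/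

section class18

variable (n : ℕ)

/-- The labels of classes 15 and 18. -/
noncomputable def labels18 : Blocks ![n, n, 0] ≃ Fin (4 * n + 3) := blockEquiv (sum_three (by ring))

theorem flip02_swap01_class15 :
    IsInducedBy (labels18 n) (Class15.g₁ n) (flip02 * swap01) := by
  refine c_mul_perm_isInducedBy (fourCycles_actsBy _ (b := 0) (b' := 1) (offset_zero _)
    (offset_three_one _ _ _) rfl rfl) (by intro b; fin_cases b <;> rfl) (by decide)
    (Fin.forall_fin_succ.mpr ⟨.inr (by decide), Fin.forall_fin_two.mpr
      ⟨.inr (by decide), .inl rfl⟩⟩) (blockEquiv_mem_iff _ fun b j h1 h2 => ?_)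
  rw [show (flip02 * swap01).left = ![-1, 1, -1] by decide]
  fin_cases b <;> simp [offset, Fin.sum_univ_three] at h2 ⊢ <;> omega

theorem flip02_class18 : IsInducedBy (labels18 n) (Class18.g₁ n) flip02 := by
  refine c_mul_perm_isInducedBy (flips_actsBy _ 0 (offset_zero _) rfl)
    (by intro b; fin_cases b <;> rfl) (by decide)
    (Fin.forall_fin_succ.mpr ⟨.inr (by decide), Fin.forall_fin_two.mpr
      ⟨.inr (by decide), .inl rfl⟩⟩) (blockEquiv_mem_iff _ fun b j h1 h2 => ?_)
  rw [show flip02.left = ![-1, 1, -1] by decide]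
  fin_cases b <;> simp [offset, Fin.sum_univ_three] at h2 ⊢ <;> omega

theorem flip12_class18 : IsInducedBy (labels18 n) (Class18.g₂ n) flip12 := by
  refine c_mul_perm_isInducedBy (flips_actsBy _ 1 (offset_three_one _ _ _) rfl)
    (by intro b; fin_cases b <;> rfl) (by decide)
    (Fin.forall_fin_succ.mpr ⟨.inr (by decide), Fin.forall_fin_two.mpr
      ⟨.inr (by decide), .inl rfl⟩⟩) (blockEquiv_mem_iff _ fun b j h1 h2 => ?_)
  rw [show flip12.left = ![1, -1, -1] by decide]
  fin_cases b <;> simp [offset, Fin.sum_univ_three] at h2 ⊢ <;> omega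

theorem swap01_class18 : IsInducedBy (labels18 n) (Class18.g₃ n) swap01 :=
  perm_isInducedBy (blockSwap_actsBy _ (b := 0) (b' := 1) (offset_zero _)
    (offset_three_one _ _ _) rfl rfl) (by intro b; fin_cases b <;> rfl)

theorem rot_class18 : Class18.g₄ n = labTr (labels18 n) (Pi.single 0 1) :=
  perm_rot _ 0 (offset_zero _) rfl

theorem rot'_class18 : Class18.g₅ n = labTr (labels18 n) (Pi.single 1 1) :=
  perm_rot _ 1 (offset_three_one _ _ _) rfl

theorem class15_generating : IsBlockGenerating (labels18 n)
    {Class15.g₁ n, Class15.g₂ n, Class15.g₃ n} {Class15.g₁ n} where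
  tb_mem_closure := Fin.forall_fin_succ.mpr
    ⟨.inr (Subgroup.subset_closure (.inr (.inl (rot_class18 n).symm))), Fin.forall_fin_two.mpr
      ⟨.inr (Subgroup.subset_closure (.inr (.inr (rot'_class18 n).symm))), .inl rfl⟩⟩
  subset := by rintro x rfl; simp
  mem_cases := by
    rintro x (rfl | rfl | rfl)
    · exact .inl rfl
    · exact .inr ⟨0, .inl (rot_class18 n)⟩
    · exact .inr ⟨1, .inl (rot'_class18 n)⟩

theorem class18_generating : IsBlockGenerating (labels18 n)
    {Class18.g₁ n, Class18.g₂ n, Class18.g₃ n, Class18.g₄ n, Class18.g₅ n}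
    {Class18.g₁ n, Class18.g₂ n, Class18.g₃ n} where
  tb_mem_closure := Fin.forall_fin_succ.mpr
    ⟨.inr (Subgroup.subset_closure (.inr (.inr (.inr (.inl (rot_class18 n).symm))))),
      Fin.forall_fin_two.mpr
      ⟨.inr (Subgroup.subset_closure (.inr (.inr (.inr (.inr (rot'_class18 n).symm))))), .inl rfl⟩⟩
  subset := by rintro x (rfl | rfl | rfl) <;> simp
  mem_cases := by
    rintro x (rfl | rfl | rfl | rfl | rfl)
    · exact .inl (.inl rfl)
    · exact .inl (.inr (.inl rfl))
    · exact .inl (.inr (.inr rfl))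
    · exact .inr ⟨0, .inl (rot_class18 n)⟩
    · exact .inr ⟨1, .inl (rot'_class18 n)⟩

theorem class15_main : IsAdmissible (Class15.G n) ∧
    IsSemidirect (Cyc (2 * n + 1) × Cyc (2 * n + 1)) (Cyc 4) (Class15.G n) ∧
    HasOrbitLengths (Class15.G n) [4 * n + 2, 1] ∧
    IsSylowTwo (Class15.G n) (Subgroup.closure {Class15.g₁ n}) ∧
    Nonempty (Subgroup.closure {Class15.g₁ n} ≃* Cyc 4) := by
  have h := class15_generating n
  have hi := IsInducedSet.singleton (flip02_swap01_class15 n)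
  have hf := h.isFrame hi isFlipping_flip02_swap01 le_rfl
  have hk := hi.nonempty_mulEquiv flip02_swap01_cyc
  refine ⟨hf.isAdmissible, h.isSemidirect hi (translations_two_blocks (b := 0) (b' := 1)
    (by decide) ?_) flip02_swap01_cyc, ?_,
    hf.isSylowTwo (isPGroup_of_mulEquiv hk 2 (card_cyc 4)), hk⟩
  · exact Fin.forall_fin_succ.mpr ⟨by simp, Fin.forall_fin_two.mpr ⟨by simp, fun _ _ => rfl⟩⟩
  refine h.hasOrbitLengths hi ![0, 0, 1] ![0, 2] (by simp [Fin.forall_fin_two]) ?_ ?_ ?_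
  · rintro q rfl
    exact fun b => by fin_cases b <;> rfl
  · exact Fin.forall_fin_succ.mpr ⟨⟨1, one_mem _, rfl⟩, Fin.forall_fin_two.mpr
      ⟨⟨_, Subgroup.subset_closure rfl, rfl⟩, ⟨1, one_mem _, rfl⟩⟩⟩
  · intro o
    fin_cases o <;> simp [Fin.sum_univ_three]
    ring

/-- The swap g₃ conjugates the dihedral group of the first block, generated by g₁ and g₄, to that of
the second, generated by g₂ and g₅, and the two commute. -/
theorem class18_wreath (hn : 1 ≤ n) : Nonempty (Class18.G n ≃*
    RegularWreathProduct (DihedralGroup (2 * n + 1)) (Cyc 2)) := by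
  have i1 := flip02_class18 n
  have i2 := flip12_class18 n
  have i3 := swap01_class18 n
  have h3 : Class18.g₃ n * Class18.g₃ n = 1 := i3.mul_eq_one i3 (by decide)
  have h31 : Class18.g₃ n * Class18.g₁ n * Class18.g₃ n = Class18.g₂ n :=
    IsInducedBy.eq ((i3.mul i1).mul i3)
      (by rwa [show swap01 * flip02 * swap01 = flip12 by decide])
  have h34 : Class18.g₃ n * labTr (labels18 n) (Pi.single 0 1) * Class18.g₃ n =
      labTr (labels18 n) (Pi.single 1 1) := by
    have h := i3.conj_labTr (Pi.single 0 1)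
    rw [inv_eq_of_mul_eq_one_left h3] at h
    rw [h]
    congr 1
    decide
  refine nonempty_mulEquiv_wreath (isCenterless_dihedral n hn)
    (i1.dihedral (w := Pi.single 0 1) (by decide) (by decide)
        (orderOf_labTr_single 0 rfl) (by simp; omega)) h3 ?_ ?_
        (Subgroup.subset_closure (.inr (.inr (.inl rfl)))) ?_
  · rintro _ (rfl | rfl) _ (rfl | rfl)
    · rw [h34]
      exact labTr_comm _ _
    · rw [h31]
      exact (i2.comm_labTr (by decide)).symm
    · rw [h34]
      exact i1.comm_labTr (by decide)
    · rw [h31]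
      exact i1.comm i2 (by decide)
  · rintro _ (rfl | rfl)
    · exact Subgroup.subset_closure (.inr (.inr (.inr (.inl (rot_class18 n).symm))))
    · exact Subgroup.subset_closure (.inl rfl)
  · rintro _ (rfl | rfl | rfl | rfl | rfl)
    · exact .inl (.inr rfl)
    · exact .inr (.inr ⟨_, .inr rfl, h31.symm⟩)
    · exact .inr (.inl rfl)
    · exact .inl (.inl (rot_class18 n))
    · exact .inr (.inr ⟨_, .inl rfl, (rot'_class18 n).trans h34.symm⟩)

theorem class18_main (hn : 1 ≤ n) : IsAdmissible (Class18.G n) ∧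
    Nonempty (Class18.G n ≃* RegularWreathProduct (DihedralGroup (2 * n + 1)) (Cyc 2)) ∧
    HasOrbitLengths (Class18.G n) [4 * n + 2, 1] ∧
    IsSylowTwo (Class18.G n) (Subgroup.closure {Class18.g₁ n, Class18.g₂ n, Class18.g₃ n}) ∧
    Nonempty (Subgroup.closure {Class18.g₁ n, Class18.g₂ n, Class18.g₃ n} ≃*
      DihedralGroup 4) ∧
    H1Vanishes ((Subgroup.closure {Class18.g₁ n, Class18.g₂ n, Class18.g₃ n}).subgroupOf
      (WD _)) := by
  have h := class18_generating n
  have hi := IsInducedSet.insert (flip02_class18 n) (.insert (flip12_class18 n)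
    (.singleton (swap01_class18 n)))
  have hf := h.isFrame hi isFlipping_flip02_flip12_swap01 le_rfl
  have hk := hi.nonempty_mulEquiv flip02_flip12_swap01_dihedral
  refine ⟨hf.isAdmissible, class18_wreath n hn, ?_,
    hf.isSylowTwo (isPGroup_of_mulEquiv hk 3 card_dihedral_four), hk,
    hf.isAdmissible.h1Vanishes hf.right_le⟩
  refine h.hasOrbitLengths hi ![0, 0, 1] ![0, 2] (by simp [Fin.forall_fin_two]) ?_ ?_ ?_
  · rintro q (rfl | rfl | rfl) <;> exact fun b => by fin_cases b <;> rfl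
  · exact Fin.forall_fin_succ.mpr ⟨⟨1, one_mem _, rfl⟩, Fin.forall_fin_two.mpr
      ⟨⟨swap01, Subgroup.subset_closure (by simp), rfl⟩, ⟨1, one_mem _, rfl⟩⟩⟩
  · intro o
    fin_cases o <;> simp [Fin.sum_univ_three]
    ring

end class18

/-! ### Class 20 -/

section class20

variable (n₁ n₂ n₃ : ℕ)

/-- The labels of class 20. -/
noncomputable def labels20 : Blocks ![n₁, n₂, n₃] ≃ Fin (2 * n₁ + 2 * n₂ + 2 * n₃ + 3) :=
  blockEquiv (sum_three (by ring))

theorem flip01_class20 : IsInducedBy (labels20 n₁ n₂ n₃) (Class20.g₁ n₁ n₂ n₃) flip01 := by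
  refine c_mul_perm_isInducedBy ((flips_actsBy _ 0 (offset_zero _) rfl).mul
    (flips_actsBy _ 1 (offset_three_one _ _ _) rfl)) (by intro b; fin_cases b <;> rfl) (by decide)
    (fun b => .inr (by revert b; decide)) (blockEquiv_mem_iff _ fun b j h1 h2 => ?_)
  rw [show flip01.left = ![-1, -1, 1] by decide]
  fin_cases b <;> simp [offset, Fin.sum_univ_three] at h2 ⊢ <;> omega

theorem flip12_class20 : IsInducedBy (labels20 n₁ n₂ n₃) (Class20.g₂ n₁ n₂ n₃) flip12 := by
  refine c_mul_perm_isInducedBy ((flips_actsBy _ 1 (offset_three_one _ _ _) rfl).mul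
    (flips_actsBy _ 2 (offset_three_two _ _ _) rfl)) (by intro b; fin_cases b <;> rfl) (by decide)
    (fun b => .inr (by revert b; decide)) (blockEquiv_mem_iff _ fun b j h1 h2 => ?_)
  rw [show flip12.left = ![1, -1, -1] by decide]
  fin_cases b <;> simp [offset, Fin.sum_univ_three] at h2 ⊢ <;> omega

theorem class20_generating : IsBlockGenerating (labels20 n₁ n₂ n₃)
    {Class20.g₁ n₁ n₂ n₃, Class20.g₂ n₁ n₂ n₃, Class20.g₃ n₁ n₂ n₃, Class20.g₄ n₁ n₂ n₃,
      Class20.g₅ n₁ n₂ n₃} {Class20.g₁ n₁ n₂ n₃, Class20.g₂ n₁ n₂ n₃} := by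
  have r0 : Class20.g₃ n₁ n₂ n₃ = labTr (labels20 n₁ n₂ n₃) (Pi.single 0 1) :=
    perm_rot _ 0 (offset_zero _) rfl
  have r1 : Class20.g₄ n₁ n₂ n₃ = labTr (labels20 n₁ n₂ n₃) (Pi.single 1 1) :=
    perm_rot _ 1 (offset_three_one _ _ _) rfl
  have r2 : Class20.g₅ n₁ n₂ n₃ = labTr (labels20 n₁ n₂ n₃) (Pi.single 2 1) :=
    perm_rot _ 2 (offset_three_two _ _ _) rfl
  refine ⟨Fin.forall_fin_succ.mpr ⟨.inr (Set.mem_of_eq_of_mem r0.symm ?_), Fin.forall_fin_two.mpr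
    ⟨.inr (Set.mem_of_eq_of_mem r1.symm ?_), .inr (Set.mem_of_eq_of_mem r2.symm ?_)⟩⟩, ?_, ?_⟩
  · exact Subgroup.subset_closure (by simp)
  · exact Subgroup.subset_closure (by simp)
  · exact Subgroup.subset_closure (by simp)
  · rintro x (rfl | rfl) <;> simp
  · rintro x (rfl | rfl | rfl | rfl | rfl)
    · exact .inl (.inl rfl)
    · exact .inl (.inr rfl)
    · exact .inr ⟨0, .inl r0⟩
    · exact .inr ⟨1, .inl r1⟩
    · exact .inr ⟨2, .inl r2⟩

theorem class20_main : IsAdmissible (Class20.G n₁ n₂ n₃) ∧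
    IsSemidirect (Cyc (2 * n₁ + 1) × Cyc (2 * n₂ + 1) × Cyc (2 * n₃ + 1)) (Cyc 2 × Cyc 2)
      (Class20.G n₁ n₂ n₃) ∧
    HasOrbitLengths (Class20.G n₁ n₂ n₃) [2 * n₁ + 1, 2 * n₂ + 1, 2 * n₃ + 1] ∧
    IsSylowTwo (Class20.G n₁ n₂ n₃)
      (Subgroup.closure {Class20.g₁ n₁ n₂ n₃, Class20.g₂ n₁ n₂ n₃}) ∧
    Nonempty (Subgroup.closure {Class20.g₁ n₁ n₂ n₃, Class20.g₂ n₁ n₂ n₃} ≃*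
      Cyc 2 × Cyc 2) := by
  have h := class20_generating n₁ n₂ n₃
  have hi := IsInducedSet.insert (flip01_class20 n₁ n₂ n₃) (.singleton (flip12_class20 n₁ n₂ n₃))
  have hf := h.isFrame hi isFlipping_flip01_flip12 le_rfl
  have hk := hi.nonempty_mulEquiv flip01_flip12_klein
  refine ⟨hf.isAdmissible, h.isSemidirect hi (translations_three_blocks _) flip01_flip12_klein, ?_,
    hf.isSylowTwo (isPGroup_of_mulEquiv hk 2 card_klein), hk⟩
  refine h.hasOrbitLengths_of_right_eq hi rfl ?_ fun b => by fin_cases b <;> rfl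
  rintro q (rfl | rfl) <;> exact fun b => rfl

end class20

/-! ### Class 22 -/

section class22

variable (n₁ n₂ : ℕ)

/-- The labels of classes 21 and 22. -/
noncomputable def labels22 : Blocks ![n₁, n₁, n₂] ≃ Fin (4 * n₁ + 2 * n₂ + 3) :=
  blockEquiv (sum_three (by ring))

theorem offset_labels22 : offset ![n₁, n₁, n₂] 2 = 4 * n₁ + 2 := by
  rw [offset_three_two]
  ring

theorem flip01_class22 : IsInducedBy (labels22 n₁ n₂) (Class22.g₁ n₁ n₂) flip01 := by
  refine c_mul_perm_isInducedBy ((flips_actsBy _ 0 (offset_zero _) rfl).mul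
    (flips_actsBy _ 1 (offset_three_one _ _ _) rfl)) (by intro b; fin_cases b <;> rfl) (by decide)
    (fun b => .inr (by revert b; decide)) (blockEquiv_mem_iff _ fun b j h1 h2 => ?_)
  rw [show flip01.left = ![-1, -1, 1] by decide]
  fin_cases b <;> simp [offset, Fin.sum_univ_three] at h2 ⊢ <;> omega

theorem flip12_class22 : IsInducedBy (labels22 n₁ n₂) (Class22.g₂ n₁ n₂) flip12 := by
  refine c_mul_perm_isInducedBy ((flips_actsBy _ 1 (offset_three_one _ _ _) rfl).mul
    (flips_actsBy _ 2 (offset_labels22 _ _) rfl)) (by intro b; fin_cases b <;> rfl) (by decide)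
    (fun b => .inr (by revert b; decide)) (blockEquiv_mem_iff _ fun b j h1 h2 => ?_)
  rw [show flip12.left = ![1, -1, -1] by decide]
  fin_cases b <;> simp [offset, Fin.sum_univ_three] at h2 ⊢ <;> omega

theorem swap01_class22 : IsInducedBy (labels22 n₁ n₂) (Class22.g₃ n₁ n₂) swap01 :=
  perm_isInducedBy (blockSwap_actsBy _ (b := 0) (b' := 1) (offset_zero _)
    (offset_three_one _ _ _) rfl rfl) (by intro b; fin_cases b <;> rfl)

theorem rot0_class22 : Class22.g₄ n₁ n₂ = labTr (labels22 n₁ n₂) (Pi.single 0 1) :=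
  perm_rot _ 0 (offset_zero _) rfl

theorem rot1_class22 : Class22.g₅ n₁ n₂ = labTr (labels22 n₁ n₂) (Pi.single 1 1) :=
  perm_rot _ 1 (offset_three_one _ _ _) rfl

theorem rot2_class22 : Class22.g₆ n₁ n₂ = labTr (labels22 n₁ n₂) (Pi.single 2 1) :=
  perm_rot _ 2 (offset_labels22 _ _) rfl

theorem class22_generating : IsBlockGenerating (labels22 n₁ n₂)
    {Class22.g₁ n₁ n₂, Class22.g₂ n₁ n₂, Class22.g₃ n₁ n₂, Class22.g₄ n₁ n₂, Class22.g₅ n₁ n₂,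
      Class22.g₆ n₁ n₂} {Class22.g₁ n₁ n₂, Class22.g₂ n₁ n₂, Class22.g₃ n₁ n₂} := by
  refine ⟨Fin.forall_fin_succ.mpr ⟨.inr (Set.mem_of_eq_of_mem (rot0_class22 n₁ n₂).symm ?_),
    Fin.forall_fin_two.mpr ⟨.inr (Set.mem_of_eq_of_mem (rot1_class22 n₁ n₂).symm ?_),
      .inr (Set.mem_of_eq_of_mem (rot2_class22 n₁ n₂).symm ?_)⟩⟩, ?_, ?_⟩
  · exact Subgroup.subset_closure (by simp)
  · exact Subgroup.subset_closure (by simp)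
  · exact Subgroup.subset_closure (by simp)
  · rintro x (rfl | rfl | rfl) <;> simp
  · rintro x (rfl | rfl | rfl | rfl | rfl | rfl)
    · exact .inl (.inl rfl)
    · exact .inl (.inr (.inl rfl))
    · exact .inl (.inr (.inr rfl))
    · exact .inr ⟨0, .inl (rot0_class22 n₁ n₂)⟩
    · exact .inr ⟨1, .inl (rot1_class22 n₁ n₂)⟩
    · exact .inr ⟨2, .inl (rot2_class22 n₁ n₂)⟩

theorem class22_main : IsAdmissible (Class22.G n₁ n₂) ∧
    IsSemidirect ((Cyc (2 * n₁ + 1) × Cyc (2 * n₁ + 1)) × Cyc (2 * n₂ + 1))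
      (DihedralGroup 4) (Class22.G n₁ n₂) ∧
    HasOrbitLengths (Class22.G n₁ n₂) [4 * n₁ + 2, 2 * n₂ + 1] ∧
    IsSylowTwo (Class22.G n₁ n₂)
      (Subgroup.closure {Class22.g₁ n₁ n₂, Class22.g₂ n₁ n₂, Class22.g₃ n₁ n₂}) ∧
    Nonempty (Subgroup.closure {Class22.g₁ n₁ n₂, Class22.g₂ n₁ n₂, Class22.g₃ n₁ n₂} ≃*
      DihedralGroup 4) ∧
    H1Vanishes ((Subgroup.closure
      {Class22.g₁ n₁ n₂, Class22.g₂ n₁ n₂, Class22.g₃ n₁ n₂}).subgroupOf (WD _)) := by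
  have h := class22_generating n₁ n₂
  have hi := IsInducedSet.insert (flip01_class22 n₁ n₂) (.insert (flip12_class22 n₁ n₂)
    (.singleton (swap01_class22 n₁ n₂)))
  have hf := h.isFrame hi isFlipping_flip01_flip12_swap01 le_rfl
  have hk := hi.nonempty_mulEquiv flip01_flip12_swap01_dihedral
  obtain ⟨eT⟩ := translations_three_blocks ![n₁, n₁, n₂]
  -- Only the bracketing of the three cyclic factors differs from that in
  -- `translations_three_blocks`.
  refine ⟨hf.isAdmissible, h.isSemidirect hi ⟨eT.trans MulEquiv.prodAssoc.symm⟩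
    flip01_flip12_swap01_dihedral, ?_,
    hf.isSylowTwo (isPGroup_of_mulEquiv hk 3 card_dihedral_four), hk,
    hf.isAdmissible.h1Vanishes hf.right_le⟩
  refine h.hasOrbitLengths hi ![0, 0, 1] ![0, 2] (by simp [Fin.forall_fin_two]) ?_ ?_ ?_
  · rintro q (rfl | rfl | rfl) <;> exact fun b => by fin_cases b <;> rfl
  · exact Fin.forall_fin_succ.mpr ⟨⟨1, one_mem _, rfl⟩, Fin.forall_fin_two.mpr
      ⟨⟨swap01, Subgroup.subset_closure (by simp), rfl⟩, ⟨1, one_mem _, rfl⟩⟩⟩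
  · intro o
    fin_cases o <;> simp [Fin.sum_univ_three]
    ring

end class22

/-! ### Changing the sign of the coordinates of blocks -/

section twist

variable {m N : ℕ} {ν : Fin m → ℕ}

theorem sp_one_mem_lengthStab (r : Fin m → ℤˣ) : sp r 1 ∈ lengthStab ν := fun _ => rfl

/-- The labels after multiplication of the coordinates of the blocks by signs. -/
noncomputable def twist (e : Blocks ν ≃ Fin N) (r : Fin m → ℤˣ) : Blocks ν ≃ Fin N :=
  Equiv.trans (lin ⟨sp r 1, sp_one_mem_lengthStab r⟩).right e

theorem twist_bp (e : Blocks ν ≃ Fin N) (r : Fin m → ℤˣ) (b : Fin m) (k : ℤ) :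
    twist e r (bp b k) = e (bp b (r b * k)) :=
  congrArg e (lin_right _ b k)

theorem ActsBy.twist {e : Blocks ν ≃ Fin N} {τ : Equiv.Perm (Fin N)} {π : Equiv.Perm (Fin m)}
    {μ : Fin m → ℤˣ} (h : ActsBy e τ π μ) (r : Fin m → ℤˣ) :
    ActsBy (twist e r) τ π fun b => r (π b) * μ b * r b := by
  intro b k
  rw [twist_bp, twist_bp, h]
  congr 2
  push_cast
  rw [← mul_assoc, ← mul_assoc, ← mul_assoc, ← mul_assoc, ← Units.val_mul (r (π b)),
    Int.units_mul_self, Units.val_one, one_mul]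

theorem labTr_twist (e : Blocks ν ≃ Fin N) (r : Fin m → ℤˣ) (w : Fin m → ℤ) :
    labTr (twist e r) w = labTr e fun b => r b * w b := by
  refine WX.ext' (fun i => ?_) fun i => rfl
  obtain ⟨p, rfl⟩ := (twist e r).surjective i
  obtain ⟨k, hk⟩ := exists_bp p
  rw [hk, labTr, WX.relabel_right_apply, tr_right, twist_bp, twist_bp, labTr,
    WX.relabel_right_apply, tr_right, mul_add]

end twist

/-! ### Class 21 -/

section class21

variable (n₁ n₂ : ℕ)

/-- The labels of class 21, with the sign of the coordinate of the second block changed. -/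
noncomputable def labels21 : Blocks ![n₁, n₁, n₂] ≃ Fin (4 * n₁ + 2 * n₂ + 3) :=
  twist (labels22 n₁ n₂) ![1, -1, 1]

/-- The permutation ψ changes the sign of the coordinate on the way from the second block to the
first, but the signs -1 of this generator are attached to the images of the other direction.
Changing the sign of the coordinate of the second block makes them agree; the rotation of that block
then becomes the inverse of a translation by 1. -/
theorem flip12_swap01_class21 :
    IsInducedBy (labels21 n₁ n₂) (Class21.g₁ n₁ n₂) (flip12 * swap01) := by
  refine c_mul_perm_isInducedBy (ActsBy.twist ((fourCycles_actsBy _ (b := 0) (b' := 1)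
    (offset_zero _) (offset_three_one _ _ _) rfl rfl).mul
    (flips_actsBy _ 2 (offset_labels22 _ _) rfl)) _) (by intro b; fin_cases b <;> rfl)
    (by decide) (fun b => .inr (by revert b; decide)) fun b k => ?_
  rw [twist_bp]
  refine blockEquiv_mem_iff _ (fun b j h1 h2 => ?_) b _
  rw [show (flip12 * swap01).left = ![1, -1, -1] by decide]
  fin_cases b <;> simp [offset, Fin.sum_univ_three] at h2 ⊢ <;> omega

theorem rot0_class21 : Class21.g₂ n₁ n₂ = labTr (labels21 n₁ n₂) (Pi.single 0 1) := by
  rw [labels21, labTr_twist, show (fun b => ((![1, -1, 1] b : ℤˣ) : ℤ) *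
    (Pi.single 0 1 : Fin 3 → ℤ) b) = Pi.single 0 1 by decide]
  exact rot0_class22 n₁ n₂

theorem rot1_class21 : Class21.g₃ n₁ n₂ = (labTr (labels21 n₁ n₂) (Pi.single 1 1))⁻¹ := by
  rw [← labTr_neg, labels21, labTr_twist, show (fun b => ((![1, -1, 1] b : ℤˣ) : ℤ) *
    (-Pi.single 1 1 : Fin 3 → ℤ) b) = Pi.single 1 1 by decide]
  exact rot1_class22 n₁ n₂

theorem rot2_class21 : Class21.g₄ n₁ n₂ = labTr (labels21 n₁ n₂) (Pi.single 2 1) := by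
  rw [labels21, labTr_twist, show (fun b => ((![1, -1, 1] b : ℤˣ) : ℤ) *
    (Pi.single 2 1 : Fin 3 → ℤ) b) = Pi.single 2 1 by decide]
  exact rot2_class22 n₁ n₂

theorem class21_tb_mem (b : Fin 3) :
    WX.relabel (labels21 n₁ n₂) (tb ![n₁, n₁, n₂] b) ∈ Class21.G n₁ n₂ := by
  revert b
  refine Fin.forall_fin_succ.mpr ⟨?_, Fin.forall_fin_two.mpr ⟨?_, ?_⟩⟩
  · exact Set.mem_of_eq_of_mem (rot0_class21 n₁ n₂).symm (Subgroup.subset_closure (by simp))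
  · exact Set.mem_of_eq_of_mem (inv_eq_iff_eq_inv.mpr (rot1_class21 n₁ n₂)).symm
      (inv_mem (Subgroup.subset_closure (by simp)))
  · exact Set.mem_of_eq_of_mem (rot2_class21 n₁ n₂).symm (Subgroup.subset_closure (by simp))

theorem class21_generating : IsBlockGenerating (labels21 n₁ n₂)
    {Class21.g₁ n₁ n₂, Class21.g₂ n₁ n₂, Class21.g₃ n₁ n₂, Class21.g₄ n₁ n₂}
    {Class21.g₁ n₁ n₂} where
  tb_mem_closure b := .inr (class21_tb_mem n₁ n₂ b)
  subset := by rintro x rfl; simp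
  mem_cases := by
    rintro x (rfl | rfl | rfl | rfl)
    · exact .inl rfl
    · exact .inr ⟨0, .inl (rot0_class21 n₁ n₂)⟩
    · exact .inr ⟨1, .inr (rot1_class21 n₁ n₂)⟩
    · exact .inr ⟨2, .inl (rot2_class21 n₁ n₂)⟩

/-- Two successive splittings: first the translations of the exchanged blocks 0 and 1 split off, and
then those of block 2 from the remaining complement, leaving the cyclic group generated by g₁. -/
theorem class21_semidirect : ∃ φ : Cyc 4 →* MulAut (Cyc (2 * n₂ + 1)),
    IsSemidirect (Cyc (2 * n₁ + 1) × Cyc (2 * n₁ + 1)) (Cyc (2 * n₂ + 1) ⋊[φ] Cyc 4)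
      (Class21.G n₁ n₂) := by
  have i1 := flip12_swap01_class21 n₁ n₂
  obtain ⟨e4⟩ := (IsInducedSet.singleton i1).nonempty_mulEquiv flip12_swap01_cyc
  have h2 : IsInternalSemidirect
      ((translations ![n₁, n₁, n₂] {2}).map (WX.relabel (labels21 n₁ n₂)))
      (Subgroup.closure {Class21.g₁ n₁ n₂})
      (Subgroup.closure {Class21.g₁ n₁ n₂, Class21.g₄ n₁ n₂}) := by
    refine isInternalSemidirect_of_blocks ?_ ?_ (by simp) ?_
    · rintro _ rfl
      exact .inl ⟨_, i1, by rintro b rfl; rfl⟩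
    · rintro b rfl
      exact Set.mem_of_eq_of_mem (rot2_class21 n₁ n₂).symm (Subgroup.subset_closure (by simp))
    · rintro x (rfl | rfl)
      · exact .inl rfl
      · exact .inr ⟨2, rfl, .inl (rot2_class21 n₁ n₂)⟩
  have h01 : IsInternalSemidirect
      ((translations ![n₁, n₁, n₂] ({0} ∪ {1})).map (WX.relabel (labels21 n₁ n₂)))
      (Subgroup.closure {Class21.g₁ n₁ n₂, Class21.g₄ n₁ n₂}) (Class21.G n₁ n₂) := by
    refine isInternalSemidirect_of_blocks ?_ (fun b _ => class21_tb_mem n₁ n₂ b) ?_ ?_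
    · rintro _ (rfl | rfl)
      · exact .inl ⟨_, i1, by rintro b (rfl | rfl); exacts [.inr rfl, .inl rfl]⟩
      · exact .inr ⟨2, by simp, rot2_class21 n₁ n₂⟩
    · rintro x (rfl | rfl) <;> simp
    · rintro x (rfl | rfl | rfl | rfl)
      · exact .inl (.inl rfl)
      · exact .inr ⟨0, .inl rfl, .inl (rot0_class21 n₁ n₂)⟩
      · exact .inr ⟨1, .inr rfl, .inr (rot1_class21 n₁ n₂)⟩
      · exact .inl (.inr rfl)
  obtain ⟨eT⟩ := nonempty_map_mulEquiv (WX.relabel_injective (labels21 n₁ n₂))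
    (A := Cyc (2 * n₂ + 1)) (translations_singleton (ν := ![n₁, n₁, n₂]) 2 rfl)
  obtain ⟨eU⟩ := nonempty_map_mulEquiv (WX.relabel_injective (labels21 n₁ n₂))
    (translations_prod (ν := ![n₁, n₁, n₂]) (J := {0}) (K := {1}) (by simp)
      (translations_singleton 0 rfl) (translations_singleton 1 rfl))
  obtain ⟨φ, ⟨eS⟩⟩ := h2.isSemidirect eT e4
  exact ⟨φ, h01.isSemidirect eU eS⟩

theorem class21_main : IsAdmissible (Class21.G n₁ n₂) ∧
    (∃ φ : Cyc 4 →* MulAut (Cyc (2 * n₂ + 1)),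
      IsSemidirect (Cyc (2 * n₁ + 1) × Cyc (2 * n₁ + 1)) (Cyc (2 * n₂ + 1) ⋊[φ] Cyc 4)
        (Class21.G n₁ n₂)) ∧
    HasOrbitLengths (Class21.G n₁ n₂) [4 * n₁ + 2, 2 * n₂ + 1] ∧
    IsSylowTwo (Class21.G n₁ n₂) (Subgroup.closure {Class21.g₁ n₁ n₂}) ∧
    Nonempty (Subgroup.closure {Class21.g₁ n₁ n₂} ≃* Cyc 4) := by
  have h := class21_generating n₁ n₂
  have hi := IsInducedSet.singleton (flip12_swap01_class21 n₁ n₂)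
  have hf := h.isFrame hi isFlipping_flip12_swap01 le_rfl
  have hk := hi.nonempty_mulEquiv flip12_swap01_cyc
  refine ⟨hf.isAdmissible, class21_semidirect n₁ n₂, ?_,
    hf.isSylowTwo (isPGroup_of_mulEquiv hk 2 (card_cyc 4)), hk⟩
  refine h.hasOrbitLengths hi ![0, 0, 1] ![0, 2] (by simp [Fin.forall_fin_two]) ?_ ?_ ?_
  · rintro q rfl
    exact fun b => by fin_cases b <;> rfl
  · exact Fin.forall_fin_succ.mpr ⟨⟨1, one_mem _, rfl⟩, Fin.forall_fin_two.mpr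
      ⟨⟨_, Subgroup.subset_closure rfl, rfl⟩, ⟨1, one_mem _, rfl⟩⟩⟩
  · intro o
    fin_cases o <;> simp [Fin.sum_univ_three]
    ring

end class21

/-! ### Classes 23 and 24 -/

theorem IsInternalSemidirect.relIndex_left {Γ : Type*} [Group Γ] {V S G : Subgroup Γ}
    (h : IsInternalSemidirect V S G) : V.relIndex G = Nat.card S := by
  rw [Subgroup.relIndex, h.isComplement'.symm.index_eq_card]
  exact Nat.card_congr (Subgroup.subgroupOfEquivOfLe h.right_le).toEquiv

theorem IsInducedBy.inv {m N : ℕ} {ν : Fin m → ℕ} {e : Blocks ν ≃ Fin N} {g : WB N}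
    {q : WX (Fin m)} (hg : IsInducedBy e g q) : IsInducedBy e g⁻¹ q⁻¹ := by
  obtain ⟨hq, rfl⟩ := hg
  refine ⟨inv_mem hq, ?_⟩
  rw [← map_inv]
  exact congrArg _ (Subtype.ext (Subgroup.coe_inv _ _))

/-- Groups generated by sign changes and translations preserve the blocks. -/
theorem closure_preserves_blocks {m N : ℕ} {ν : Fin m → ℕ} {e : Blocks ν ≃ Fin N}
    {X : Set (WB N)} (hX : ∀ x ∈ X, (∃ q, IsInducedBy e x q ∧ ∀ b, q.right b = b) ∨
      ∃ b, x = WX.relabel e (tb ν b)) :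
    ∀ x ∈ Subgroup.closure X, ∀ p, (e.symm (x.right (e p))).1 = p.1 := by
  intro x hx
  rw [← Subgroup.mem_toSubmonoid, Subgroup.closure_toSubmonoid_of_finite] at hx
  induction hx using Submonoid.closure_induction with
  | one => exact fun p => by simp
  | mul x y _ _ ihx ihy =>
    intro p
    have h := ihx (e.symm (y.right (e p)))
    rwa [e.apply_symm_apply, ihy p, ← WX.mul_right_apply] at h
  | mem x hx =>
    intro p
    obtain ⟨k, hk⟩ := exists_bp p
    rcases hX x hx with ⟨q, ⟨hq, rfl⟩, h1⟩ | ⟨d, rfl⟩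
    · change (e.symm ((WX.relabel e (lin _)).right (e _))).1 = _
      rw [WX.relabel_right_apply, e.symm_apply_apply, hk, lin_right]
      exact h1 _
    · rw [WX.relabel_right_apply, e.symm_apply_apply, hk, tb, tr_right]
      rfl

section class23

variable (n : ℕ)

/-- The labels of classes 23 and 24. -/
noncomputable def labels23 : Blocks ![n, n, n] ≃ Fin (6 * n + 3) := blockEquiv (sum_three (by ring))

theorem offset_labels23 : offset ![n, n, n] 2 = 4 * n + 2 := by
  rw [offset_three_two]
  ring

theorem flip01_class23 : IsInducedBy (labels23 n) (Class23.g₁ n) flip01 := by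
  refine c_mul_perm_isInducedBy ((flips_actsBy _ 0 (offset_zero _) rfl).mul
    (flips_actsBy _ 1 (offset_three_one _ _ _) rfl)) (by intro b; fin_cases b <;> rfl) (by decide)
    (fun b => .inr (by revert b; decide)) (blockEquiv_mem_iff _ fun b j h1 h2 => ?_)
  rw [show flip01.left = ![-1, -1, 1] by decide]
  fin_cases b <;> simp [offset, Fin.sum_univ_three] at h2 ⊢ <;> omega

theorem flip12_class23 : IsInducedBy (labels23 n) (Class23.g₂ n) flip12 := by
  refine c_mul_perm_isInducedBy ((flips_actsBy _ 1 (offset_three_one _ _ _) rfl).mul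
    (flips_actsBy _ 2 (offset_labels23 _) rfl)) (by intro b; fin_cases b <;> rfl) (by decide)
    (fun b => .inr (by revert b; decide)) (blockEquiv_mem_iff _ fun b j h1 h2 => ?_)
  rw [show flip12.left = ![1, -1, -1] by decide]
  fin_cases b <;> simp [offset, Fin.sum_univ_three] at h2 ⊢ <;> omega

theorem cycle012_class23 : IsInducedBy (labels23 n) (Class23.g₆ n) cycle012 :=
  perm_isInducedBy (blockCycle_actsBy _) (by intro b; fin_cases b <;> rfl)

theorem swap01_class24 : IsInducedBy (labels23 n) (Class24.g₃ n) swap01 :=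
  perm_isInducedBy (blockSwap_actsBy _ (b := 0) (b' := 1) (offset_zero _)
    (offset_three_one _ _ _) rfl rfl) (by intro b; fin_cases b <;> rfl)

theorem rot0_class23 : Class23.g₃ n = labTr (labels23 n) (Pi.single 0 1) :=
  perm_rot _ 0 (offset_zero _) rfl

theorem rot1_class23 : Class23.g₄ n = labTr (labels23 n) (Pi.single 1 1) :=
  perm_rot _ 1 (offset_three_one _ _ _) rfl

theorem rot2_class23 : Class23.g₅ n = labTr (labels23 n) (Pi.single 2 1) :=
  perm_rot _ 2 (offset_labels23 _) rfl

theorem class23_tb_mem {X : Set (WB (6 * n + 3))} (h0 : Class23.g₃ n ∈ X) (h1 : Class23.g₄ n ∈ X)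
    (h2 : Class23.g₅ n ∈ X) (b : Fin 3) :
    WX.relabel (labels23 n) (tb ![n, n, n] b) ∈ Subgroup.closure X := by
  revert b
  refine Fin.forall_fin_succ.mpr ⟨?_, Fin.forall_fin_two.mpr ⟨?_, ?_⟩⟩
  · exact Set.mem_of_eq_of_mem (rot0_class23 n).symm (Subgroup.subset_closure h0)
  · exact Set.mem_of_eq_of_mem (rot1_class23 n).symm (Subgroup.subset_closure h1)
  · exact Set.mem_of_eq_of_mem (rot2_class23 n).symm (Subgroup.subset_closure h2)

theorem class23_normal_generating : IsBlockGenerating (labels23 n)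
    {Class23.g₁ n, Class23.g₂ n, Class23.g₃ n, Class23.g₄ n, Class23.g₅ n}
    {Class23.g₁ n, Class23.g₂ n} where
  tb_mem_closure b := .inr (class23_tb_mem n (by simp) (by simp) (by simp) b)
  subset := by rintro x (rfl | rfl) <;> simp
  mem_cases := by
    rintro x (rfl | rfl | rfl | rfl | rfl)
    · exact .inl (.inl rfl)
    · exact .inl (.inr rfl)
    · exact .inr ⟨0, .inl (rot0_class23 n)⟩
    · exact .inr ⟨1, .inl (rot1_class23 n)⟩
    · exact .inr ⟨2, .inl (rot2_class23 n)⟩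

theorem class23_generating : IsBlockGenerating (labels23 n)
    {Class23.g₁ n, Class23.g₂ n, Class23.g₃ n, Class23.g₄ n, Class23.g₅ n, Class23.g₆ n}
    {Class23.g₁ n, Class23.g₂ n, Class23.g₆ n} where
  tb_mem_closure b := .inr (class23_tb_mem n (by simp) (by simp) (by simp) b)
  subset := by rintro x (rfl | rfl | rfl) <;> simp
  mem_cases := by
    rintro x (rfl | rfl | rfl | rfl | rfl | rfl)
    · exact .inl (.inl rfl)
    · exact .inl (.inr (.inl rfl))
    · exact .inr ⟨0, .inl (rot0_class23 n)⟩
    · exact .inr ⟨1, .inl (rot1_class23 n)⟩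
    · exact .inr ⟨2, .inl (rot2_class23 n)⟩
    · exact .inl (.inr (.inr rfl))

theorem class24_generating : IsBlockGenerating (labels23 n)
    {Class24.g₁ n, Class24.g₂ n, Class24.g₃ n, Class24.g₄ n, Class24.g₅ n, Class24.g₆ n,
      Class24.g₇ n}
    {Class24.g₁ n, Class24.g₂ n, Class24.g₃ n, Class24.g₇ n} where
  tb_mem_closure b := .inr (class23_tb_mem n (.inr (.inr (.inr (.inl rfl))))
    (.inr (.inr (.inr (.inr (.inl rfl))))) (.inr (.inr (.inr (.inr (.inr (.inl rfl)))))) b)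
  subset := by rintro x (rfl | rfl | rfl | rfl) <;> simp
  mem_cases := by
    rintro x (rfl | rfl | rfl | rfl | rfl | rfl | rfl)
    · exact .inl (.inl rfl)
    · exact .inl (.inr (.inl rfl))
    · exact .inl (.inr (.inr (.inl rfl)))
    · exact .inr ⟨0, .inl (rot0_class23 n)⟩
    · exact .inr ⟨1, .inl (rot1_class23 n)⟩
    · exact .inr ⟨2, .inl (rot2_class23 n)⟩
    · exact .inl (.inr (.inr (.inr rfl)))

/-- Sign changes and translations preserve every block, whereas a power of the cyclic permutation of
the blocks does so only if it is trivial. -/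
theorem class23_disjoint : ∀ v ∈ Subgroup.closure
    {Class23.g₁ n, Class23.g₂ n, Class23.g₃ n, Class23.g₄ n, Class23.g₅ n},
    v ∈ Subgroup.closure {Class23.g₆ n} → v = 1 := by
  intro v hv hv'
  have h1 := closure_preserves_blocks (e := labels23 n) ?_ v hv
  · have hi := IsInducedSet.singleton (cycle012_class23 n)
    rw [hi.closure_eq] at hv'
    obtain ⟨q, hq, rfl⟩ := hv'
    have h2 : q.1 ∈ Subgroup.closure {cycle012} := by
      rw [← closure_preimage_map hi.subset]
      exact ⟨q, hq, rfl⟩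
    have h3 : Subgroup.closure {cycle012} ≤
        (SemidirectProduct.inr : _ →* WX (Fin 3)).range := by
      rw [Subgroup.closure_le]
      rintro _ rfl
      exact ⟨_, rfl⟩
    obtain ⟨σ, hσ⟩ := h3 h2
    have h4 : q = 1 := by
      refine Subtype.ext (hσ.symm.trans ?_)
      have h5 : σ = 1 := by
        refine Equiv.ext fun b => ?_
        have h6 := h1 (bp b 0)
        rw [show blockHom (labels23 n) q = WX.relabel (labels23 n) (lin q) from rfl,
          WX.relabel_right_apply, Equiv.symm_apply_apply, lin_right, ← hσ] at h6
        exact h6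
      rw [h5, map_one]
      rfl
    rw [h4, map_one]
  · rintro x (rfl | rfl | rfl | rfl | rfl)
    · exact .inl ⟨_, flip01_class23 n, fun b => rfl⟩
    · exact .inl ⟨_, flip12_class23 n, fun b => rfl⟩
    · exact .inr ⟨_, rot0_class23 n⟩
    · exact .inr ⟨_, rot1_class23 n⟩
    · exact .inr ⟨_, rot2_class23 n⟩

/-- Conjugation by g₆ permutes the three rotations cyclically and sends g₁ to g₂ and g₂ to g₁g₂, so
the subgroup generated by g₁, …, g₅ is normal. -/
theorem class23_isInternalSemidirect : IsInternalSemidirect (Subgroup.closure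
    {Class23.g₁ n, Class23.g₂ n, Class23.g₃ n, Class23.g₄ n, Class23.g₅ n})
    (Subgroup.closure {Class23.g₆ n}) (Class23.G n) := by
  refine .of_closure (Subgroup.closure_mono ?_) (Subgroup.closure_mono (by simp))
    (conj_mem_closure ?_) (class23_disjoint n) ?_
  · rintro x (rfl | rfl | rfl | rfl | rfl) <;> simp
  · have i1 := flip01_class23 n
    have i2 := flip12_class23 n
    have i6 := cycle012_class23 n
    have h1 : Class23.g₆ n * Class23.g₁ n * (Class23.g₆ n)⁻¹ = Class23.g₂ n :=
      IsInducedBy.eq ((i6.mul i1).mul i6.inv)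
        (by rwa [show cycle012 * flip01 * cycle012⁻¹ = flip12 by decide])
    have h2 : Class23.g₆ n * Class23.g₂ n * (Class23.g₆ n)⁻¹ = Class23.g₁ n * Class23.g₂ n :=
      IsInducedBy.eq ((i6.mul i2).mul i6.inv)
        (by rw [show cycle012 * flip12 * cycle012⁻¹ = flip01 * flip12 by decide]; exact i1.mul i2)
    have h3 : Class23.g₆ n * Class23.g₃ n * (Class23.g₆ n)⁻¹ = Class23.g₄ n := by
      rw [rot0_class23, rot1_class23, i6.conj_labTr]
      congr 1
      decide
    have h4 : Class23.g₆ n * Class23.g₄ n * (Class23.g₆ n)⁻¹ = Class23.g₅ n := by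
      rw [rot1_class23, rot2_class23, i6.conj_labTr]
      congr 1
      decide
    have h5 : Class23.g₆ n * Class23.g₅ n * (Class23.g₆ n)⁻¹ = Class23.g₃ n := by
      rw [rot2_class23, rot0_class23, i6.conj_labTr]
      congr 1
      decide
    rintro _ rfl y (rfl | rfl | rfl | rfl | rfl)
    · rw [h1]
      exact Subgroup.subset_closure (by simp)
    · rw [h2]
      exact mul_mem (Subgroup.subset_closure (by simp)) (Subgroup.subset_closure (by simp))
    · rw [h3]
      exact Subgroup.subset_closure (by simp)
    · rw [h4]
      exact Subgroup.subset_closure (by simp)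
    · rw [h5]
      exact Subgroup.subset_closure (by simp)
  · rintro x (rfl | rfl | rfl | rfl | rfl | rfl)
    · exact Subgroup.mem_sup_left (Subgroup.subset_closure (by simp))
    · exact Subgroup.mem_sup_left (Subgroup.subset_closure (by simp))
    · exact Subgroup.mem_sup_left (Subgroup.subset_closure (by simp))
    · exact Subgroup.mem_sup_left (Subgroup.subset_closure (by simp))
    · exact Subgroup.mem_sup_left (Subgroup.subset_closure (by simp))
    · exact Subgroup.mem_sup_right (Subgroup.subset_closure rfl)

theorem class23_main : IsAdmissible (Class23.G n) ∧
    (∃ φ : Cyc 2 × Cyc 2 →* MulAut (Cyc (2 * n + 1) × Cyc (2 * n + 1) × Cyc (2 * n + 1)),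
      IsSemidirect
        ((Cyc (2 * n + 1) × Cyc (2 * n + 1) × Cyc (2 * n + 1)) ⋊[φ] (Cyc 2 × Cyc 2)) (Cyc 3)
        (Class23.G n)) ∧
    HasOrbitLengths (Class23.G n) [6 * n + 3] ∧
    IsSylowTwo (Class23.G n) (Subgroup.closure {Class23.g₁ n, Class23.g₂ n}) ∧
    Nonempty (Subgroup.closure {Class23.g₁ n, Class23.g₂ n} ≃* Cyc 2 × Cyc 2) := by
  have h := class23_generating n
  have hN := class23_normal_generating n
  have hs := class23_isInternalSemidirect n
  have i6 := cycle012_class23 n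
  have hi := IsInducedSet.insert (flip01_class23 n) (.insert (flip12_class23 n) (.singleton i6))
  have hi' := IsInducedSet.insert (flip01_class23 n) (.singleton (flip12_class23 n))
  have hf := h.isFrame hi isFlipping_flip01_flip12_cycle012 le_rfl
  have hf' := hN.isFrame hi' isFlipping_flip01_flip12 le_rfl
  have hk := hi'.nonempty_mulEquiv flip01_flip12_klein
  obtain ⟨e3⟩ : Nonempty (Subgroup.closure {Class23.g₆ n} ≃* Cyc 3) :=
    (IsInducedSet.singleton i6).nonempty_mulEquiv
      (nonempty_mulEquiv_cyc (orderOf_eq_prime (by decide) (by decide)))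
  obtain ⟨φ, ⟨eN⟩⟩ := hN.isSemidirect hi' (A := Cyc (2 * n + 1) × Cyc (2 * n + 1) × Cyc (2 * n + 1))
    (translations_three_blocks _) flip01_flip12_klein
  -- The complement in the frame of the whole group contains g₆ and is not a 2-group. The Klein
  -- group has odd index in the normal subgroup by its own frame, and this subgroup has index 3.
  have ho : Odd ((Subgroup.closure {Class23.g₁ n, Class23.g₂ n}).relIndex (Class23.G n)) := by
    rw [← Subgroup.relIndex_mul_relIndex _ _ _ hf'.right_le hs.left_le, hs.relIndex_left,
      Nat.card_congr e3.toEquiv, card_cyc]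
    exact hf'.odd_relIndex.mul (by decide)
  refine ⟨hf.isAdmissible, ⟨φ, hs.isSemidirect eN e3⟩, ?_,
    isSylowTwo_of_odd (hf'.right_le.trans hs.left_le) ho (isPGroup_of_mulEquiv hk 2 card_klein), hk⟩
  refine h.hasOrbitLengths hi ![0, 0, 0] ![0] (by simp) ?_ ?_ ?_
  · rintro q (rfl | rfl | rfl) <;> exact fun b => by fin_cases b <;> rfl
  · exact Fin.forall_fin_succ.mpr ⟨⟨1, one_mem _, rfl⟩, Fin.forall_fin_two.mpr
      ⟨⟨cycle012 * cycle012, mul_mem (Subgroup.subset_closure (by simp))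
        (Subgroup.subset_closure (by simp)), rfl⟩,
        ⟨cycle012, Subgroup.subset_closure (by simp), rfl⟩⟩⟩
  · intro o
    fin_cases o
    simp [Fin.sum_univ_three]
    ring

theorem class24_main : IsAdmissible (Class24.G n) ∧
    IsSemidirect (Cyc (2 * n + 1) × Cyc (2 * n + 1) × Cyc (2 * n + 1))
      (Equiv.Perm (Fin 4)) (Class24.G n) ∧
    HasOrbitLengths (Class24.G n) [6 * n + 3] ∧
    IsSylowTwo (Class24.G n) (Subgroup.closure {Class24.g₁ n, Class24.g₂ n, Class24.g₃ n}) ∧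
    Nonempty (Subgroup.closure {Class24.g₁ n, Class24.g₂ n, Class24.g₃ n} ≃*
      DihedralGroup 4) ∧
    H1Vanishes ((Subgroup.closure {Class24.g₁ n, Class24.g₂ n, Class24.g₃ n}).subgroupOf
      (WD _)) := by
  have h := class24_generating n
  have i1 : IsInducedBy (labels23 n) (Class24.g₁ n) flip01 := flip01_class23 n
  have i2 : IsInducedBy (labels23 n) (Class24.g₂ n) flip12 := flip12_class23 n
  have i3 := swap01_class24 n
  have i7 : IsInducedBy (labels23 n) (Class24.g₇ n) cycle012 := cycle012_class23 n
  have hi := IsInducedSet.insert i1 (.insert i2 (.insert i3 (.singleton i7)))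
  have hi' := IsInducedSet.insert i1 (.insert i2 (.singleton i3))
  have hf := h.isFrame hi isFlipping_flip01_flip12_swap01_cycle012 le_rfl
  have hk := hi'.nonempty_mulEquiv flip01_flip12_swap01_dihedral
  have hle : Subgroup.closure {Class24.g₁ n, Class24.g₂ n, Class24.g₃ n} ≤
      Subgroup.closure {Class24.g₁ n, Class24.g₂ n, Class24.g₃ n, Class24.g₇ n} := by
    refine Subgroup.closure_mono ?_
    rintro x (rfl | rfl | rfl) <;> simp
  -- The dihedral group has index 24/8 = 3 in the complement 𝔖₄ of the frame, which has odd index in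
  -- the whole group.
  have ho : Odd ((Subgroup.closure {Class24.g₁ n, Class24.g₂ n, Class24.g₃ n}).relIndex
      (Class24.G n)) := by
    rw [← Subgroup.relIndex_mul_relIndex _ _ (Class24.G n) hle hf.right_le]
    refine Odd.mul ?_ hf.odd_relIndex
    obtain ⟨e4⟩ := hi.nonempty_mulEquiv card_closure_signed.2
    obtain ⟨e8⟩ := hk
    have hc := Subgroup.card_mul_index ((Subgroup.closure {Class24.g₁ n, Class24.g₂ n,
      Class24.g₃ n}).subgroupOf
        (Subgroup.closure {Class24.g₁ n, Class24.g₂ n, Class24.g₃ n, Class24.g₇ n}))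
    rw [Nat.card_congr (Subgroup.subgroupOfEquivOfLe hle).toEquiv, Nat.card_congr e8.toEquiv,
      Nat.card_congr e4.toEquiv, card_dihedral_four, Nat.card_perm, Nat.card_fin,
      show Nat.factorial 4 = 24 from rfl] at hc
    have h3 : (Subgroup.closure {Class24.g₁ n, Class24.g₂ n, Class24.g₃ n}).relIndex
        (Subgroup.closure {Class24.g₁ n, Class24.g₂ n, Class24.g₃ n, Class24.g₇ n}) = 3 := by
      rw [Subgroup.relIndex]
      omega
    rw [h3]
    decide
  refine ⟨hf.isAdmissible, h.isSemidirect hi (translations_three_blocks _) card_closure_signed.2,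
    ?_, isSylowTwo_of_odd (hle.trans hf.right_le) ho
      (isPGroup_of_mulEquiv hk 3 card_dihedral_four), hk,
    hf.isAdmissible.h1Vanishes (hle.trans hf.right_le)⟩
  refine h.hasOrbitLengths hi ![0, 0, 0] ![0] (by simp) ?_ ?_ ?_
  · rintro q (rfl | rfl | rfl | rfl) <;> exact fun b => by fin_cases b <;> rfl
  · exact Fin.forall_fin_succ.mpr ⟨⟨1, one_mem _, rfl⟩, Fin.forall_fin_two.mpr
      ⟨⟨cycle012 * cycle012, mul_mem (Subgroup.subset_closure (by simp))
        (Subgroup.subset_closure (by simp)), rfl⟩,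
        ⟨cycle012, Subgroup.subset_closure (by simp), rfl⟩⟩⟩
  · intro o
    fin_cases o
    simp [Fin.sum_univ_three]
    ring

end class23

/-! ### Digits -/

theorem sum_digits_lt {p : ℕ} [NeZero p] (c : ℕ → ZMod p) (n : ℕ) :
    ∑ i ∈ range n, (c i).val * p ^ i < p ^ n := by
  induction n with
  | zero => simp
  | succ n ih =>
    rw [Finset.sum_range_succ]
    have h1 := Nat.mul_le_mul_right (p ^ n) (Nat.succ_le_of_lt (ZMod.val_lt (c n)))
    rw [Nat.succ_mul] at h1
    rw [_root_.pow_succ, mul_comm (p ^ n)]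
    omega

theorem sum_digits_succ {p : ℕ} (c : ℕ → ZMod p) (n : ℕ) :
    ∑ i ∈ range (n + 1), (c i).val * p ^ i =
      (∑ i ∈ range n, (c (i + 1)).val * p ^ i) * p + (c 0).val := by
  rw [Finset.sum_range_succ', Finset.sum_mul, pow_zero, mul_one]
  congr 1
  exact Finset.sum_congr rfl fun i _ => by rw [_root_.pow_succ, mul_assoc]

/-- The lowest digit is the remainder modulo p; after cancelling it and dividing by p, induction
applies. -/
theorem sum_digits_inj {p : ℕ} [NeZero p] {n : ℕ} {c c' : ℕ → ZMod p}
    (h : ∑ i ∈ range n, (c i).val * p ^ i = ∑ i ∈ range n, (c' i).val * p ^ i) :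
    ∀ i < n, c i = c' i := by
  induction n generalizing c c' with
  | zero => exact fun i hi => absurd hi (by omega)
  | succ n ih =>
    rw [sum_digits_succ, sum_digits_succ] at h
    have h0 := congrArg (· % p) h
    simp only [Nat.mul_add_mod_self_right, Nat.mod_eq_of_lt (ZMod.val_lt _)] at h0
    rw [h0] at h
    have h1 := ih (c := fun i => c (i + 1)) (c' := fun i => c' (i + 1))
      (Nat.eq_of_mul_eq_mul_right (NeZero.pos p) (Nat.add_right_cancel h))
    intro i hi
    rcases i with _ | i
    · exact ZMod.val_injective p h0
    · exact h1 i (by omega)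

namespace FieldData

variable {p r : ℕ} (D : FieldData p r)

/-- The coefficients of an element of the field. -/
noncomputable def coeff (x : D.field) (i : ℕ) : ZMod p :=
  (AdjoinRoot.modByMonicHom D.monic x).coeff i

theorem coeff_add (x y : D.field) (i : ℕ) : D.coeff (x + y) i = D.coeff x i + D.coeff y i := by
  rw [coeff, map_add, Polynomial.coeff_add, coeff, coeff]

theorem coeff_zero (i : ℕ) : D.coeff 0 i = 0 := by
  rw [coeff, map_zero, Polynomial.coeff_zero]

theorem ext_coeff {x y : D.field} (h : ∀ i < r, D.coeff x i = D.coeff y i) : x = y := by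
  refine (AdjoinRoot.powerBasisAux' D.monic).repr.injective (Finsupp.ext fun i => ?_)
  rw [AdjoinRoot.powerBasisAux'_repr_apply_to_fun, AdjoinRoot.powerBasisAux'_repr_apply_to_fun]
  exact h i (i.2.trans_eq D.natDegree_eq)

/-- The number with the given coefficients as digits. -/
noncomputable def dig (x : D.field) : ℕ := ∑ i ∈ range r, (D.coeff x i).val * p ^ i

theorem dig_zero : D.dig 0 = 0 :=
  Finset.sum_eq_zero fun i _ => by rw [coeff_zero, ZMod.val_zero, zero_mul]

variable [hp : Fact p.Prime]

theorem dig_lt (x : D.field) : D.dig x < p ^ r := sum_digits_lt _ _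

theorem dig_injective : Function.Injective D.dig := fun _ _ h =>
  D.ext_coeff (sum_digits_inj h)

theorem coeff_one (hr : 1 ≤ r) (i : ℕ) : D.coeff 1 i = if i = 0 then 1 else 0 := by
  have h1 : (1 : Polynomial (ZMod p)) %ₘ D.h = 1 := by
    rw [Polynomial.modByMonic_eq_self_iff D.monic, Polynomial.degree_one,
      Polynomial.degree_eq_natDegree D.monic.ne_zero, D.natDegree_eq]
    exact_mod_cast hr
  rw [coeff, ← map_one (AdjoinRoot.mk D.h), AdjoinRoot.modByMonicHom_mk, h1, Polynomial.coeff_one]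

/-- Adding 1 changes the constant coefficient only, modulo p and without a carry. So it runs
cyclically through the p numbers with a fixed quotient k by p, which is one cycle of `addCycles`. -/
theorem dig_add_one (hr : 1 ≤ r) (x : D.field) : ∃ k < p ^ (r - 1), ∃ i < p,
    D.dig x = k * p + i ∧ D.dig (x + 1) = k * p + (i + 1) % p := by
  obtain ⟨s, rfl⟩ : ∃ s, r = s + 1 := ⟨r - 1, by omega⟩
  have hp1 : 1 % p = 1 := Nat.mod_eq_of_lt hp.out.one_lt
  refine ⟨∑ i ∈ range s, (D.coeff x (i + 1)).val * p ^ i, sum_digits_lt _ _,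
    (D.coeff x 0).val, ZMod.val_lt _, sum_digits_succ _ _, ?_⟩
  rw [dig, sum_digits_succ]
  congr 2
  · refine Finset.sum_congr rfl fun i _ => ?_
    rw [coeff_add, coeff_one _ hr, if_neg (by omega), add_zero]
  · rw [coeff_add, coeff_one _ hr, if_pos rfl, ZMod.val_add, ZMod.val_one]

/-- The number 0 is not a label, so the zero element takes the free label p^r. Otherwise the label
is the number with the coefficients as digits. -/
theorem lab_eq (x : D.field) : D.lab x = if D.dig x = 0 then p ^ r else D.dig x := by
  have h : x = 0 ↔ D.dig x = 0 := by
    rw [← D.dig_zero, D.dig_injective.eq_iff]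
  unfold lab
  by_cases hx : x = 0
  · rw [if_pos hx, if_pos (h.mp hx)]
  · rw [if_neg hx, if_neg (mt h.mpr hx)]
    rfl

theorem lab_pos (x : D.field) : 1 ≤ D.lab x := by
  have := D.dig_lt x
  rw [lab_eq]
  split_ifs <;> omega

theorem lab_le (x : D.field) : D.lab x ≤ p ^ r := by
  have := D.dig_lt x
  rw [lab_eq]
  split_ifs <;> omega

theorem lab_injective : Function.Injective D.lab := by
  intro x y h
  have hx := D.dig_lt x
  have hy := D.dig_lt y
  rw [lab_eq, lab_eq] at h
  apply D.dig_injective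
  split_ifs at h <;> omega

theorem finite_field : Finite D.field :=
  Finite.of_injective (fun x => (⟨D.dig x, D.dig_lt x⟩ : Fin (p ^ r)))
    fun _ _ h => D.dig_injective (congrArg Fin.val h)

omit hp in
theorem card_field : Nat.card D.field = p ^ r := by
  rw [Nat.card_congr (AdjoinRoot.powerBasisAux' D.monic).equivFun.toEquiv, Nat.card_fun,
    Nat.card_zmod, Nat.card_fin, D.natDegree_eq]

theorem eq_zero_or_isUnit (x : D.field) : x = 0 ∨ ∃ u : D.fieldˣ, (u : D.field) = x := by
  have := Fact.mk D.irreducible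
  by_cases h : x = 0
  · exact .inl h
  · refine .inr ⟨⟨x, x⁻¹, ?_, ?_⟩, rfl⟩
    · exact mul_inv_cancel₀ h
    · exact inv_mul_cancel₀ h

theorem nontrivial_field : Nontrivial D.field := by
  have := Fact.mk D.irreducible
  infer_instance

theorem card_units : Nat.card D.fieldˣ = p ^ r - 1 := by
  have := Fact.mk D.irreducible
  have := D.finite_field
  rw [← D.card_field]
  exact Nat.card_units D.field

theorem orderOf_generator : orderOf D.Γ = p ^ r - 1 := by
  rw [← D.card_units]
  exact orderOf_eq_card_of_forall_mem_zpowers D.generates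

variable {N : ℕ} [NeZero N]

theorem addCycles_apply_of_notMem {a j : ℕ} (hr : 1 ≤ r) (ha : a + p ^ r ≤ N) (h1 : 1 ≤ j)
    (h2 : j ≤ N) (hj : j ≤ a ∨ a + p ^ r < j) :
    (addCycles p r a : Equiv.Perm (Fin N)) (pt j) = pt j := by
  have hp0 := hp.out.pos
  have hq : p ^ (r - 1) * p = p ^ r := by rw [← _root_.pow_succ, Nat.sub_add_cancel hr]
  refine prod_apply_of_fixed fun k hk => ?_
  have hk' : (k + 1) * p ≤ p ^ r := hq ▸ Nat.mul_le_mul_right p hk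
  rw [Nat.succ_mul] at hk'
  have hlab : ∀ i < p, 1 ≤ (if k = 0 ∧ i = 0 then p ^ r else k * p + i) ∧
      (if k = 0 ∧ i = 0 then p ^ r else k * p + i) ≤ p ^ r := by
    intro i hi
    split_ifs with h
    · exact ⟨Nat.pos_of_ne_zero (pow_ne_zero _ hp0.ne'), le_rfl⟩
    · refine ⟨?_, by omega⟩
      rcases Nat.eq_zero_or_pos k with rfl | hk0
      · omega
      · have := Nat.mul_pos hk0 hp0
        omega
  refine cyc_apply_of_notMem ?_ h1 h2 ?_
  · simp only [List.mem_map, List.mem_range]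
    rintro _ ⟨i, hi, rfl⟩
    have := hlab i hi
    omega
  · simp only [List.mem_map, List.mem_range, not_exists, not_and]
    intro i hi
    have := hlab i hi
    omega

theorem addCycles_apply {a : ℕ} (hr : 1 ≤ r) (ha : a + p ^ r ≤ N) (x : D.field) :
    (addCycles p r a : Equiv.Perm (Fin N)) (pt (a + D.lab x)) = pt (a + D.lab (x + 1)) := by
  have hp0 := hp.out.pos
  have hq : p ^ (r - 1) * p = p ^ r := by rw [← _root_.pow_succ, Nat.sub_add_cancel hr]
  -- The label of the element with digit number kp + i. Modulo p^r it is kp + i in the exceptional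
  -- case too, which gives injectivity.
  let L : ℕ → ℕ → ℕ := fun k i => if k = 0 ∧ i = 0 then p ^ r else k * p + i
  have hL : ∀ k < p ^ (r - 1), ∀ i < p, 1 ≤ L k i ∧ L k i ≤ p ^ r ∧
      L k i % p ^ r = k * p + i := by
    intro k hk i hi
    have hk' : (k + 1) * p ≤ p ^ r := hq ▸ Nat.mul_le_mul_right p hk
    rw [Nat.succ_mul] at hk'
    simp only [L]
    split_ifs with h
    · exact ⟨Nat.pos_of_ne_zero (pow_ne_zero _ hp0.ne'), le_rfl, by simp [h.1, h.2]⟩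
    · refine ⟨?_, by omega, Nat.mod_eq_of_lt (by omega)⟩
      rcases Nat.eq_zero_or_pos k with rfl | hk0
      · omega
      · have := Nat.mul_pos hk0 hp0
        omega
  have hinj : ∀ k < p ^ (r - 1), ∀ i < p, ∀ k' < p ^ (r - 1), ∀ i' < p, L k i = L k' i' →
      k = k' ∧ i = i' := by
    intro k hk i hi k' hk' i' hi' h
    have h1 : k * p + i = k' * p + i' := by
      rw [← (hL k hk i hi).2.2, ← (hL k' hk' i' hi').2.2, h]
    have h2 := congrArg (· % p) h1
    simp only [Nat.mul_add_mod_self_right, Nat.mod_eq_of_lt hi, Nat.mod_eq_of_lt hi'] at h2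
    rw [h2] at h1
    exact ⟨Nat.eq_of_mul_eq_mul_right hp0 (Nat.add_right_cancel h1), h2⟩
  have hlab : ∀ (y : D.field) k i, D.dig y = k * p + i → D.lab y = L k i := by
    intro y k i h
    have h0 : k * p + i = 0 ↔ k = 0 ∧ i = 0 := by
      rw [Nat.add_eq_zero_iff, Nat.mul_eq_zero]
      simp [hp0.ne']
    rw [lab_eq, h]
    simp only [L, h0]
  obtain ⟨k, hk, i, hi, h1, h2⟩ := D.dig_add_one hr x
  have hi' := Nat.mod_lt (i + 1) hp0
  rw [hlab _ _ _ h1, hlab _ _ _ h2]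
  have hmem : ∀ k < p ^ (r - 1), ∀ j ∈ (List.range p).map fun i => a + L k i,
      1 ≤ j ∧ j ≤ N := by
    intro k hk
    simp only [List.mem_map, List.mem_range]
    rintro _ ⟨i, hi, rfl⟩
    have := hL k hk i hi
    omega
  have hfix : ∀ i < p, ∀ j < p ^ (r - 1), j ≠ k →
      (cyc ((List.range p).map fun i => a + L j i) : Equiv.Perm (Fin N)) (pt (a + L k i)) =
        pt (a + L k i) := by
    intro i hi j hj hjk
    have := hL k hk i hi
    refine cyc_apply_of_notMem (hmem j hj) (by omega) (by omega) ?_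
    simp only [List.mem_map, List.mem_range, not_exists, not_and]
    intro i' hi' h
    exact hjk (hinj j hj i' hi' k hk i hi (Nat.add_left_cancel h)).1
  refine prod_apply_of_unique hk ?_ (hfix i hi) (hfix _ hi')
  have hnd : ((List.range p).map fun i => a + L k i).Nodup := by
    refine List.nodup_range.map_on fun i hi j hj h => ?_
    simp only [List.mem_range] at hi hj
    exact (hinj k hk i hi k hk j hj (Nat.add_left_cancel h)).2
  have h3 := cyc_apply_getElem (N := N) hnd (hmem k hk) i (by simpa using hi)
  simpa using h3

omit [NeZero N] in
theorem mulCycle_list_mem {a : ℕ} (ha : a + p ^ r ≤ N) :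
    ∀ j ∈ (List.range (p ^ r - 1)).map fun k => a + D.lab ((D.Γ ^ k : D.fieldˣ) : D.field),
      1 ≤ j ∧ j ≤ N := by
  simp only [List.mem_map, List.mem_range]
  rintro _ ⟨k, -, rfl⟩
  have h1 := D.lab_pos ((D.Γ ^ k : D.fieldˣ) : D.field)
  have h2 := D.lab_le ((D.Γ ^ k : D.fieldˣ) : D.field)
  omega

theorem mulCycle_apply_of_notMem {a j : ℕ} (ha : a + p ^ r ≤ N) (h1 : 1 ≤ j)
    (h2 : j ≤ N) (hj : j ≤ a ∨ a + p ^ r < j) :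
    (D.mulCycle a : Equiv.Perm (Fin N)) (pt j) = pt j := by
  refine cyc_apply_of_notMem (D.mulCycle_list_mem ha) h1 h2 ?_
  simp only [List.mem_map, List.mem_range, not_exists, not_and]
  intro k _
  have h1 := D.lab_pos ((D.Γ ^ k : D.fieldˣ) : D.field)
  have h2 := D.lab_le ((D.Γ ^ k : D.fieldˣ) : D.field)
  omega

theorem mulCycle_apply {a : ℕ} (ha : a + p ^ r ≤ N) (x : D.field) :
    (D.mulCycle a : Equiv.Perm (Fin N)) (pt (a + D.lab x)) = pt (a + D.lab (D.Γ * x)) := by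
  have hn := D.nontrivial_field
  have hf := D.finite_field
  have ho := D.orderOf_generator
  have hpos : 0 < p ^ r - 1 := by
    rw [← ho]
    exact orderOf_pos D.Γ
  -- The zero element does not occur in the cycle and is fixed. A unit is a power of Γ with exponent
  -- below the order p^r - 1, and multiplication by Γ is one step, the last one wrapping around.
  rcases D.eq_zero_or_isUnit x with rfl | ⟨u, rfl⟩
  · rw [mul_zero]
    have h1 := D.lab_pos 0
    have h2 := D.lab_le 0
    refine cyc_apply_of_notMem (D.mulCycle_list_mem ha) (by omega) (by omega) ?_
    simp only [List.mem_map, List.mem_range, not_exists, not_and]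
    intro k _ h
    exact (D.Γ ^ k).ne_zero (D.lab_injective (Nat.add_left_cancel h))
  · obtain ⟨k, hk, rfl⟩ : ∃ k < p ^ r - 1, D.Γ ^ k = u := by
      have h := (mem_powers_iff_mem_zpowers).mpr (D.generates u)
      obtain ⟨k, hk⟩ := h
      refine ⟨k % (p ^ r - 1), Nat.mod_lt _ hpos, ?_⟩
      rw [← ho, pow_mod_orderOf]
      exact hk
    have hnd : ((List.range (p ^ r - 1)).map
        fun k => a + D.lab ((D.Γ ^ k : D.fieldˣ) : D.field)).Nodup := by
      refine List.nodup_range.map_on fun i hi j hj h => ?_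
      simp only [List.mem_range] at hi hj
      have h' := Units.ext (D.lab_injective (Nat.add_left_cancel h))
      exact pow_injOn_Iio_orderOf (by simpa [ho] using hi) (by simpa [ho] using hj) h'
    have h3 := cyc_apply_getElem (N := N) hnd (D.mulCycle_list_mem ha) k (by simpa using hk)
    have h4 : D.Γ ^ ((k + 1) % (p ^ r - 1)) = D.Γ * D.Γ ^ k := by
      rw [← ho, pow_mod_orderOf, pow_succ']
    simp only [List.getElem_map, List.getElem_range, List.length_map, List.length_range, h4] at h3
    rw [← Units.val_mul]
    exact h3

end FieldData

/-! ### Signed permutations of a disjoint union -/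

namespace WX

variable {α β : Type*}

/-- Signed permutations of the two parts of a disjoint union. -/
def sum : WX α × WX β →* WX (α ⊕ β) where
  toFun g := ⟨Sum.elim g.1.left g.2.left, Equiv.Perm.sumCongr g.1.right g.2.right⟩
  map_one' := ext' (by rintro (i | i) <;> rfl) (by rintro (i | i) <;> rfl)
  map_mul' g h := ext' (by rintro (i | i) <;> rfl) (by rintro (i | i) <;> rfl)

theorem sum_right_inl (g : WX α × WX β) (i : α) :
    (sum g).right (.inl i) = .inl (g.1.right i) := rfl

theorem sum_right_inr (g : WX α × WX β) (i : β) :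
    (sum g).right (.inr i) = .inr (g.2.right i) := rfl

theorem sum_left_inl (g : WX α × WX β) (i : α) : (sum g).left (.inl i) = g.1.left i := rfl

theorem sum_left_inr (g : WX α × WX β) (i : β) : (sum g).left (.inr i) = g.2.left i := rfl

theorem sum_injective : Function.Injective (sum : WX α × WX β →* WX (α ⊕ β)) := by
  intro g h hgh
  refine Prod.ext (SemidirectProduct.ext (funext fun i => ?_) (Equiv.ext fun i => ?_))
    (SemidirectProduct.ext (funext fun i => ?_) (Equiv.ext fun i => ?_))
  · rw [← sum_left_inl, hgh, sum_left_inl]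
  · exact Sum.inl_injective (congrArg (fun k : WX (α ⊕ β) => k.right (.inl i)) hgh)
  · rw [← sum_left_inr, hgh, sum_left_inr]
  · exact Sum.inr_injective (congrArg (fun k : WX (α ⊕ β) => k.right (.inr i)) hgh)

theorem flips_sum_inl {g : WX α × WX β} {i : α} : Flips (sum g) (.inl i) ↔ Flips g.1 i := by
  simp only [Flips, sum_right_inl, sum_left_inl, Sum.inl.injEq]

theorem flips_sum_inr {g : WX α × WX β} {i : β} : Flips (sum g) (.inr i) ↔ Flips g.2 i := by
  simp only [Flips, sum_right_inr, sum_left_inr, Sum.inr.injEq]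

end WX

/-! ### Signed affine permutations -/

section affine

variable {F : Type*} [CommRing F]

/-- Translations. -/
def trF : Multiplicative F →* WX F where
  toFun a := SemidirectProduct.inr (Equiv.addRight a.toAdd)
  map_one' := WX.ext' (fun x => add_zero x) fun _ => rfl
  map_mul' a b := WX.ext' (fun x => by
    change x + (a.toAdd + b.toAdd) = x + b.toAdd + a.toAdd
    ring) fun _ => rfl

theorem trF_right (a : Multiplicative F) (x : F) : (trF a).right x = x + a.toAdd := rfl

theorem trF_injective : Function.Injective (trF : Multiplicative F →* WX F) := by
  intro a b h
  have h1 := trF_right a 0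
  rw [h, trF_right, zero_add, zero_add] at h1
  exact Multiplicative.toAdd.injective h1.symm

/-- The linear part of an affine permutation. -/
def affUnit : (F ≃ᵃ[F] F) →* Fˣ where
  toFun f :=
    { val := f.linear 1
      inv := f.linear.symm 1
      val_inv := by
        rw [mul_comm, ← smul_eq_mul, ← map_smul, smul_eq_mul, mul_one,
          LinearEquiv.apply_symm_apply]
      inv_val := by
        rw [mul_comm, ← smul_eq_mul, ← map_smul, smul_eq_mul, mul_one,
          LinearEquiv.symm_apply_apply] }
  map_one' := Units.ext rfl
  map_mul' f g := Units.ext (by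
    change f.linear (g.linear 1) = f.linear 1 * g.linear 1
    rw [mul_comm, ← smul_eq_mul, ← map_smul, smul_eq_mul, mul_one])

theorem apply_eq_affUnit_mul_add (f : F ≃ᵃ[F] F) (x : F) : f x = affUnit f * x + f 0 := by
  have h := f.map_vadd 0 x
  simp only [vadd_eq_add, add_zero] at h
  rw [h]
  congr 1
  change f.linear x = f.linear 1 * x
  rw [mul_comm, ← smul_eq_mul, ← map_smul, smul_eq_mul, mul_one]

/-- Translations as affine permutations. -/
def affAdd (a : F) : F ≃ᵃ[F] F := AffineEquiv.constVAdd F F a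

theorem affUnit_affAdd (a : F) : affUnit (affAdd a) = 1 := Units.ext rfl

/-- Multiplications as affine permutations. -/
def affMul (u : Fˣ) : F ≃ᵃ[F] F := (DistribMulAction.toLinearEquiv F F u).toAffineEquiv

theorem affUnit_affMul (u : Fˣ) : affUnit (affMul u) = u := Units.ext (mul_one (u : F))

theorem affMul_conj_affAdd (u : Fˣ) (a : F) :
    affMul u * affAdd a * (affMul u)⁻¹ = affAdd (u * a) := by
  rw [mul_inv_eq_iff_eq_mul]
  refine AffineEquiv.ext fun x => ?_
  change u * (a + x) = u * a + u * x
  rw [mul_add]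

theorem eq_affAdd_mul_affMul (f : F ≃ᵃ[F] F) : f = affAdd (f 0) * affMul (affUnit f) := by
  refine AffineEquiv.ext fun x => ?_
  rw [apply_eq_affUnit_mul_add]
  exact add_comm _ _

/-- Multiplications are powers of the one by Γ, and conjugation by them turns the translation by 1
into the translation by any unit. -/
theorem closure_affMul_affAdd {Γ : Fˣ} (hΓ : ∀ u : Fˣ, u ∈ Subgroup.zpowers Γ)
    (hF : ∀ x : F, x = 0 ∨ ∃ u : Fˣ, (u : F) = x) :
    Subgroup.closure {affMul Γ, affAdd (1 : F)} = ⊤ := by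
  have h1 : ∀ u : Fˣ, affMul u ∈ Subgroup.closure {affMul Γ, affAdd (1 : F)} := by
    intro u
    obtain ⟨k, rfl⟩ := hΓ u
    let f : Fˣ →* (F ≃ᵃ[F] F) :=
      { toFun := affMul
        map_one' := AffineEquiv.ext fun x => one_mul x
        map_mul' := fun u v => AffineEquiv.ext fun x => mul_assoc (u : F) v x }
    change f (Γ ^ k) ∈ _
    rw [map_zpow]
    exact zpow_mem (mem_closure_left (f Γ) _) k
  have h2 : ∀ a : F, affAdd a ∈ Subgroup.closure {affMul Γ, affAdd (1 : F)} := by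
    intro a
    rcases hF a with rfl | ⟨u, rfl⟩
    · have h3 : affAdd (0 : F) = 1 := AffineEquiv.ext fun x => zero_add x
      rw [h3]
      exact one_mem _
    · have h3 := affMul_conj_affAdd u 1
      rw [mul_one] at h3
      rw [← h3]
      exact mul_mem (mul_mem (h1 u) (mem_closure_right _ _)) (inv_mem (h1 u))
  rw [eq_top_iff]
  intro f _
  rw [eq_affAdd_mul_affMul f]
  exact mul_mem (h2 _) (h1 _)

variable (χ : Fˣ →* ℤˣ)

/-- Multiplications, with signs. -/
def linF : Fˣ →* WX F where
  toFun u := ⟨fun _ => χ u, Units.mulLeft u⟩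
  map_one' := WX.ext' (fun x => one_mul x) fun _ => map_one χ
  map_mul' u v := WX.ext' (fun x => mul_assoc (u : F) v x) fun _ => map_mul χ u v

theorem linF_right (u : Fˣ) (x : F) : (linF χ u).right x = u * x := rfl

theorem linF_injective : Function.Injective (linF χ) := by
  intro u v h
  have h1 := linF_right χ u 1
  rw [h, linF_right, mul_one, mul_one] at h1
  exact Units.ext h1.symm

theorem linF_conj_trF (u : Fˣ) (a : F) :
    linF χ u * trF (.ofAdd a) * (linF χ u)⁻¹ = trF (.ofAdd (u * a)) := by
  rw [mul_inv_eq_iff_eq_mul]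
  refine WX.ext' (fun x => ?_) fun x => ?_
  · change u * (x + a) = u * x + u * a
    rw [mul_add]
  · change χ u * 1 = 1 * χ u
    rw [mul_one, one_mul]

/-- Affine permutations, with signs. -/
def affF : (F ≃ᵃ[F] F) →* WX F where
  toFun f := ⟨fun _ => χ (affUnit f), f.toEquiv⟩
  map_one' := WX.ext' (fun x => rfl) fun _ => by
    change χ (affUnit 1) = 1
    rw [map_one, map_one]
  map_mul' f g := WX.ext' (fun x => rfl) fun _ => by
    change χ (affUnit (f * g)) = χ (affUnit f) * χ (affUnit g)
    rw [map_mul, map_mul]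

theorem affF_injective : Function.Injective (affF χ) := by
  intro f g h
  exact AffineEquiv.ext fun x => congrArg (fun k : WX F => k.right x) h

theorem affF_affMul (u : Fˣ) : affF χ (affMul u) = linF χ u := by
  refine WX.ext' (fun x => rfl) fun x => ?_
  change χ (affUnit (affMul u)) = χ u
  rw [affUnit_affMul]

theorem affF_affAdd (a : F) : affF χ (affAdd a) = trF (.ofAdd a) := by
  refine WX.ext' (fun x => add_comm a x) fun x => ?_
  change χ (affUnit (affAdd a)) = 1
  rw [affUnit_affAdd, map_one]

/-- Multiplication by `Γ`, with signs and together with an element whose order divides that of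
`Γ`, generates with the translation by one a group isomorphic to the affine group. -/
theorem exists_affine_hom {β : Type*} {Γ : Fˣ} (hΓ : ∀ u : Fˣ, u ∈ Subgroup.zpowers Γ)
    (hF : ∀ x : F, x = 0 ∨ ∃ u : Fˣ, (u : F) = x) {b : WX β} (hb : orderOf b ∣ orderOf Γ) :
    ∃ f : (F ≃ᵃ[F] F) →* WX F × WX β, (∀ x, (f x).1 = affF χ x) ∧
      f.range = Subgroup.closure {(linF χ Γ, b), (trF (.ofAdd 1), 1)} := by
  -- The divisibility of orders makes Γ ↦ b a homomorphism. The group is then the graph of its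
  -- composition with the linear part, over the signed affine group.
  let η : Fˣ →* WX β := monoidHomOfForallMemZpowers hΓ hb
  have hη : η Γ = b := monoidHomOfForallMemZpowers_apply_gen hΓ hb
  refine ⟨(affF χ).prod (η.comp affUnit), fun x => rfl, ?_⟩
  rw [MonoidHom.range_eq_map, ← closure_affMul_affAdd hΓ hF, MonoidHom.map_closure,
    Set.image_pair]
  congr 2
  · exact Prod.ext (affF_affMul χ Γ) ((congrArg η (affUnit_affMul Γ)).trans hη)
  · rw [Set.singleton_eq_singleton_iff]
    exact Prod.ext (affF_affAdd χ 1) ((congrArg η (affUnit_affAdd 1)).trans (map_one η))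

end affine

/-! ### Affine groups acting on a ring and on blocks -/

section affineGroups

variable {F β : Type*} [CommRing F] {χ : Fˣ →* ℤˣ} {Γ : Fˣ} {b : WX β}

/-- Conjugation of the translation by 1 by powers of the multiplication. The second component c is
carried along, since in class 8 the translation of the field is coupled to one of a block. -/
theorem exists_trF_mem (hΓ : ∀ u : Fˣ, u ∈ Subgroup.zpowers Γ) {H : Subgroup (WX F × WX β)}
    {c : WX β} (h1 : (linF χ Γ, b) ∈ H) (h2 : (trF (.ofAdd 1), c) ∈ H) (u : Fˣ) :
    ∃ k : ℤ, (trF (.ofAdd (u : F)), b ^ k * c * (b ^ k)⁻¹) ∈ H := by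
  obtain ⟨k, rfl⟩ := hΓ u
  refine ⟨k, ?_⟩
  have h := mul_mem (mul_mem (zpow_mem h1 k) h2) (inv_mem (zpow_mem h1 k))
  rw [Prod.pow_mk, ← map_zpow, Prod.mk_mul_mk, Prod.inv_mk, Prod.mk_mul_mk, linF_conj_trF,
    mul_one] at h
  exact h

variable (hΓ : ∀ u : Fˣ, u ∈ Subgroup.zpowers Γ) (hF : ∀ x : F, x = 0 ∨ ∃ u : Fˣ, (u : F) = x)
include hΓ hF

theorem affine_closure_mulEquiv (hb : orderOf b ∣ orderOf Γ) :
    Nonempty (Subgroup.closure {(linF χ Γ, b), (trF (.ofAdd 1), 1)} ≃* (F ≃ᵃ[F] F)) := by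
  obtain ⟨f, hf, hr⟩ := exists_affine_hom χ hΓ hF hb
  rw [← hr]
  refine ⟨(MonoidHom.ofInjective fun x y h => affF_injective χ ?_).symm⟩
  rw [← hf, h, hf]

/-- The group is the graph of a homomorphism, so the second component is determined by the first. -/
theorem eq_one_of_mem_affine_closure (hb : orderOf b ∣ orderOf Γ) {v : WX F × WX β}
    (hv : v.1 = 1) (h : v ∈ Subgroup.closure {(linF χ Γ, b), (trF (.ofAdd 1), 1)}) : v = 1 := by
  obtain ⟨f, hf, hr⟩ := exists_affine_hom χ hΓ hF hb
  rw [← hr] at h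
  obtain ⟨x, rfl⟩ := h
  rw [hf, ← map_one (affF χ)] at hv
  rw [affF_injective χ hv, map_one]

/-- The subgroup K acts on the second part only. It commutes with the translations of F and is
normalized by b; it meets the affine group trivially because the latter is a graph over its first
component. -/
theorem affine_internalSemidirect {Δ : Type*} [Group Δ] [Finite Δ] {J : WX F × WX β →* Δ}
    (hJ : Function.Injective J) (hb : orderOf b ∣ orderOf Γ) {K : Subgroup (WX β)}
    (hK : ∀ k ∈ K, b * k * b⁻¹ ∈ K) {S : Subgroup Δ} {X : Set Δ}
    (hS : S ≤ Subgroup.closure {J (linF χ Γ, b), J (trF (.ofAdd 1), 1)})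
    (hSX : S ≤ Subgroup.closure X) (hKX : ∀ k ∈ K, J (1, k) ∈ Subgroup.closure X)
    (hX : ∀ x ∈ X, x ∈ K.map (J.comp (MonoidHom.inr _ _)) ⊔ S) :
    IsInternalSemidirect (K.map (J.comp (MonoidHom.inr _ _))) S (Subgroup.closure X) := by
  refine .of_closure ?_ hSX (fun s hs v hv => ?_) ?_ hX
  · rintro _ ⟨k, hk, rfl⟩
    exact hKX k hk
  · have h := conj_mem_closure (X := {J (linF χ Γ, b), J (trF (.ofAdd 1), 1)})
      (Y := (K.map (J.comp (MonoidHom.inr _ _)) : Set Δ))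
    rw [Subgroup.closure_eq] at h
    refine h ?_ s (hS hs) v hv
    rintro _ (rfl | rfl) _ ⟨k, hk, rfl⟩ <;>
    simp only [MonoidHom.comp_apply, ← map_inv, ← map_mul]
    · exact ⟨_, hK k hk, congrArg J (Prod.ext (by simp) rfl)⟩
    · exact ⟨k, hk, by simp⟩
  · rintro _ ⟨k, -, rfl⟩ hv
    have h := hS hv
    rw [← Set.image_pair, ← MonoidHom.map_closure] at h
    obtain ⟨v, hv, h1⟩ := h
    have h2 := hJ h1
    rw [← h1, eq_one_of_mem_affine_closure hΓ hF hb (congrArg Prod.fst h2) hv, map_one]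

/-- The semidirect product of the translations and the group generated by a multiplication. -/
theorem affine_translations_internalSemidirect :
    IsInternalSemidirect ((trF (F := F)).range.map (MonoidHom.inl (WX F) (WX β)))
      (Subgroup.closure {(linF χ Γ, b)})
      (Subgroup.closure {(linF χ Γ, b), (trF (.ofAdd 1), 1)}) := by
  refine .of_closure ?_ (Subgroup.closure_mono (by simp)) ?_ ?_ ?_
  · rintro _ ⟨_, ⟨a, rfl⟩, rfl⟩
    obtain ⟨a, rfl⟩ := Multiplicative.ofAdd.surjective a
    rcases hF a with rfl | ⟨u, rfl⟩
    · rw [ofAdd_zero, map_one trF, map_one (MonoidHom.inl _ _)]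
      exact one_mem _
    · obtain ⟨k, hk⟩ := exists_trF_mem hΓ
        (mem_closure_left (linF χ Γ, b) _) (mem_closure_right _ (trF (.ofAdd 1), 1)) u
      rw [mul_one, mul_inv_cancel] at hk
      exact hk
  · intro s hs
    obtain ⟨k, rfl⟩ := Subgroup.mem_closure_singleton.mp hs
    rintro _ ⟨_, ⟨a, rfl⟩, rfl⟩
    obtain ⟨a, rfl⟩ := Multiplicative.ofAdd.surjective a
    refine ⟨_, ⟨.ofAdd ((Γ ^ k : Fˣ) * a), rfl⟩, Prod.ext ?_ ?_⟩
    · rw [Prod.pow_mk, ← map_zpow]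
      exact (linF_conj_trF χ _ _).symm
    · change 1 = ((linF χ Γ, b) ^ k).2 * 1 * (((linF χ Γ, b) ^ k).2)⁻¹
      rw [mul_one, mul_inv_cancel]
  · rintro _ ⟨_, ⟨a, rfl⟩, rfl⟩ hs
    obtain ⟨k, hk⟩ := Subgroup.mem_closure_singleton.mp hs
    rw [Prod.pow_mk, ← map_zpow] at hk
    have h := congrArg (fun g : WX F × WX β => g.1.right 0) hk
    change ((Γ ^ k : Fˣ) : F) * 0 = 0 + a.toAdd at h
    rw [mul_zero, zero_add] at h
    have ha : a = 1 := Multiplicative.toAdd.injective h.symm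
    rw [ha, map_one, map_one]
  · rintro x (rfl | rfl)
    · exact Subgroup.mem_sup_right (Subgroup.subset_closure rfl)
    · exact Subgroup.mem_sup_left ⟨_, ⟨_, rfl⟩, rfl⟩

end affineGroups

/-! ### Frames and orbits for groups acting on a field and at most two blocks. -/

section affineFrames

variable {F : Type*} [CommRing F] {m : ℕ} {ν : Fin m → ℕ}

variable (F ν) in
/-- The translations of the ring and of the blocks. -/
def affTranslations : Subgroup (WX F × WX (Blocks ν)) :=
  (trF (F := F)).range.prod (translations ν Set.univ)

variable (χ : Fˣ →* ℤˣ)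

/-- Multiplications of the ring together with signed permutations of the blocks. -/
def affLin : Fˣ × lengthStab ν →* WX F × WX (Blocks ν) := (linF χ).prodMap lin

theorem affLin_conj_mem (q : Fˣ × lengthStab ν) {v : WX F × WX (Blocks ν)}
    (hv : v ∈ affTranslations F ν) : affLin χ q * v * (affLin χ q)⁻¹ ∈ affTranslations F ν := by
  obtain ⟨⟨a, ha⟩, hv⟩ := hv
  obtain ⟨a, rfl⟩ := Multiplicative.ofAdd.surjective a
  refine ⟨⟨.ofAdd (q.1 * a), ?_⟩, lin_conj_mem (J := Set.univ) (fun _ _ => trivial) hv⟩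
  rw [← linF_conj_trF χ, ha]
  rfl

theorem affTranslations_odd (hF : Odd (Nat.card F)) : Odd (Nat.card (affTranslations F ν)) := by
  rw [affTranslations, Nat.card_congr (Subgroup.prodEquiv _ _).toEquiv, Nat.card_prod]
  refine Odd.mul ?_ (translations_odd _)
  rwa [← Nat.card_congr (MonoidHom.ofInjective trF_injective).toEquiv]

theorem affTranslations_inter_affLin {v : WX F × WX (Blocks ν)} (hv : v ∈ affTranslations F ν)
    {q : Fˣ × lengthStab ν} (h : affLin χ q = v) : v = 1 := by
  obtain ⟨⟨a, ha⟩, hv⟩ := hv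
  refine Prod.ext ?_ (translations_inter_lin hv (congrArg Prod.snd h))
  have h1 : linF χ q.1 = trF a := (congrArg Prod.fst h).trans ha.symm
  have h2 := linF_right χ q.1 0
  rw [h1, trF_right, mul_zero, zero_add] at h2
  have h3 : a = 1 := Multiplicative.toAdd.injective h2
  rw [← ha, h3, map_one]
  rfl

/-- The signs of the multiplications in `Y` have product one, and their products flip each
block. -/
structure IsAffineFlipping (Y : Set (Fˣ × lengthStab ν)) : Prop where
  prod_eq : ∀ y ∈ Y, χ y.1 * ∏ b, y.2.1.left b = 1
  flips : ∀ b, ∃ q ∈ Subgroup.closure Y, WX.Flips q.2.1 b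

/-- `X` generates a group consisting of translations, transitive on the ring and on each block,
and of the multiplications generated by `Y`. -/
structure IsAffineGenerating (Γ : Fˣ) (X : Set (WX F × WX (Blocks ν)))
    (Y : Set (Fˣ × lengthStab ν)) : Prop where
  mem_cases : ∀ x ∈ X, x ∈ affTranslations F ν ∨ ∃ y ∈ Y, x = affLin χ y
  affLin_mem : ∀ y ∈ Y, affLin χ y ∈ Subgroup.closure X
  exists_mul : ∃ y ∈ Y, y.1 = Γ
  exists_add : ∃ w, (trF (.ofAdd 1), tr w) ∈ Subgroup.closure X
  exists_tr : ∀ b, ν b = 0 ∨ ∃ a w, w b = 1 ∧ (trF a, tr w) ∈ Subgroup.closure X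

namespace IsAffineGenerating

variable {χ} {Γ : Fˣ} {X : Set (WX F × WX (Blocks ν))} {Y : Set (Fˣ × lengthStab ν)}
variable (h : IsAffineGenerating χ Γ X Y)
include h

theorem map_le : (Subgroup.closure Y).map (affLin χ) ≤ Subgroup.closure X := by
  rw [Subgroup.map_le_iff_le_comap, Subgroup.closure_le]
  exact h.affLin_mem

/-- The normal part is the intersection with all translations, because the group may contain only
coupled translations of the ring and of the blocks. -/
theorem isInternalSemidirect : IsInternalSemidirect (Subgroup.closure X ⊓ affTranslations F ν)
    ((Subgroup.closure Y).map (affLin χ)) (Subgroup.closure X) := by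
  refine .of_closure inf_le_left h.map_le ?_ ?_ fun x hx => ?_
  · rintro _ ⟨q, hq, rfl⟩ v hv
    have h1 := h.map_le ⟨q, hq, rfl⟩
    exact ⟨Subgroup.mul_mem _ (Subgroup.mul_mem _ h1 hv.1) (Subgroup.inv_mem _ h1), affLin_conj_mem χ q hv.2⟩
  · rintro v hv ⟨q, -, hq⟩
    exact affTranslations_inter_affLin χ hv.2 hq
  · rcases h.mem_cases x hx with hv | ⟨y, hy, rfl⟩
    · exact Subgroup.mem_sup_left ⟨Subgroup.subset_closure hx, hv⟩
    · exact Subgroup.mem_sup_right ⟨y, Subgroup.subset_closure hy, rfl⟩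

theorem exists_move_zero (hΓ : ∀ u : Fˣ, u ∈ Subgroup.zpowers Γ)
    (hF : ∀ x : F, x = 0 ∨ ∃ u : Fˣ, (u : F) = x) (x : F) :
    ∃ g ∈ Subgroup.closure X, g.1.right x = 0 := by
  rcases hF x with rfl | ⟨u, rfl⟩
  · exact ⟨1, one_mem _, rfl⟩
  · obtain ⟨y, hy, h1⟩ := h.exists_mul
    obtain ⟨w, h2⟩ := h.exists_add
    have h3 := h.affLin_mem y hy
    change (linF χ y.1, lin y.2) ∈ _ at h3
    rw [h1] at h3
    obtain ⟨k, hk⟩ := exists_trF_mem hΓ h3 h2 u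
    refine ⟨_, inv_mem hk, ?_⟩
    change ((trF (.ofAdd (u : F)))⁻¹).right (u : F) = 0
    have h4 := WX.right_inv_apply (trF (.ofAdd (u : F))) 0
    rwa [trF_right, zero_add] at h4

theorem exists_move_bp (b : Fin m) (k : ℤ) :
    ∃ g ∈ Subgroup.closure X, g.2.right (bp b k) = bp b 0 := by
  rcases h.exists_tr b with hb | ⟨a, w, hw, hg⟩
  · refine ⟨1, one_mem _, ?_⟩
    change bp b k = bp b 0
    rw [bp_eq_iff, hb]
    simp
  · refine ⟨_, zpow_mem hg (-k), ?_⟩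
    rw [Prod.pow_mk, ← tr_zsmul, tr_right]
    simp [hw]

variable (hΓ : ∀ u : Fˣ, u ∈ Subgroup.zpowers Γ) (hF : ∀ x : F, x = 0 ∨ ∃ u : Fˣ, (u : F) = x)
include hΓ hF

/-- A unit u with ux = x for a unit x is 1 and has sign 1, so in F only 0 can be flipped, and the
generator with first component Γ flips it. Together with the base points of at most two blocks there
are at most three points. -/
theorem isFrame [Fintype F] (hm : m ≤ 2) (hodd : Odd (Nat.card F)) (hχ : χ Γ = -1)
    (hY : IsAffineFlipping χ Y) :
    IsFrame ((Subgroup.closure X ⊓ affTranslations F ν).map WX.sum)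
      (((Subgroup.closure Y).map (affLin χ)).map WX.sum) ((Subgroup.closure X).map WX.sum)
      (({0} : Finset F).disjSum (basePoints ν)) where
  toIsInternalSemidirect := h.isInternalSemidirect.map WX.sum_injective
  odd := by
    rw [Subgroup.card_map_of_injective WX.sum_injective]
    exact (affTranslations_odd hodd).of_dvd_nat (Subgroup.card_dvd_of_le inf_le_right)
  card_le := by
    have h1 : #(basePoints ν) ≤ m := Finset.card_image_le.trans (by simp)
    rw [Finset.card_disjSum, Finset.card_singleton]
    omega
  maps := by
    rintro _ ⟨_, ⟨q, -, rfl⟩, rfl⟩ p hp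
    rcases Finset.mem_disjSum.mp hp with ⟨x, hx, rfl⟩ | ⟨x, hx, rfl⟩
    · rw [Finset.mem_singleton.mp hx]
      refine Finset.inl_mem_disjSum.mpr (Finset.mem_singleton.mpr ?_)
      exact mul_zero (q.1 : F)
    · obtain ⟨b, -, rfl⟩ := Finset.mem_image.mp hx
      refine Finset.inr_mem_disjSum.mpr ?_
      change (lin q.2).right (bp b 0) ∈ _
      rw [lin_right, mul_zero]
      exact bp_zero_mem _
  flips_mem := by
    rintro _ ⟨_, ⟨q, -, rfl⟩, rfl⟩ (x | x) hx
    · rw [WX.flips_sum_inl] at hx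
      refine Finset.inl_mem_disjSum.mpr (Finset.mem_singleton.mpr ?_)
      rcases hF x with hx0 | ⟨u, rfl⟩
      · exact hx0
      · have h1 : q.1 * u = 1 * u := (Units.ext hx.1).trans (one_mul u).symm
        have h2 : χ q.1 = -1 := hx.2
        rw [mul_right_cancel h1, map_one] at h2
        exact absurd h2 (by decide)
    · obtain ⟨k, hk⟩ := exists_bp x
      rw [WX.flips_sum_inr] at hx
      rw [hk] at hx ⊢
      rw [flips_lin hx]
      exact Finset.inr_mem_disjSum.mpr (bp_zero_mem _)
  flipped := by
    intro p hp
    rcases Finset.mem_disjSum.mp hp with ⟨x, hx, rfl⟩ | ⟨x, hx, rfl⟩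
    · obtain ⟨y, hy, h1⟩ := h.exists_mul
      refine ⟨_, ⟨_, ⟨y, Subgroup.subset_closure hy, rfl⟩, rfl⟩, WX.flips_sum_inl.mpr ?_⟩
      rw [Finset.mem_singleton.mp hx]
      exact ⟨mul_zero (y.1 : F), (congrArg χ h1).trans hχ⟩
    · obtain ⟨b, -, rfl⟩ := Finset.mem_image.mp hx
      obtain ⟨q, hq, h1⟩ := hY.flips b
      refine ⟨_, ⟨_, ⟨q, hq, rfl⟩, rfl⟩, WX.flips_sum_inr.mpr ⟨?_, h1.2⟩⟩
      change (lin q.2).right (bp b 0) = _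
      rw [lin_right, h1.1, mul_zero]
  move := by
    rintro (x | x)
    · obtain ⟨g, hg, h1⟩ := h.exists_move_zero hΓ hF x
      refine ⟨_, ⟨g, hg, rfl⟩, ?_⟩
      rw [WX.sum_right_inl, h1]
      exact Finset.inl_mem_disjSum.mpr (Finset.mem_singleton_self _)
    · obtain ⟨k, hk⟩ := exists_bp x
      obtain ⟨g, hg, h1⟩ := h.exists_move_bp x.1 k
      refine ⟨_, ⟨g, hg, rfl⟩, ?_⟩
      rw [WX.sum_right_inr, hk, h1]
      exact Finset.inr_mem_disjSum.mpr (bp_zero_mem _)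
  even := by
    have h1 : Subgroup.closure X ≤ ((WX.sign : WX (F ⊕ Blocks ν) →* ℤˣ).comp WX.sum).ker := by
      rw [Subgroup.closure_le]
      intro x hx
      change ∏ i, (WX.sum x).left i = 1
      rw [Fintype.prod_sum_type]
      rcases h.mem_cases x hx with ⟨⟨a, ha⟩, w, -, hw⟩ | ⟨y, hy, rfl⟩
      · simp only [WX.sum_left_inl, WX.sum_left_inr, ← ha, ← hw]
        exact (congrArg₂ _ Finset.prod_const_one Finset.prod_const_one).trans (one_mul 1)
      · rw [← hY.prod_eq y hy, ← lin_prod_left]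
        refine congrArg (· * _) ?_
        change ∏ _x : F, χ y.1 = χ y.1
        -- The constant sign of a multiplication is counted as often as F has elements, an odd
        -- number.
        rw [Finset.prod_const, Finset.card_univ, ← Nat.card_eq_fintype_card]
        obtain ⟨k, hk⟩ := hodd
        rw [hk, _root_.pow_succ, pow_mul, Int.units_sq, one_pow, one_mul]
    rintro _ ⟨g, hg, rfl⟩
    exact h1 hg

/-- The ring is a single orbit, in the position o₀ of the list, since every element can be moved to
0. The other orbits are unions of blocks. -/
theorem hasOrbitLengths [Finite F] {N : ℕ} (e : F ⊕ Blocks ν ≃ Fin N) {l : List ℕ}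
    (o₀ : Fin l.length) (β : Fin m → Fin l.length) (rep : Fin l.length → Fin m)
    (hβ : ∀ b, β b ≠ o₀) (hrep : ∀ o, o = o₀ ∨ β (rep o) = o)
    (hY : ∀ q ∈ Y, ∀ b, β (q.2.1.right b) = β b)
    (hr : ∀ b, ∃ q ∈ Subgroup.closure Y, q.2.1.right b = rep (β b))
    (hcard : ∀ o, (if o₀ = o then Nat.card F else 0) +
      ∑ b, (if β b = o then 2 * ν b + 1 else 0) = l.get o) :
    HasOrbitLengths (((Subgroup.closure X).map WX.sum).map (WX.relabel e)) l := by
  have := Fintype.ofFinite F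
  have key : ∀ g ∈ Subgroup.closure X, ∀ p, β (g.2.right p).1 = β p.1 := by
    intro g hg
    induction hg using Subgroup.closure_induction with
    | mem x hx =>
      intro p
      rcases h.mem_cases x hx with ⟨-, w, -, hw⟩ | ⟨y, hy, rfl⟩
      · rw [← hw]
        rfl
      · obtain ⟨k, hk⟩ := exists_bp p
        change β ((lin y.2).right p).1 = _
        rw [hk, lin_right]
        exact hY y hy _
    | one => exact fun p => rfl
    | mul x y _ _ hx hy => intro p; rw [Prod.snd_mul, WX.mul_right_apply, hx, hy]
    | inv x _ hx =>
      intro p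
      rw [← hx, ← WX.mul_right_apply, ← Prod.snd_mul, mul_inv_cancel]
      rfl
  refine hasOrbitLengths_map e (Sum.elim (fun _ => o₀) fun p => β p.1)
    (fun o => if o = o₀ then .inl 0 else .inr (bp (rep o) 0)) (fun o => ?_) ?_ ?_ fun o => ?_
  · split_ifs with ho
    · exact ho.symm
    · exact (hrep o).resolve_left ho
  · rintro _ ⟨g, hg, rfl⟩ (x | p)
    · rfl
    · exact key g hg p
  · rintro (x | p)
    · obtain ⟨g, hg, h1⟩ := h.exists_move_zero hΓ hF x
      refine ⟨_, ⟨g, hg, rfl⟩, ?_⟩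
      rw [WX.sum_right_inl, h1]
      exact (if_pos rfl).symm
    · obtain ⟨k, hk⟩ := exists_bp p
      obtain ⟨g, hg, h1⟩ := h.exists_move_bp p.1 k
      obtain ⟨q, hq, h2⟩ := hr p.1
      refine ⟨_, ⟨affLin χ q * g, mul_mem (h.map_le ⟨q, hq, rfl⟩) hg, rfl⟩, ?_⟩
      rw [WX.sum_right_inr, Sum.elim_inr, if_neg (hβ _), Prod.snd_mul, WX.mul_right_apply]
      nth_rw 1 [hk]
      rw [h1]
      change Sum.inr ((lin q.2).right _) = _
      rw [lin_right, mul_zero, h2]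
  · rw [← hcard o, Nat.card_eq_fintype_card, Fintype.card_subtype, Finset.card_filter,
      Fintype.sum_sum_type, Fintype.sum_sigma]
    refine congrArg₂ _ ?_ (Finset.sum_congr rfl fun b _ => ?_)
    · change ∑ _x : F, (if o₀ = o then 1 else 0) = _
      rw [Finset.sum_const, Finset.card_univ]
      split_ifs <;> simp
    · change ∑ _x : ZMod (2 * ν b + 1), (if β b = o then 1 else 0) = _
      rw [Finset.sum_const, Finset.card_univ, ZMod.card]
      split_ifs <;> simp

end IsAffineGenerating

end affineFrames

/-! ### Labels of the points of a field and of blocks -/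

section affineLabels

/-- The signed permutations of the labels given by those of the two parts. -/
def affHom {F : Type*} {m N : ℕ} {ν : Fin m → ℕ} (e : F ⊕ Blocks ν ≃ Fin N) :
    WX F × WX (Blocks ν) →* WB N := (WX.relabel e).comp WX.sum

theorem affHom_injective {F : Type*} {m N : ℕ} {ν : Fin m → ℕ} (e : F ⊕ Blocks ν ≃ Fin N) :
    Function.Injective (affHom e) := (WX.relabel_injective e).comp WX.sum_injective

/-- The permutation `τ` of the labels multiplies the elements of the ring by `u`, permutes the
blocks according to `π` and multiplies the coordinates of the blocks by `μ`. -/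
def ActsAffine {F : Type*} [CommRing F] {m N : ℕ} {ν : Fin m → ℕ} (e : F ⊕ Blocks ν ≃ Fin N)
    (τ : Equiv.Perm (Fin N)) (u : Fˣ) (π : Equiv.Perm (Fin m)) (μ : Fin m → ℤˣ) : Prop :=
  (∀ x, τ (e (.inl x)) = e (.inl (u * x))) ∧
    ∀ b k, τ (e (.inr (bp b k))) = e (.inr (bp (π b) (μ b * k)))

theorem ActsAffine.mul {F : Type*} [CommRing F] {m N : ℕ} {ν : Fin m → ℕ}
    {e : F ⊕ Blocks ν ≃ Fin N} {τ τ' : Equiv.Perm (Fin N)} {u u' : Fˣ}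
    {π π' : Equiv.Perm (Fin m)} {μ μ' : Fin m → ℤˣ} (h : ActsAffine e τ u π μ)
    (h' : ActsAffine e τ' u' π' μ') :
    ActsAffine e (τ * τ') (u * u') (π * π') (fun b => μ (π' b) * μ' b) := by
  refine ⟨fun x => ?_, fun b k => ?_⟩
  · rw [Equiv.Perm.mul_apply, h'.1, h.1, Units.val_mul, mul_assoc]
  · rw [Equiv.Perm.mul_apply, h'.2, h.2, Units.val_mul, mul_assoc]
    rfl

theorem ActsAffine.one {F : Type*} [CommRing F] {m N : ℕ} {ν : Fin m → ℕ}
    {e : F ⊕ Blocks ν ≃ Fin N} : ActsAffine e 1 1 1 1 := by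
  constructor <;> intros <;> simp

noncomputable instance FieldData.instFintype {p r : ℕ} (D : FieldData p r) [Fact p.Prime] :
    Fintype D.field :=
  have := D.finite_field
  Fintype.ofFinite _

variable {p r : ℕ} (D : FieldData p r) [hp : Fact p.Prime] {m : ℕ} {ν o : Fin m → ℕ}
  {a N : ℕ}

/-- The labels after `a` are those of the field and the labels after `o b` are those of the
block `b`. -/
structure IsLayout (p r : ℕ) (ν o : Fin m → ℕ) (a N : ℕ) : Prop where
  card : p ^ r + ∑ b, (2 * ν b + 1) = N
  field_le : a + p ^ r ≤ N
  block_le : ∀ b, o b + 2 * ν b + 1 ≤ N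
  disjoint : ∀ b, o b + 2 * ν b + 1 ≤ a ∨ a + p ^ r ≤ o b
  block_disjoint : ∀ b b', b ≠ b' → o b + 2 * ν b + 1 ≤ o b' ∨ o b' + 2 * ν b' + 1 ≤ o b

variable (o a) in
/-- The label of a point. -/
noncomputable def affLabel : D.field ⊕ Blocks ν → ℕ :=
  Sum.elim (fun x => a + D.lab x) fun p => o p.1 + label (ν p.1) p.2

theorem affLabel_injective (h : IsLayout p r ν o a N) :
    Function.Injective (affLabel D o a : D.field ⊕ Blocks ν → ℕ) := by
  have h1 : ∀ (x : D.field) (b : Fin m) (y : ZMod (2 * ν b + 1)),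
      a + D.lab x ≠ o b + label (ν b) y := by
    intro x b y
    have := D.lab_pos x
    have := D.lab_le x
    have := label_pos _ y
    have := label_le _ y
    have := h.disjoint b
    omega
  rintro (x | ⟨b, y⟩) (x' | ⟨b', y'⟩) hxy
  · rw [D.lab_injective (Nat.add_left_cancel hxy)]
  · exact absurd hxy (h1 x b' y')
  · exact absurd hxy.symm (h1 x' b y)
  · have hxy' : o b + label (ν b) y = o b' + label (ν b') y' := hxy
    by_cases hb : b = b'
    · subst hb
      rw [label_injective _ (Nat.add_left_cancel hxy')]
    · have := label_pos _ y
      have := label_le _ y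
      have := label_pos _ y'
      have := label_le _ y'
      have := h.block_disjoint b b' hb
      omega

variable [NeZero N] (h : IsLayout p r ν o a N)

/-- The points of the field and of the blocks labelled by `1, …, N`. -/
noncomputable def affEquiv : D.field ⊕ Blocks ν ≃ Fin N :=
  labelEquiv (affLabel D o a)
    (by
      rintro (x | ⟨b, y⟩)
      · have h1 := D.lab_pos x
        have h2 := D.lab_le x
        have h3 := h.field_le
        change 1 ≤ a + D.lab x ∧ a + D.lab x ≤ N
        omega
      · have h1 := label_pos _ y
        have h2 := label_le _ y
        have h3 := h.block_le b
        change 1 ≤ o b + label (ν b) y ∧ o b + label (ν b) y ≤ N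
        omega) (affLabel_injective D h)
    (by
      rw [Fintype.card_sum, Fintype.card_sigma, ← Nat.card_eq_fintype_card, D.card_field]
      simp only [ZMod.card]
      exact h.card)

theorem affEquiv_inl (x : D.field) : affEquiv D h (.inl x) = pt (a + D.lab x) := rfl

theorem affEquiv_inr (b : Fin m) (k : ℤ) :
    affEquiv D h (.inr (bp b k)) = pt (o b + intLabel (ν b) k) := rfl

include h in
omit [NeZero N] in
theorem lab_bounds (x : D.field) : 1 ≤ a + D.lab x ∧ a + D.lab x ≤ N ∧
    ∀ b, a + D.lab x ≤ o b ∨ o b + 2 * ν b + 1 < a + D.lab x := by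
  have h1 := D.lab_pos x
  have h2 := D.lab_le x
  have h3 := h.field_le
  refine ⟨by omega, by omega, fun b => ?_⟩
  have := h.disjoint b
  omega

include h in
omit [NeZero N] hp in
theorem intLabel_bounds (b : Fin m) (k : ℤ) : 1 ≤ o b + intLabel (ν b) k ∧
    o b + intLabel (ν b) k ≤ N ∧
    (o b + intLabel (ν b) k ≤ a ∨ a + p ^ r < o b + intLabel (ν b) k) ∧
    ∀ b', b ≠ b' → o b + intLabel (ν b) k ≤ o b' ∨
      o b' + 2 * ν b' + 1 < o b + intLabel (ν b) k := by
  have h1 := intLabel_pos (ν b) k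
  have h2 := intLabel_le (ν b) k
  have h3 := h.block_le b
  have h4 := h.disjoint b
  refine ⟨by omega, by omega, by omega, fun b' hb => ?_⟩
  have := h.block_disjoint b b' hb
  omega

theorem mulCycle_actsAffine : ActsAffine (affEquiv D h) (D.mulCycle a) D.Γ 1 1 := by
  refine ⟨fun x => ?_, fun b k => ?_⟩
  · exact D.mulCycle_apply h.field_le x
  · obtain ⟨h1, h2, h3, -⟩ := intLabel_bounds h b k
    rw [affEquiv_inr, D.mulCycle_apply_of_notMem h.field_le h1 h2 h3, ← affEquiv_inr D h]
    simp

theorem flips_actsAffine (b : Fin m) {a' n : ℕ} (ha : o b = a') (hn : ν b = n) :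
    ActsAffine (affEquiv D h) (flips a' n) 1 1 (Function.update 1 b (-1)) := by
  subst ha hn
  have hle := h.block_le b
  refine ⟨fun x => ?_, fun b' k => ?_⟩
  · obtain ⟨h1, h2, h3⟩ := lab_bounds D h x
    have := h3 b
    rw [affEquiv_inl, flips_apply_of_notMem hle h1 h2 (by omega), ← affEquiv_inl D h]
    simp
  · obtain ⟨h1, h2, -, h3⟩ := intLabel_bounds h b' k
    rw [affEquiv_inr]
    by_cases hb : b' = b
    · subst hb
      rw [intLabel, flips_apply hle, Function.update_self, ← Int.cast_neg, ← intLabel,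
        ← affEquiv_inr D h]
      simp
    · have := h3 b hb
      rw [flips_apply_of_notMem hle h1 h2 (by omega), ← affEquiv_inr D h,
        Function.update_of_ne hb]
      simp

theorem swap_actsAffine {b b' : Fin m} (hne : b ≠ b') {i j : ℕ} (hb : ν b = 0) (hb' : ν b' = 0)
    (hi : o b + 1 = i) (hj : o b' + 1 = j) :
    ActsAffine (affEquiv D h) (cyc [i, j]) 1 (Equiv.swap b b') 1 := by
  have key : ∀ b₁ k, ν b₁ = 0 → (bp b₁ k : Blocks ν) = bp b₁ 0 := by
    intro b₁ k h
    rw [bp_eq_iff, h]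
    simp
  have h1 : ∀ b₁, ν b₁ = 0 → affEquiv D h (.inr (bp b₁ 0)) = pt (o b₁ + 1) := by
    intro b₁ h
    rw [affEquiv_inr]
    congr 2
  refine ⟨fun x => ?_, fun b₁ k => ?_⟩
  · rw [cyc_pair, ← hi, ← hj, ← h1 b hb, ← h1 b' hb', Equiv.swap_apply_of_ne_of_ne] <;> simp
  rw [cyc_pair, ← hi, ← hj, ← h1 b hb, ← h1 b' hb', Equiv.swap_apply_def, Equiv.swap_apply_def]
  simp only [Equiv.apply_eq_iff_eq, Pi.one_apply, Units.val_one, one_mul, Sum.inr.injEq]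
  by_cases e1 : b₁ = b
  · subst e1
    rw [if_pos (key _ _ hb), if_pos rfl, key _ k hb']
  · rw [if_neg fun h => e1 (congrArg Sigma.fst h), if_neg e1]
    by_cases e2 : b₁ = b'
    · subst e2
      rw [if_pos (key _ _ hb'), if_pos rfl, key _ k hb]
    · rw [if_neg fun h => e2 (congrArg Sigma.fst h), if_neg e2]

theorem perm_rot_eq_affHom (b : Fin m) {a' n : ℕ} (ha : o b = a') (hn : ν b = n) :
    perm (rot a' n) = affHom (affEquiv D h) (1, tb ν b) := by
  subst ha hn
  have hle := h.block_le b
  refine perm_eq_relabel ?_ (by rintro (x | x) <;> rfl)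
  rintro (x | x)
  · obtain ⟨h1, h2, h3⟩ := lab_bounds D h x
    have := h3 b
    rw [affEquiv_inl, rot_apply_of_notMem hle h1 h2 this, ← affEquiv_inl D h]
    rfl
  · obtain ⟨k, hk⟩ := exists_bp x
    rw [hk, WX.sum_right_inr, tb, tr_right, affEquiv_inr]
    obtain ⟨h1, h2, -, h3⟩ := intLabel_bounds h x.1 k
    by_cases hb : x.1 = b
    · rw [hb, Pi.single_eq_same, intLabel, rot_apply hle, affEquiv_inr, intLabel]
      push_cast
      rfl
    · rw [Pi.single_eq_of_ne hb, add_zero, rot_apply_of_notMem hle h1 h2 (h3 b hb),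
        ← affEquiv_inr D h]

theorem perm_addCycles_eq_affHom (hr : 1 ≤ r) :
    perm (addCycles p r a) = affHom (affEquiv D h) (trF (.ofAdd 1), 1) := by
  refine perm_eq_relabel ?_ (by rintro (x | x) <;> rfl)
  rintro (x | x)
  · exact D.addCycles_apply hr h.field_le x
  · obtain ⟨k, hk⟩ := exists_bp x
    obtain ⟨h1, h2, h3, -⟩ := intLabel_bounds h x.1 k
    rw [hk, affEquiv_inr, FieldData.addCycles_apply_of_notMem hr h.field_le h1 h2 h3, ← affEquiv_inr D h]
    rfl

/-- The labels of the points with sign `-1`. -/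
def IsSignSet (p r : ℕ) (ν o : Fin m → ℕ) (a : ℕ) (S : Finset ℕ) (ε : ℤˣ)
    (ε' : Fin m → ℤˣ) : Prop :=
  (∀ j, 1 ≤ j → j ≤ p ^ r → (a + j ∈ S ↔ ε = -1)) ∧
    ∀ b j, 1 ≤ j → j ≤ 2 * ν b + 1 → (o b + j ∈ S ↔ ε' b = -1)

theorem c_mul_perm_eq_affHom {S : Finset ℕ} {τ : Equiv.Perm (Fin N)} {χ : D.fieldˣ →* ℤˣ}
    {u : D.fieldˣ} {π : Equiv.Perm (Fin m)} {μ : Fin m → ℤˣ}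
    (hτ : ActsAffine (affEquiv D h) τ u π μ) {q : lengthStab ν} (hπ : ∀ b, π b = q.1.right b)
    (hμ : ∀ b, ν b = 0 ∨ μ b = q.1.left (q.1.right b))
    (hS : IsSignSet p r ν o a S (χ u) q.1.left) :
    c S * perm τ = affHom (affEquiv D h) (affLin χ (u, q)) := by
  refine c_mul_perm_eq_relabel ?_ ?_
  · rintro (x | x)
    · exact hτ.1 x
    · obtain ⟨k, hk⟩ := exists_bp x
      change _ = affEquiv D h (.inr ((lin q).right x))
      rw [hk, hτ.2, lin_right, hπ _]
      congr 2
      rcases hμ x.1 with h | h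
      · rw [bp_eq_iff, q.2, h]
        simp
      · rw [h]
        rfl
  · rintro (x | x)
    · obtain ⟨h1, h2, -⟩ := lab_bounds D h x
      rw [affEquiv_inl, pt_val_add_one h1 h2]
      exact hS.1 _ (D.lab_pos x) (D.lab_le x)
    · obtain ⟨k, hk⟩ := exists_bp x
      obtain ⟨h1, h2, -⟩ := intLabel_bounds h x.1 k
      rw [hk, affEquiv_inr, pt_val_add_one h1 h2]
      exact hS.2 _ _ (intLabel_pos _ _) (intLabel_le _ _)

theorem c_eq_affHom {S : Finset ℕ} {χ : D.fieldˣ →* ℤˣ} {q : lengthStab ν}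
    (hπ : ∀ b, q.1.right b = b) (hμ : ∀ b, ν b = 0 ∨ 1 = q.1.left (q.1.right b))
    (hS : IsSignSet p r ν o a S 1 q.1.left) :
    c S = affHom (affEquiv D h) (affLin χ (1, q)) := by
  rw [← mul_one (c S), ← map_one (SemidirectProduct.inr : _ →* WB N)]
  exact c_mul_perm_eq_affHom D h .one (fun b => (hπ b).symm) hμ (by rwa [map_one])

theorem perm_eq_affHom {τ : Equiv.Perm (Fin N)} {χ : D.fieldˣ →* ℤˣ} {q : lengthStab ν}
    (hτ : ActsAffine (affEquiv D h) τ 1 q.1.right 1) (hq : q.1.left = 1) :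
    perm τ = affHom (affEquiv D h) (affLin χ (1, q)) := by
  rw [← one_mul (perm τ), ← c_empty]
  refine c_mul_perm_eq_affHom D h hτ (fun _ => rfl) (fun b => .inr (by rw [hq]; rfl)) ?_
  simp [IsSignSet, hq]

/-! ### The groups of signed permutations of the labels -/

theorem two_dvd_pow_sub_one (h2 : 2 < p) : 2 ∣ p ^ r - 1 :=
  ((hp.out.odd_of_ne_two (by omega)).pow.tsub_odd odd_one).two_dvd

/-- The quadratic character: Γ generates the units and has the even order p^r - 1. -/
theorem FieldData.exists_character (h2 : 2 < p) : ∃ χ : D.fieldˣ →* ℤˣ, χ D.Γ = -1 := by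
  have h4 : orderOf (-1 : ℤˣ) ∣ orderOf D.Γ := by
    rw [D.orderOf_generator]
    exact (orderOf_dvd_of_pow_eq_one (by decide)).trans (two_dvd_pow_sub_one h2)
  exact ⟨monoidHomOfForallMemZpowers D.generates h4, monoidHomOfForallMemZpowers_apply_gen _ _⟩

namespace IsAffineGenerating

variable {D} {h} {χ : D.fieldˣ →* ℤˣ} {X : Set (WX D.field × WX (Blocks ν))}
  {Y : Set (D.fieldˣ × lengthStab ν)} (hX : IsAffineGenerating χ D.Γ X Y)
include hX

theorem isFrame_labels (hm : m ≤ 2) (h2 : 2 < p) (hχ : χ D.Γ = -1) (hY : IsAffineFlipping χ Y) :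
    ∃ B, IsFrame ((Subgroup.closure X ⊓ affTranslations D.field ν).map (affHom (affEquiv D h)))
      (((Subgroup.closure Y).map (affLin χ)).map (affHom (affEquiv D h)))
      ((Subgroup.closure X).map (affHom (affEquiv D h))) B := by
  have hodd : Odd (Nat.card D.field) := by
    rw [D.card_field]
    exact (hp.out.odd_of_ne_two (by omega)).pow
  simp only [affHom, ← Subgroup.map_map]
  exact ⟨_, (hX.isFrame D.generates D.eq_zero_or_isUnit hm hodd hχ hY).map (affEquiv D h)⟩

theorem hasOrbitLengths_labels {l : List ℕ} (o₀ : Fin l.length) (β : Fin m → Fin l.length)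
    (rep : Fin l.length → Fin m) (hβ : ∀ b, β b ≠ o₀) (hrep : ∀ o, o = o₀ ∨ β (rep o) = o)
    (hY : ∀ q ∈ Y, ∀ b, β (q.2.1.right b) = β b)
    (hr : ∀ b, ∃ q ∈ Subgroup.closure Y, q.2.1.right b = rep (β b))
    (hcard : ∀ o, (if o₀ = o then p ^ r else 0) +
      ∑ b, (if β b = o then 2 * ν b + 1 else 0) = l.get o) :
    HasOrbitLengths ((Subgroup.closure X).map (affHom (affEquiv D h))) l := by
  have h1 := hX.hasOrbitLengths D.generates D.eq_zero_or_isUnit (affEquiv D h) o₀ β rep hβ hrep hY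
    hr (by rw [D.card_field]; exact hcard)
  rwa [Subgroup.map_map] at h1

end IsAffineGenerating

end affineLabels

/-! ### A field together with one or two single points -/

section affinePoints

variable {p r : ℕ} [hp : Fact p.Prime] {m : ℕ}

/-- The signed permutations of blocks with one point. -/
def zeroStab (m : ℕ) : WX (Fin m) →* lengthStab (fun _ : Fin m => 0) where
  toFun q := ⟨q, fun _ => rfl⟩
  map_one' := rfl
  map_mul' _ _ := rfl

variable (p r m) in
omit hp in
theorem zeroLayout : IsLayout p r (fun _ : Fin m => 0) (fun b => p ^ r + b.val) 0 (p ^ r + m) where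
  card := by simp
  field_le := by omega
  block_le b := by have := b.2; omega
  disjoint b := .inr (by omega)
  block_disjoint b b' hb := by
    have := Fin.val_ne_of_ne hb
    omega

variable [NeZero (p ^ r + m)] (D : FieldData p r) (χ : D.fieldˣ →* ℤˣ)

/-- The signed permutations of the labels given by those of the two parts. -/
noncomputable def pointHom (m : ℕ) [NeZero (p ^ r + m)] :
    WX D.field × WX (Blocks fun _ : Fin m => 0) →* WB (p ^ r + m) :=
  affHom (affEquiv D (zeroLayout p r m))

theorem pointHom_injective : Function.Injective (pointHom D m) := affHom_injective _

/-- Multiplications and signed permutations of the single points. -/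
noncomputable def pointLin : D.fieldˣ × WX (Fin m) →* WB (p ^ r + m) :=
  ((pointHom D m).comp (affLin χ)).comp ((MonoidHom.id _).prodMap (zeroStab m))

theorem pointLin_injective : Function.Injective (pointLin D χ : D.fieldˣ × WX (Fin m) →* _) := by
  rintro ⟨u, q⟩ ⟨u', q'⟩ h
  have h1 := pointHom_injective D h
  exact Prod.ext (linF_injective χ (congrArg Prod.fst h1))
    (congrArg Subtype.val (lin_injective (congrArg Prod.snd h1)))

theorem orderOf_pointLin (u : D.fieldˣ) (q : WX (Fin m)) :
    orderOf (pointLin D χ (u, q)) = (orderOf u).lcm (orderOf q) := by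
  rw [orderOf_injective _ (pointLin_injective D χ), Prod.orderOf_mk]

theorem perm_addCycles_eq_pointHom (hr : 1 ≤ r) :
    perm (addCycles p r 0) = pointHom D m (trF (.ofAdd 1), 1) :=
  perm_addCycles_eq_affHom D _ hr

variable {D χ} in
omit [NeZero (p ^ r + m)] in
theorem orderOf_lin_zeroStab_dvd {q : WX (Fin m)} {k : ℕ} (hq : q ^ k = 1) (hk : k ∣ p ^ r - 1) :
    orderOf (lin (zeroStab m q)) ∣ orderOf D.Γ := by
  rw [D.orderOf_generator]
  refine (orderOf_dvd_of_pow_eq_one ?_).trans hk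
  rw [← map_pow, ← map_pow, hq, map_one, map_one]

theorem points_affine (hr : 1 ≤ r) {q : WX (Fin m)} {k : ℕ} (hq : q ^ k = 1)
    (hk : k ∣ p ^ r - 1) :
    Nonempty (Subgroup.closure {pointLin D χ (D.Γ, q), perm (addCycles p r 0)} ≃*
      (D.field ≃ᵃ[D.field] D.field)) := by
  have h := nonempty_map_mulEquiv (pointHom_injective D) (affine_closure_mulEquiv (χ := χ)
    D.generates D.eq_zero_or_isUnit (orderOf_lin_zeroStab_dvd hq hk))
  rwa [MonoidHom.map_closure, Set.image_pair, ← perm_addCycles_eq_pointHom D hr] at h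

/-- The order of q need not divide that of Γ, so the group need not be affine; the pair (Γ, q) still
generates a cyclic complement of the translations, whose order is the least common multiple. -/
theorem points_semidirect (hr : 1 ≤ r) (q : WX (Fin m)) {k : ℕ}
    (hk : (p ^ r - 1).lcm (orderOf q) = k) :
    IsSemidirect (Multiplicative D.field) (Cyc k)
      (Subgroup.closure {pointLin D χ (D.Γ, q), perm (addCycles p r 0)}) := by
  have h := (affine_translations_internalSemidirect (χ := χ) (b := lin (zeroStab m q))
    D.generates D.eq_zero_or_isUnit).map (pointHom_injective D)
  rw [MonoidHom.map_closure, MonoidHom.map_closure, Set.image_pair, Set.image_singleton,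
    ← perm_addCycles_eq_pointHom D hr] at h
  obtain ⟨e⟩ := nonempty_map_mulEquiv (pointHom_injective D) (nonempty_map_mulEquiv
    (f := MonoidHom.inl (WX D.field) (WX (Blocks fun _ : Fin m => 0)))
    (fun x y hxy => congrArg Prod.fst hxy)
    ⟨(MonoidHom.ofInjective (trF_injective (F := D.field))).symm⟩)
  refine h.isSemidirect e (nonempty_mulEquiv_cyc ?_).some
  refine (orderOf_pointLin D χ D.Γ q).trans ?_
  rw [D.orderOf_generator, hk]

theorem points_internalSemidirect (hr : 1 ≤ r) {q : WX (Fin m)} {k : ℕ} (hq : q ^ k = 1)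
    (hk : k ∣ p ^ r - 1) {K : Subgroup (WX (Fin m))} (hK : ∀ k ∈ K, q * k * q⁻¹ ∈ K)
    {S : Subgroup (WB (p ^ r + m))} {X : Set (WB (p ^ r + m))}
    (hS : S ≤ Subgroup.closure {pointLin D χ (D.Γ, q), perm (addCycles p r 0)})
    (hSX : S ≤ Subgroup.closure X) (hKX : ∀ k ∈ K, pointLin D χ (1, k) ∈ Subgroup.closure X)
    (hX : ∀ x ∈ X, x ∈ K.map ((pointLin D χ).comp (MonoidHom.inr _ _)) ⊔ S) :
    IsInternalSemidirect (K.map ((pointLin D χ).comp (MonoidHom.inr _ _))) S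
      (Subgroup.closure X) := by
  have e : K.map ((pointLin D χ).comp (MonoidHom.inr _ _)) =
      (K.map (lin.comp (zeroStab m))).map ((pointHom D m).comp (MonoidHom.inr _ _)) := by
    rw [Subgroup.map_map]
    congr 1
    refine MonoidHom.ext fun k => congrArg (pointHom D m) (Prod.ext (map_one (linF χ)) rfl)
  rw [e] at hX ⊢
  rw [perm_addCycles_eq_pointHom D hr] at hS
  refine affine_internalSemidirect (χ := χ) D.generates D.eq_zero_or_isUnit
    (pointHom_injective D) (orderOf_lin_zeroStab_dvd hq hk) ?_ hS hSX ?_ hX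
  · rintro _ ⟨k, hk, rfl⟩
    exact ⟨_, hK k hk, by simp⟩
  · rintro _ ⟨k, hk, rfl⟩
    have h := hKX k hk
    rw [pointLin, MonoidHom.comp_apply, MonoidHom.comp_apply] at h
    convert h using 2
    exact Prod.ext (map_one (linF χ)).symm rfl

section points_main

variable {D χ} {Y : Set (D.fieldˣ × WX (Fin m))}

variable (D χ Y) in
omit hp [NeZero (p ^ r + m)] in
theorem points_generating (hY : ∃ y ∈ Y, y.1 = D.Γ) :
    IsAffineGenerating χ D.Γ (insert (trF (.ofAdd 1), 1)
      (affLin χ '' ((MonoidHom.id _).prodMap (zeroStab m) '' Y)))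
      ((MonoidHom.id _).prodMap (zeroStab m) '' Y) where
  mem_cases := by
    rintro _ (rfl | ⟨y, hy, rfl⟩)
    · exact .inl ⟨⟨_, rfl⟩, one_mem _⟩
    · exact .inr ⟨y, hy, rfl⟩
  affLin_mem y hy := Subgroup.subset_closure (.inr ⟨y, hy, rfl⟩)
  exists_mul := by
    obtain ⟨y, hy, h⟩ := hY
    exact ⟨_, ⟨y, hy, rfl⟩, h⟩
  exists_add := ⟨0, Subgroup.subset_closure (.inl (Prod.ext rfl (tr_eq_one_iff.mpr (by simp))))⟩
  exists_tr _ := .inl rfl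

theorem points_closure (hr : 1 ≤ r) :
    (Subgroup.closure (insert (trF (.ofAdd 1), 1)
      (affLin χ '' ((MonoidHom.id _).prodMap (zeroStab m) '' Y)))).map (pointHom D m) =
    Subgroup.closure (insert (perm (addCycles p r 0)) (pointLin D χ '' Y)) := by
  rw [MonoidHom.map_closure, Set.image_insert_eq, ← perm_addCycles_eq_pointHom D hr,
    Set.image_image, Set.image_image]
  rfl

variable (hr : 1 ≤ r) (hY : ∃ y ∈ Y, y.1 = D.Γ)
include hr hY

theorem points_main (hm : m ≤ 2) (h2 : 2 < p) (hχ : χ D.Γ = -1)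
    (hsign : ∀ y ∈ Y, χ y.1 * ∏ b, y.2.left b = 1)
    (hflips : ∀ b, ∃ q ∈ Subgroup.closure Y, WX.Flips q.2 b) :
    IsAdmissible (Subgroup.closure (insert (perm (addCycles p r 0)) (pointLin D χ '' Y))) ∧
    ContainsSylowTwo (Subgroup.closure (insert (perm (addCycles p r 0)) (pointLin D χ '' Y)))
      (Subgroup.closure (pointLin D χ '' Y)) := by
  have hf : IsAffineFlipping χ ((MonoidHom.id _).prodMap (zeroStab m) '' Y) := by
    refine ⟨by rintro _ ⟨y, hy, rfl⟩; exact hsign y hy, fun b => ?_⟩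
    obtain ⟨q, hq, hb⟩ := hflips b
    rw [← MonoidHom.map_closure]
    exact ⟨_, ⟨q, hq, rfl⟩, hb⟩
  obtain ⟨B, h⟩ := (points_generating D χ Y hY).isFrame_labels (h := zeroLayout p r m) hm h2 hχ hf
  rw [show affHom (affEquiv D (zeroLayout p r m)) = pointHom D m from rfl, points_closure hr,
    ← MonoidHom.map_closure, Subgroup.map_map, Subgroup.map_map] at h
  rw [← MonoidHom.map_closure]
  exact ⟨h.isAdmissible, h.containsSylowTwo⟩

theorem points_orbits {l : List ℕ} (o₀ : Fin l.length)
    (β : Fin m → Fin l.length) (rep : Fin l.length → Fin m) (hβ : ∀ b, β b ≠ o₀)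
    (hrep : ∀ o, o = o₀ ∨ β (rep o) = o) (hYβ : ∀ q ∈ Y, ∀ b, β (q.2.right b) = β b)
    (hq : ∀ b, ∃ q ∈ Subgroup.closure Y, q.2.right b = rep (β b))
    (hcard : ∀ o, (if o₀ = o then p ^ r else 0) +
      ∑ b, (if β b = o then 1 else 0) = l.get o) :
    HasOrbitLengths (Subgroup.closure (insert (perm (addCycles p r 0)) (pointLin D χ '' Y))) l := by
  have h := (points_generating D χ Y hY).hasOrbitLengths_labels (h := zeroLayout p r m) o₀ β rep
    hβ hrep (by rintro _ ⟨y, hy, rfl⟩; exact hYβ y hy) (fun b => by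
      obtain ⟨q, hq, hb⟩ := hq b
      rw [← MonoidHom.map_closure]
      exact ⟨_, ⟨q, hq, rfl⟩, hb⟩) hcard
  rwa [show affHom (affEquiv D (zeroLayout p r m)) = pointHom D m from rfl,
    points_closure hr] at h

end points_main

end affinePoints

/-! ### Classes 2, 14, 16, 17 and 19 -/

section classes

variable {p r : ℕ} [hp : Fact p.Prime] (D : FieldData p r) (χ : D.fieldˣ →* ℤˣ)

/-- The sign `-1` on the only block. -/
def flipOne : WX (Fin 1) := sp ![-1] 1

/-- The sign `-1` on the first of two blocks. -/
def flipFirst : WX (Fin 2) := sp ![-1, 1] 1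

theorem pointLin_class2 (hχ : χ D.Γ = -1) :
    Class2.g₁ D = pointLin D χ (D.Γ, flipOne) := by
  refine c_mul_perm_eq_affHom D (zeroLayout p r 1) (mulCycle_actsAffine D _) (fun _ => rfl)
    (fun _ => .inl rfl) ⟨fun j h1 h2 => ?_, fun b j h1 h2 => ?_⟩
  · simp [hχ]
    omega
  · fin_cases b
    change p ^ r + 0 + j ∈ _ ↔ (-1 : ℤˣ) = -1
    simp at h2 ⊢
    omega

theorem class2_main (h2 : 2 < p) (hr : 1 ≤ r) : IsAdmissible (Class2.G D) ∧
    Nonempty (Class2.G D ≃* (D.field ≃ᵃ[D.field] D.field)) ∧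
    HasOrbitLengths (Class2.G D) [p ^ r, 1] ∧
    ContainsSylowTwo (Class2.G D) (Subgroup.closure {Class2.g₁ D}) := by
  obtain ⟨χ, hχ⟩ := D.exists_character h2
  have e1 := pointLin_class2 D χ hχ
  have hY : ∃ y ∈ ({(D.Γ, flipOne)} : Set (D.fieldˣ × WX (Fin 1))), y.1 = D.Γ := ⟨_, rfl, rfl⟩
  have h1 := points_main hr hY (by omega) h2 hχ
    (by rintro _ rfl; rw [hχ]; exact (by decide : (-1 : ℤˣ) * ∏ b, flipOne.left b = 1))
    fun b => ⟨_, Subgroup.subset_closure rfl, (by decide : ∀ b, WX.Flips flipOne b) b⟩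
  have h3 := points_orbits (χ := χ) hr hY (l := [p ^ r, 1]) 0 ![1] ![0, 0] (by simp)
    (Fin.forall_fin_two.mpr ⟨.inl rfl, .inr rfl⟩) (fun q hq b => by simp)
    (fun b => ⟨1, one_mem _, Subsingleton.elim _ _⟩)
    (Fin.forall_fin_two.mpr ⟨by simp, by simp⟩)
  rw [Set.image_singleton, ← e1, Set.pair_comm] at h1 h3
  have h4 := points_affine D χ hr (q := flipOne) (k := 2) (by decide) (two_dvd_pow_sub_one h2)
  rw [← e1] at h4
  exact ⟨h1.1, h4, h3, h1.2⟩

omit hp in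
theorem isSignSet_pair {S : Finset ℕ} {ε : ℤˣ} {q : WX (Fin 2)}
    (hS : ∀ j, 1 ≤ j → j ≤ p ^ r → (j ∈ S ↔ ε = -1)) (h0 : p ^ r + 1 ∈ S ↔ q.left 0 = -1)
    (h1 : p ^ r + 2 ∈ S ↔ q.left 1 = -1) : IsSignSet p r (fun _ : Fin 2 => 0)
      (fun b => p ^ r + b.val) 0 S ε (zeroStab 2 q).1.left := by
  refine ⟨fun j hj hj' => by rw [zero_add]; exact hS j hj hj', ?_⟩
  have key : ∀ j, 1 ≤ j → j ≤ 2 * 0 + 1 → j = 1 := by omega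
  refine Fin.forall_fin_two.mpr ⟨fun j hj hj' => ?_, fun j hj hj' => ?_⟩
  · rw [key j hj hj']
    exact h0
  · rw [key j hj hj']
    exact h1

theorem pointLin_class14 (hχ : χ D.Γ = -1) :
    Class14.g₁ D = pointLin D χ (D.Γ, flipFirst * swapBoth) := by
  have h := (mulCycle_actsAffine D (zeroLayout p r 2)).mul (swap_actsAffine D _ (b := 0) (b' := 1)
    (i := p ^ r + 1) (j := p ^ r + 2) (by decide) rfl rfl rfl rfl)
  rw [mul_one, one_mul] at h
  refine c_mul_perm_eq_affHom D _ h (q := zeroStab 2 (flipFirst * swapBoth)) (fun b => rfl)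
    (fun _ => .inl rfl) (isSignSet_pair (fun j h1 h2 => ?_) ?_ ?_)
  · simp [hχ]
    omega
  · rw [show (flipFirst * swapBoth).left 0 = -1 by decide]
    simp
  · rw [show (flipFirst * swapBoth).left 1 = 1 by decide]
    simp

theorem pointLin_class17 (hχ : χ D.Γ = -1) :
    Class17.g₁ D = pointLin D χ (D.Γ, flipFirst) := by
  refine c_mul_perm_eq_affHom D (zeroLayout p r 2) (mulCycle_actsAffine D _) (fun b => rfl)
    (fun _ => .inl rfl) (isSignSet_pair (fun j h1 h2 => ?_) ?_ ?_)
  · simp [hχ]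
    omega
  · simp [flipFirst, sp]
  · simp [flipFirst, sp]

theorem pointLin_flipBoth : Class16.g₃ D = pointLin D χ (1, flipBoth) := by
  refine c_eq_affHom D (zeroLayout p r 2) (fun b => rfl) (fun _ => .inl rfl)
    (isSignSet_pair (fun j h1 h2 => ?_) ?_ ?_)
  · simp
    omega
  · simp [flipBoth, sp]
  · simp [flipBoth, sp]

theorem pointLin_swapBoth : Class19.g₃ D = pointLin D χ (1, swapBoth) :=
  perm_eq_affHom D (zeroLayout p r 2)
    (swap_actsAffine D _ (b := 0) (b' := 1) (by decide) rfl rfl rfl rfl) rfl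

section pairs

variable {D χ} {Y : Set (D.fieldˣ × WX (Fin 2))} (hr : 1 ≤ r) (hY : ∃ y ∈ Y, y.1 = D.Γ)
include hr hY

theorem points_pair_main (h2 : 2 < p) (hχ : χ D.Γ = -1)
    (hsign : ∀ y ∈ Y, χ y.1 * ∏ b, y.2.left b = 1)
    (hf : ∃ q ∈ Subgroup.closure Y, q.2 = flipBoth) :
    IsAdmissible (Subgroup.closure (insert (perm (addCycles p r 0)) (pointLin D χ '' Y))) ∧
    ContainsSylowTwo (Subgroup.closure (insert (perm (addCycles p r 0)) (pointLin D χ '' Y)))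
      (Subgroup.closure (pointLin D χ '' Y)) := by
  refine points_main hr hY le_rfl h2 hχ hsign fun b => ?_
  obtain ⟨q, hq, h⟩ := hf
  refine ⟨q, hq, ?_⟩
  rw [h]
  revert b
  decide

theorem points_pair_orbits (hq : ∃ q ∈ Subgroup.closure Y, q.2.right 1 = 0) :
    HasOrbitLengths (Subgroup.closure (insert (perm (addCycles p r 0)) (pointLin D χ '' Y)))
      [p ^ r, 2] :=
  points_orbits (χ := χ) hr hY (l := [p ^ r, 2]) 0 (fun _ => 1) (fun _ => 0)
    (fun _ => by simp) (Fin.forall_fin_two.mpr ⟨.inl rfl, .inr rfl⟩) (fun _ _ _ => rfl)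
    (Fin.forall_fin_two.mpr ⟨⟨1, one_mem _, rfl⟩, hq⟩)
    (Fin.forall_fin_two.mpr ⟨by simp, by simp⟩)

end pairs

theorem pointLin_comm_add (hr : 1 ≤ r) (q : WX (Fin 2)) :
    pointLin D χ (1, q) * perm (addCycles p r 0) = perm (addCycles p r 0) * pointLin D χ (1, q) := by
  rw [perm_addCycles_eq_pointHom D hr]
  change pointHom D 2 _ * _ = _ * pointHom D 2 _
  rw [← map_mul, ← map_mul]
  refine congrArg _ (Prod.ext ?_ ?_)
  · change linF χ 1 * _ = _ * linF χ 1
    rw [map_one, one_mul, mul_one]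
  · change _ * 1 = 1 * _
    rw [one_mul, mul_one]

theorem pointLin_comm {q q' : WX (Fin 2)} (h : q * q' = q' * q) (u : D.fieldˣ) :
    pointLin D χ (1, q) * pointLin D χ (u, q') = pointLin D χ (u, q') * pointLin D χ (1, q) := by
  rw [← map_mul, ← map_mul, Prod.mk_mul_mk, Prod.mk_mul_mk, one_mul, mul_one, h]

theorem map_closure_pointLin (Q : Set (WX (Fin 2))) :
    (Subgroup.closure Q).map ((pointLin D χ).comp (MonoidHom.inr _ _)) =
      Subgroup.closure ((fun q => pointLin D χ (1, q)) '' Q) :=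
  MonoidHom.map_closure _ _

/-- The product of the group of order two generated by `flipBoth` and an affine group. -/
theorem points_prod (hr : 1 ≤ r) {q : WX (Fin 2)} {k : ℕ} (hq : q ^ k = 1) (hk : k ∣ p ^ r - 1)
    (hc : flipBoth * q = q * flipBoth) :
    Nonempty (Subgroup.closure {pointLin D χ (D.Γ, q), perm (addCycles p r 0),
      pointLin D χ (1, flipBoth)} ≃* Cyc 2 × (D.field ≃ᵃ[D.field] D.field)) := by
  have h := points_internalSemidirect D χ hr hq hk (K := Subgroup.closure {flipBoth})
    (X := {pointLin D χ (D.Γ, q), perm (addCycles p r 0), pointLin D χ (1, flipBoth)})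
    (fun k hk => by
      obtain ⟨j, rfl⟩ := Subgroup.mem_closure_singleton.mp hk
      rwa [← (Commute.zpow_left hc j).eq, mul_inv_cancel_right])
    le_rfl (Subgroup.closure_mono (by rintro x (rfl | rfl) <;> simp)) (fun k hk => by
      obtain ⟨j, rfl⟩ := Subgroup.mem_closure_singleton.mp hk
      have h1 := zpow_mem (Subgroup.subset_closure (k := ({pointLin D χ (D.Γ, q),
        perm (addCycles p r 0), pointLin D χ (1, flipBoth)} : Set (WB (p ^ r + 2))))
        (.inr (.inr rfl))) j
      rwa [← map_zpow, Prod.pow_mk, one_zpow] at h1) (by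
      rintro x (rfl | rfl | rfl)
      · exact Subgroup.mem_sup_right (mem_closure_left _ _)
      · exact Subgroup.mem_sup_right (mem_closure_right _ _)
      · exact Subgroup.mem_sup_left ⟨_, Subgroup.subset_closure rfl, rfl⟩)
  rw [map_closure_pointLin, Set.image_singleton] at h
  obtain ⟨e⟩ := h.nonempty_mulEquiv_prod (commute_closure (by
    rintro x rfl y (rfl | rfl)
    · exact pointLin_comm D χ hc _
    · exact pointLin_comm_add D χ hr _))
  obtain ⟨e1⟩ := nonempty_mulEquiv_cyc (m := 2) (a := pointLin D χ (1, flipBoth)) (by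
    rw [orderOf_pointLin, orderOf_one, Nat.lcm_one_left]
    exact orderOf_eq_prime (by decide) (by decide))
  obtain ⟨e2⟩ := points_affine D χ hr hq hk
  exact ⟨e.symm.trans (e1.prodCongr e2)⟩

theorem flipFirst_mul_swapBoth_sq :
    (flipFirst * swapBoth) * (flipFirst * swapBoth) = flipBoth := by decide

/-- On the two single points g₁ acts with order 4, and its square flips both. If 4 divides q - 1,
this action is a function of the linear part and the group is the affine one; otherwise q - 1 is
twice an odd number and the order of g₁ is lcm(q - 1, 4) = 2(q - 1). -/
theorem class14_main (h2 : 2 < p) (hr : 1 ≤ r) : IsAdmissible (Class14.G D) ∧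
    (4 ∣ p ^ r - 1 → Nonempty (Class14.G D ≃* (D.field ≃ᵃ[D.field] D.field))) ∧
    (¬ 4 ∣ p ^ r - 1 →
      IsSemidirect (Multiplicative D.field) (Cyc (2 * (p ^ r - 1))) (Class14.G D)) ∧
    HasOrbitLengths (Class14.G D) [p ^ r, 2] ∧
    ContainsSylowTwo (Class14.G D) (Subgroup.closure {Class14.g₁ D}) := by
  obtain ⟨χ, hχ⟩ := D.exists_character h2
  have e1 := pointLin_class14 D χ hχ
  have hY : ∃ y ∈ ({(D.Γ, flipFirst * swapBoth)} : Set (D.fieldˣ × WX (Fin 2))), y.1 = D.Γ :=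
    ⟨_, rfl, rfl⟩
  have h0 : (D.Γ, flipFirst * swapBoth) ∈ Subgroup.closure
    ({(D.Γ, flipFirst * swapBoth)} : Set (D.fieldˣ × WX (Fin 2))) := Subgroup.subset_closure rfl
  have h1 := points_pair_main hr hY h2 hχ
    (by
      rintro _ rfl
      rw [hχ]
      exact (by decide : (-1 : ℤˣ) * ∏ b, (flipFirst * swapBoth).left b = 1))
    ⟨_, mul_mem h0 h0, flipFirst_mul_swapBoth_sq⟩
  have h3 := points_pair_orbits (χ := χ) hr hY
    ⟨_, h0, (by decide : (flipFirst * swapBoth).right 1 = 0)⟩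
  rw [Set.image_singleton, ← e1, Set.pair_comm] at h1 h3
  refine ⟨h1.1, fun h4 => ?_, fun h4 => ?_, h3, h1.2⟩
  · have h5 := points_affine D χ hr (q := flipFirst * swapBoth) (by decide) h4
    rwa [← e1] at h5
  · have o : orderOf (flipFirst * swapBoth) = 4 :=
      orderOf_eq_four flipFirst_mul_swapBoth_sq (by decide) (by decide)
    have h5 := points_semidirect D χ hr (flipFirst * swapBoth) (k := 2 * (p ^ r - 1)) (by
      obtain ⟨k, hk⟩ := two_dvd_pow_sub_one (r := r) h2
      have h6 : Odd k := by
        rw [← Nat.not_even_iff_odd]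
        rintro ⟨j, rfl⟩
        exact h4 ⟨j, by omega⟩
      rw [o, hk, show 4 = 2 * 2 from rfl, Nat.lcm_mul_left,
        (Nat.coprime_two_right.mpr h6).lcm_eq_mul, mul_comm k])
    rwa [← e1] at h5

/-- The power of g₁ with exponent q - 1 is trivial on the field. As q - 1 is twice an odd number, it
is an odd power of `flipBoth` on the two points, that is g₃. -/
theorem class16_eq_class14 (h2 : 2 < p) (h4 : ¬ 4 ∣ p ^ r - 1) : Class16.G D = Class14.G D := by
  obtain ⟨χ, hχ⟩ := D.exists_character h2
  refine closure_eq_closure ?_ ?_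
  · rintro x (rfl | rfl | rfl)
    · exact mem_closure_left _ _
    · exact mem_closure_right _ _
    · have h : Class16.g₃ D = Class14.g₁ D ^ (p ^ r - 1) := by
        rw [pointLin_class14 D χ hχ, pointLin_flipBoth D χ, ← map_pow, Prod.pow_mk,
          ← D.orderOf_generator, pow_orderOf_eq_one, D.orderOf_generator]
        obtain ⟨k, hk⟩ := two_dvd_pow_sub_one (r := r) h2
        rcases Nat.even_or_odd' k with ⟨j, rfl | rfl⟩
        · exact absurd ⟨j, by omega⟩ h4
        · rw [hk, pow_mul, pow_two, flipFirst_mul_swapBoth_sq, _root_.pow_succ, pow_mul,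
            show flipBoth ^ 2 = 1 by decide, one_pow, one_mul]
      rw [h]
      exact pow_mem (mem_closure_left _ _) _
  · rintro x (rfl | rfl)
    · exact Subgroup.subset_closure (.inl rfl)
    · exact Subgroup.subset_closure (.inr (.inl rfl))

theorem class16_main (h2 : 2 < p) (hr : 1 ≤ r) : IsAdmissible (Class16.G D) ∧
    (4 ∣ p ^ r - 1 → Nonempty (Class16.G D ≃* Cyc 2 × (D.field ≃ᵃ[D.field] D.field))) ∧
    (¬ 4 ∣ p ^ r - 1 →
      IsSemidirect (Multiplicative D.field) (Cyc (2 * (p ^ r - 1))) (Class16.G D)) ∧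
    HasOrbitLengths (Class16.G D) [p ^ r, 2] ∧
    ContainsSylowTwo (Class16.G D) (Subgroup.closure {Class16.g₁ D, Class16.g₃ D}) := by
  obtain ⟨χ, hχ⟩ := D.exists_character h2
  have e1 : Class16.g₁ D = _ := pointLin_class14 D χ hχ
  have e3 := pointLin_flipBoth D χ
  have hY : ∃ y ∈ ({(D.Γ, flipFirst * swapBoth), (1, flipBoth)} : Set (D.fieldˣ × WX (Fin 2))),
    y.1 = D.Γ := ⟨_, .inl rfl, rfl⟩
  have h1 := points_pair_main hr hY h2 hχ
    (by
      rintro _ (rfl | rfl)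
      · rw [hχ]
        exact (by decide : (-1 : ℤˣ) * ∏ b, (flipFirst * swapBoth).left b = 1)
      · rw [map_one]
        exact (by decide : 1 * ∏ b, flipBoth.left b = 1))
    ⟨_, mem_closure_right _ _, rfl⟩
  have h3 := points_pair_orbits (χ := χ) hr hY
    ⟨_, mem_closure_left _ _, (by decide : (flipFirst * swapBoth).right 1 = 0)⟩
  rw [Set.image_pair, ← e1, ← e3, Set.insert_comm] at h1 h3
  refine ⟨h1.1, fun h4 => ?_, fun h4 => ?_, h3, h1.2⟩
  · have h5 := points_prod D χ hr (q := flipFirst * swapBoth) (k := 4) (by decide) h4 (by decide)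
    rwa [← e1, ← e3] at h5
  · rw [class16_eq_class14 D h2 h4]
    exact (class14_main D h2 hr).2.2.1 h4

theorem class17_main (h2 : 2 < p) (hr : 1 ≤ r) : IsAdmissible (Class17.G D) ∧
    Nonempty (Class17.G D ≃* Cyc 2 × (D.field ≃ᵃ[D.field] D.field)) ∧
    HasOrbitLengths (Class17.G D) [p ^ r, 1, 1] ∧
    ContainsSylowTwo (Class17.G D) (Subgroup.closure {Class17.g₁ D, Class17.g₃ D}) := by
  obtain ⟨χ, hχ⟩ := D.exists_character h2
  have e1 := pointLin_class17 D χ hχ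
  have e3 : Class17.g₃ D = _ := pointLin_flipBoth D χ
  have hY : ∃ y ∈ ({(D.Γ, flipFirst), (1, flipBoth)} : Set (D.fieldˣ × WX (Fin 2))),
    y.1 = D.Γ := ⟨_, .inl rfl, rfl⟩
  have h1 := points_pair_main hr hY h2 hχ
    (by
      rintro _ (rfl | rfl)
      · rw [hχ]
        exact (by decide : (-1 : ℤˣ) * ∏ b, flipFirst.left b = 1)
      · rw [map_one]
        exact (by decide : 1 * ∏ b, flipBoth.left b = 1))
    ⟨_, mem_closure_right _ _, rfl⟩
  have h3 := points_orbits (χ := χ) hr hY (l := [p ^ r, 1, 1]) 0 Fin.succ ![0, 0, 1]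
    (fun b => Fin.succ_ne_zero b)
    (Fin.forall_fin_succ.mpr ⟨.inl rfl, Fin.forall_fin_two.mpr ⟨.inr rfl, .inr rfl⟩⟩)
    (by rintro _ (rfl | rfl) b <;> rfl)
    (Fin.forall_fin_two.mpr ⟨⟨1, one_mem _, rfl⟩, ⟨1, one_mem _, rfl⟩⟩)
    (Fin.forall_fin_succ.mpr ⟨by simp, Fin.forall_fin_two.mpr ⟨by simp; rfl, by simp; rfl⟩⟩)
  rw [Set.image_pair, ← e1, ← e3, Set.insert_comm] at h1 h3
  refine ⟨h1.1, ?_, h3, h1.2⟩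
  have h5 := points_prod D χ hr (q := flipFirst) (k := 2) (by decide) (two_dvd_pow_sub_one h2)
    (by decide)
  rwa [← e1, ← e3] at h5

/-- The group generated by `swapBoth` and `flipBoth` is normal. -/
theorem class19_internalSemidirect (h2 : 2 < p) (hr : 1 ≤ r) (hχ : χ D.Γ = -1)
    {S : Subgroup (WB (p ^ r + 2))} {X : Set (WB (p ^ r + 2))}
    (hS : S ≤ Subgroup.closure {pointLin D χ (D.Γ, flipFirst), perm (addCycles p r 0)})
    (hSX : S ≤ Subgroup.closure (X ∪ {Class19.g₁ D, Class19.g₃ D, Class19.g₄ D}))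
    (hXS : X ⊆ S) (hm : pointLin D χ (D.Γ, flipFirst) ∈ S) :
    IsInternalSemidirect (Subgroup.closure {Class19.g₃ D, Class19.g₄ D}) S
      (Subgroup.closure (X ∪ {Class19.g₁ D, Class19.g₃ D, Class19.g₄ D})) := by
  have e3 := pointLin_swapBoth D χ
  have e4 : Class19.g₄ D = _ := pointLin_flipBoth D χ
  have e1 : Class19.g₁ D = pointLin D χ (D.Γ, flipFirst) * Class19.g₃ D := by
    rw [e3, ← map_mul, Prod.mk_mul_mk, mul_one]
    exact pointLin_class14 D χ hχ
  have hK : (Subgroup.closure {swapBoth, flipBoth}).map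
      ((pointLin D χ).comp (MonoidHom.inr _ _)) = Subgroup.closure {Class19.g₃ D, Class19.g₄ D} := by
    rw [map_closure_pointLin, Set.image_pair, e3, e4]
  rw [← hK]
  refine points_internalSemidirect D χ hr (q := flipFirst) (k := 2) (by decide)
    (two_dvd_pow_sub_one h2) (fun k hk => ?_) hS hSX (fun k hk => ?_) ?_
  -- The sign change on one point conjugates the transposition to its product with the sign change
  -- on both.
  · refine conj_mem_closure (X := {flipFirst}) ?_ _ (Subgroup.subset_closure rfl) k hk
    rintro _ rfl _ (rfl | rfl)
    · rw [show flipFirst * swapBoth * flipFirst⁻¹ = swapBoth * flipBoth by decide]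
      exact mul_mem (mem_closure_left _ _) (mem_closure_right _ _)
    · rw [show flipFirst * flipBoth * flipFirst⁻¹ = flipBoth by decide]
      exact mem_closure_right _ _
  · have h1 : pointLin D χ (1, k) ∈ Subgroup.closure {Class19.g₃ D, Class19.g₄ D} := by
      rw [← hK]
      exact ⟨k, hk, rfl⟩
    exact Subgroup.closure_mono (by rintro x (rfl | rfl) <;> simp) h1
  · rw [hK]
    have h3 := Subgroup.mem_sup_left (T := S) (mem_closure_left (Class19.g₃ D) (Class19.g₄ D))
    rintro x (hx | rfl | rfl | rfl)
    · exact Subgroup.mem_sup_right (hXS hx)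
    · rw [e1]
      exact mul_mem (Subgroup.mem_sup_right hm) h3
    · exact h3
    · exact Subgroup.mem_sup_left (mem_closure_right _ _)

theorem class19_main (h2 : 2 < p) (hr : 1 ≤ r) : IsAdmissible (Class19.G D) ∧
    IsSemidirect (Cyc 2 × Cyc 2) (D.field ≃ᵃ[D.field] D.field) (Class19.G D) ∧
    HasOrbitLengths (Class19.G D) [p ^ r, 2] ∧
    ContainsSylowTwo (Class19.G D)
      (Subgroup.closure {Class19.g₁ D, Class19.g₃ D, Class19.g₄ D}) ∧
    IsSemidirect (Cyc 2 × Cyc 2) (Cyc (p ^ r - 1))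
      (Subgroup.closure {Class19.g₁ D, Class19.g₃ D, Class19.g₄ D}) ∧
    ConditionH1 ((Subgroup.closure {Class19.g₁ D, Class19.g₃ D, Class19.g₄ D}).subgroupOf
      (WD _)) := by
  obtain ⟨χ, hχ⟩ := D.exists_character h2
  have e1 : Class19.g₁ D = _ := pointLin_class14 D χ hχ
  have e3 := pointLin_swapBoth D χ
  have e4 : Class19.g₄ D = _ := pointLin_flipBoth D χ
  have hY : ∃ y ∈ ({(D.Γ, flipFirst * swapBoth), (1, swapBoth), (1, flipBoth)} :
    Set (D.fieldˣ × WX (Fin 2))), y.1 = D.Γ := ⟨_, .inl rfl, rfl⟩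
  have h1 := points_pair_main hr hY h2 hχ
    (by
      rintro _ (rfl | rfl | rfl)
      · rw [hχ]
        exact (by decide : (-1 : ℤˣ) * ∏ b, (flipFirst * swapBoth).left b = 1)
      · rw [map_one]
        exact (by decide : 1 * ∏ b, swapBoth.left b = 1)
      · rw [map_one]
        exact (by decide : 1 * ∏ b, flipBoth.left b = 1))
    ⟨_, Subgroup.subset_closure (.inr (.inr rfl)), rfl⟩
  have h3 := points_pair_orbits (χ := χ) hr hY
    ⟨_, Subgroup.subset_closure (.inl rfl), (by decide : (flipFirst * swapBoth).right 1 = 0)⟩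
  rw [Set.image_insert_eq, Set.image_pair, ← e1, ← e3, ← e4, Set.insert_comm] at h1 h3
  have e0 : pointLin D χ (D.Γ, flipFirst) = Class19.g₁ D * Class19.g₃ D := by
    rw [e1, e3, ← map_mul, Prod.mk_mul_mk, mul_one,
      show flipFirst * swapBoth * swapBoth = flipFirst by decide]
  have hs : pointLin D χ (D.Γ, flipFirst) ∈
      Subgroup.closure {Class19.g₁ D, Class19.g₃ D, Class19.g₄ D} := by
    rw [e0]
    exact mul_mem (Subgroup.subset_closure (by simp)) (Subgroup.subset_closure (by simp))
  have hK := nonempty_map_mulEquiv (f := (pointLin D χ).comp (MonoidHom.inr _ _))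
    (fun x y hxy => congrArg Prod.snd (pointLin_injective D χ hxy))
    (nonempty_mulEquiv_klein (a := swapBoth) (b := flipBoth) (by decide) (by decide) (by decide)
      (by decide) (by decide) (by decide))
  rw [map_closure_pointLin, Set.image_pair, ← e3, ← e4] at hK
  obtain ⟨eK⟩ := hK
  -- The same splitting is used twice: with the translation it describes G, and without it, in `hS`,
  -- the group generated by g₁, g₃ and g₄. The complement is generated by g₁g₃, which no longer
  -- exchanges the two points, with or without the translation.
  have hG := class19_internalSemidirect D χ h2 hr hχ (X := {perm (addCycles p r 0)}) le_rfl
    ((Subgroup.closure_le _).mpr (by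
      rintro x (rfl | rfl)
      · exact Subgroup.closure_mono Set.subset_union_right hs
      · exact Subgroup.subset_closure (.inl rfl)))
    (Set.singleton_subset_iff.mpr (mem_closure_right _ _)) (mem_closure_left _ _)
  have hS := class19_internalSemidirect D χ h2 hr hχ (X := ∅)
    (S := Subgroup.closure {pointLin D χ (D.Γ, flipFirst)})
    (Subgroup.closure_mono (by simp))
    (by rwa [Subgroup.closure_le, Set.singleton_subset_iff, Set.empty_union])
    (Set.empty_subset _) (Subgroup.subset_closure rfl)
  rw [Set.singleton_union, Set.insert_comm] at hG
  rw [Set.empty_union] at hS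
  obtain ⟨eG⟩ := points_affine D χ hr (q := flipFirst) (k := 2) (by decide)
    (two_dvd_pow_sub_one h2)
  obtain ⟨eS⟩ := nonempty_mulEquiv_cyc (m := p ^ r - 1) (a := pointLin D χ (D.Γ, flipFirst)) (by
    rw [orderOf_pointLin, D.orderOf_generator]
    exact Nat.lcm_eq_left ((orderOf_dvd_of_pow_eq_one (by decide)).trans (two_dvd_pow_sub_one h2)))
  refine ⟨h1.1, hG.isSemidirect eK eG, h3, h1.2, hS.isSemidirect eK eS,
    h1.1.conditionH1_of_le h1.2.1⟩

end classes

/-! ### Classes 4, 6 and 8 -/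

section class6

variable {p r : ℕ} [hp : Fact p.Prime] (n : ℕ) (D : FieldData p r) (χ : D.fieldˣ →* ℤˣ)

variable (p r) in
omit hp in
theorem layout6 : IsLayout p r ![n] ![0] (2 * n + 1) (2 * n + p ^ r + 1) where
  card := by simp; omega
  field_le := by omega
  block_le b := by simp
  disjoint b := .inl (by simp)
  block_disjoint b b' hb := absurd (Subsingleton.elim b b') hb

/-- The signed permutations of the labels of classes 6 and 8. -/
noncomputable def hom6 : WX D.field × WX (Blocks ![n]) →* WB (2 * n + p ^ r + 1) :=
  affHom (affEquiv D (layout6 p r n))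

/-- The sign `-1` on the only block. -/
def flipStab : lengthStab ![n] := ⟨flipOne, fun _ => rfl⟩

theorem mul_class6 (hχ : χ D.Γ = -1) :
    Class6.s n D = hom6 n D (affLin χ (D.Γ, flipStab n)) := by
  have h := (flips_actsAffine D (layout6 p r n) 0 (a' := 0) rfl rfl).mul
    (mulCycle_actsAffine D (layout6 p r n))
  rw [one_mul, one_mul] at h
  refine c_mul_perm_eq_affHom D _ h (q := flipStab n) (fun b => rfl) (fun b => .inr ?_)
    ⟨fun j h1 h2 => ?_, fun b j h1 h2 => ?_⟩
  · fin_cases b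
    rfl
  · simp [hχ]
    omega
  · fin_cases b
    change 0 + j ∈ _ ↔ (-1 : ℤˣ) = -1
    simp at h2 ⊢
    omega

theorem rot_class6 : Class6.g₂ n D = hom6 n D (1, tb ![n] 0) :=
  perm_rot_eq_affHom D (layout6 p r n) 0 rfl rfl

theorem add_class6 (hr : 1 ≤ r) : Class6.g₂' n D = hom6 n D (trF (.ofAdd 1), 1) :=
  perm_addCycles_eq_affHom D (layout6 p r n) hr

theorem rot_mul_add_class6 (hr : 1 ≤ r) :
    Class6.g₂ n D * Class6.g₂' n D = hom6 n D (trF (.ofAdd 1), tb ![n] 0) := by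
  rw [rot_class6, add_class6 n D hr, ← map_mul, Prod.mk_mul_mk, one_mul, mul_one]

omit hp in
theorem isAffineFlipping_class6 (hχ : χ D.Γ = -1) :
    IsAffineFlipping χ {(D.Γ, flipStab n)} where
  prod_eq := by
    rintro _ rfl
    rw [hχ]
    exact (by decide : (-1 : ℤˣ) * ∏ b, flipOne.left b = 1)
  flips b := ⟨_, Subgroup.subset_closure rfl, (by decide : ∀ b, WX.Flips flipOne b) b⟩

variable {n D χ} in
theorem class6_admissible (h2 : 2 < p) (hχ : χ D.Γ = -1) {X : Set (WX D.field × WX (Blocks ![n]))}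
    (h : IsAffineGenerating χ D.Γ X {(D.Γ, flipStab n)}) :
    IsAdmissible ((Subgroup.closure X).map (hom6 n D)) ∧
    HasOrbitLengths ((Subgroup.closure X).map (hom6 n D)) [2 * n + 1, p ^ r] := by
  obtain ⟨B, hf⟩ := h.isFrame_labels (h := layout6 p r n) (by omega) h2 hχ
    (isAffineFlipping_class6 n D χ hχ)
  exact ⟨hf.isAdmissible, h.hasOrbitLengths_labels (h := layout6 p r n) (l := [2 * n + 1, p ^ r]) 1
    (fun _ => 0) (fun _ => 0) (fun _ => by simp) (Fin.forall_fin_two.mpr ⟨.inr rfl, .inl rfl⟩)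
    (fun _ _ _ => rfl) (fun b => ⟨1, one_mem _, Subsingleton.elim _ _⟩)
    (Fin.forall_fin_two.mpr ⟨by simp, by simp⟩)⟩

omit hp in
theorem class6_generating : IsAffineGenerating χ D.Γ
    {affLin χ (D.Γ, flipStab n), (1, tb ![n] 0), (trF (.ofAdd 1), 1)} {(D.Γ, flipStab n)} where
  mem_cases := by
    rintro _ (rfl | rfl | rfl)
    · exact .inr ⟨_, rfl, rfl⟩
    · exact .inl ⟨⟨1, map_one _⟩, tb_mem trivial⟩
    · exact .inl ⟨⟨_, rfl⟩, one_mem _⟩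
  affLin_mem := by
    rintro _ rfl
    exact Subgroup.subset_closure (.inl rfl)
  exists_mul := ⟨_, rfl, rfl⟩
  exists_add := ⟨0, Subgroup.subset_closure (.inr (.inr (Prod.ext rfl tr_zero)))⟩
  exists_tr b := .inr ⟨1, Pi.single 0 1, by rw [Subsingleton.elim b 0, Pi.single_eq_same],
    Subgroup.subset_closure (.inr (.inl (Prod.ext (map_one _) rfl)))⟩

omit hp in
theorem class8_generating : IsAffineGenerating χ D.Γ
    {affLin χ (D.Γ, flipStab n), (trF (.ofAdd 1), tb ![n] 0)} {(D.Γ, flipStab n)} where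
  mem_cases := by
    rintro _ (rfl | rfl)
    · exact .inr ⟨_, rfl, rfl⟩
    · exact .inl ⟨⟨_, rfl⟩, tb_mem trivial⟩
  affLin_mem := by
    rintro _ rfl
    exact Subgroup.subset_closure (.inl rfl)
  exists_mul := ⟨_, rfl, rfl⟩
  exists_add := ⟨_, mem_closure_right _ _⟩
  -- The coupled translation is transitive on the block by itself, and together with the
  -- multiplication on the field.
  exists_tr b := .inr ⟨_, Pi.single 0 1, by rw [Subsingleton.elim b 0, Pi.single_eq_same],
    mem_closure_right _ _⟩

theorem class6_semidirect (h2 : 2 < p) (hr : 1 ≤ r) :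
    IsSemidirect (Cyc (2 * n + 1)) (D.field ≃ᵃ[D.field] D.field) (Class6.G n D) := by
  obtain ⟨χ, hχ⟩ := D.exists_character h2
  have e1 := mul_class6 n D χ hχ
  have hb : orderOf (lin (flipStab n)) ∣ orderOf D.Γ := by
    rw [D.orderOf_generator]
    refine (orderOf_dvd_of_pow_eq_one ?_).trans (two_dvd_pow_sub_one h2)
    rw [← map_pow, show flipStab n ^ 2 = 1 from Subtype.ext (by decide : flipOne ^ 2 = 1), map_one]
  have hJ := affHom_injective (affEquiv D (layout6 p r n))
  have hS : Nonempty (Subgroup.closure {Class6.s n D, Class6.g₂' n D} ≃*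
      (D.field ≃ᵃ[D.field] D.field)) := by
    have h := nonempty_map_mulEquiv hJ (affine_closure_mulEquiv (χ := χ) D.generates
      D.eq_zero_or_isUnit hb)
    rw [MonoidHom.map_closure, Set.image_pair] at h
    rw [e1, add_class6 n D hr]
    exact h
  have hK : Nonempty ((translations ![n] {0}).map ((hom6 n D).comp (MonoidHom.inr _ _)) ≃*
      Cyc (2 * n + 1)) :=
    nonempty_map_mulEquiv (f := (hom6 n D).comp (MonoidHom.inr (WX D.field) (WX (Blocks ![n]))))
      (fun x y hxy => congrArg Prod.snd (hJ hxy))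
      (translations_singleton (ν := ![n]) 0 rfl)
  refine (affine_internalSemidirect (χ := χ) (b := lin (flipStab n))
    (S := Subgroup.closure {Class6.s n D, Class6.g₂' n D}) D.generates D.eq_zero_or_isUnit hJ hb
    (fun k hk => lin_conj_mem (fun b hb => hb) hk) ?_ ?_ ?_ ?_).isSemidirect hK.some hS.some
  · rw [e1, add_class6 n D hr]
    exact le_rfl
  · exact Subgroup.closure_mono (by rintro x (rfl | rfl) <;> simp)
  · intro k hk
    rw [translations_eq_closure, Set.image_singleton] at hk
    obtain ⟨j, rfl⟩ := Subgroup.mem_closure_singleton.mp hk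
    have h1 := zpow_mem (Subgroup.subset_closure (.inr (.inl (rot_class6 n D).symm)) :
      hom6 n D (1, tb ![n] 0) ∈ Class6.G n D) j
    rwa [← map_zpow, Prod.pow_mk, one_zpow] at h1
  · rintro x (rfl | rfl | rfl)
    · exact Subgroup.mem_sup_right (mem_closure_left _ _)
    · rw [rot_class6]
      exact Subgroup.mem_sup_left ⟨_, tb_mem rfl, rfl⟩
    · exact Subgroup.mem_sup_right (mem_closure_right _ _)

theorem class6_main (h2 : 2 < p) (hr : 1 ≤ r) : IsAdmissible (Class6.G n D) ∧
    IsSemidirect (Cyc (2 * n + 1)) (D.field ≃ᵃ[D.field] D.field) (Class6.G n D) ∧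
    HasOrbitLengths (Class6.G n D) [2 * n + 1, p ^ r] := by
  obtain ⟨χ, hχ⟩ := D.exists_character h2
  have h := class6_admissible h2 hχ (class6_generating n D χ)
  rw [MonoidHom.map_closure, Set.image_insert_eq, Set.image_pair, ← mul_class6 n D χ hχ,
    ← rot_class6, ← add_class6 n D hr] at h
  exact ⟨h.1, class6_semidirect n D h2 hr, h.2⟩

/-- The coupled translation has components of the coprime orders 2n+1 and p, the characteristic
being the additive order of 1, so each component is a power of it. -/
theorem class8_eq_class6 (h : (2 * n + 1).Coprime p) (hr : 1 ≤ r) :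
    Class8.G n D = Class6.G n D := by
  obtain ⟨u, v, huv⟩ := Nat.isCoprime_iff_coprime.mpr h
  have hA : (trF (.ofAdd 1) : WX D.field) ^ (p : ℤ) = 1 := by
    rw [← map_zpow, ← ofAdd_zsmul, natCast_zsmul, nsmul_one]
    have : (p : D.field) = 0 := by
      rw [← map_natCast (algebraMap (ZMod p) D.field), ZMod.natCast_self, map_zero]
    rw [this, ofAdd_zero, map_one]
  have hB : tb ![n] 0 ^ ((2 * n + 1 : ℕ) : ℤ) = 1 := by
    rw [zpow_natCast]
    exact (congrArg _ (orderOf_tb (ν := ![n]) 0).symm).trans (pow_orderOf_eq_one _)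
  have h1 : Class6.g₂ n D ∈ Class8.G n D := by
    -- From u(2n+1) + vp = 1: the exponent pv kills the translation of the field and is 1 modulo
    -- 2n+1.
    have h2 := zpow_mem (mem_closure_right (Class6.s n D) (Class6.g₂ n D * Class6.g₂' n D)) (p * v)
    rw [rot_mul_add_class6 n D hr, ← map_zpow, Prod.pow_mk, zpow_mul, hA, one_zpow,
      show (p : ℤ) * v = 1 - (2 * n + 1 : ℕ) * u by rw [← huv]; ring, zpow_sub, zpow_mul, hB,
      one_zpow, zpow_one, inv_one, mul_one, ← rot_class6, ← rot_mul_add_class6 n D hr] at h2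
    exact h2
  have h2 := mem_closure_right (Class6.s n D) (Class6.g₂ n D * Class6.g₂' n D)
  refine closure_eq_closure ?_ ?_
  · rintro x (rfl | rfl)
    · exact Subgroup.subset_closure (.inl rfl)
    · exact mul_mem (Subgroup.subset_closure (.inr (.inl rfl)))
        (Subgroup.subset_closure (.inr (.inr rfl)))
  · rintro x (rfl | rfl | rfl)
    · exact mem_closure_left _ _
    · exact h1
    · exact (Subgroup.mul_mem_cancel_left _ h1).mp h2

theorem class8_main (h2 : 2 < p) (hr : 1 ≤ r) : IsAdmissible (Class8.G n D) ∧
    ((2 * n + 1).Coprime p → Class8.G n D = Class6.G n D) ∧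
    HasOrbitLengths (Class8.G n D) [2 * n + 1, p ^ r] := by
  obtain ⟨χ, hχ⟩ := D.exists_character h2
  have h := class6_admissible h2 hχ (class8_generating n D χ)
  rw [MonoidHom.map_closure, Set.image_pair, ← mul_class6 n D χ hχ,
    ← rot_mul_add_class6 n D hr] at h
  exact ⟨h.1, fun hc => class8_eq_class6 n D hc hr, h.2⟩

end class6

section class4

variable {p r : ℕ} [hp : Fact p.Prime] (n : ℕ) (D : FieldData p r) (χ : D.fieldˣ →* ℤˣ)

variable (p r) in
omit hp in
theorem layout4 :
    IsLayout p r ![n, 0] ![0, 2 * n + 1 + p ^ r] (2 * n + 1) (2 * n + p ^ r + 2) where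
  card := by simp; omega
  field_le := by omega
  block_le := Fin.forall_fin_two.mpr ⟨by simp; omega, by simp; omega⟩
  disjoint := Fin.forall_fin_two.mpr ⟨.inl (by simp), .inr (by simp)⟩
  block_disjoint := Fin.forall_fin_two.mpr ⟨Fin.forall_fin_two.mpr
    ⟨by simp, fun _ => .inl (by simp)⟩, Fin.forall_fin_two.mpr
      ⟨fun _ => .inr (by simp), by simp⟩⟩

/-- The signed permutations of the labels of class 4. -/
noncomputable def hom4 : WX D.field × WX (Blocks ![n, 0]) →* WB (2 * n + p ^ r + 2) :=
  affHom (affEquiv D (layout4 p r n))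

/-- The sign `-1` on the second of two blocks. -/
def flipSecond : WX (Fin 2) := sp ![1, -1] 1

/-- The sign `-1` on both blocks. -/
def flipBothStab : lengthStab ![n, 0] := ⟨flipBoth, fun _ => rfl⟩

/-- The sign `-1` on the second of two blocks. -/
def flipSecondStab : lengthStab ![n, 0] := ⟨flipSecond, fun _ => rfl⟩

theorem flip_class4 : Class4.g₁ n D = hom4 n D (affLin χ (1, flipBothStab n)) := by
  refine c_mul_perm_eq_affHom D _ (flips_actsAffine D (layout4 p r n) 0 (a' := 0) rfl rfl)
    (q := flipBothStab n) (fun b => rfl) (Fin.forall_fin_two.mpr ⟨.inr rfl, .inl rfl⟩)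
    ⟨fun j h1 h2 => ?_, Fin.forall_fin_two.mpr ⟨fun j h1 h2 => ?_, fun j h1 h2 => ?_⟩⟩
  · rw [map_one]
    simp
    omega
  · change 0 + j ∈ _ ↔ (-1 : ℤˣ) = -1
    simp at h2 ⊢
    omega
  · change 2 * n + 1 + p ^ r + j ∈ _ ↔ (-1 : ℤˣ) = -1
    simp at h2 ⊢
    omega

theorem mul_class4 (hχ : χ D.Γ = -1) :
    Class4.g₁' n D = hom4 n D (affLin χ (D.Γ, flipSecondStab n)) := by
  refine c_mul_perm_eq_affHom D _ (mulCycle_actsAffine D (layout4 p r n))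
    (q := flipSecondStab n) (fun b => rfl) (Fin.forall_fin_two.mpr ⟨.inr rfl, .inl rfl⟩)
    ⟨fun j h1 h2 => ?_, Fin.forall_fin_two.mpr ⟨fun j h1 h2 => ?_, fun j h1 h2 => ?_⟩⟩
  · rw [hχ]
    simp
    omega
  · change 0 + j ∈ _ ↔ (1 : ℤˣ) = -1
    simp at h2 ⊢
    omega
  · change 2 * n + 1 + p ^ r + j ∈ _ ↔ (-1 : ℤˣ) = -1
    simp at h2 ⊢
    omega

theorem rot_class4 : Class4.g₂ n D = hom4 n D (1, tb ![n, 0] 0) :=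
  perm_rot_eq_affHom D (layout4 p r n) 0 rfl rfl

theorem add_class4 (hr : 1 ≤ r) : Class4.g₂' n D = hom4 n D (trF (.ofAdd 1), 1) :=
  perm_addCycles_eq_affHom D (layout4 p r n) hr

omit hp in
theorem class4_generating : IsAffineGenerating χ D.Γ
    {affLin χ (1, flipBothStab n), (1, tb ![n, 0] 0), affLin χ (D.Γ, flipSecondStab n),
      (trF (.ofAdd 1), 1)} {(1, flipBothStab n), (D.Γ, flipSecondStab n)} where
  mem_cases := by
    rintro _ (rfl | rfl | rfl | rfl)
    · exact .inr ⟨_, .inl rfl, rfl⟩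
    · exact .inl ⟨⟨1, map_one _⟩, tb_mem trivial⟩
    · exact .inr ⟨_, .inr rfl, rfl⟩
    · exact .inl ⟨⟨_, rfl⟩, one_mem _⟩
  affLin_mem := by
    rintro _ (rfl | rfl)
    · exact Subgroup.subset_closure (.inl rfl)
    · exact Subgroup.subset_closure (.inr (.inr (.inl rfl)))
  exists_mul := ⟨_, .inr rfl, rfl⟩
  exists_add := ⟨0, Subgroup.subset_closure (.inr (.inr (.inr (Prod.ext rfl tr_zero))))⟩
  exists_tr := Fin.forall_fin_two.mpr ⟨.inr ⟨1, Pi.single 0 1, Pi.single_eq_same _ _,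
    Subgroup.subset_closure (.inr (.inl (Prod.ext (map_one _) rfl)))⟩, .inl rfl⟩

omit hp in
theorem isAffineFlipping_class4 (hχ : χ D.Γ = -1) :
    IsAffineFlipping χ {(1, flipBothStab n), (D.Γ, flipSecondStab n)} where
  prod_eq := by
    rintro _ (rfl | rfl)
    · rw [map_one]
      exact (by decide : 1 * ∏ b, flipBoth.left b = 1)
    · rw [hχ]
      exact (by decide : (-1 : ℤˣ) * ∏ b, flipSecond.left b = 1)
  flips b := ⟨_, mem_closure_left _ _, (by decide : ∀ b, WX.Flips flipBoth b) b⟩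

omit hp in
theorem affLin_one (q : lengthStab ![n, 0]) : affLin χ (1, q) = (1, lin q) :=
  Prod.ext (map_one (linF χ)) rfl

theorem class4_dihedral (hn : 1 ≤ n) : Nonempty (Subgroup.closure {Class4.g₂ n D, Class4.g₁ n D} ≃*
    DihedralGroup (2 * n + 1)) := by
  have hJ : Function.Injective (hom4 n D) := affHom_injective _
  have hb : lin (flipBothStab n) * lin (flipBothStab n) = 1 := by
    rw [← map_mul, show flipBothStab n * flipBothStab n = 1 from
      Subtype.ext (by decide : flipBoth * flipBoth = 1), map_one]
  have hbi : (lin (flipBothStab n))⁻¹ = lin (flipBothStab n) := inv_eq_of_mul_eq_one_left hb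
  -- The field component of this generator is the unit 1, so the trivial character serves as well.
  have e1 := flip_class4 n D 1
  rw [affLin_one] at e1
  rw [e1, rot_class4]
  refine nonempty_mulEquiv_dihedral_of_two_lt (m := 2 * n + 1) ?_ (by omega) ?_ ?_
  · rw [orderOf_injective _ hJ, Prod.orderOf_mk, orderOf_one, Nat.lcm_one_left]
    exact orderOf_tb (ν := ![n, 0]) 0
  · rw [← map_mul, Prod.mk_mul_mk, hb, one_mul]
    exact map_one _
  · rw [← map_mul, ← map_mul, ← map_inv, Prod.mk_mul_mk, Prod.mk_mul_mk, Prod.inv_mk]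
    refine congrArg _ (Prod.ext (by simp) ?_)
    have h := lin_conj_tr (flipBothStab n) (Pi.single 0 1)
    rw [hbi] at h
    refine h.trans ?_
    rw [tb, ← tr_neg]
    congr 1
    funext b
    fin_cases b <;> rfl

theorem class4_main (hn : 1 ≤ n) (h2 : 2 < p) (hr : 1 ≤ r) : IsAdmissible (Class4.G n D) ∧
    Nonempty (Class4.G n D ≃* DihedralGroup (2 * n + 1) × (D.field ≃ᵃ[D.field] D.field)) ∧
    HasOrbitLengths (Class4.G n D) [2 * n + 1, p ^ r, 1] := by
  obtain ⟨χ, hχ⟩ := D.exists_character h2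
  have e1 := flip_class4 n D χ
  have e2 := rot_class4 n D
  have e3 := mul_class4 n D χ hχ
  have e4 := add_class4 n D hr
  have h := class4_generating n D χ
  have hG : (Subgroup.closure {affLin χ (1, flipBothStab n), (1, tb ![n, 0] 0),
      affLin χ (D.Γ, flipSecondStab n), (trF (.ofAdd 1), 1)}).map (hom4 n D) = Class4.G n D := by
    rw [MonoidHom.map_closure, Set.image_insert_eq, Set.image_insert_eq, Set.image_pair, ← e1,
      ← e2, ← e3, ← e4, Class4.G]
  have hJ := affHom_injective (affEquiv D (layout4 p r n))
  refine ⟨?_, ?_, ?_⟩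
  · obtain ⟨B, hf⟩ := h.isFrame_labels (h := layout4 p r n) le_rfl h2 hχ
      (isAffineFlipping_class4 n D χ hχ)
    exact hG ▸ hf.isAdmissible
  · have hb : orderOf (lin (flipSecondStab n)) ∣ orderOf D.Γ := by
      rw [D.orderOf_generator]
      refine (orderOf_dvd_of_pow_eq_one ?_).trans (two_dvd_pow_sub_one h2)
      rw [← map_pow, show flipSecondStab n ^ 2 = 1 from
        Subtype.ext (by decide : flipSecond ^ 2 = 1), map_one]
    have hS := nonempty_map_mulEquiv hJ (affine_closure_mulEquiv (χ := χ) D.generates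
      D.eq_zero_or_isUnit hb)
    rw [MonoidHom.map_closure, Set.image_pair] at hS
    change Nonempty (Subgroup.closure {hom4 n D (affLin χ (D.Γ, flipSecondStab n)),
      hom4 n D (trF (.ofAdd 1), 1)} ≃* _) at hS
    rw [← e3, ← e4] at hS
    refine nonempty_mulEquiv_prod_of_closure (isCenterless_dihedral n hn)
      (class4_dihedral n D hn) hS ?_ ?_ ?_ ?_
    -- An element acting on the blocks only commutes with the Frobenius group as soon as it commutes
    -- with the sign change on the last point, which is the action of the latter on the blocks.
    · have hc : ∀ x : WX (Blocks ![n, 0]), Commute x (lin (flipSecondStab n)) →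
          ∀ z ∈ ({Class4.g₁' n D, Class4.g₂' n D} : Set (WB (2 * n + p ^ r + 2))),
            hom4 n D (1, x) * z = z * hom4 n D (1, x) := by
        rintro x hx z (rfl | rfl)
        · rw [e3, ← map_mul, ← map_mul]
          refine congrArg _ (Prod.ext ?_ hx)
          exact (one_mul _).trans (mul_one _).symm
        · rw [e4, ← map_mul, ← map_mul, Prod.mk_mul_mk, Prod.mk_mul_mk, one_mul, one_mul, mul_one,
            mul_one]
      rintro y (rfl | rfl)
      · rw [e2]
        refine hc _ (mul_inv_eq_iff_eq_mul.mp ((lin_conj_tr _ _).trans ?_)).symm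
        rw [tb]
        congr 1
        funext b
        fin_cases b <;> rfl
      · rw [e1, affLin_one]
        refine hc _ (((map_mul lin _ _).symm.trans (congrArg lin ?_)).trans (map_mul lin _ _))
        exact Subtype.ext (by decide : flipBoth * flipSecond = flipSecond * flipBoth)
    · rintro y (rfl | rfl) <;> exact Subgroup.subset_closure (by simp)
    · rintro y (rfl | rfl) <;> exact Subgroup.subset_closure (by simp)
    · rintro x (rfl | rfl | rfl | rfl)
      · exact Subgroup.mem_sup_left (mem_closure_right _ _)
      · exact Subgroup.mem_sup_left (mem_closure_left _ _)
      · exact Subgroup.mem_sup_right (mem_closure_left _ _)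
      · exact Subgroup.mem_sup_right (mem_closure_right _ _)
  · rw [← hG]
    exact h.hasOrbitLengths_labels (h := layout4 p r n) (l := [2 * n + 1, p ^ r, 1]) 1
      ![0, 2] ![0, 0, 1] (Fin.forall_fin_two.mpr ⟨by simp, (by decide : (2 : Fin 3) ≠ 1)⟩)
      (Fin.forall_fin_succ.mpr ⟨.inr rfl, Fin.forall_fin_two.mpr ⟨.inl rfl, .inr rfl⟩⟩)
      (by rintro _ (rfl | rfl) b <;> rfl)
      (Fin.forall_fin_two.mpr ⟨⟨1, one_mem _, rfl⟩, ⟨1, one_mem _, rfl⟩⟩)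
      (Fin.forall_fin_succ.mpr ⟨by simp; exact (by decide : (2 : Fin 3) ≠ 0), Fin.forall_fin_two.mpr
        ⟨by simp; exact (by decide : (2 : Fin 3) ≠ 1), by simp; rfl⟩⟩)

end class4

end ConicBundle

theorem mainTheorem8 :
    -- (1)
    (∀ n : ℕ, 1 ≤ n →
      IsAdmissible (Class1.G n) ∧
      Nonempty (Class1.G n ≃* DihedralGroup (2 * n + 1)) ∧
      HasOrbitLengths (Class1.G n) [2 * n + 1, 1] ∧
      ContainsSylowTwo (Class1.G n) (Subgroup.closure {Class1.g₁ n})) ∧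
    -- (2)
    (∀ p r : ℕ, p.Prime → 2 < p → 1 ≤ r → ∀ D : FieldData p r,
      IsAdmissible (Class2.G D) ∧
      Nonempty (Class2.G D ≃* (D.field ≃ᵃ[D.field] D.field)) ∧
      HasOrbitLengths (Class2.G D) [p ^ r, 1] ∧
      ContainsSylowTwo (Class2.G D) (Subgroup.closure {Class2.g₁ D})) ∧
    -- (3)
    (∀ n₁ n₂ : ℕ, 1 ≤ n₁ → 1 ≤ n₂ →
      IsAdmissible (Class3.G n₁ n₂) ∧
      Nonempty (Class3.G n₁ n₂ ≃* DihedralGroup (2 * n₁ + 1) × DihedralGroup (2 * n₂ + 1)) ∧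
      HasOrbitLengths (Class3.G n₁ n₂) [2 * n₁ + 1, 2 * n₂ + 1, 1]) ∧
    -- (4)
    (∀ n p r : ℕ, 1 ≤ n → p.Prime → 2 < p → 1 ≤ r → ∀ D : FieldData p r,
      IsAdmissible (Class4.G n D) ∧
      Nonempty (Class4.G n D ≃* DihedralGroup (2 * n + 1) × (D.field ≃ᵃ[D.field] D.field)) ∧
      HasOrbitLengths (Class4.G n D) [2 * n + 1, p ^ r, 1]) ∧
    -- (5)
    (∀ n₁ n₂ : ℕ, 1 ≤ n₁ → 1 ≤ n₂ →
      IsAdmissible (Class5.G n₁ n₂) ∧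
      IsSemidirect (Cyc (2 * n₁ + 1)) (DihedralGroup (2 * n₂ + 1)) (Class5.G n₁ n₂) ∧
      HasOrbitLengths (Class5.G n₁ n₂) [2 * n₁ + 1, 2 * n₂ + 1]) ∧
    -- (6)
    (∀ n p r : ℕ, 1 ≤ n → p.Prime → 2 < p → 1 ≤ r → ∀ D : FieldData p r,
      IsAdmissible (Class6.G n D) ∧
      IsSemidirect (Cyc (2 * n + 1)) (D.field ≃ᵃ[D.field] D.field) (Class6.G n D) ∧
      HasOrbitLengths (Class6.G n D) [2 * n + 1, p ^ r]) ∧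
    -- (7)
    (∀ n₁ n₂ : ℕ, 1 ≤ n₁ → 1 ≤ n₂ →
      IsAdmissible (Class7.G n₁ n₂) ∧
      Nonempty (Class7.G n₁ n₂ ≃* DihedralGroup (Nat.lcm (2 * n₁ + 1) (2 * n₂ + 1))) ∧
      ((2 * n₁ + 1).Coprime (2 * n₂ + 1) → Class7.G n₁ n₂ = Class5.G n₁ n₂) ∧
      (2 * n₂ + 1 ∣ 2 * n₁ + 1 → Nonempty (Class7.G n₁ n₂ ≃* DihedralGroup (2 * n₁ + 1))) ∧
      HasOrbitLengths (Class7.G n₁ n₂) [2 * n₁ + 1, 2 * n₂ + 1]) ∧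
    -- (8)
    (∀ n p r : ℕ, 1 ≤ n → p.Prime → 2 < p → 1 ≤ r → ∀ D : FieldData p r,
      IsAdmissible (Class8.G n D) ∧
      ((2 * n + 1).Coprime p → Class8.G n D = Class6.G n D) ∧
      HasOrbitLengths (Class8.G n D) [2 * n + 1, p ^ r]) ∧
    -- (9)
    (∀ n : ℕ, 1 ≤ n →
      IsAdmissible (Class9.G n) ∧
      Nonempty (Class9.G n ≃* DihedralGroup (4 * n + 2)) ∧
      HasOrbitLengths (Class9.G n) [2 * n + 1, 1, 1] ∧
      IsSylowTwo (Class9.G n) (Subgroup.closure {Class9.g₁ n, Class9.g₃ n}) ∧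
      Nonempty (Subgroup.closure {Class9.g₁ n, Class9.g₃ n} ≃* Cyc 2 × Cyc 2)) ∧
    -- (10)
    (∀ n : ℕ, 1 ≤ n →
      IsAdmissible (Class10.G n) ∧
      IsSemidirect (Cyc (2 * n + 1)) (Cyc 4) (Class10.G n) ∧
      HasOrbitLengths (Class10.G n) [2 * n + 1, 2] ∧
      IsSylowTwo (Class10.G n) (Subgroup.closure {Class10.g₁ n}) ∧
      Nonempty (Subgroup.closure {Class10.g₁ n} ≃* Cyc 4)) ∧
    -- (11)
    (∀ n : ℕ, 1 ≤ n →
      IsAdmissible (Class11.G n) ∧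
      IsSemidirect (Cyc (2 * n + 1)) (DihedralGroup 4) (Class11.G n) ∧
      HasOrbitLengths (Class11.G n) [2 * n + 1, 2] ∧
      IsSylowTwo (Class11.G n) (Subgroup.closure {Class11.g₁ n, Class11.g₃ n}) ∧
      Nonempty (Subgroup.closure {Class11.g₁ n, Class11.g₃ n} ≃* DihedralGroup 4) ∧
      H1Vanishes ((Subgroup.closure {Class11.g₁ n, Class11.g₃ n}).subgroupOf (WD _))) ∧
    -- (12)
    (∀ n : ℕ, 1 ≤ n →
      IsAdmissible (Class12.G n) ∧
      Nonempty (Class12.G n ≃* DihedralGroup (4 * n + 2)) ∧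
      HasOrbitLengths (Class12.G n) [4 * n + 2] ∧
      IsSylowTwo (Class12.G n) (Subgroup.closure {Class12.g₁ n, Class12.g₃ n}) ∧
      Nonempty (Subgroup.closure {Class12.g₁ n, Class12.g₃ n} ≃* Cyc 2 × Cyc 2)) ∧
    -- (13)
    (∀ n : ℕ, 1 ≤ n →
      IsAdmissible (Class13.G n) ∧
      Nonempty (Class13.G n ≃* DihedralGroup (2 * n + 1) × DihedralGroup (2 * n + 1)) ∧
      HasOrbitLengths (Class13.G n) [4 * n + 2] ∧
      IsSylowTwo (Class13.G n) (Subgroup.closure {Class13.g₁ n, Class13.g₄ n}) ∧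
      Nonempty (Subgroup.closure {Class13.g₁ n, Class13.g₄ n} ≃* Cyc 2 × Cyc 2)) ∧
    -- (14)
    (∀ p r : ℕ, p.Prime → 2 < p → 1 ≤ r → ∀ D : FieldData p r,
      IsAdmissible (Class14.G D) ∧
      (4 ∣ p ^ r - 1 → Nonempty (Class14.G D ≃* (D.field ≃ᵃ[D.field] D.field))) ∧
      (¬ 4 ∣ p ^ r - 1 →
        IsSemidirect (Multiplicative D.field) (Cyc (2 * (p ^ r - 1))) (Class14.G D)) ∧
      HasOrbitLengths (Class14.G D) [p ^ r, 2] ∧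
      ContainsSylowTwo (Class14.G D) (Subgroup.closure {Class14.g₁ D})) ∧
    -- (15)
    (∀ n : ℕ, 1 ≤ n →
      IsAdmissible (Class15.G n) ∧
      IsSemidirect (Cyc (2 * n + 1) × Cyc (2 * n + 1)) (Cyc 4) (Class15.G n) ∧
      HasOrbitLengths (Class15.G n) [4 * n + 2, 1] ∧
      IsSylowTwo (Class15.G n) (Subgroup.closure {Class15.g₁ n}) ∧
      Nonempty (Subgroup.closure {Class15.g₁ n} ≃* Cyc 4)) ∧
    -- (16)
    (∀ p r : ℕ, p.Prime → 2 < p → 1 ≤ r → ∀ D : FieldData p r,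
      IsAdmissible (Class16.G D) ∧
      (4 ∣ p ^ r - 1 → Nonempty (Class16.G D ≃* Cyc 2 × (D.field ≃ᵃ[D.field] D.field))) ∧
      (¬ 4 ∣ p ^ r - 1 →
        IsSemidirect (Multiplicative D.field) (Cyc (2 * (p ^ r - 1))) (Class16.G D)) ∧
      HasOrbitLengths (Class16.G D) [p ^ r, 2] ∧
      ContainsSylowTwo (Class16.G D) (Subgroup.closure {Class16.g₁ D, Class16.g₃ D})) ∧
    -- (17)
    (∀ p r : ℕ, p.Prime → 2 < p → 1 ≤ r → ∀ D : FieldData p r,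
      IsAdmissible (Class17.G D) ∧
      Nonempty (Class17.G D ≃* Cyc 2 × (D.field ≃ᵃ[D.field] D.field)) ∧
      HasOrbitLengths (Class17.G D) [p ^ r, 1, 1] ∧
      ContainsSylowTwo (Class17.G D) (Subgroup.closure {Class17.g₁ D, Class17.g₃ D})) ∧
    -- (18)
    (∀ n : ℕ, 1 ≤ n →
      IsAdmissible (Class18.G n) ∧
      Nonempty (Class18.G n ≃* RegularWreathProduct (DihedralGroup (2 * n + 1)) (Cyc 2)) ∧
      HasOrbitLengths (Class18.G n) [4 * n + 2, 1] ∧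
      IsSylowTwo (Class18.G n) (Subgroup.closure {Class18.g₁ n, Class18.g₂ n, Class18.g₃ n}) ∧
      Nonempty (Subgroup.closure {Class18.g₁ n, Class18.g₂ n, Class18.g₃ n} ≃*
        DihedralGroup 4) ∧
      H1Vanishes ((Subgroup.closure {Class18.g₁ n, Class18.g₂ n, Class18.g₃ n}).subgroupOf
        (WD _))) ∧
    -- (19)
    (∀ p r : ℕ, p.Prime → 2 < p → 1 ≤ r → ∀ D : FieldData p r,
      IsAdmissible (Class19.G D) ∧
      IsSemidirect (Cyc 2 × Cyc 2) (D.field ≃ᵃ[D.field] D.field) (Class19.G D) ∧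
      HasOrbitLengths (Class19.G D) [p ^ r, 2] ∧
      ContainsSylowTwo (Class19.G D)
        (Subgroup.closure {Class19.g₁ D, Class19.g₃ D, Class19.g₄ D}) ∧
      IsSemidirect (Cyc 2 × Cyc 2) (Cyc (p ^ r - 1))
        (Subgroup.closure {Class19.g₁ D, Class19.g₃ D, Class19.g₄ D}) ∧
      ConditionH1 ((Subgroup.closure {Class19.g₁ D, Class19.g₃ D, Class19.g₄ D}).subgroupOf
        (WD _))) ∧
    -- (20)
    (∀ n₁ n₂ n₃ : ℕ, 1 ≤ n₁ → 1 ≤ n₂ → 1 ≤ n₃ →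
      IsAdmissible (Class20.G n₁ n₂ n₃) ∧
      IsSemidirect (Cyc (2 * n₁ + 1) × Cyc (2 * n₂ + 1) × Cyc (2 * n₃ + 1)) (Cyc 2 × Cyc 2)
        (Class20.G n₁ n₂ n₃) ∧
      HasOrbitLengths (Class20.G n₁ n₂ n₃) [2 * n₁ + 1, 2 * n₂ + 1, 2 * n₃ + 1] ∧
      IsSylowTwo (Class20.G n₁ n₂ n₃)
        (Subgroup.closure {Class20.g₁ n₁ n₂ n₃, Class20.g₂ n₁ n₂ n₃}) ∧
      Nonempty (Subgroup.closure {Class20.g₁ n₁ n₂ n₃, Class20.g₂ n₁ n₂ n₃} ≃*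
        Cyc 2 × Cyc 2)) ∧
    -- (21)
    (∀ n₁ n₂ : ℕ, 1 ≤ n₁ → 1 ≤ n₂ →
      IsAdmissible (Class21.G n₁ n₂) ∧
      (∃ φ : Cyc 4 →* MulAut (Cyc (2 * n₂ + 1)),
        IsSemidirect (Cyc (2 * n₁ + 1) × Cyc (2 * n₁ + 1)) (Cyc (2 * n₂ + 1) ⋊[φ] Cyc 4)
          (Class21.G n₁ n₂)) ∧
      HasOrbitLengths (Class21.G n₁ n₂) [4 * n₁ + 2, 2 * n₂ + 1] ∧
      IsSylowTwo (Class21.G n₁ n₂) (Subgroup.closure {Class21.g₁ n₁ n₂}) ∧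
      Nonempty (Subgroup.closure {Class21.g₁ n₁ n₂} ≃* Cyc 4)) ∧
    -- (22)
    (∀ n₁ n₂ : ℕ, 1 ≤ n₁ → 1 ≤ n₂ →
      IsAdmissible (Class22.G n₁ n₂) ∧
      IsSemidirect ((Cyc (2 * n₁ + 1) × Cyc (2 * n₁ + 1)) × Cyc (2 * n₂ + 1))
        (DihedralGroup 4) (Class22.G n₁ n₂) ∧
      HasOrbitLengths (Class22.G n₁ n₂) [4 * n₁ + 2, 2 * n₂ + 1] ∧
      IsSylowTwo (Class22.G n₁ n₂)
        (Subgroup.closure {Class22.g₁ n₁ n₂, Class22.g₂ n₁ n₂, Class22.g₃ n₁ n₂}) ∧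
      Nonempty (Subgroup.closure {Class22.g₁ n₁ n₂, Class22.g₂ n₁ n₂, Class22.g₃ n₁ n₂} ≃*
        DihedralGroup 4) ∧
      H1Vanishes ((Subgroup.closure
        {Class22.g₁ n₁ n₂, Class22.g₂ n₁ n₂, Class22.g₃ n₁ n₂}).subgroupOf (WD _))) ∧
    -- (23)
    (∀ n : ℕ, 1 ≤ n →
      IsAdmissible (Class23.G n) ∧
      (∃ φ : Cyc 2 × Cyc 2 →* MulAut (Cyc (2 * n + 1) × Cyc (2 * n + 1) × Cyc (2 * n + 1)),
        IsSemidirect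
          ((Cyc (2 * n + 1) × Cyc (2 * n + 1) × Cyc (2 * n + 1)) ⋊[φ] (Cyc 2 × Cyc 2)) (Cyc 3)
          (Class23.G n)) ∧
      HasOrbitLengths (Class23.G n) [6 * n + 3] ∧
      IsSylowTwo (Class23.G n) (Subgroup.closure {Class23.g₁ n, Class23.g₂ n}) ∧
      Nonempty (Subgroup.closure {Class23.g₁ n, Class23.g₂ n} ≃* Cyc 2 × Cyc 2)) ∧
    -- (24)
    (∀ n : ℕ, 1 ≤ n →
      IsAdmissible (Class24.G n) ∧
      IsSemidirect (Cyc (2 * n + 1) × Cyc (2 * n + 1) × Cyc (2 * n + 1))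
        (Equiv.Perm (Fin 4)) (Class24.G n) ∧
      HasOrbitLengths (Class24.G n) [6 * n + 3] ∧
      IsSylowTwo (Class24.G n) (Subgroup.closure {Class24.g₁ n, Class24.g₂ n, Class24.g₃ n}) ∧
      Nonempty (Subgroup.closure {Class24.g₁ n, Class24.g₂ n, Class24.g₃ n} ≃*
        DihedralGroup 4) ∧
      H1Vanishes ((Subgroup.closure {Class24.g₁ n, Class24.g₂ n, Class24.g₃ n}).subgroupOf
        (WD _))) := by
  refine ⟨class1_main, fun p r hp h2 hr D => ?_, class3_main, fun n p r hn hp h2 hr D => ?_,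
    fun n₁ n₂ _ h₂ => class5_main n₁ n₂ h₂, fun n p r hn hp h2 hr D => ?_,
    fun n₁ n₂ h₁ _ => class7_main n₁ n₂ h₁, fun n p r hn hp h2 hr D => ?_, class9_main,
    fun n _ => class10_main n, fun n _ => class11_main n, class12_main, class13_main,
    fun p r hp h2 hr D => ?_, fun n _ => class15_main n, fun p r hp h2 hr D => ?_,
    fun p r hp h2 hr D => ?_, class18_main, fun p r hp h2 hr D => ?_,
    fun n₁ n₂ n₃ _ _ _ => class20_main n₁ n₂ n₃, fun n₁ n₂ _ _ => class21_main n₁ n₂,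
    fun n₁ n₂ _ _ => class22_main n₁ n₂, fun n _ => class23_main n, fun n _ => class24_main n⟩
  all_goals have := Fact.mk hp
  · exact class2_main D h2 hr
  · exact class4_main n D hn h2 hr
  · exact class6_main n D h2 hr
  · exact class8_main n D h2 hr
  · exact class14_main D h2 hr
  · exact class16_main D h2 hr
  · exact class17_main D h2 hr
  · exact class19_main D h2 hr
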